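/- The computational model is the word RAM with uninitialized memory: words have $w$ bits, the usual arithmetic, comparison, bitwise and memory access instructions on words take one step each, and algorithms (which do not depend on $w$) have to work, with a running time that does not depend on $w$, for every word length $w\ge c\cdot\log_2(N+2)$, where $c$ is a constant that depends only on the algorithm, and $N=n$ for the multiplication of $n\times n$ matrices, $N=|V(H)|+|V(G)|$ for an input $(H,G)$. Numbers that do not fit into one word are output in base $2^w$. All graphs are finite and simple, with vertex sets of the form $\{0,\dots,k-1\}$, and are given by their adjacency matrices. Let $\omega$ be any real number such that, in this model, two $n\times n$ matrices with entries in $\{0,\dots,n\}$ can be multiplied in time $O(n^\omega)$. (For a graph $G$ without vertices, and for $n=0$ here, read $|V(G)|^\omega$ and $n^\omega$ as $1$.) (a) There are an algorithm and a polynomial $p$ such that, given any graph $H$ of treewidth at most $2$ and any graph $G$, the algorithm computes the number $\#\mathrm{Hom}(H,G)$ of homomorphisms from $H$ to $G$ in time at most $p(|V(H)|)\cdot|V(G)|^{\omega}$. (b) The spasm of $H$ consists of the simple graphs $F$ (up to isomorphism) for which there is a homomorphism from $H$ to $F$ that is surjective on vertices and on edges. There are an algorithm and a computable function $f:\mathbb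 N\to\mathbb N$ such that, given any graph $H$ for which all graphs in the spasm have treewidth at most $2$ and any graph $G$, the algorithm computes the number $\#\mathrm{Sub}(H,G)$ of subgraphs of $G$ that are isomorphic to $H$ in time at most $f(|V(H)|)\cdot|V(G)|^{\omega}$. -/

import Mathlib

/-! ## The word RAM

A word RAM with word length `w` has registers and a fixed finite number of randomly accessible
arrays (the ones that the program mentions), each with `2 ^ w` cells; registers and cells hold words,
that is, natural numbers below `2 ^ w`. Each elementary instruction takes one time step. Programs
are finite and do not depend on the input or on `w`. -/

namespace WordRAM

/-- The instructions that combine two words. -/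
inductive Op
  | add | sub | mul | mulHigh | div | mod | and | or | xor | shiftLeft | shiftRight | lt | eq

/-- The effect of an instruction on words of length `w`. The arithmetic is modulo `2 ^ w`, and
`mulHigh` gives the more significant word of the two-word product. -/
def Op.eval (w : ℕ) (o : Op) (a b : ℕ) : ℕ :=
  (match o with
    | .add => a + b
    | .sub => a + 2 ^ w - b
    | .mul => a * b
    | .mulHigh => a * b / 2 ^ w
    | .div => a / b
    | .mod => a % b
    | .and => a &&& b
    | .or => a ||| b
    | .xor => a ^^^ b
    | .shiftLeft => a <<< b
    | .shiftRight => a >>> b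
    | .lt => if a < b then 1 else 0
    | .eq => if a = b then 1 else 0) % 2 ^ w

/-- A memory state: `reg x` is the content of register `x`, and `mem a i` is the content of the
cell with index `i` of the array `a`. -/
structure State where
  reg : ℕ → ℕ
  mem : ℕ → ℕ → ℕ

/-- All registers and cells hold words of length `w`. -/
def State.Bounded (w : ℕ) (s : State) : Prop :=
  (∀ x, s.reg x < 2 ^ w) ∧ ∀ a i, s.mem a i < 2 ^ w

/-- Write the word `v` to register `x`. -/
def State.setReg (s : State) (x v : ℕ) : State :=
  { s with reg := Function.update s.reg x v }

/-- Write the word `v` to cell `i` of the array `a`. -/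
def State.setMem (s : State) (a i v : ℕ) : State :=
  { s with mem := Function.update s.mem a (Function.update (s.mem a) i v) }

/-- Programs. -/
inductive Prog
  /-- `x := c` -/
  | const (x c : ℕ)
  /-- `x := y o z` -/
  | op (o : Op) (x y z : ℕ)
  /-- `x := a[y]` -/
  | load (x a y : ℕ)
  /-- `a[y] := x` -/
  | store (a y x : ℕ)
  /-- first `P`, then `Q` -/
  | seq (P Q : Prog)
  /-- if `x ≠ 0` then `P` else `Q` -/
  | ite (x : ℕ) (P Q : Prog)
  /-- while `x ≠ 0` do `P` -/
  | while (x : ℕ) (P : Prog)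

/-- `Run w P s s' t`: on the word RAM with word length `w`, the program `P`, started in the state
`s`, halts after exactly `t` steps in the state `s'`. -/
inductive Run (w : ℕ) : Prog → State → State → ℕ → Prop
  | const (x c : ℕ) (s : State) :
      Run w (.const x c) s (s.setReg x (c % 2 ^ w)) 1
  | op (o : Op) (x y z : ℕ) (s : State) :
      Run w (.op o x y z) s (s.setReg x (o.eval w (s.reg y) (s.reg z))) 1
  | load (x a y : ℕ) (s : State) :
      Run w (.load x a y) s (s.setReg x (s.mem a (s.reg y))) 1
  | store (a y x : ℕ) (s : State) :
      Run w (.store a y x) s (s.setMem a (s.reg y) (s.reg x)) 1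
  | seq {P Q : Prog} {s s₁ s₂ : State} {t₁ t₂ : ℕ} :
      Run w P s s₁ t₁ → Run w Q s₁ s₂ t₂ → Run w (.seq P Q) s s₂ (t₁ + t₂)
  | iteTrue {x : ℕ} {P Q : Prog} {s s' : State} {t : ℕ} :
      s.reg x ≠ 0 → Run w P s s' t → Run w (.ite x P Q) s s' (t + 1)
  | iteFalse {x : ℕ} {P Q : Prog} {s s' : State} {t : ℕ} :
      s.reg x = 0 → Run w Q s s' t → Run w (.ite x P Q) s s' (t + 1)
  | whileDone {x : ℕ} {P : Prog} {s : State} :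
      s.reg x = 0 → Run w (.while x P) s s 1
  | whileStep {x : ℕ} {P : Prog} {s s₁ s₂ : State} {t₁ t₂ : ℕ} :
      s.reg x ≠ 0 → Run w P s s₁ t₁ → Run w (.while x P) s₁ s₂ t₂ →
        Run w (.while x P) s s₂ (t₁ + t₂ + 1)

/-- The array `a` of the state `s` starts with the `n × n` matrix `A`, row by row. -/
def State.HoldsMatrix (s : State) (a : ℕ) {n : ℕ} (A : Matrix (Fin n) (Fin n) ℕ) : Prop :=
  ∀ i j : Fin n, s.mem a (i * n + j) = A i j

/-- `ω` is an exponent of matrix multiplication: there is a program that multiplies any two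
`n × n` matrices with entries in `{0, …, n}` in `O(n ^ ω)` steps on every word RAM with a word length
of at least `c * log₂ (n + 2)`, for a constant `c`. The dimension is given in register `0`, the
factors are given in the arrays `0` and `1`, the product is to be written to the array `2`. The rest
of the memory is not initialized: it may hold any words at the start. -/
def IsMatMulExponent (ω : ℝ) : Prop :=
  ∃ (P : Prog) (c : ℕ) (C : ℝ), ∀ (n w : ℕ) (A B : Matrix (Fin n) (Fin n) ℕ),
    (∀ i j, A i j ≤ n) → (∀ i j, B i j ≤ n) → (n + 2) ^ c ≤ 2 ^ w →
    ∀ s : State, s.Bounded w → s.reg 0 = n → s.HoldsMatrix 0 A → s.HoldsMatrix 1 B →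
      ∃ (s' : State) (t : ℕ), Run w P s s' t ∧ (t : ℝ) ≤ C * ((max n 1 : ℕ) : ℝ) ^ ω ∧
        s'.HoldsMatrix 2 (A * B)

/-- The natural number that the state `s` gives as output: its digits in base `2 ^ w` are the first
cells of the array `2`, least significant digit first, and register `0` holds their number. -/
def State.output (w : ℕ) (s : State) : ℕ :=
  ∑ i ∈ Finset.range (s.reg 0), s.mem 2 i * (2 ^ w) ^ i

open Classical in
/-- The program `P` computes the number `count k n H G` from the graphs `H` on `{0, …, k - 1}` and
`G` on `{0, …, n - 1}` within `time k n` steps, for all `H` with the property `promise` and all `G`,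
on every word RAM with a word length of at least `c * log₂ (k + n + 2)`, for a constant `c`.
The numbers of vertices are given in the registers `0` and `1`, the adjacency matrices in the
arrays `0` and `1`. The rest of the memory is not initialized. -/
def CountsInTime (P : Prog) (promise : (k : ℕ) → SimpleGraph (Fin k) → Prop)
    (count : (k n : ℕ) → SimpleGraph (Fin k) → SimpleGraph (Fin n) → ℕ)
    (time : ℕ → ℕ → ℝ) : Prop :=
  ∃ c : ℕ, ∀ (k n w : ℕ) (H : SimpleGraph (Fin k)) (G : SimpleGraph (Fin n)),
    promise k H → (k + n + 2) ^ c ≤ 2 ^ w →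
    ∀ s : State, s.Bounded w → s.reg 0 = k → s.reg 1 = n →
      s.HoldsMatrix 0 (H.adjMatrix ℕ) → s.HoldsMatrix 1 (G.adjMatrix ℕ) →
      ∃ (s' : State) (t : ℕ), Run w P s s' t ∧ (t : ℝ) ≤ time k n ∧
        s'.output w = count k n H G

end WordRAM

/-! ## Treewidth, homomorphic images and subgraph counts -/

/-- A tree decomposition of the graph `G`, with the nodes of the tree numbered. -/
structure TreeDecomposition {V : Type*} (G : SimpleGraph V) where
  numNodes : ℕ
  tree : SimpleGraph (Fin numNodes)
  isTree : tree.IsTree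
  bag : Fin numNodes → Finset V
  connected : ∀ v, (tree.induce {t | v ∈ bag t}).Connected
  edge : ∀ u v, G.Adj u v → ∃ t, u ∈ bag t ∧ v ∈ bag t

/-- The treewidth of a finite graph, the least `d` such that some tree decomposition has only bags of
size at most `d + 1` (with the value `0` for the graph without vertices). -/
noncomputable def treewidth {V : Type*} (G : SimpleGraph V) : ℕ :=
  sInf {d | ∃ D : TreeDecomposition G, ∀ t, (D.bag t).card ≤ d + 1}

/-- `F` is (isomorphic to) a member of the spasm of `H`: there is a homomorphism from `H` to
`F` that is surjective on the vertices and on the edges. -/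
def InSpasm {V W : Type*} (H : SimpleGraph V) (F : SimpleGraph W) : Prop :=
  ∃ φ : H →g F, Function.Surjective φ ∧
    ∀ a b, F.Adj a b → ∃ u v, H.Adj u v ∧ φ u = a ∧ φ v = b

/-- The number of homomorphisms from `H` to `G`. -/
noncomputable def homCount {V W : Type*} (H : SimpleGraph V) (G : SimpleGraph W) : ℕ :=
  Nat.card (H →g G)

/-- The number of subgraphs of `G` that are isomorphic to `H`. -/
noncomputable def subCount {V W : Type*} (H : SimpleGraph V) (G : SimpleGraph W) : ℕ :=
  Nat.card {S : G.Subgraph // Nonempty (H ≃g S.coe)}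

/-! Part (a) is vertex elimination. The number of homomorphisms from `H` to `G` is a sum, over all
assignments of vertices of `G` to vertices of `H`, of products of weights of pairs; each weight is
an `n × n` matrix, at the start the adjacency matrix of `G` for an edge of `H` and the all-ones
matrix otherwise. A graph of treewidth at most two has a vertex `x` with at most two neighbours `a`,
`b` (`Elim.Tw2.exists_degree_le_two`). Summing over the value of `x` first gives a new weight for
the pair `(a, b)`, and this sum is a matrix product; it is multiplied entrywise into the old weight
(`Elim.Inv.Z_elim`). On the graph this is the contraction of an edge at `x`, or the deletion of `x`,
so the treewidth stays at most two (`Elim.Tw2.elim`). Two auxiliary vertices `q < p`, larger than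
all others, unify the cases: `p` replaces a missing second neighbour, so that unary weights are
weights of pairs `(a, p)`, and `q` stands for a missing neighbour. When no vertex is left, the
weight of `(q, p)` is the answer.

The entries grow up to about `n ^ k`, while the given multiplication accepts entries up to `n`.
Numbers are therefore kept with `K = 2 * (k + 1)` digits in base `n + 1`, modulo `(n + 1) ^ K`, and
a product of matrices becomes a convolution of products of digit matrices (`Alg.conv_spec`,
`Alg.mul_spec`): at most `K ^ 2` calls of the given program. All other work is a polynomial in `k`
times `n ^ 2`, and `n ^ 2 = O(n ^ ω)` because the entries of a product have to be written
(`sq_le_of_mul`).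

Part (b) rests on `#Sub = #Inj / #Aut` (`Elim.card_copy`). The number of injective homomorphisms is
a signed sum over functions `f` on `V(H)` with `f v ≤ v` of the numbers of homomorphisms `ψ` with `ψ
∘ f = ψ` (`Elim.sum_term`). Such a `ψ` is a homomorphism from the quotient of `H` by `f`; if an edge
is collapsed there is none, and otherwise the quotient is in the spasm and part (a) applies
(`Elim.card_quot`, `Elim.tw2_quot`). All `k ^ k` functions are enumerated, the automorphisms are
counted along the way, and a long division follows (`Alg.divide_spec`).

Programs are verified with a small program logic. `Hwp` is total correctness with a time bound on
the visible memory: registers below `50` and arrays below `103`. The registers from `50` on are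
scratch for expressions. The given multiplication program is renamed so that its registers and
arrays start at `100`; its first three arrays are the visible arrays `100`, `101`, `102`. -/

namespace WordRAM

/-! ## Basic facts about runs -/

theorem Op.eval_lt (w : ℕ) (o : Op) (a b : ℕ) : o.eval w a b < 2 ^ w :=
  Nat.mod_lt _ (by positivity)

theorem State.Bounded.setReg {w x v : ℕ} {s : State} (h : s.Bounded w) (hv : v < 2 ^ w) :
    (s.setReg x v).Bounded w := by
  refine ⟨fun y => ?_, h.2⟩
  by_cases hy : y = x
  · simpa [State.setReg, hy] using hv
  · simpa [State.setReg, hy] using h.1 y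

theorem State.Bounded.setMem {w a i v : ℕ} {s : State} (h : s.Bounded w) (hv : v < 2 ^ w) :
    (s.setMem a i v).Bounded w := by
  refine ⟨h.1, fun b j => ?_⟩
  by_cases hb : b = a
  · by_cases hj : j = i
    · simpa [State.setMem, hb, hj] using hv
    · simpa [State.setMem, hb, hj] using h.2 a j
  · simpa [State.setMem, hb] using h.2 b j

theorem Run.bounded {w : ℕ} {P : Prog} {s s' : State} {t : ℕ} (h : Run w P s s' t) :
    s.Bounded w → s'.Bounded w := by
  induction h with
  | const x c s => exact fun hs => hs.setReg (Nat.mod_lt _ (by positivity))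
  | op o x y z s => exact fun hs => hs.setReg (Op.eval_lt _ _ _ _)
  | load x a y s => exact fun hs => hs.setReg (hs.2 _ _)
  | store a y x s => exact fun hs => hs.setMem (hs.1 _)
  | seq _ _ ih₁ ih₂ => exact fun hs => ih₂ (ih₁ hs)
  | iteTrue _ _ ih => exact ih
  | iteFalse _ _ ih => exact ih
  | whileDone _ => exact id
  | whileStep _ _ _ ih₁ ih₂ => exact fun hs => ih₂ (ih₁ hs)

/-- A run writes to at most as many cells of an array as it has steps. -/
theorem Run.exists_finset_changed {w : ℕ} {P : Prog} {s s' : State} {t : ℕ} (a : ℕ)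
    (h : Run w P s s' t) :
    ∃ I : Finset ℕ, I.card ≤ t ∧ ∀ i, i ∉ I → s'.mem a i = s.mem a i := by
  induction h with
  | const x c s => exact ⟨∅, by simp, fun _ _ => rfl⟩
  | op o x y z s => exact ⟨∅, by simp, fun _ _ => rfl⟩
  | load x a y s => exact ⟨∅, by simp, fun _ _ => rfl⟩
  | store b y x s =>
    refine ⟨{s.reg y}, by simp, fun i hi => ?_⟩
    have hi' : i ≠ s.reg y := by simpa using hi
    by_cases hb : a = b
    · subst hb
      simp [State.setMem, hi']
    · simp [State.setMem, hb]
  | seq _ _ ih₁ ih₂ =>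
    obtain ⟨I, hI, h1⟩ := ih₁
    obtain ⟨J, hJ, h2⟩ := ih₂
    refine ⟨I ∪ J, (Finset.card_union_le _ _).trans (by omega), fun i hi => ?_⟩
    simp only [Finset.mem_union, not_or] at hi
    rw [h2 i hi.2, h1 i hi.1]
  | iteTrue _ _ ih =>
    obtain ⟨I, hI, h1⟩ := ih
    exact ⟨I, by omega, h1⟩
  | iteFalse _ _ ih =>
    obtain ⟨I, hI, h1⟩ := ih
    exact ⟨I, by omega, h1⟩
  | whileDone _ => exact ⟨∅, by simp, fun _ _ => rfl⟩
  | whileStep _ _ _ ih₁ ih₂ =>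
    obtain ⟨I, hI, h1⟩ := ih₁
    obtain ⟨J, hJ, h2⟩ := ih₂
    refine ⟨I ∪ J, (Finset.card_union_le _ _).trans (by omega), fun i hi => ?_⟩
    simp only [Finset.mem_union, not_or] at hi
    rw [h2 i hi.2, h1 i hi.1]

/-- The program with all registers and arrays renamed by adding `100`. -/
def Prog.shift : Prog → Prog
  | .const x c => .const (x + 100) c
  | .op o x y z => .op o (x + 100) (y + 100) (z + 100)
  | .load x a y => .load (x + 100) (a + 100) (y + 100)
  | .store a y x => .store (a + 100) (y + 100) (x + 100)
  | .seq P Q => .seq P.shift Q.shift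
  | .ite x P Q => .ite (x + 100) P.shift Q.shift
  | .while x P => .while (x + 100) P.shift

/-- The part of the state that a renamed program can access. -/
def State.unshift (s : State) : State :=
  ⟨fun x => s.reg (x + 100), fun a => s.mem (a + 100)⟩

theorem Run.shift {w : ℕ} {P : Prog} {s s' : State} {t : ℕ} (h : Run w P s s' t) :
    ∀ σ : State, σ.unshift = s → ∃ σ' : State, Run w P.shift σ σ' t ∧ σ'.unshift = s' ∧
      (∀ x < 100, σ'.reg x = σ.reg x) ∧ ∀ a < 100, σ'.mem a = σ.mem a := by
  induction h with
  | const x c s =>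
    rintro σ rfl
    refine ⟨_, Run.const _ _ _, ?_, fun y hy => ?_, fun a ha => rfl⟩
    · simp only [State.unshift, State.setReg, State.mk.injEq, and_true]
      funext y; simp [Function.update_apply]
    · have : y ≠ x + 100 := by omega
      simp [State.setReg, this]
  | op o x y z s =>
    rintro σ rfl
    refine ⟨_, Run.op _ _ _ _ _, ?_, fun y hy => ?_, fun a ha => rfl⟩
    · simp only [State.unshift, State.setReg, State.mk.injEq, and_true]
      funext y; simp [Function.update_apply]
    · have : y ≠ x + 100 := by omega
      simp [State.setReg, this]
  | load x a y s =>
    rintro σ rfl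
    refine ⟨_, Run.load _ _ _ _, ?_, fun y hy => ?_, fun a ha => rfl⟩
    · simp only [State.unshift, State.setReg, State.mk.injEq, and_true]
      funext y; simp [Function.update_apply]
    · have : y ≠ x + 100 := by omega
      simp [State.setReg, this]
  | store a y x s =>
    rintro σ rfl
    refine ⟨_, Run.store _ _ _ _, ?_, fun y hy => rfl, fun b hb => ?_⟩
    · simp only [State.unshift, State.setMem, State.mk.injEq, true_and]
      funext b; simp [Function.update_apply]
    · have : b ≠ a + 100 := by omega
      simp [State.setMem, this]
  | seq _ _ ih₁ ih₂ =>
    intro σ hσ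
    obtain ⟨σ₁, r1, e1, f1, g1⟩ := ih₁ σ hσ
    obtain ⟨σ₂, r2, e2, f2, g2⟩ := ih₂ σ₁ e1
    exact ⟨σ₂, Run.seq r1 r2, e2, fun x hx => (f2 x hx).trans (f1 x hx),
      fun x hx => (g2 x hx).trans (g1 x hx)⟩
  | iteTrue h0 _ ih =>
    intro σ hσ
    obtain ⟨σ₁, r1, e1, f1⟩ := ih σ hσ
    exact ⟨σ₁, Run.iteTrue (by subst hσ; exact h0) r1, e1, f1⟩
  | iteFalse h0 _ ih =>
    intro σ hσ
    obtain ⟨σ₁, r1, e1, f1⟩ := ih σ hσ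
    exact ⟨σ₁, Run.iteFalse (by subst hσ; exact h0) r1, e1, f1⟩
  | whileDone h0 =>
    intro σ hσ
    exact ⟨σ, Run.whileDone (by subst hσ; exact h0), hσ, fun _ _ => rfl, fun _ _ => rfl⟩
  | whileStep h0 _ _ ih₁ ih₂ =>
    intro σ hσ
    obtain ⟨σ₁, r1, e1, f1, g1⟩ := ih₁ σ hσ
    obtain ⟨σ₂, r2, e2, f2, g2⟩ := ih₂ σ₁ e1
    exact ⟨σ₂, Run.whileStep (by subst hσ; exact h0) r1 r2, e2,
      fun x hx => (f2 x hx).trans (f1 x hx), fun x hx => (g2 x hx).trans (g1 x hx)⟩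

/-- Among the registers below `50` and the arrays below `103`, the program writes only to the
registers in `L` and to the arrays in `A`. -/
def Prog.wr (L A : List ℕ) : Prog → Bool
  | .const x _ => decide (50 ≤ x) || L.contains x
  | .op _ x _ _ => decide (50 ≤ x) || L.contains x
  | .load x _ _ => decide (50 ≤ x) || L.contains x
  | .store a _ _ => decide (103 ≤ a) || A.contains a
  | .seq P Q => P.wr L A && Q.wr L A
  | .ite _ P Q => P.wr L A && Q.wr L A
  | .while _ P => P.wr L A

/-- Renaming moves all registers and arrays to indices from `100` on. Of the visible memory only the
arrays `100`, `101`, `102`, the factors and the product, can be affected. -/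
theorem Prog.wr_shift (L A : List ℕ) (h100 : 100 ∈ A) (h101 : 101 ∈ A) (h102 : 102 ∈ A)
    (P : Prog) : P.shift.wr L A = true := by
  induction P with
  | const x c => simp [shift, wr]
  | op o x y z => simp [shift, wr]
  | load x a y => simp [shift, wr]
  | store a y x =>
    by_cases ha : 3 ≤ a
    · simp [shift, wr]; omega
    · interval_cases a <;> simp_all [shift, wr]
  | seq P Q h1 h2 => simp [shift, wr, h1, h2]
  | ite x P Q h1 h2 => simp [shift, wr, h1, h2]
  | _ x P h => simp [shift, wr, h]

/-- Turns the syntactic check `wr`, which `decide` evaluates for concrete programs, into a statement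
about what a run leaves unchanged. Almost all frame conditions below come from it. -/
theorem Run.frame {w : ℕ} {P : Prog} {s s' : State} {t : ℕ} (L A : List ℕ) (h : Run w P s s' t) :
    P.wr L A = true →
      (∀ x < 50, x ∉ L → s'.reg x = s.reg x) ∧ ∀ a < 103, a ∉ A → s'.mem a = s.mem a := by
  induction h with
  | const x c s =>
    intro h
    refine ⟨fun y hy hL => ?_, fun _ _ _ => rfl⟩
    have : y ≠ x := by rintro rfl; simp [Prog.wr, hL] at h; omega
    simp [State.setReg, this]
  | op o x y z s =>
    intro h
    refine ⟨fun y hy hL => ?_, fun _ _ _ => rfl⟩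
    have : y ≠ x := by rintro rfl; simp [Prog.wr, hL] at h; omega
    simp [State.setReg, this]
  | load x a y s =>
    intro h
    refine ⟨fun y hy hL => ?_, fun _ _ _ => rfl⟩
    have : y ≠ x := by rintro rfl; simp [Prog.wr, hL] at h; omega
    simp [State.setReg, this]
  | store a y x s =>
    intro h
    refine ⟨fun _ _ _ => rfl, fun b hb hA => ?_⟩
    have : b ≠ a := by rintro rfl; simp [Prog.wr, hA] at h; omega
    simp [State.setMem, this]
  | seq _ _ ih₁ ih₂ =>
    intro h
    simp only [Prog.wr, Bool.and_eq_true] at h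
    have h1 := ih₁ h.1
    have h2 := ih₂ h.2
    exact ⟨fun x hx hL => (h2.1 x hx hL).trans (h1.1 x hx hL),
      fun x hx hL => (h2.2 x hx hL).trans (h1.2 x hx hL)⟩
  | iteTrue _ _ ih =>
    intro h
    simp only [Prog.wr, Bool.and_eq_true] at h
    exact ih h.1
  | iteFalse _ _ ih =>
    intro h
    simp only [Prog.wr, Bool.and_eq_true] at h
    exact ih h.2
  | whileDone _ => exact fun _ => ⟨fun _ _ _ => rfl, fun _ _ _ => rfl⟩
  | whileStep _ _ _ ih₁ ih₂ =>
    intro h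
    have h1 := ih₁ h
    have h2 := ih₂ h
    exact ⟨fun x hx hL => (h2.1 x hx hL).trans (h1.1 x hx hL),
      fun x hx hL => (h2.2 x hx hL).trans (h1.2 x hx hL)⟩

/-! ## Expressions and structured programs -/

/-- The visible part of a state: the registers below `50` and the arrays below `103`. -/
structure HS where
  v : ℕ → ℕ
  m : ℕ → ℕ → ℕ

def HS.setV (σ : HS) (x a : ℕ) : HS := { σ with v := Function.update σ.v x a }

def HS.setM (σ : HS) (a i x : ℕ) : HS :=
  { σ with m := Function.update σ.m a (Function.update (σ.m a) i x) }

@[simp] theorem HS.setV_v (σ : HS) (x a y : ℕ) :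
    (σ.setV x a).v y = if y = x then a else σ.v y := by
  simp [HS.setV, Function.update_apply]

@[simp] theorem HS.setV_m (σ : HS) (x a : ℕ) : (σ.setV x a).m = σ.m := rfl

@[simp] theorem HS.setM_v (σ : HS) (a i x : ℕ) : (σ.setM a i x).v = σ.v := rfl

theorem HS.setM_m (σ : HS) (a i x b j : ℕ) :
    (σ.setM a i x).m b j = if b = a ∧ j = i then x else σ.m b j := by
  by_cases hb : b = a
  · subst hb; by_cases hj : j = i <;> simp [HS.setM, hj]
  · simp [HS.setM, hb]

theorem HS.setM_m_self (σ : HS) (a i x j : ℕ) :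
    (σ.setM a i x).m a j = if j = i then x else σ.m a j := by
  simp [HS.setM_m]

theorem HS.setM_m_ne (σ : HS) {a b : ℕ} (i x : ℕ) (h : b ≠ a) : (σ.setM a i x).m b = σ.m b := by
  funext j; simp [HS.setM_m, h]

/-- The values in the visible part of the state fit into words. -/
def HS.Bd (w : ℕ) (σ : HS) : Prop :=
  (∀ x < 50, σ.v x < 2 ^ w) ∧ ∀ a < 103, ∀ i, σ.m a i < 2 ^ w

/-- `σ` is the visible part of `s`. -/
def Rep (w : ℕ) (s : State) (σ : HS) : Prop :=
  s.Bounded w ∧ (∀ x < 50, s.reg x = σ.v x) ∧ ∀ a < 103, s.mem a = σ.m a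

theorem Rep.bd {w : ℕ} {s : State} {σ : HS} (h : Rep w s σ) : σ.Bd w :=
  ⟨fun x hx => h.2.1 x hx ▸ h.1.1 x, fun a ha i => h.2.2 a ha ▸ h.1.2 a i⟩

/-- Expressions. The operations in `o` must not overflow; `wrap` stands for the instructions of the
word RAM. -/
inductive Ex
  | v (x : ℕ)
  | c (a : ℕ)
  | o (o : Op) (e f : Ex)
  | wrap (o : Op) (e f : Ex)
  | ld (a : ℕ) (e : Ex)

namespace Ex

instance : Add Ex := ⟨Ex.o .add⟩
instance : Sub Ex := ⟨Ex.o .sub⟩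
instance : Mul Ex := ⟨Ex.o .mul⟩
instance : Div Ex := ⟨Ex.o .div⟩
instance : Mod Ex := ⟨Ex.o .mod⟩

def lt (e f : Ex) : Ex := .o .lt e f
def eq (e f : Ex) : Ex := .o .eq e f

/-- The operation on natural numbers, without reduction modulo `2 ^ w`. It is meaningful only under
`okOp`, which excludes overflow, a negative difference and the operations with the default value
`0`. -/
def ideal (o : Op) (a b : ℕ) : ℕ :=
  match o with
  | .add => a + b
  | .sub => a - b
  | .mul => a * b
  | .div => a / b
  | .mod => a % b
  | .lt => if a < b then 1 else 0
  | .eq => if a = b then 1 else 0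
  | _ => 0

def okOp (w : ℕ) (o : Op) (a b : ℕ) : Prop :=
  match o with
  | .add => a + b < 2 ^ w
  | .sub => b ≤ a
  | .mul => a * b < 2 ^ w
  | .div => True
  | .mod => True
  | .lt => 1 < 2 ^ w
  | .eq => 1 < 2 ^ w
  | _ => False

/-- The value of an expression. -/
def ev (w : ℕ) (σ : HS) : Ex → ℕ
  | .v x => σ.v x
  | .c a => a
  | .o p e f => ideal p (e.ev w σ) (f.ev w σ)
  | .wrap p e f => p.eval w (e.ev w σ) (f.ev w σ)
  | .ld a e => σ.m a (e.ev w σ)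

/-- No overflow occurs in the evaluation of the expression. -/
def ok (w : ℕ) (σ : HS) : Ex → Prop
  | .v x => x < 50
  | .c a => a < 2 ^ w
  | .o p e f => e.ok w σ ∧ f.ok w σ ∧ okOp w p (e.ev w σ) (f.ev w σ)
  | .wrap _ e f => e.ok w σ ∧ f.ok w σ
  | .ld a e => a < 103 ∧ e.ok w σ

def cost : Ex → ℕ
  | .v _ => 1
  | .c _ => 1
  | .o _ e f => e.cost + f.cost + 1
  | .wrap _ e f => e.cost + f.cost + 1
  | .ld _ e => e.cost + 1

/-- Code that writes the value of an expression to the register `r`, and uses only registers from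
`r` on. -/
def comp (r : ℕ) : Ex → Prog
  | .v x => .op .or r x x
  | .c a => .const r a
  | .o p e f => .seq (e.comp r) (.seq (f.comp (r + 1)) (.op p r r (r + 1)))
  | .wrap p e f => .seq (e.comp r) (.seq (f.comp (r + 1)) (.op p r r (r + 1)))
  | .ld a e => .seq (e.comp r) (.load r a r)

section simp
variable (w : ℕ) (σ : HS) (e f : Ex)
@[simp] theorem ev_v (x : ℕ) : (Ex.v x).ev w σ = σ.v x := rfl
@[simp] theorem ev_c (a : ℕ) : (Ex.c a).ev w σ = a := rfl
@[simp] theorem ev_add : (e + f).ev w σ = e.ev w σ + f.ev w σ := rfl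
@[simp] theorem ev_sub : (e - f).ev w σ = e.ev w σ - f.ev w σ := rfl
@[simp] theorem ev_mul : (e * f).ev w σ = e.ev w σ * f.ev w σ := rfl
@[simp] theorem ev_div : (e / f).ev w σ = e.ev w σ / f.ev w σ := rfl
@[simp] theorem ev_mod : (e % f).ev w σ = e.ev w σ % f.ev w σ := rfl
@[simp] theorem ev_lt : (e.lt f).ev w σ = if e.ev w σ < f.ev w σ then 1 else 0 := rfl
@[simp] theorem ev_eq : (e.eq f).ev w σ = if e.ev w σ = f.ev w σ then 1 else 0 := rfl
@[simp] theorem ev_wrap (p : Op) : (Ex.wrap p e f).ev w σ = p.eval w (e.ev w σ) (f.ev w σ) := rfl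
@[simp] theorem ev_ld (a : ℕ) : (Ex.ld a e).ev w σ = σ.m a (e.ev w σ) := rfl
@[simp] theorem ok_v (x : ℕ) : (Ex.v x).ok w σ ↔ x < 50 := Iff.rfl
@[simp] theorem ok_c (a : ℕ) : (Ex.c a).ok w σ ↔ a < 2 ^ w := Iff.rfl
@[simp] theorem ok_add : (e + f).ok w σ ↔ e.ok w σ ∧ f.ok w σ ∧ e.ev w σ + f.ev w σ < 2 ^ w :=
  Iff.rfl
@[simp] theorem ok_sub : (e - f).ok w σ ↔ e.ok w σ ∧ f.ok w σ ∧ f.ev w σ ≤ e.ev w σ := Iff.rfl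
@[simp] theorem ok_mul : (e * f).ok w σ ↔ e.ok w σ ∧ f.ok w σ ∧ e.ev w σ * f.ev w σ < 2 ^ w :=
  Iff.rfl
@[simp] theorem ok_div : (e / f).ok w σ ↔ e.ok w σ ∧ f.ok w σ :=
  ⟨fun h => ⟨h.1, h.2.1⟩, fun h => ⟨h.1, h.2, trivial⟩⟩
@[simp] theorem ok_mod : (e % f).ok w σ ↔ e.ok w σ ∧ f.ok w σ :=
  ⟨fun h => ⟨h.1, h.2.1⟩, fun h => ⟨h.1, h.2, trivial⟩⟩
@[simp] theorem ok_lt : (e.lt f).ok w σ ↔ e.ok w σ ∧ f.ok w σ ∧ 1 < 2 ^ w := Iff.rfl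
@[simp] theorem ok_eq : (e.eq f).ok w σ ↔ e.ok w σ ∧ f.ok w σ ∧ 1 < 2 ^ w := Iff.rfl
@[simp] theorem ok_wrap (p : Op) : (Ex.wrap p e f).ok w σ ↔ e.ok w σ ∧ f.ok w σ := Iff.rfl
@[simp] theorem ok_ld (a : ℕ) : (Ex.ld a e).ok w σ ↔ a < 103 ∧ e.ok w σ := Iff.rfl
@[simp] theorem cost_v (x : ℕ) : (Ex.v x).cost = 1 := rfl
@[simp] theorem cost_c (a : ℕ) : (Ex.c a).cost = 1 := rfl
@[simp] theorem cost_add : (e + f).cost = e.cost + f.cost + 1 := rfl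
@[simp] theorem cost_sub : (e - f).cost = e.cost + f.cost + 1 := rfl
@[simp] theorem cost_mul : (e * f).cost = e.cost + f.cost + 1 := rfl
@[simp] theorem cost_div : (e / f).cost = e.cost + f.cost + 1 := rfl
@[simp] theorem cost_mod : (e % f).cost = e.cost + f.cost + 1 := rfl
@[simp] theorem cost_lt : (e.lt f).cost = e.cost + f.cost + 1 := rfl
@[simp] theorem cost_eq : (e.eq f).cost = e.cost + f.cost + 1 := rfl
@[simp] theorem cost_wrap (p : Op) : (Ex.wrap p e f).cost = e.cost + f.cost + 1 := rfl
@[simp] theorem cost_ld (a : ℕ) : (Ex.ld a e).cost = e.cost + 1 := rfl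
end simp

theorem eval_eq_ideal {w a b : ℕ} {o : Op} (ha : a < 2 ^ w) (hb : b < 2 ^ w) (h : okOp w o a b) :
    o.eval w a b = ideal o a b := by
  cases o <;> simp only [okOp] at h <;> simp only [Op.eval, ideal]
  · exact Nat.mod_eq_of_lt h
  · rw [show a + 2 ^ w - b = a - b + 2 ^ w by omega, Nat.add_mod_right]
    exact Nat.mod_eq_of_lt (by omega)
  · exact Nat.mod_eq_of_lt h
  · exact Nat.mod_eq_of_lt ((Nat.div_le_self _ _).trans_lt ha)
  · exact Nat.mod_eq_of_lt ((Nat.mod_le _ _).trans_lt ha)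
  · split_ifs <;> exact Nat.mod_eq_of_lt (by omega)
  · split_ifs <;> exact Nat.mod_eq_of_lt (by omega)

/-- The registers from `r` on serve as an evaluation stack: the right operand is computed from `r +
1` on, so the left operand in `r` survives. Since `50 ≤ r`, the visible state does not change. -/
theorem comp_run {w : ℕ} {σ : HS} (e : Ex) : ∀ (r : ℕ) (s : State), 50 ≤ r → Rep w s σ →
    e.ok w σ → ∃ s' : State, Run w (e.comp r) s s' e.cost ∧ s'.reg r = e.ev w σ ∧ Rep w s' σ ∧
      ∀ x < r, s'.reg x = s.reg x := by
  have key : ∀ (r : ℕ) (s : State) (a : ℕ), 50 ≤ r → Rep w s σ → a < 2 ^ w →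
      (s.setReg r a).reg r = a ∧ Rep w (s.setReg r a) σ ∧
        ∀ x < r, (s.setReg r a).reg x = s.reg x := by
    intro r s a hr hs ha
    refine ⟨by simp [State.setReg], ⟨hs.1.setReg ha, fun x hx => ?_, hs.2.2⟩, fun x hx => ?_⟩
    · have : x ≠ r := by omega
      simpa [State.setReg, this] using hs.2.1 x hx
    · have : x ≠ r := by omega
      simp [State.setReg, this]
  have bin : ∀ (p : Op) (e f : Ex), (∀ (r : ℕ) (s : State), 50 ≤ r → Rep w s σ →
      e.ok w σ → ∃ s' : State, Run w (e.comp r) s s' e.cost ∧ s'.reg r = e.ev w σ ∧ Rep w s' σ ∧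
      ∀ x < r, s'.reg x = s.reg x) → (∀ (r : ℕ) (s : State), 50 ≤ r → Rep w s σ →
      f.ok w σ → ∃ s' : State, Run w (f.comp r) s s' f.cost ∧ s'.reg r = f.ev w σ ∧ Rep w s' σ ∧
      ∀ x < r, s'.reg x = s.reg x) → ∀ (r : ℕ) (s : State), 50 ≤ r → Rep w s σ →
      e.ok w σ → f.ok w σ → ∃ s' : State,
      Run w (.seq (e.comp r) (.seq (f.comp (r + 1)) (.op p r r (r + 1)))) s s'
        (e.cost + f.cost + 1) ∧ s'.reg r = p.eval w (e.ev w σ) (f.ev w σ) ∧ Rep w s' σ ∧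
      (∀ x < r, s'.reg x = s.reg x) ∧ e.ev w σ < 2 ^ w ∧ f.ev w σ < 2 ^ w := by
    intro p e f he hf r s hr hs h1 h2
    obtain ⟨s₁, r1, v1, R1, f1⟩ := he r s hr hs h1
    obtain ⟨s₂, r2, v2, R2, f2⟩ := hf (r + 1) s₁ (by omega) R1 h2
    obtain ⟨v3, R3, f3⟩ := key r s₂ (p.eval w (s₂.reg r) (s₂.reg (r + 1))) hr R2 (p.eval_lt w _ _)
    refine ⟨_, (r1.seq (r2.seq (Run.op p r r (r + 1) s₂))), ?_, R3, fun x hx => ?_, ?_, ?_⟩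
    · rw [v3, v2, f2 r (by omega), v1]
    · rw [f3 x hx, f2 x (by omega), f1 x hx]
    · rw [← v1]; exact R1.1.1 _
    · rw [← v2]; exact R2.1.1 _
  induction e with
  | v x =>
    intro r s hr hs hx
    have hx : x < 50 := hx
    have e1 : Op.eval w .or (s.reg x) (s.reg x) = σ.v x := by
      simp only [Op.eval, Nat.or_self]
      rw [Nat.mod_eq_of_lt (hs.1.1 x), hs.2.1 x hx]
    obtain ⟨h1, h2, h3⟩ := key r s _ hr hs (Op.eval_lt w .or (s.reg x) (s.reg x))
    exact ⟨_, Run.op .or r x x s, h1.trans e1, h2, h3⟩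
  | c a =>
    intro r s hr hs ha
    have ha : a < 2 ^ w := ha
    obtain ⟨h1, h2, h3⟩ := key r s (a % 2 ^ w) hr hs (Nat.mod_lt _ (by positivity))
    exact ⟨_, Run.const r a s, h1.trans (Nat.mod_eq_of_lt ha), h2, h3⟩
  | o p e f he hf =>
    rintro r s hr hs ⟨h1, h2, h3⟩
    obtain ⟨s', a1, a2, a3, a4, a5, a6⟩ := bin p e f he hf r s hr hs h1 h2
    exact ⟨s', a1, a2.trans (eval_eq_ideal a5 a6 h3), a3, a4⟩
  | wrap p e f he hf =>
    rintro r s hr hs ⟨h1, h2⟩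
    obtain ⟨s', a1, a2, a3, a4, a5, a6⟩ := bin p e f he hf r s hr hs h1 h2
    exact ⟨s', a1, a2, a3, a4⟩
  | ld a e he =>
    rintro r s hr hs ⟨ha, h1⟩
    obtain ⟨s₁, r1, v1, R1, f1⟩ := he r s hr hs h1
    obtain ⟨v3, R3, f3⟩ := key r s₁ (s₁.mem a (s₁.reg r)) hr R1 (R1.1.2 _ _)
    refine ⟨_, r1.seq (Run.load r a r s₁), ?_, R3, fun x hx => ?_⟩
    · rw [v3, v1, R1.2.2 a ha]; rfl
    · rw [f3 x hx, f1 x hx]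

end Ex

namespace Prog

/-- No operation. -/
def skip : Prog := .const 50 0

/-- `x := e` -/
def set (x : ℕ) (e : Ex) : Prog := .seq (e.comp 50) (.op .or x 50 50)

/-- `a[e] := f` -/
def put (a : ℕ) (e f : Ex) : Prog := .seq (e.comp 50) (.seq (f.comp 51) (.store a 50 51))

/-- if `e ≠ 0` then `P` else `Q` -/
def cond (e : Ex) (P Q : Prog) : Prog := .seq (e.comp 50) (.ite 50 P Q)

/-- while `e ≠ 0` do `P` -/
def loop (e : Ex) (P : Prog) : Prog := .seq (e.comp 50) (.while 50 (.seq P (e.comp 50)))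

/-- for `i = 0, …, e - 1` do `P` -/
def for_ (i : ℕ) (e : Ex) (P : Prog) : Prog :=
  .seq (set i (.c 0)) (loop (.lt (.v i) e) (.seq P (set i (.v i + .c 1))))

end Prog

infixr:60 ";;" => Prog.seq

/-- `P` transforms the visible part `σ` of a state in such a way that the new visible part and the
running time satisfy `Q`. -/
def Hwp (w : ℕ) (P : Prog) (Q : HS → ℕ → Prop) (σ : HS) : Prop :=
  ∀ s, Rep w s σ → ∃ s' σ' t, Run w P s s' t ∧ Rep w s' σ' ∧ Q σ' t

/-- `σ'` arises from `σ` by changes in the registers in `L` and the arrays in `A`. -/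
structure Fr (L A : List ℕ) (σ σ' : HS) : Prop where
  v : ∀ x, x < 50 → x ∉ L → σ'.v x = σ.v x
  m : ∀ a, a < 103 → a ∉ A → σ'.m a = σ.m a

theorem Fr.refl (L A : List ℕ) (σ : HS) : Fr L A σ σ := ⟨fun _ _ _ => rfl, fun _ _ _ => rfl⟩

theorem Fr.trans {L A : List ℕ} {σ σ' σ'' : HS} (h : Fr L A σ σ') (h' : Fr L A σ' σ'') :
    Fr L A σ σ'' :=
  ⟨fun x h1 h2 => (h'.v x h1 h2).trans (h.v x h1 h2),
    fun x h1 h2 => (h'.m x h1 h2).trans (h.m x h1 h2)⟩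

theorem Fr.mono {L A L' A' : List ℕ} {σ σ' : HS} (h : Fr L A σ σ') (hL : ∀ x ∈ L, x ∈ L')
    (hA : ∀ x ∈ A, x ∈ A') : Fr L' A' σ σ' :=
  ⟨fun x h1 h2 => h.v x h1 fun h3 => h2 (hL x h3),
    fun x h1 h2 => h.m x h1 fun h3 => h2 (hA x h3)⟩

theorem Fr.setV {L A : List ℕ} {σ σ' : HS} (h : Fr L A σ σ') {x a : ℕ} (hx : x ∈ L) :
    Fr L A σ (σ'.setV x a) := by
  refine ⟨fun y h1 h2 => ?_, h.m⟩
  have : y ≠ x := by rintro rfl; exact h2 hx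
  simpa [this] using h.v y h1 h2

/-! ### Rules of the program logic. -/

namespace Hwp

variable {w : ℕ} {P P' : Prog} {Q Q' : HS → ℕ → Prop} {σ : HS}

theorem mono (h : Hwp w P Q' σ) (hQ : ∀ σ' t, Q' σ' t → Q σ' t) : Hwp w P Q σ := by
  intro s hs
  obtain ⟨s', σ', t, h1, h2, h3⟩ := h s hs
  exact ⟨s', σ', t, h1, h2, hQ _ _ h3⟩

theorem bd (h : σ.Bd w → Hwp w P Q σ) : Hwp w P Q σ := fun s hs => h hs.bd s hs

theorem frame (h : Hwp w P Q σ) (L A : List ℕ) (hP : P.wr L A = true) :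
    Hwp w P (fun σ' t => Fr L A σ σ' ∧ Q σ' t) σ := by
  intro s hs
  obtain ⟨s', σ', t, h1, h2, h3⟩ := h s hs
  have hf := h1.frame L A hP
  refine ⟨s', σ', t, h1, h2, ⟨fun x hx hL => ?_, fun a ha hA => ?_⟩, h3⟩
  · rw [← h2.2.1 x hx, hf.1 x hx hL, hs.2.1 x hx]
  · rw [← h2.2.2 a ha, hf.2 a ha hA, hs.2.2 a ha]

theorem seq (h : Hwp w P (fun σ₁ t₁ => Hwp w P' (fun σ₂ t₂ => Q σ₂ (t₁ + t₂)) σ₁) σ) :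
    Hwp w (P ;; P') Q σ := by
  intro s hs
  obtain ⟨s₁, σ₁, t₁, r1, R1, h1⟩ := h s hs
  obtain ⟨s₂, σ₂, t₂, r2, R2, h2⟩ := h1 s₁ R1
  exact ⟨s₂, σ₂, _, r1.seq r2, R2, h2⟩

theorem skip (h : Q σ 1) : Hwp w Prog.skip Q σ := by
  intro s hs
  refine ⟨_, σ, 1, Run.const _ _ _, ⟨hs.1.setReg (Nat.mod_lt _ (by positivity)), fun x hx => ?_,
    hs.2.2⟩, h⟩
  have : x ≠ 50 := by omega
  simpa [State.setReg, this] using hs.2.1 x hx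

theorem set {x : ℕ} {e : Ex} (hx : x < 50) (he : e.ok w σ)
    (h : Q (σ.setV x (e.ev w σ)) (e.cost + 1)) : Hwp w (Prog.set x e) Q σ := by
  intro s hs
  obtain ⟨s₁, r1, v1, R1, f1⟩ := e.comp_run 50 s le_rfl hs he
  have e1 : Op.eval w .or (s₁.reg 50) (s₁.reg 50) = e.ev w σ := by
    simp only [Op.eval, Nat.or_self]
    rw [Nat.mod_eq_of_lt (R1.1.1 50), v1]
  refine ⟨_, σ.setV x (e.ev w σ), _, r1.seq (Run.op .or x 50 50 s₁),
    ⟨R1.1.setReg (Op.eval_lt _ _ _ _), fun y hy => ?_, R1.2.2⟩, h⟩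
  by_cases hyx : y = x
  · subst hyx; simpa [State.setReg] using e1
  · simpa [State.setReg, hyx] using R1.2.1 y hy

theorem put {a : ℕ} {e f : Ex} (ha : a < 103) (he : e.ok w σ) (hf : f.ok w σ)
    (h : Q (σ.setM a (e.ev w σ) (f.ev w σ)) (e.cost + f.cost + 1)) :
    Hwp w (Prog.put a e f) Q σ := by
  intro s hs
  obtain ⟨s₁, r1, v1, R1, f1⟩ := e.comp_run 50 s le_rfl hs he
  obtain ⟨s₂, r2, v2, R2, f2⟩ := f.comp_run 51 s₁ (by omega) R1 hf
  refine ⟨_, σ.setM a (e.ev w σ) (f.ev w σ), _, r1.seq (r2.seq (Run.store a 50 51 s₂)),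
    ⟨R2.1.setMem (R2.1.1 _), R2.2.1, fun b hb => ?_⟩, by rw [← add_assoc]; exact h⟩
  have h50 : s₂.reg 50 = e.ev w σ := by rw [f2 50 (by omega), v1]
  by_cases hb' : b = a
  · subst hb'
    simp [State.setMem, HS.setM, h50, v2, R2.2.2 b hb]
  · simpa [State.setMem, HS.setM, hb'] using R2.2.2 b hb

theorem cond {e : Ex} (he : e.ok w σ)
    (h1 : e.ev w σ ≠ 0 → Hwp w P (fun σ' t => Q σ' (e.cost + (t + 1))) σ)
    (h2 : e.ev w σ = 0 → Hwp w P' (fun σ' t => Q σ' (e.cost + (t + 1))) σ) :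
    Hwp w (Prog.cond e P P') Q σ := by
  intro s hs
  obtain ⟨s₁, r1, v1, R1, f1⟩ := e.comp_run 50 s le_rfl hs he
  by_cases h0 : e.ev w σ = 0
  · obtain ⟨s₂, σ₂, t, r2, R2, q⟩ := h2 h0 s₁ R1
    exact ⟨s₂, σ₂, _, r1.seq (Run.iteFalse (v1.trans h0) r2), R2, q⟩
  · obtain ⟨s₂, σ₂, t, r2, R2, q⟩ := h1 h0 s₁ R1
    exact ⟨s₂, σ₂, _, r1.seq (Run.iteTrue (by rwa [v1]) r2), R2, q⟩

/-- The number `N` of iterations is known in advance and the invariant is indexed by the iteration,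
so one induction on the number of remaining iterations gives termination, correctness and the time
bound together. -/
theorem loop {e : Ex} (N B : ℕ) (I : ℕ → HS → Prop) (h0 : I 0 σ)
    (hstep : ∀ j < N, ∀ σ', I j σ' → e.ok w σ' ∧ e.ev w σ' ≠ 0 ∧
      Hwp w P (fun σ'' t => t ≤ B ∧ I (j + 1) σ'') σ')
    (hend : ∀ σ', I N σ' → e.ok w σ' ∧ e.ev w σ' = 0)
    (hQ : ∀ σ' t, I N σ' → t ≤ N * (B + e.cost + 1) + e.cost + 1 → Q σ' t) :
    Hwp w (Prog.loop e P) Q σ := by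
  have key : ∀ m ≤ N, ∀ (s : State) (σ' : HS), Rep w s σ' → s.reg 50 = e.ev w σ' →
      I (N - m) σ' → ∃ s' σ'' t, Run w (.while 50 (.seq P (e.comp 50))) s s' t ∧
        Rep w s' σ'' ∧ I N σ'' ∧ t ≤ m * (B + e.cost + 1) + 1 := by
    intro m
    induction m with
    | zero =>
      intro _ s σ' hs h50 hI
      exact ⟨s, σ', 1, Run.whileDone (h50.trans (hend σ' hI).2), hs, hI, by simp⟩
    | succ m ih =>
      intro hm s σ' hs h50 hI
      obtain ⟨_, hne, hP⟩ := hstep (N - (m + 1)) (by omega) σ' hI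
      obtain ⟨s₁, σ₁, t₁, r1, R1, ht, hI1⟩ := hP s hs
      rw [show N - (m + 1) + 1 = N - m by omega] at hI1
      have hok : e.ok w σ₁ := by
        rcases Nat.eq_zero_or_pos m with rfl | hm'
        · exact (hend σ₁ hI1).1
        · exact (hstep (N - m) (by omega) σ₁ hI1).1
      obtain ⟨s₂, r2, v2, R2, f2⟩ := e.comp_run 50 s₁ le_rfl R1 hok
      obtain ⟨s₃, σ₃, t₃, r3, R3, hI3, ht3⟩ := ih (by omega) s₂ σ₁ R2 v2 hI1
      refine ⟨s₃, σ₃, _, Run.whileStep (by rwa [h50]) (r1.seq r2) r3, R3, hI3, ?_⟩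
      rw [Nat.succ_mul]; omega
  intro s hs
  have hok : e.ok w σ := by
    rcases Nat.eq_zero_or_pos N with rfl | hN
    · exact (hend σ h0).1
    · exact (hstep 0 hN σ h0).1
  obtain ⟨s₁, r1, v1, R1, f1⟩ := e.comp_run 50 s le_rfl hs hok
  obtain ⟨s₃, σ₃, t₃, r3, R3, hI3, ht3⟩ := key N le_rfl s₁ σ R1 v1 (by simpa using h0)
  exact ⟨s₃, σ₃, _, r1.seq r3, R3, hQ _ _ hI3 (by omega)⟩

/-- Loops, with the automatic information on what has not been changed. -/
theorem loop_frame {e : Ex} (L A : List ℕ) (hwr : P.wr L A = true) (N B : ℕ) (I : ℕ → HS → Prop)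
    (h0 : I 0 σ)
    (hstep : ∀ j < N, ∀ σ', Fr L A σ σ' → I j σ' → e.ok w σ' ∧ e.ev w σ' ≠ 0 ∧
      Hwp w P (fun σ'' t => t ≤ B ∧ I (j + 1) σ'') σ')
    (hend : ∀ σ', Fr L A σ σ' → I N σ' → e.ok w σ' ∧ e.ev w σ' = 0)
    (hQ : ∀ σ' t, Fr L A σ σ' → I N σ' → t ≤ N * (B + e.cost + 1) + e.cost + 1 → Q σ' t) :
    Hwp w (Prog.loop e P) Q σ := by
  refine loop N B (fun j σ' => Fr L A σ σ' ∧ I j σ') ⟨Fr.refl _ _ _, h0⟩ ?_ ?_ ?_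
  · rintro j hj σ' ⟨hF, hI⟩
    obtain ⟨h1, h2, h3⟩ := hstep j hj σ' hF hI
    exact ⟨h1, h2, (h3.frame L A hwr).mono fun σ'' t h => ⟨h.2.1, hF.trans h.1, h.2.2⟩⟩
  · rintro σ' ⟨hF, hI⟩; exact hend σ' hF hI
  · rintro σ' t ⟨hF, hI⟩ ht; exact hQ σ' t hF hI ht

/-- The invariant may mention the counter. For this reason the body has to establish it for the
state in which the counter has already been increased. The body itself must not write to the
counter. -/
theorem for_ {i : ℕ} {e : Ex} (L A : List ℕ) (N B : ℕ) (I : ℕ → HS → Prop)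
    (hw : 1 < 2 ^ w) (hwr : P.wr L A = true) (hi : i < 50) (hiL : i ∉ L)
    (he : ∀ σ', Fr (i :: L) A σ σ' → e.ok w σ' ∧ e.ev w σ' = N)
    (h0 : I 0 (σ.setV i 0))
    (hstep : ∀ j < N, ∀ σ', Fr (i :: L) A σ σ' → σ'.v i = j → I j σ' →
      Hwp w P (fun σ'' t => t ≤ B ∧ I (j + 1) (σ''.setV i (j + 1))) σ')
    (hQ : ∀ σ' t, Fr (i :: L) A σ σ' → I N σ' → t ≤ N * (B + e.cost + 7) + e.cost + 5 → Q σ' t) :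
    Hwp w (Prog.for_ i e P) Q σ := by
  intro s hs
  -- The bound needs no hypothesis: `N` is the value of an expression without overflow, hence the
  -- content of a register.
  have hNw : N < 2 ^ w := by
    obtain ⟨h1, h2⟩ := he σ (Fr.refl _ _ _)
    obtain ⟨s₁, -, v1, R1, -⟩ := e.comp_run 50 s le_rfl hs h1
    rw [← h2, ← v1]
    exact R1.1.1 50
  have hiF : ∀ σ' σ'' : HS, Fr L A σ' σ'' → σ''.v i = σ'.v i := fun σ' σ'' h => h.v i hi hiL
  have hmono : ∀ σ' σ'' : HS, Fr L A σ' σ'' → Fr (i :: L) A σ' σ'' := fun σ' σ'' h =>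
    h.mono (fun x hx => List.mem_cons_of_mem _ hx) fun x hx => hx
  refine Hwp.seq (Hwp.set hi (by simp) ?_) s hs
  have hrec : ∀ N' ≤ N, ∀ σ', Fr (i :: L) A σ σ' → σ'.v i = N' →
      (Ex.lt (.v i) e).ok w σ' ∧ ((Ex.lt (.v i) e).ev w σ' = if N' < N then 1 else 0) := by
    intro N' _ σ' hF hv
    obtain ⟨h1, h2⟩ := he σ' hF
    simp [h1, h2, hv, hi, hw]
  -- The increment of the counter takes four steps.
  refine loop N (B + 4) (fun j σ' => Fr (i :: L) A σ σ' ∧ σ'.v i = j ∧ I j σ') ?_ ?_ ?_ ?_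
  · exact ⟨(Fr.refl _ _ _).setV (by simp), by simp, by simpa using h0⟩
  · rintro j hj σ' ⟨hF, hv, hI⟩
    obtain ⟨h1, h2⟩ := hrec j hj.le σ' hF hv
    refine ⟨h1, by simp [h2, hj], Hwp.seq (((hstep j hj σ' hF hv hI).frame L A hwr).mono ?_)⟩
    rintro σ₁ t₁ ⟨hF1, ht, hI1⟩
    have hv1 : σ₁.v i = j := (hiF _ _ hF1).trans hv
    refine Hwp.set hi (by refine ⟨hi, ?_, ?_⟩ <;> simp only [Ex.ok_c, Ex.ev_v, Ex.ev_c, Ex.okOp, hv1] <;> omega) ⟨by simp; omega, ?_, by simp [hv1], ?_⟩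
    · exact (hF.trans (hmono _ _ hF1)).setV (by simp)
    · simpa [hv1] using hI1
  · rintro σ' ⟨hF, hv, hI⟩
    obtain ⟨h1, h2⟩ := hrec N le_rfl σ' hF hv
    exact ⟨h1, by simp [h2]⟩
  · rintro σ' t ⟨hF, hv, hI⟩ ht
    refine hQ σ' _ hF hI ?_
    simp only [Ex.cost_lt, Ex.cost_v, Ex.cost_c] at ht ⊢
    have e1 : B + 4 + (1 + e.cost + 1) + 1 = B + e.cost + 7 := by ring
    rw [e1] at ht
    omega

end Hwp

end WordRAM

namespace WordRAM

/-- A loop that writes the values `val j` to the cells `idx j` of an array. -/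
theorem Hwp.fill {w : ℕ} {Q : HS → ℕ → Prop} {σ : HS} {i a : ℕ} {u e f : Ex} (N : ℕ)
    (idx val : ℕ → ℕ) (hw : 1 < 2 ^ w) (hi : i < 50) (ha : a < 103)
    (hidx : ∀ j' < N, ∀ j < j', idx j ≠ idx j')
    (hu : ∀ σ', Fr [i] [a] σ σ' → u.ok w σ' ∧ u.ev w σ' = N)
    (hstep : ∀ j < N, ∀ σ', Fr [i] [a] σ σ' → σ'.v i = j →
      (∀ x, (∀ j' < j, idx j' ≠ x) → σ'.m a x = σ.m a x) →
      e.ok w σ' ∧ e.ev w σ' = idx j ∧ f.ok w σ' ∧ f.ev w σ' = val j)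
    (hQ : ∀ σ' t, Fr [i] [a] σ σ' → (∀ j < N, σ'.m a (idx j) = val j) →
      (∀ x, (∀ j < N, idx j ≠ x) → σ'.m a x = σ.m a x) →
      t ≤ N * (e.cost + f.cost + u.cost + 8) + u.cost + 5 → Q σ' t) :
    Hwp w (Prog.for_ i u (Prog.put a e f)) Q σ := by
  have hwr : (Prog.put a e f).wr [] [a] = true := by
    have hc : ∀ (g : Ex) (r : ℕ), 50 ≤ r → (g.comp r).wr [] [a] = true := by
      intro g
      induction g with
      | v x => intro r hr; simp [Ex.comp, Prog.wr, hr]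
      | c x => intro r hr; simp [Ex.comp, Prog.wr, hr]
      | o p e f h1 h2 => intro r hr; simp [Ex.comp, Prog.wr, hr, h1 r hr, h2 (r + 1) (by omega)]
      | wrap p e f h1 h2 => intro r hr; simp [Ex.comp, Prog.wr, hr, h1 r hr, h2 (r + 1) (by omega)]
      | ld x e h1 => intro r hr; simp [Ex.comp, Prog.wr, hr, h1 r hr]
    simp [Prog.put, Prog.wr, hc e 50, hc f 51]
  refine Hwp.for_ [] [a] N (e.cost + f.cost + 1) (fun j σ' =>
    (∀ j' < j, σ'.m a (idx j') = val j') ∧ ∀ x, (∀ j' < j, idx j' ≠ x) → σ'.m a x = σ.m a x)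
    hw hwr hi (by simp) hu ?_ ?_ ?_
  · simp
  · rintro j hj σ' hF hv ⟨h1, h2⟩
    obtain ⟨e1, e2, e3, e4⟩ := hstep j hj σ' hF hv h2
    refine Hwp.put ha e1 e3 ⟨le_rfl, fun j' hj' => ?_, fun x hx => ?_⟩
    · rw [HS.setV_m, HS.setM_m_self, e2, e4]
      rcases Nat.lt_succ_iff_lt_or_eq.1 hj' with h | rfl
      · rw [if_neg (hidx j hj j' h), h1 j' h]
      · simp
    · rw [HS.setV_m, HS.setM_m_self, e2, if_neg (hx j (by omega)).symm]
      exact h2 x fun j' hj' => hx j' (by omega)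
  · rintro σ' t hF ⟨h1, h2⟩ ht
    refine hQ σ' t hF h1 h2 (ht.trans (le_of_eq ?_))
    ring

/-! ## The parameters -/

/-- The registers `0, …, 5` and `7` hold the parameters: the numbers of vertices, the base `n + 1`
and the number `2 * (k + 1)` of digits of large numbers, the number of entries of a matrix, and the
numbers of rows and of the last row of the table of matrices. -/
structure Ctx (k n : ℕ) (σ : HS) : Prop where
  h0 : σ.v 0 = k
  h1 : σ.v 1 = n
  h2 : σ.v 2 = n + 1
  h3 : σ.v 3 = 2 * (k + 1)
  h4 : σ.v 4 = n * n
  h5 : σ.v 5 = k + 2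
  h7 : σ.v 7 = k + 1

theorem Ctx.of_fr {k n : ℕ} {L A : List ℕ} {σ σ' : HS} (h : Ctx k n σ) (hF : Fr L A σ σ')
    (hL : ∀ x ∈ [0, 1, 2, 3, 4, 5, 7], x ∉ L := by decide) : Ctx k n σ' where
  h0 := (hF.v 0 (by norm_num) (hL _ (by decide))).trans h.h0
  h1 := (hF.v 1 (by norm_num) (hL _ (by decide))).trans h.h1
  h2 := (hF.v 2 (by norm_num) (hL _ (by decide))).trans h.h2
  h3 := (hF.v 3 (by norm_num) (hL _ (by decide))).trans h.h3
  h4 := (hF.v 4 (by norm_num) (hL _ (by decide))).trans h.h4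
  h5 := (hF.v 5 (by norm_num) (hL _ (by decide))).trans h.h5
  h7 := (hF.v 7 (by norm_num) (hL _ (by decide))).trans h.h7

/-- The words are long enough for the parameters. -/
structure Sz (k n w : ℕ) : Prop where
  pos : 1 ≤ n
  le : (k + n + 2) ^ 10 ≤ 2 ^ w

namespace Sz
variable {k n w : ℕ} (h : Sz k n w)
include h

/-- All addresses and intermediate values of the algorithms are bounded by powers of `k + n + 2`
with an exponent below ten, so none of them overflows. -/
theorem lt_of_le_pow {a i : ℕ} (ha : a ≤ (k + n + 2) ^ i) (hi : i < 10 := by norm_num) :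
    a < 2 ^ w :=
  ha.trans_lt ((Nat.pow_lt_pow_right (by omega) hi).trans_le h.le)

theorem one_lt : 1 < 2 ^ w := h.lt_of_le_pow (i := 1) (by simp)

theorem w_ne : w ≠ 0 := by
  rintro rfl
  simpa using h.one_lt

end Sz

theorem mul_add_lt_mul {a b c d : ℕ} (h1 : a < b) (h2 : c < d) : a * d + c < b * d := by
  calc a * d + c < a * d + d := by omega
    _ = (a + 1) * d := by ring
    _ ≤ b * d := Nat.mul_le_mul_right _ h1

theorem Sz.mat_lt {k n w m i : ℕ} (h : Sz k n w) (hm : m < (k + 2) * (k + 2))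
    (hi : i < n * n * (2 * (k + 1))) : m * (n * n * (2 * (k + 1))) + i < 2 ^ w := by
  refine h.lt_of_le_pow (i := 6) ((mul_add_lt_mul hm hi).le.trans ?_)
  calc (k + 2) * (k + 2) * (n * n * (2 * (k + 1)))
      ≤ ((k + n + 2) * (k + n + 2)) * ((k + n + 2) * (k + n + 2) *
        ((k + n + 2) * (k + n + 2))) := by gcongr <;> omega
    _ = _ := by ring

theorem Sz.idx_lt {k n w m e d : ℕ} (h : Sz k n w) (hm : m < (k + 2) * (k + 2)) (he : e < n * n)
    (hd : d < 2 * (k + 1)) : m * (n * n) + e < 2 ^ w ∧ m * (n * n) < 2 ^ w ∧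
      (m * (n * n) + e) * (2 * (k + 1)) < 2 ^ w ∧
      (m * (n * n) + e) * (2 * (k + 1)) + d < 2 ^ w := by
  have h1 := h.mat_lt hm (mul_add_lt_mul he hd)
  have h2 : m * (n * n * (2 * (k + 1))) + (e * (2 * (k + 1)) + d) =
    (m * (n * n) + e) * (2 * (k + 1)) + d := by ring
  have h3 : m * (n * n) + e ≤ (m * (n * n) + e) * (2 * (k + 1)) :=
    Nat.le_mul_of_pos_right _ (by omega)
  omega

/-! ## Convolution of digit sequences -/

namespace Alg

/-- The accumulators are set to zero. -/
def zeroAcc : Prog := .for_ 32 (.v 4) (.put 8 (.v 32) (.c 0))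
/-- The numbers in the array `102` are added to the accumulators. -/
def addAcc : Prog := .for_ 32 (.v 4) (.put 8 (.v 32) (.ld 8 (.v 32) + .ld 102 (.v 32)))
/-- The last digits of the accumulators become digits of the results. -/
def digitAcc : Prog := .for_ 32 (.v 4) (.put 4 (.v 32 * .v 3 + .v 36) (.ld 8 (.v 32) % .v 2))
/-- The last digits of the accumulators are removed. -/
def carryAcc : Prog := .for_ 32 (.v 4) (.put 8 (.v 32) (.ld 8 (.v 32) / .v 2))
/-- The results become the matrix whose number is in register `20`. -/
def copyOut : Prog :=
  .for_ 32 (.v 4 * .v 3) (.put 3 (.v 20 * (.v 4 * .v 3) + .v 32) (.ld 4 (.v 32)))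

/-- The convolution of the products of digits that are computed by `P`. -/
def conv (P : Prog) : Prog :=
  zeroAcc ;;
  .for_ 36 (.v 3) (
    .for_ 30 (.v 36 + .c 1) (.set 31 (.v 36 - .v 30) ;; P ;; addAcc) ;;
    digitAcc ;; carryAcc) ;;
  copyOut

section
variable {k n w : ℕ} {σ : HS}

theorem zeroAcc_spec (hS : Sz k n w) (hC : Ctx k n σ) :
    Hwp w zeroAcc (fun σ' t => t ≤ n * n * 20 + 20 ∧ ∀ e < n * n, σ'.m 8 e = 0) σ := by
  refine Hwp.fill (n * n) id (fun _ => 0) hS.one_lt (by norm_num) (by norm_num)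
    (fun j' _ j hj => hj.ne) (fun σ' hF => ?_) (fun j hj σ' hF hv hm => ?_)
    fun σ' t hF h1 h2 ht => ?_
  · simp [(hC.of_fr hF).h4]
  · simp [hv]
  · simp only [Ex.cost_v, Ex.cost_c] at ht
    exact ⟨by omega, h1⟩

theorem addAcc_spec (hS : Sz k n w) (hC : Ctx k n σ)
    (hb : ∀ e < n * n, σ.m 8 e + σ.m 102 e < 2 ^ w) :
    Hwp w addAcc (fun σ' t => t ≤ n * n * 20 + 20 ∧
      ∀ e < n * n, σ'.m 8 e = σ.m 8 e + σ.m 102 e) σ := by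
  refine Hwp.fill (n * n) id (fun e => σ.m 8 e + σ.m 102 e) hS.one_lt (by norm_num) (by norm_num)
    (fun j' _ j hj => hj.ne) (fun σ' hF => ?_) (fun j hj σ' hF hv hm => ?_)
    fun σ' t hF h1 h2 ht => ?_
  · simp [(hC.of_fr hF).h4]
  · have e1 := hm j fun j' hj' => hj'.ne
    have e2 := hF.m 102 (by norm_num) (by decide)
    simp [hv, e1, e2, hb j hj]
  · simp only [Ex.cost_v, Ex.cost_ld, Ex.cost_add] at ht
    exact ⟨by omega, h1⟩

theorem carryAcc_spec (hS : Sz k n w) (hC : Ctx k n σ) :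
    Hwp w carryAcc (fun σ' t => t ≤ n * n * 20 + 20 ∧
      ∀ e < n * n, σ'.m 8 e = σ.m 8 e / (n + 1)) σ := by
  refine Hwp.fill (n * n) id (fun e => σ.m 8 e / (n + 1)) hS.one_lt (by norm_num) (by norm_num)
    (fun j' _ j hj => hj.ne) (fun σ' hF => ?_) (fun j hj σ' hF hv hm => ?_)
    fun σ' t hF h1 h2 ht => ?_
  · simp [(hC.of_fr hF).h4]
  · have e1 := hm j fun j' hj' => hj'.ne
    simp [hv, e1, (hC.of_fr hF).h2]
  · simp only [Ex.cost_v, Ex.cost_ld, Ex.cost_div] at ht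
    exact ⟨by omega, h1⟩

theorem digitAcc_spec (hS : Sz k n w) (hC : Ctx k n σ) {g : ℕ} (hg : σ.v 36 = g)
    (hgK : g < 2 * (k + 1)) :
    Hwp w digitAcc (fun σ' t => t ≤ n * n * 20 + 20 ∧
      (∀ e < n * n, σ'.m 4 (e * (2 * (k + 1)) + g) = σ.m 8 e % (n + 1)) ∧
      ∀ e, ∀ g' < 2 * (k + 1), g' ≠ g →
        σ'.m 4 (e * (2 * (k + 1)) + g') = σ.m 4 (e * (2 * (k + 1)) + g')) σ := by
  have hinj : ∀ e e' g', g' < 2 * (k + 1) →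
      e * (2 * (k + 1)) + g = e' * (2 * (k + 1)) + g' → e = e' ∧ g = g' := by
    intro e e' g' hg' h
    have h1 : (e * (2 * (k + 1)) + g) / (2 * (k + 1)) = e := by
      rw [add_comm, Nat.add_mul_div_right _ _ (by omega), Nat.div_eq_of_lt hgK, zero_add]
    have h2 : (e' * (2 * (k + 1)) + g') / (2 * (k + 1)) = e' := by
      rw [add_comm, Nat.add_mul_div_right _ _ (by omega), Nat.div_eq_of_lt hg', zero_add]
    rw [h, h2] at h1
    subst h1
    exact ⟨rfl, by omega⟩
  refine Hwp.fill (n * n) (fun e => e * (2 * (k + 1)) + g) (fun e => σ.m 8 e % (n + 1)) hS.one_lt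
    (by norm_num) (by norm_num)
    (fun j' _ j hj h => hj.ne (hinj _ _ _ hgK h).1) (fun σ' hF => ?_) (fun j hj σ' hF hv hm => ?_)
    fun σ' t hF h1 h2 ht => ?_
  · simp [(hC.of_fr hF).h4]
  · have e1 := hF.m 8 (by norm_num) (by decide)
    have e2 := hF.v 36 (by norm_num) (by decide)
    have e3 := hS.idx_lt (m := 0) (by positivity) hj hgK
    simp only [zero_mul, zero_add] at e3
    simp [hv, e1, e2, hg, (hC.of_fr hF).h2, (hC.of_fr hF).h3, e3]
  · simp only [Ex.cost_v, Ex.cost_ld, Ex.cost_mod, Ex.cost_add, Ex.cost_mul] at ht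
    exact ⟨by omega, h1, fun e g' hg' hne => h2 _ fun j hj h => hne (hinj _ _ _ hg' h).2.symm⟩

theorem copyOut_spec (hS : Sz k n w) (hC : Ctx k n σ) {m : ℕ} (hm : σ.v 20 = m)
    (hmk : m < (k + 2) * (k + 2)) :
    Hwp w copyOut (fun σ' t => t ≤ n * n * (2 * (k + 1)) * 30 + 20 ∧
      (∀ i < n * n * (2 * (k + 1)), σ'.m 3 (m * (n * n * (2 * (k + 1))) + i) = σ.m 4 i) ∧
      ∀ m' i, m' ≠ m → i < n * n * (2 * (k + 1)) →
        σ'.m 3 (m' * (n * n * (2 * (k + 1))) + i) = σ.m 3 (m' * (n * n * (2 * (k + 1))) + i)) σ := by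
  refine Hwp.fill (n * n * (2 * (k + 1))) (fun i => m * (n * n * (2 * (k + 1))) + i) (σ.m 4)
    hS.one_lt (by norm_num) (by norm_num)
    (fun j' _ j hj h => by omega) (fun σ' hF => ?_) (fun j hj σ' hF hv hm' => ?_)
    fun σ' t hF h1 h2 ht => ?_
  · have h0 : n * n * (2 * (k + 1)) < 2 ^ w :=
      hS.lt_of_le_pow (i := 4) (calc
        n * n * (2 * (k + 1)) ≤ (k + n + 2) * (k + n + 2) * ((k + n + 2) * (k + n + 2)) := by
          gcongr <;> omega
        _ = _ := by ring)
    simp [(hC.of_fr hF).h4, (hC.of_fr hF).h3, h0]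
  · have e1 := hF.m 4 (by norm_num) (by decide)
    have e2 := hF.v 20 (by norm_num) (by decide)
    have e3 := hS.mat_lt hmk hj
    have e4 : n * n * (2 * (k + 1)) < 2 ^ w := by
      have := hS.mat_lt (k := k) (m := 1) (by nlinarith) (Nat.lt_of_le_of_lt (Nat.zero_le _) hj)
      omega
    simp [hv, e1, e2, hm, (hC.of_fr hF).h4, (hC.of_fr hF).h3, e3, e4]
    omega
  · simp only [Ex.cost_v, Ex.cost_ld, Ex.cost_add, Ex.cost_mul] at ht
    refine ⟨by omega, h1, fun m' i hne hi => h2 _ fun j hj h => hne ?_⟩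
    have h3 : ∀ a b, b < n * n * (2 * (k + 1)) →
        (a * (n * n * (2 * (k + 1))) + b) / (n * n * (2 * (k + 1))) = a := by
      intro a b hb
      rw [add_comm, Nat.add_mul_div_right _ _ (by omega), Nat.div_eq_of_lt hb, zero_add]
    rw [← h3 m' i hi, ← h, h3 m j hj]

end

end Alg

end WordRAM

namespace WordRAM

theorem Prog.wr_mono {L A L' A' : List ℕ} (hL : ∀ x ∈ L, x ∈ L') (hA : ∀ x ∈ A, x ∈ A')
    (P : Prog) (h : P.wr L A = true) : P.wr L' A' = true := by
  induction P with
  | const x c => simp [wr] at h ⊢; exact h.imp id (hL x)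
  | op o x y z => simp [wr] at h ⊢; exact h.imp id (hL x)
  | load x a y => simp [wr] at h ⊢; exact h.imp id (hL x)
  | store a y x => simp [wr] at h ⊢; exact h.imp id (hA a)
  | seq P Q h1 h2 => simp [wr] at h ⊢; exact ⟨h1 h.1, h2 h.2⟩
  | ite x P Q h1 h2 => simp [wr] at h ⊢; exact ⟨h1 h.1, h2 h.2⟩
  | _ x P h1 => exact h1 h

theorem Prog.wr_seq {L A : List ℕ} {P Q : Prog} (h1 : P.wr L A = true) (h2 : Q.wr L A = true) :
    (P ;; Q).wr L A = true := by
  simp [wr, h1, h2]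

theorem Prog.wr_for {L A : List ℕ} {P : Prog} {i : ℕ} {e : Ex}
    (h : (Prog.for_ i e .skip).wr L A = true) (h1 : P.wr L A = true) :
    (Prog.for_ i e P).wr L A = true := by
  simp [wr, for_, loop, skip] at h ⊢
  simp [h, h1]

theorem Prog.wr_cond {L A : List ℕ} {P Q : Prog} {e : Ex}
    (h : (Prog.cond e .skip .skip).wr L A = true) (h1 : P.wr L A = true) (h2 : Q.wr L A = true) :
    (Prog.cond e P Q).wr L A = true := by
  simp [wr, cond, skip] at h ⊢
  simp [h, h1, h2]

namespace Alg

/-- Up to `K ^ 2` executions of the digit product (of cost `B`) with additions to the accumulators,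
`K` passes for digits and carries, and one copy, where `K = 2 * (k + 1)`. -/
def convTime (k n B : ℕ) : ℕ :=
  2 * (k + 1) * (2 * (k + 1) * (B + n * n * 20 + 50) + n * n * 40 + 100) + n * n * 100 * (k + 1) + 200

theorem conv_wr {P : Prog} (hwr : P.wr [32, 35] [100, 101, 102] = true) :
    (conv P).wr [30, 31, 32, 35, 36] [3, 4, 8, 100, 101, 102] = true :=
  Prog.wr_seq (by decide) (Prog.wr_seq (Prog.wr_for (by decide) (Prog.wr_seq
    (Prog.wr_for (by decide) (Prog.wr_seq (by decide)
      (Prog.wr_seq (Prog.wr_mono (by decide) (by decide) P hwr) (by decide))))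
    (by decide))) (by decide))

/-- School multiplication column by column, for all entries `e` at once. Before column `g` the
accumulator of `e` holds the carry of the earlier columns. The products `z d (g - d) e` are added,
the last digit in base `n + 1` is written as digit `g`, and the rest is carried on. Thus carry times
`(n + 1) ^ g` plus the digits written so far is always the sum of the columns below `g`. Columns
from `K` on are not computed, and the last carry `c` is discarded: the result is correct modulo `(n
+ 1) ^ K`. Results are collected in the array `4` and copied at the end, so the target matrix may
also be one of the factors. -/
theorem conv_spec {k n w : ℕ} {σ : HS} (hS : Sz k n w) (hC : Ctx k n σ) {P : Prog} {B m : ℕ}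
    (z : ℕ → ℕ → ℕ → ℕ) (hm : σ.v 20 = m) (hmk : m < (k + 2) * (k + 2))
    (hwr : P.wr [32, 35] [100, 101, 102] = true)
    (hz : ∀ d f e, d < 2 * (k + 1) → f < 2 * (k + 1) → e < n * n → z d f e ≤ n ^ 3)
    (hP : ∀ σ', Fr [30, 31, 32, 35, 36] [4, 8, 100, 101, 102] σ σ' → ∀ d f, d < 2 * (k + 1) →
      f < 2 * (k + 1) → σ'.v 30 = d → σ'.v 31 = f →
      Hwp w P (fun σ'' t => t ≤ B ∧ ∀ e < n * n, σ''.m 102 e = z d f e) σ') :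
    Hwp w (conv P) (fun σ' t => t ≤ convTime k n B ∧
      (∀ m' i, m' ≠ m → i < n * n * (2 * (k + 1)) →
        σ'.m 3 (m' * (n * n * (2 * (k + 1))) + i) = σ.m 3 (m' * (n * n * (2 * (k + 1))) + i)) ∧
      ∀ e < n * n, (∀ g < 2 * (k + 1),
        σ'.m 3 (m * (n * n * (2 * (k + 1))) + (e * (2 * (k + 1)) + g)) ≤ n) ∧
        ∃ c, c * (n + 1) ^ (2 * (k + 1)) + ∑ g ∈ Finset.range (2 * (k + 1)),
          σ'.m 3 (m * (n * n * (2 * (k + 1))) + (e * (2 * (k + 1)) + g)) * (n + 1) ^ g =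
          ∑ g ∈ Finset.range (2 * (k + 1)),
            (∑ d ∈ Finset.range (g + 1), z d (g - d) e) * (n + 1) ^ g) σ := by
  have hw := hS.one_lt
  have hn := hS.pos
  set K := 2 * (k + 1) with hK
  -- A column has at most `K` products, each at most `n ^ 3`. The same bound holds for the carry, so
  -- an accumulator never exceeds `2 * M`.
  set M := K * n ^ 3 with hM
  have hM2 : 2 * M < 2 ^ w := hS.lt_of_le_pow (i := 6) (by
    calc 2 * M = (2 * (2 * (k + 1))) * n ^ 3 := by rw [hM, hK]; ring
      _ ≤ ((k + n + 2) ^ 3) * (k + n + 2) ^ 3 := by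
        gcongr
        · calc 2 * (2 * (k + 1)) = 2 * 2 * (k + 1) := by ring
            _ ≤ (k + n + 2) * (k + n + 2) * (k + n + 2) := by gcongr <;> omega
            _ = _ := by ring
        · omega
      _ = _ := by ring)
  have hSum : ∀ g < K, ∀ e < n * n, ∀ j ≤ g + 1,
      ∑ d ∈ Finset.range j, z d (g - d) e ≤ M := by
    intro g hg e he j hj
    calc ∑ d ∈ Finset.range j, z d (g - d) e ≤ ∑ d ∈ Finset.range j, n ^ 3 :=
          Finset.sum_le_sum fun d hd => hz _ _ _ (by have := Finset.mem_range.1 hd; omega)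
            (by have := Finset.mem_range.1 hd; omega) he
      _ = j * n ^ 3 := by simp
      _ ≤ M := by rw [hM]; gcongr; omega
  have hKw : K < 2 ^ w := hS.lt_of_le_pow (i := 2) (by
    calc K ≤ (k + n + 2) * (k + n + 2) := by rw [hK]; gcongr <;> omega
      _ = _ := by ring)
  have hg36 : ∀ g < K, ∀ σ₁ : HS, Fr [36, 30, 31, 32, 35] [4, 8, 100, 101, 102] σ σ₁ → σ₁.v 36 = g →
      (∀ e < n * n, σ₁.m 8 e ≤ M) →
      Hwp w (.for_ 30 (.v 36 + .c 1) (.set 31 (.v 36 - .v 30) ;; P ;; addAcc))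
        (fun σ' t => t ≤ K * (B + n * n * 20 + 40) + 10 ∧ ∀ e < n * n, σ'.m 8 e =
          σ₁.m 8 e + ∑ d ∈ Finset.range (g + 1), z d (g - d) e) σ₁ := by
    intro g hg σ₁ hF1 hv1 hb1
    refine Hwp.for_ [31, 32, 35] [8, 100, 101, 102] (g + 1) (B + n * n * 20 + 30)
      (fun j σ' => ∀ e < n * n, σ'.m 8 e = σ₁.m 8 e + ∑ d ∈ Finset.range j, z d (g - d) e) hw
      (Prog.wr_seq (by decide) (Prog.wr_seq (Prog.wr_mono (by decide) (by decide) P hwr)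
        (by decide))) (by norm_num) (by decide) ?_ ?_ ?_ ?_
    · intro σ' hF
      have := hF.v 36 (by norm_num) (by decide)
      simp [this, hv1, hS.w_ne]; omega
    · simp
    · intro j hj σ' hF hv hI
      have h36 : σ'.v 36 = g := (hF.v 36 (by norm_num) (by decide)).trans hv1
      refine Hwp.seq (Hwp.set (by norm_num) (by simp [h36, hv]; omega) ?_)
      have hFF : Fr [30, 31, 32, 35, 36] [4, 8, 100, 101, 102] σ
          (σ'.setV 31 (Ex.ev w σ' (.v 36 - .v 30))) :=
        (((hF1.mono (by decide) (by decide)).trans (hF.mono (by decide) (by decide))).setV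
          (by decide))
      refine Hwp.seq (((hP _ hFF j (g - j) (by omega) (by omega) (by simp [hv])
        (by simp [h36, hv])).frame _ _ hwr).mono ?_)
      rintro σ₂ t₂ ⟨hF2, ht2, hz2⟩
      have h8 : ∀ e, σ₂.m 8 e = σ'.m 8 e := fun e => by
        rw [hF2.m 8 (by norm_num) (by decide)]; rfl
      have hC2 : Ctx k n σ₂ := (hC.of_fr hFF).of_fr hF2
      refine (addAcc_spec hS hC2 fun e he => ?_).mono ?_
      · rw [h8, hz2 e he, hI e he]
        have h3 := hSum g hg e he (j + 1) (by omega)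
        rw [Finset.sum_range_succ] at h3
        have := hb1 e he
        omega
      · rintro σ₃ t₃ ⟨ht3, h3⟩
        refine ⟨by simp; omega, fun e he => ?_⟩
        rw [HS.setV_m, h3 e he, h8, hz2 e he, hI e he, Finset.sum_range_succ, add_assoc]
    · intro σ' t hF hI ht
      refine ⟨?_, hI⟩
      simp only [Ex.cost_add, Ex.cost_v, Ex.cost_c] at ht
      calc t ≤ (g + 1) * (B + n * n * 20 + 30 + (1 + 1 + 1) + 7) + 10 := by omega
        _ ≤ K * (B + n * n * 20 + 40) + 10 := by gcongr; omega
  refine Hwp.seq (((zeroAcc_spec hS hC).frame [32] [8] (by decide)).mono ?_)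
  rintro σ₀ t₀ ⟨hF0, ht0, h80⟩
  have hF0' : Fr [36, 30, 31, 32, 35] [4, 8, 100, 101, 102] σ σ₀ := hF0.mono (by decide) (by decide)
  refine Hwp.seq (Hwp.for_ [30, 31, 32, 35] [4, 8, 100, 101, 102] K
    (K * (B + n * n * 20 + 40) + n * n * 40 + 60)
    (fun g σ' => ∀ e < n * n, σ'.m 8 e ≤ M ∧ (∀ g' < g, σ'.m 4 (e * K + g') ≤ n) ∧
      σ'.m 8 e * (n + 1) ^ g + ∑ g' ∈ Finset.range g, σ'.m 4 (e * K + g') * (n + 1) ^ g' =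
        ∑ g' ∈ Finset.range g, (∑ d ∈ Finset.range (g' + 1), z d (g' - d) e) * (n + 1) ^ g')
    hw (Prog.wr_seq (Prog.wr_for (by decide) (Prog.wr_seq (by decide)
      (Prog.wr_seq (Prog.wr_mono (by decide) (by decide) P hwr) (by decide)))) (by decide))
    (by norm_num) (by decide) ?_ ?_ ?_ ?_)
  · intro σ' hF
    simp [((hC.of_fr hF0).of_fr hF).h3, hK]
  · intro e he
    simp [h80 e he]
  · intro g hg σ₁ hF1 hv1 hI
    have hFF := hF0'.trans hF1
    refine Hwp.seq (((hg36 g hg σ₁ hFF hv1 fun e he => (hI e he).1).frame [30, 31, 32, 35]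
      [8, 100, 101, 102] (Prog.wr_for (by decide) (Prog.wr_seq (by decide)
      (Prog.wr_seq (Prog.wr_mono (by decide) (by decide) P hwr) (by decide))))).mono ?_)
    rintro σ₂ t₂ ⟨hF2, ht2, h82⟩
    have hC2 : Ctx k n σ₂ := (hC.of_fr hFF).of_fr hF2
    have h36 : σ₂.v 36 = g := (hF2.v 36 (by norm_num) (by decide)).trans hv1
    refine Hwp.seq (((digitAcc_spec hS hC2 h36 hg).frame [32] [4] (by decide)).mono ?_)
    rintro σ₃ t₃ ⟨hF3, ht3, hd3, ho3⟩
    refine (((carryAcc_spec hS (hC2.of_fr hF3)).frame [32] [8] (by decide)).mono ?_)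
    rintro σ₄ t₄ ⟨hF4, ht4, h84⟩
    refine ⟨by omega, fun e he => ?_⟩
    obtain ⟨i1, i2, i3⟩ := hI e he
    have h4 : σ₄.m 4 = σ₃.m 4 := hF4.m 4 (by norm_num) (by decide)
    have h4' : σ₂.m 4 = σ₁.m 4 := hF2.m 4 (by norm_num) (by decide)
    have h8 : σ₃.m 8 = σ₂.m 8 := hF3.m 8 (by norm_num) (by decide)
    have hA := h82 e he
    have hs := hSum g hg e he (g + 1) le_rfl
    have hold : ∀ g' < g, σ₄.m 4 (e * K + g') = σ₁.m 4 (e * K + g') := fun g' hg' => by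
      rw [h4, ho3 e g' (by omega) (by omega), h4']
    have hnew : σ₄.m 4 (e * K + g) = σ₂.m 8 e % (n + 1) := by rw [h4, hd3 e he]
    have hc : σ₄.m 8 e = σ₂.m 8 e / (n + 1) := by rw [h84 e he, h8]
    simp only [HS.setV_m]
    refine ⟨?_, fun g' hg' => ?_, ?_⟩
    · rw [hc]
      -- The carry does not grow, because the base `n + 1` is at least two.
      refine Nat.div_le_of_le_mul ?_
      calc σ₂.m 8 e ≤ 2 * M := by omega
        _ ≤ (n + 1) * M := by gcongr; omega
    · rcases Nat.lt_succ_iff_lt_or_eq.1 hg' with h | rfl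
      · rw [hold g' h]; exact i2 g' h
      · rw [hnew]; exact Nat.lt_succ_iff.1 (Nat.mod_lt _ (by omega))
    · rw [Finset.sum_range_succ, Finset.sum_range_succ, Finset.sum_congr rfl fun g' hg' => by
        rw [hold g' (Finset.mem_range.1 hg')], hnew, hc, ← i3]
      have h5 := Nat.div_add_mod (σ₂.m 8 e) (n + 1)
      calc _ = (∑ g' ∈ Finset.range g, σ₁.m 4 (e * K + g') * (n + 1) ^ g') +
            ((n + 1) * (σ₂.m 8 e / (n + 1)) + σ₂.m 8 e % (n + 1)) * (n + 1) ^ g := by ring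
        _ = _ := by rw [h5, hA]; ring
  · intro σ₁ t₁ hF1 hI ht1
    have hFF := hF0'.trans hF1
    have hm1 : σ₁.v 20 = m := (hFF.v 20 (by norm_num) (by decide)).trans hm
    refine ((copyOut_spec hS (hC.of_fr hFF) hm1 hmk).frame [32] [3] (by decide)).mono ?_
    rintro σ₂ t₂ ⟨hF2, ht2, hd2, ho2⟩
    refine ⟨?_, fun m' i hne hi => ?_, fun e he => ⟨fun g hg => ?_, σ₁.m 8 e, ?_⟩⟩
    · simp only [Ex.cost_v] at ht1
      change t₂ ≤ n * n * K * 30 + 20 at ht2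
      have h1 : t₀ + (t₁ + t₂) ≤ K * (K * (B + n * n * 20 + 40) + n * n * 40 + 60 + 1 + 7)
        + n * n * 20 + n * n * K * 30 + 60 := by omega
      refine h1.trans ?_
      rw [convTime, ← hK, show n * n * 100 * (k + 1) = n * n * K * 50 by rw [hK]; ring]
      have h2 : n * n ≤ n * n * K := Nat.le_mul_of_pos_right _ (by omega)
      have h3 : K * (K * (B + n * n * 20 + 40) + n * n * 40 + 60 + 1 + 7) ≤
        K * (K * (B + n * n * 20 + 50) + n * n * 40 + 100) := by
        have : K * (B + n * n * 20 + 40) ≤ K * (B + n * n * 20 + 50) := by gcongr; norm_num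
        exact Nat.mul_le_mul_left _ (by omega)
      omega
    · rw [ho2 m' i hne hi, hFF.m 3 (by norm_num) (by decide)]
    · rw [hd2 _ (mul_add_lt_mul he hg)]; exact (hI e he).2.1 g hg
    · rw [← (hI e he).2.2]
      congr 1
      exact Finset.sum_congr rfl fun g hg => by
        rw [hd2 _ (mul_add_lt_mul he (Finset.mem_range.1 hg))]

end Alg

end WordRAM

namespace WordRAM

/-! ## Multiplication of matrices of large numbers -/

/-- Numbers are computed modulo `(n + 1) ^ (2 * (k + 1))`. -/
abbrev Res (k n : ℕ) := ZMod ((n + 1) ^ (2 * (k + 1)))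

/-- The residue class with the digits `x 0, x 1, …` in base `n + 1`. -/
def dv (k n : ℕ) (x : ℕ → ℕ) : Res k n :=
  ∑ g ∈ Finset.range (2 * (k + 1)), (x g : Res k n) * ((n : Res k n) + 1) ^ g

theorem base_pow_eq_zero (k n : ℕ) : ((n : Res k n) + 1) ^ (2 * (k + 1)) = 0 := by
  have h : (((n + 1) ^ (2 * (k + 1)) : ℕ) : Res k n) = 0 := ZMod.natCast_self _
  push_cast at h
  exact h

theorem dv_congr {k n : ℕ} {x y : ℕ → ℕ} (h : ∀ g < 2 * (k + 1), x g = y g) :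
    dv k n x = dv k n y :=
  Finset.sum_congr rfl fun g hg => by rw [h g (Finset.mem_range.1 hg)]

theorem dv_natCast (k n : ℕ) (x : ℕ → ℕ) :
    dv k n x = ((∑ g ∈ Finset.range (2 * (k + 1)), x g * (n + 1) ^ g : ℕ) : Res k n) := by
  simp [dv]

/-- The Cauchy product can be cut off at column `K`, since all later terms contain the factor `b ^ K
= 0`. -/
theorem sum_mul_sum_of_pow_eq_zero {R : Type*} [CommRing R] (b : R) (K : ℕ) (hb : b ^ K = 0)
    (x y : ℕ → R) :
    (∑ d ∈ Finset.range K, x d * b ^ d) * ∑ f ∈ Finset.range K, y f * b ^ f =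
      ∑ g ∈ Finset.range K, (∑ d ∈ Finset.range (g + 1), x d * y (g - d)) * b ^ g := by
  have h1 : ∑ g ∈ Finset.range K, (∑ d ∈ Finset.range (g + 1), x d * y (g - d)) * b ^ g =
      ∑ d ∈ Finset.range K, ∑ g ∈ Finset.Ico d K, x d * y (g - d) * b ^ g := by
    simp_rw [Finset.sum_mul]
    refine Finset.sum_comm' fun g d => ?_
    simp only [Finset.mem_range, Finset.mem_Ico]
    omega
  rw [h1, Finset.sum_mul_sum]
  refine Finset.sum_congr rfl fun d hd => ?_
  have hd := Finset.mem_range.1 hd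
  rw [Finset.sum_Ico_eq_sum_range]
  symm
  refine Finset.sum_subset_zero_on_sdiff (fun f hf => ?_) (fun f hf => ?_) fun f hf => ?_
  · simp only [Finset.mem_range] at *; omega
  · simp only [Finset.mem_sdiff, Finset.mem_range] at hf
    have : x d * b ^ d * (y f * b ^ f) = x d * y f * b ^ (d + f) := by ring
    rw [this, show d + f = K + (d + f - K) by omega, pow_add, hb]
    ring
  · rw [Nat.add_sub_cancel_left]; ring

/-- Entry `e` of the matrix `m`. -/
def mval (k n : ℕ) (σ : HS) (m e : ℕ) : Res k n :=
  dv k n fun g => σ.m 3 (m * (n * n * (2 * (k + 1))) + (e * (2 * (k + 1)) + g))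

/-- The digits of the entries of the matrix `m` are at most `n`. -/
def MOK (k n : ℕ) (σ : HS) (m : ℕ) : Prop :=
  ∀ e < n * n, ∀ g < 2 * (k + 1), σ.m 3 (m * (n * n * (2 * (k + 1))) + (e * (2 * (k + 1)) + g)) ≤ n

/-- The matrix `m` has been replaced by the matrix with the entries `x`, and all other matrices are
unchanged. -/
structure MSet (k n : ℕ) (σ σ' : HS) (m : ℕ) (x : ℕ → Res k n) : Prop where
  other : ∀ m' ≠ m, ∀ i < n * n * (2 * (k + 1)),
    σ'.m 3 (m' * (n * n * (2 * (k + 1))) + i) = σ.m 3 (m' * (n * n * (2 * (k + 1))) + i)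
  ok : MOK k n σ' m
  val : ∀ e < n * n, mval k n σ' m e = x e

theorem MSet.mok {k n : ℕ} {σ σ' : HS} {m : ℕ} {x : ℕ → Res k n} (h : MSet k n σ σ' m x) (m' : ℕ)
    (hm : MOK k n σ m') : MOK k n σ' m' := by
  by_cases hmm : m' = m
  · exact hmm ▸ h.ok
  · intro e he g hg
    rw [h.other m' hmm _ (mul_add_lt_mul he hg)]
    exact hm e he g hg

theorem MSet.val_ne {k n : ℕ} {σ σ' : HS} {m : ℕ} {x : ℕ → Res k n} (h : MSet k n σ σ' m x)
    {m' : ℕ} (hm : m' ≠ m) {e : ℕ} (he : e < n * n) : mval k n σ' m' e = mval k n σ m' e :=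
  dv_congr fun _ hg => h.other m' hm _ (mul_add_lt_mul he hg)

theorem mval_congr {k n : ℕ} {σ σ' : HS} (h : σ'.m 3 = σ.m 3) (m e : ℕ) :
    mval k n σ' m e = mval k n σ m e := by
  simp [mval, h]

theorem MOK.congr {k n : ℕ} {σ σ' : HS} {m : ℕ} (hm : MOK k n σ m) (h : σ'.m 3 = σ.m 3) :
    MOK k n σ' m := by
  simpa [MOK, h] using hm

/-- The discarded carry is a multiple of `(n + 1) ^ (2 * (k + 1))`, which is zero in `Res k n`. -/
theorem conv_value {k n : ℕ} {y : ℕ → ℕ} {c : ℕ} {S : ℕ → ℕ}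
    (h : c * (n + 1) ^ (2 * (k + 1)) + ∑ g ∈ Finset.range (2 * (k + 1)), y g * (n + 1) ^ g =
      ∑ g ∈ Finset.range (2 * (k + 1)), S g * (n + 1) ^ g) : dv k n y = dv k n S := by
  have h1 := congrArg (fun a : ℕ => (a : Res k n)) h
  simp only [Nat.cast_add, Nat.cast_mul, Nat.cast_pow, Nat.cast_one, base_pow_eq_zero,
    mul_zero, zero_add] at h1
  simpa [dv] using h1

theorem dv_mul_dv (k n : ℕ) (x y : ℕ → ℕ) : dv k n x * dv k n y =
    dv k n fun g => ∑ d ∈ Finset.range (g + 1), x d * y (g - d) := by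
  rw [dv, dv, sum_mul_sum_of_pow_eq_zero _ _ (base_pow_eq_zero k n)]
  simp [dv]

theorem dv_sum {ι : Type*} (k n : ℕ) (s : Finset ι) (x : ι → ℕ → ℕ) :
    dv k n (fun g => ∑ i ∈ s, x i g) = ∑ i ∈ s, dv k n (x i) := by
  simp only [dv, Nat.cast_sum, Finset.sum_mul]
  exact Finset.sum_comm

namespace Alg

/-- The products of the corresponding entries of two digit matrices. -/
def hadDigits : Prog :=
  .for_ 32 (.v 4) (.put 102 (.v 32) (.ld 3 ((.v 21 * .v 4 + .v 32) * .v 3 + .v 30) *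
    .ld 3 ((.v 22 * .v 4 + .v 32) * .v 3 + .v 31)))

/-- The entrywise product of matrices. -/
def had : Prog := conv hadDigits

/-- The product of two digit matrices. -/
def mulDigits (P : Prog) : Prog :=
  .for_ 32 (.v 4) (.put 100 (.v 32) (.ld 3 ((.v 21 * .v 4 + .v 32) * .v 3 + .v 30))) ;;
  .for_ 32 (.v 4) (.put 101 (.v 32) (.ld 3 ((.v 22 * .v 4 + .v 32) * .v 3 + .v 31))) ;;
  .op .or 100 1 1 ;; P.shift

/-- The product of matrices. -/
def mul (P : Prog) : Prog := conv (mulDigits P)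

theorem mulDigits_wr (P : Prog) : (mulDigits P).wr [32, 35] [100, 101, 102] = true :=
  Prog.wr_seq (by decide) (Prog.wr_seq (by decide) (Prog.wr_seq (by decide)
    (Prog.wr_shift _ _ (by decide) (by decide) (by decide) P)))

theorem mul_wr (P : Prog) : (mul P).wr [30, 31, 32, 35, 36] [3, 4, 8, 100, 101, 102] = true :=
  conv_wr (mulDigits_wr P)

theorem had_spec {k n w : ℕ} {σ : HS} (hS : Sz k n w) (hC : Ctx k n σ) {m m1 m2 : ℕ}
    (hm : σ.v 20 = m) (hm1 : σ.v 21 = m1) (hm2 : σ.v 22 = m2) (hmk : m < (k + 2) * (k + 2))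
    (hmk1 : m1 < (k + 2) * (k + 2)) (hmk2 : m2 < (k + 2) * (k + 2)) (h1 : MOK k n σ m1)
    (h2 : MOK k n σ m2) :
    Hwp w had (fun σ' t => t ≤ convTime k n (n * n * 50 + 50) ∧
      MSet k n σ σ' m fun e => mval k n σ m1 e * mval k n σ m2 e) σ := by
  have hn := hS.pos
  refine (conv_spec hS hC (B := n * n * 50 + 50) (fun d f e =>
    σ.m 3 (m1 * (n * n * (2 * (k + 1))) + (e * (2 * (k + 1)) + d)) *
    σ.m 3 (m2 * (n * n * (2 * (k + 1))) + (e * (2 * (k + 1)) + f))) hm hmk (by decide)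
    ?_ ?_).mono ?_
  · intro d f e hd hf he
    calc _ ≤ n * n := Nat.mul_le_mul (h1 e he d hd) (h2 e he f hf)
      _ ≤ n * n * n := Nat.le_mul_of_pos_right _ hn
      _ = n ^ 3 := by ring
  · intro σ' hF d f hd hf hvd hvf
    refine Hwp.fill (n * n) id (fun e =>
      σ.m 3 (m1 * (n * n * (2 * (k + 1))) + (e * (2 * (k + 1)) + d)) *
      σ.m 3 (m2 * (n * n * (2 * (k + 1))) + (e * (2 * (k + 1)) + f)))
      hS.one_lt (by norm_num) (by norm_num)
      (fun j' _ j hj => hj.ne) (fun σ₁ hF1 => ?_) (fun j hj σ₁ hF1 hv hm' => ?_)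
      fun σ₁ t hF1 e1 e2 ht => ?_
    · simp [((hC.of_fr hF).of_fr hF1).h4]
    · have hC1 := (hC.of_fr hF).of_fr hF1
      have e3 : σ₁.m 3 = σ.m 3 := (hF1.m 3 (by norm_num) (by decide)).trans
        (hF.m 3 (by norm_num) (by decide))
      have e4 : σ₁.v 21 = m1 := ((hF1.v 21 (by norm_num) (by decide)).trans
        (hF.v 21 (by norm_num) (by decide))).trans hm1
      have e5 : σ₁.v 22 = m2 := ((hF1.v 22 (by norm_num) (by decide)).trans
        (hF.v 22 (by norm_num) (by decide))).trans hm2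
      have e6 : σ₁.v 30 = d := (hF1.v 30 (by norm_num) (by decide)).trans hvd
      have e7 : σ₁.v 31 = f := (hF1.v 31 (by norm_num) (by decide)).trans hvf
      have i1 := hS.idx_lt hmk1 hj hd
      have i2 := hS.idx_lt hmk2 hj hf
      have a1 : (m1 * (n * n) + j) * (2 * (k + 1)) + d =
        m1 * (n * n * (2 * (k + 1))) + (j * (2 * (k + 1)) + d) := by ring
      have a2 : (m2 * (n * n) + j) * (2 * (k + 1)) + f =
        m2 * (n * n * (2 * (k + 1))) + (j * (2 * (k + 1)) + f) := by ring
      have hlt : σ.m 3 (m1 * (n * n * (2 * (k + 1))) + (j * (2 * (k + 1)) + d)) *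
          σ.m 3 (m2 * (n * n * (2 * (k + 1))) + (j * (2 * (k + 1)) + f)) < 2 ^ w := by
        refine hS.lt_of_le_pow (i := 2) ?_
        calc _ ≤ n * n := Nat.mul_le_mul (h1 j hj d hd) (h2 j hj f hf)
          _ ≤ (k + n + 2) * (k + n + 2) := by gcongr <;> omega
          _ = _ := by ring
      rw [a1] at i1
      rw [a2] at i2
      simp [hv, e3, e4, e5, e6, e7, hC1.h4, hC1.h3, i1, i2, a1, a2, hlt]
    · simp only [Ex.cost_v, Ex.cost_ld, Ex.cost_add, Ex.cost_mul] at ht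
      exact ⟨by omega, e1⟩
  · rintro σ' t ⟨ht, ho, hv⟩
    refine ⟨ht, fun m' hne i hi => ho m' i hne hi, fun e he => (hv e he).1, fun e he => ?_⟩
    obtain ⟨c, hc⟩ := (hv e he).2
    rw [mval, conv_value hc, mval, mval, dv_mul_dv]

end Alg

/-- `P` multiplies `n × n` matrices with entries in `{0, …, n}` in at most `T n` steps. -/
def MatMul (P : Prog) (c : ℕ) (T : ℕ → ℕ) : Prop :=
  ∀ (n w : ℕ) (A B : Matrix (Fin n) (Fin n) ℕ),
    (∀ i j, A i j ≤ n) → (∀ i j, B i j ≤ n) → (n + 2) ^ c ≤ 2 ^ w →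
    ∀ s : State, s.Bounded w → s.reg 0 = n → s.HoldsMatrix 0 A → s.HoldsMatrix 1 B →
      ∃ (s' : State) (t : ℕ), Run w P s s' t ∧ t ≤ T n ∧ s'.HoldsMatrix 2 (A * B)

namespace Alg

/-- Register `100` plays the role of register `0` of `P` and receives the dimension. All other
memory that the renamed program sees may hold arbitrary words, which the assumption on `P` allows.
-/
theorem call_spec {n w c : ℕ} {σ : HS} {P : Prog} {T : ℕ → ℕ} (hP : MatMul P c T)
    (hw : (n + 2) ^ c ≤ 2 ^ w) (h1 : σ.v 1 = n) (hA : ∀ e < n * n, σ.m 100 e ≤ n)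
    (hB : ∀ e < n * n, σ.m 101 e ≤ n) :
    Hwp w (.op .or 100 1 1 ;; P.shift) (fun σ' t => t ≤ T n + 1 ∧ ∀ i < n, ∀ j < n,
      σ'.m 102 (i * n + j) = ∑ z ∈ Finset.range n, σ.m 100 (i * n + z) * σ.m 101 (z * n + j)) σ := by
  intro s hs
  have hn : s.reg 1 = n := (hs.2.1 1 (by norm_num)).trans h1
  have hor : Op.eval w .or (s.reg 1) (s.reg 1) = n := by
    simp only [Op.eval, Nat.or_self]
    rw [Nat.mod_eq_of_lt (hs.1.1 1), hn]
  set s₁ := s.setReg 100 (Op.eval w .or (s.reg 1) (s.reg 1)) with hs1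
  have hb1 : s₁.Bounded w := hs.1.setReg (Op.eval_lt _ _ _ _)
  have hb2 : s₁.unshift.Bounded w := ⟨fun x => hb1.1 _, fun a i => hb1.2 _ _⟩
  obtain ⟨s', t, hr, ht, hh⟩ := hP n w (fun i j => σ.m 100 (i * n + j))
    (fun i j => σ.m 101 (i * n + j)) (fun i j => hA _ (mul_add_lt_mul i.2 j.2))
    (fun i j => hB _ (mul_add_lt_mul i.2 j.2)) hw s₁.unshift hb2
    (by simpa [State.unshift, hs1, State.setReg] using hor)
    (fun i j => by
      have := hs.2.2 100 (by norm_num)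
      simp [State.unshift, hs1, State.setReg, this])
    (fun i j => by
      have := hs.2.2 101 (by norm_num)
      simp [State.unshift, hs1, State.setReg, this])
  obtain ⟨s₂, r2, u2, f2, g2⟩ := hr.shift s₁ rfl
  refine ⟨s₂, ⟨s₂.reg, s₂.mem⟩, _, (Run.op .or 100 1 1 s).seq r2, ⟨r2.bounded hb1, fun _ _ => rfl,
    fun _ _ => rfl⟩, by omega, fun i hi j hj => ?_⟩
  have h3 := hh ⟨i, hi⟩ ⟨j, hj⟩
  rw [← u2] at h3
  simp only [State.unshift] at h3
  rw [Finset.sum_range]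
  exact h3

/-- The digit convolution in which the product of two digits is the product of two digit matrices,
computed by one call of `P`. The digits are at most `n`, which is exactly what `P` requires of the
entries; this dictates the base `n + 1`. The entries of a digit product are at most `n * n ^ 2`. -/
theorem mul_spec {k n w c : ℕ} {σ : HS} {P : Prog} {T : ℕ → ℕ} (hP : MatMul P c T)
    (hw : (n + 2) ^ c ≤ 2 ^ w) (hS : Sz k n w) (hC : Ctx k n σ) {m m1 m2 : ℕ}
    (hm : σ.v 20 = m) (hm1 : σ.v 21 = m1) (hm2 : σ.v 22 = m2) (hmk : m < (k + 2) * (k + 2))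
    (hmk1 : m1 < (k + 2) * (k + 2)) (hmk2 : m2 < (k + 2) * (k + 2)) (h1 : MOK k n σ m1)
    (h2 : MOK k n σ m2) :
    Hwp w (mul P) (fun σ' t => t ≤ convTime k n (n * n * 60 + T n + 60) ∧
      MSet k n σ σ' m fun e => ∑ z ∈ Finset.range n,
        mval k n σ m1 (e / n * n + z) * mval k n σ m2 (z * n + e % n)) σ := by
  have hn := hS.pos
  have hdiv : ∀ e < n * n, e / n < n := fun e he => Nat.div_lt_of_lt_mul he
  have hmod : ∀ e : ℕ, e % n < n := fun e => Nat.mod_lt _ hn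
  refine (conv_spec hS hC (B := n * n * 60 + T n + 60) (fun d f e => ∑ z ∈ Finset.range n,
    σ.m 3 (m1 * (n * n * (2 * (k + 1))) + ((e / n * n + z) * (2 * (k + 1)) + d)) *
    σ.m 3 (m2 * (n * n * (2 * (k + 1))) + ((z * n + e % n) * (2 * (k + 1)) + f))) hm hmk
    (mulDigits_wr P) ?_ ?_).mono ?_
  · intro d f e hd hf he
    calc _ ≤ ∑ z ∈ Finset.range n, n * n := Finset.sum_le_sum fun z hz => Nat.mul_le_mul
            (h1 _ (mul_add_lt_mul (hdiv e he) (Finset.mem_range.1 hz)) d hd)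
            (h2 _ (mul_add_lt_mul (Finset.mem_range.1 hz) (hmod e)) f hf)
      _ = n ^ 3 := by simp; ring
  · intro σ' hF d f hd hf hvd hvf
    have key : ∀ (σ₁ : HS) (L A : List ℕ) (a x y m' d : ℕ), Ctx k n σ₁ → x < 50 → y < 50 →
        σ₁.m 3 = σ.m 3 →
        x ≠ 32 → y ≠ 32 → a ∈ [100, 101] → σ₁.v x = m' → σ₁.v y = d → MOK k n σ m' →
        m' < (k + 2) * (k + 2) → d < 2 * (k + 1) →
        Hwp w (.for_ 32 (.v 4) (.put a (.v 32) (.ld 3 ((.v x * .v 4 + .v 32) * .v 3 + .v y))))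
          (fun σ₂ t => t ≤ n * n * 25 + 10 ∧ ∀ e < n * n, σ₂.m a e =
            σ.m 3 (m' * (n * n * (2 * (k + 1))) + (e * (2 * (k + 1)) + d))) σ₁ := by
      intro σ₁ L A a x y m' d hC1 hx50 hy50 h3 hx hy ha hvx hvy hM hm'k hdk
      refine Hwp.fill (n * n) id
        (fun e => σ.m 3 (m' * (n * n * (2 * (k + 1))) + (e * (2 * (k + 1)) + d))) hS.one_lt (by norm_num) (by simp at ha; omega)
        (fun j' _ j hj => hj.ne) (fun σ₂ hF2 => ?_) (fun j hj σ₂ hF2 hv hm' => ?_)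
        fun σ₂ t hF2 e1 e2 ht => ?_
      · simp [(hC1.of_fr hF2).h4]
      · have hC2 := hC1.of_fr hF2
        have e3 : σ₂.m 3 = σ.m 3 := (hF2.m 3 (by norm_num)
          (by simp at ha ⊢; omega)).trans h3
        have e4 : σ₂.v x = m' := (hF2.v x hx50 (by simpa using hx)).trans hvx
        have e5 : σ₂.v y = d := (hF2.v y hy50 (by simpa using hy)).trans hvy
        have i1 := hS.idx_lt hm'k hj hdk
        have a1 : (m' * (n * n) + j) * (2 * (k + 1)) + d =
          m' * (n * n * (2 * (k + 1))) + (j * (2 * (k + 1)) + d) := by ring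
        simp [hv, e3, e4, e5, hC2.h4, hC2.h3, i1, hx50, hy50]
        rw [a1]
      · simp only [Ex.cost_v, Ex.cost_ld, Ex.cost_add, Ex.cost_mul] at ht
        exact ⟨by omega, e1⟩
    have hC0 := hC.of_fr hF
    refine Hwp.seq (((key σ' [] [] 100 21 30 m1 d hC0 (by norm_num) (by norm_num)
      (hF.m 3 (by norm_num) (by decide)) (by norm_num) (by norm_num) (by decide)
      ((hF.v 21 (by norm_num) (by decide)).trans hm1) hvd h1 hmk1 hd).frame [32] [100]
      (by decide)).mono ?_)
    rintro σ₁ t₁ ⟨hF1, ht1, hv1⟩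
    refine Hwp.seq (((key σ₁ [] [] 101 22 31 m2 f (hC0.of_fr hF1) (by norm_num) (by norm_num)
      ((hF1.m 3 (by norm_num) (by decide)).trans (hF.m 3 (by norm_num) (by decide))) (by norm_num)
      (by norm_num) (by decide) ((hF1.v 22 (by norm_num) (by decide)).trans
        ((hF.v 22 (by norm_num) (by decide)).trans hm2))
      ((hF1.v 31 (by norm_num) (by decide)).trans hvf) h2 hmk2 hf).frame [32] [101]
      (by decide)).mono ?_)
    rintro σ₂ t₂ ⟨hF2, ht2, hv2⟩
    have h100 : σ₂.m 100 = σ₁.m 100 := hF2.m 100 (by norm_num) (by decide)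
    refine (call_spec hP hw ((hC0.of_fr hF1).of_fr hF2).h1 (fun e he => ?_)
      (fun e he => ?_)).mono ?_
    · rw [h100, hv1 e he]; exact h1 e he d hd
    · rw [hv2 e he]; exact h2 e he f hf
    · rintro σ₃ t₃ ⟨ht3, hv3⟩
      refine ⟨by omega, fun e he => ?_⟩
      have h4 := hv3 (e / n) (hdiv e he) (e % n) (hmod e)
      rw [Nat.div_add_mod' e n] at h4
      rw [h4, h100]
      refine Finset.sum_congr rfl fun z hz => ?_
      have hz := Finset.mem_range.1 hz
      rw [hv1 _ (mul_add_lt_mul (hdiv e he) hz), hv2 _ (mul_add_lt_mul hz (hmod e))]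
  · rintro σ' t ⟨ht, ho, hv⟩
    refine ⟨ht, fun m' hne i hi => ho m' i hne hi, fun e he => (hv e he).1, fun e he => ?_⟩
    obtain ⟨c, hc⟩ := (hv e he).2
    rw [mval, conv_value hc]
    simp only [mval, dv_mul_dv]
    rw [← dv_sum]
    refine dv_congr fun g hg => Finset.sum_comm

end Alg

end WordRAM

/-! ## Graphs of treewidth at most two -/

namespace Elim

open Classical in
/-- The graph with the edge relation `F` on the vertex set `S` has a tree decomposition with bags of
size at most three. The tree is given by the distances `r` from a root and the parents: a vertex in a
bag `B i` that is also in another bag that is not farther from the root is in the bag of the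
parent of `i`. -/
def Tw2 {V : Type*} (S : Finset V) (F : V → V → Prop) : Prop :=
  ∃ (N : ℕ) (B : Fin N → Finset V) (r : Fin N → ℕ), (∀ i, (B i).card ≤ 3) ∧
    (∀ i, ∃ p, ∀ j, j ≠ i → r j ≤ r i → ∀ v, v ∈ B i → v ∈ B j → r p < r i ∧ v ∈ B p) ∧
    ∀ u ∈ S, ∀ v ∈ S, u ≠ v → F u v → ∃ i, u ∈ B i ∧ v ∈ B i

theorem exists_min_rank {N : ℕ} (r : Fin N → ℕ) {q : Fin N → Prop} (h : ∃ i, q i) :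
    ∃ i, q i ∧ ∀ j, q j → r i ≤ r j := by
  classical
  obtain ⟨i, hi⟩ := h
  obtain ⟨m, hm, hmin⟩ := Finset.exists_min_image (Finset.univ.filter q) r ⟨i, by simpa using hi⟩
  exact ⟨m, by simpa using hm, fun j hj => hmin j (by simpa using hj)⟩

-- Each vertex has a top bag, the one nearest to the root. For a vertex `x` whose top bag is as far
-- from the root as possible, all neighbours lie in this bag, which has room for only two vertices
-- besides `x`.
open Classical in
theorem Tw2.exists_degree_le_two {V : Type*} {S : Finset V} {F : V → V → Prop} (h : Tw2 S F)
    (hS : S.Nonempty) : ∃ x ∈ S, (S.filter fun y => y ≠ x ∧ F x y).card ≤ 2 := by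
  obtain ⟨N, B, r, hB, hr, hE⟩ := h
  -- `Tw2` does not require that each vertex is in a bag; a vertex in no bag is isolated.
  by_cases hx : ∃ x ∈ S, ∀ i, x ∉ B i
  · obtain ⟨x, hxS, hx⟩ := hx
    refine ⟨x, hxS, ?_⟩
    rw [Finset.filter_false_of_mem, Finset.card_empty]
    · omega
    · rintro y hy ⟨hne, hF⟩
      obtain ⟨i, hi, -⟩ := hE x hxS y hy hne.symm hF
      exact hx i hi
  · push Not at hx
    have hx' : ∀ x ∈ S, ∃ i, x ∈ B i ∧ ∀ j, x ∈ B j → r i ≤ r j := fun x hxS =>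
      exists_min_rank r (hx x hxS)
    have : Nonempty (Fin N) := hS.elim fun x hxS => ⟨(hx x hxS).choose⟩
    choose! top ht hmin using hx'
    obtain ⟨x, hxS, hmax⟩ := Finset.exists_max_image S (fun x => r (top x)) hS
    refine ⟨x, hxS, ?_⟩
    have hsub : (S.filter fun y => y ≠ x ∧ F x y) ⊆ (B (top x)).erase x := by
      intro y hy
      obtain ⟨hy, hne, hF⟩ := Finset.mem_filter.1 hy
      refine Finset.mem_erase.2 ⟨hne, ?_⟩
      obtain ⟨i, ⟨hi1, hi2⟩, him⟩ := exists_min_rank r (hE x hxS y hy hne.symm hF)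
      by_cases hit : i = top x
      · exact hit ▸ hi2
      -- Let `i` be the bag nearest to the root with both `x` and `y`, and suppose that it is not
      -- the top bag of `x`. Then its parent `p` contains `x`. If `i` is the top bag of `y`, then
      -- the top bag of `x`, being no farther from the root than `p`, is strictly nearer than that
      -- of `y`, against the choice of `x`. Otherwise `p` contains `y` as well, against the choice
      -- of `i`.
      · exfalso
        obtain ⟨p, hp⟩ := hr i
        have h1 := hp (top x) (fun h => hit h.symm) (hmin x hxS i hi1) x hi1 (ht x hxS)
        have h2 := hmax y hy
        by_cases hiy : top y = i
        · have h3 := hmin x hxS p h1.2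
          rw [hiy] at h2
          have h4 := hmin x hxS i hi1
          omega
        · have h3 := hp (top y) hiy (hmin y hy i hi2) y hi2 (ht y hy)
          have h4 := him p ⟨h1.2, h3.2⟩
          omega
    refine (Finset.card_le_card hsub).trans ?_
    rw [Finset.card_erase_of_mem (ht x hxS)]
    have := hB (top x)
    omega

theorem Tw2.mono {V : Type*} {S S' : Finset V} {F F' : V → V → Prop} (h : Tw2 S F)
    (hS : S' ⊆ S) (hF : ∀ u ∈ S', ∀ v ∈ S', F' u v → F u v) : Tw2 S' F' := by
  obtain ⟨N, B, r, hB, hr, hE⟩ := h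
  exact ⟨N, B, r, hB, hr, fun u hu v hv hne huv => hE u (hS hu) v (hS hv) hne (hF u hu v hv huv)⟩

/-- Contraction of the edge between `x` and `a`. -/
theorem Tw2.contract {V : Type*} [DecidableEq V] {S : Finset V} {F F' : V → V → Prop}
    (h : Tw2 S F) {x a : V} (hx : x ∈ S) (ha : a ∈ S) (hxa : x ≠ a) (hF : F x a)
    (hF' : ∀ u ∈ S.erase x, ∀ v ∈ S.erase x, u ≠ v → F' u v →
      F u v ∨ (u = a ∧ F x v) ∨ (v = a ∧ F x u)) : Tw2 (S.erase x) F' := by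
  classical
  obtain ⟨N, B, r, hB, hr, hE⟩ := h
  -- The bag `c` is a common bag of `x` and `a` nearest to the root; the subtrees of `x` and `a`
  -- meet there, so their union is again connected.
  obtain ⟨c, ⟨hcx, hca⟩, hcm⟩ := exists_min_rank r (hE x hx a ha hxa hF)
  -- Replacing `x` by `a` in all bags gives the decomposition of the contracted graph. Only the
  -- parent condition for `a` needs an argument.
  set f : V → V := fun v => if v = x then a else v with hf
  have hmem : ∀ i v, v ∈ (B i).image f ↔ (v ≠ x ∧ v ∈ B i) ∨ (v = a ∧ x ∈ B i) := by
    intro i v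
    simp only [Finset.mem_image, hf]
    constructor
    · rintro ⟨y, hy, rfl⟩
      by_cases hyx : y = x
      · exact Or.inr ⟨by simp [hyx], hyx ▸ hy⟩
      · exact Or.inl (by simp [hyx, hy])
    · rintro (⟨h1, h2⟩ | ⟨rfl, h2⟩)
      · exact ⟨v, h2, by simp [h1]⟩
      · exact ⟨x, h2, by simp⟩
  refine ⟨N, fun i => (B i).image f, r, fun i => Finset.card_image_le.trans (hB i), fun i => ?_,
    fun u hu v hv hne huv => ?_⟩
  · obtain ⟨p, hp⟩ := hr i
    refine ⟨p, fun j hji hj v hvi hvj => ?_⟩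
    simp only [hmem] at hvi hvj ⊢
    by_cases hva : v = a
    · subst hva
      have hvx : v ≠ x := fun h => hxa h.symm
      have hi : v ∈ B i ∨ x ∈ B i := by tauto
      have hj' : v ∈ B j ∨ x ∈ B j := by tauto
      suffices r p < r i ∧ (v ∈ B p ∨ x ∈ B p) by tauto
      -- The bags `i` and `j` contain different ends of the contracted edge. If another bag not
      -- farther from the root than `i` contains `y`, the parent of `i` contains `y`. Otherwise
      -- either `i = c`, which also contains `z`, and `j` forces `z` into the parent; or `c` is
      -- farther from the root than `i` and `j`, which force `y` and `z` into the parent of `c`,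
      -- against the minimality of `c`.
      have go : ∀ y z : V, y ∈ B c → z ∈ B c → (∀ d, y ∈ B d → z ∈ B d → r c ≤ r d) →
          y ∈ B i → z ∈ B j → r p < r i ∧ (y ∈ B p ∨ z ∈ B p) := by
        intro y z hyc hzc hmin hyi hzj
        by_cases hy' : ∃ j', j' ≠ i ∧ r j' ≤ r i ∧ y ∈ B j'
        · obtain ⟨j', h1, h2, h3⟩ := hy'
          exact (hp j' h1 h2 y hyi h3).imp id Or.inl
        · push Not at hy'
          by_cases hci : c = i
          · subst hci
            exact (hp j hji hj z hzc hzj).imp id Or.inr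
          · exfalso
            have hic : r i < r c := by
              by_contra hlt
              exact hy' c hci (by omega) hyc
            obtain ⟨pc, hpc⟩ := hr c
            have h1 := hpc i (fun h => hci h.symm) hic.le y hyc hyi
            have h2 := hpc j (by rintro rfl; omega) (by omega) z hzc hzj
            have h3 := hmin pc h1.2 h2.2
            omega
      have hmin1 : ∀ d, v ∈ B d → x ∈ B d → r c ≤ r d := fun d h1 h2 => hcm d ⟨h2, h1⟩
      have hmin2 : ∀ d, x ∈ B d → v ∈ B d → r c ≤ r d := fun d h1 h2 => hcm d ⟨h1, h2⟩
      rcases hi with hi | hi <;> rcases hj' with hj' | hj'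
      · exact (hp j hji hj v hi hj').imp id Or.inl
      · exact go v x hca hcx hmin1 hi hj'
      · exact (go x v hcx hca hmin2 hi hj').imp id Or.symm
      · exact (hp j hji hj x hi hj').imp id Or.inr
    · have hi : v ≠ x ∧ v ∈ B i := by tauto
      have hj' : v ∈ B j := by tauto
      have := hp j hji hj v hi.2 hj'
      tauto
  · have hu' := Finset.mem_erase.1 hu
    have hv' := Finset.mem_erase.1 hv
    simp only [hmem]
    rcases hF' u hu v hv hne huv with h1 | ⟨rfl, h1⟩ | ⟨rfl, h1⟩
    · obtain ⟨i, h2, h3⟩ := hE u hu'.2 v hv'.2 hne h1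
      exact ⟨i, Or.inl ⟨hu'.1, h2⟩, Or.inl ⟨hv'.1, h3⟩⟩
    · obtain ⟨i, h2, h3⟩ := hE x hx v hv'.2 hv'.1.symm h1
      exact ⟨i, Or.inr ⟨rfl, h2⟩, Or.inl ⟨hv'.1, h3⟩⟩
    · obtain ⟨i, h2, h3⟩ := hE x hx u hu'.2 hu'.1.symm h1
      exact ⟨i, Or.inl ⟨hu'.1, h3⟩, Or.inr ⟨rfl, h2⟩⟩

end Elim

namespace SimpleGraph

variable {ι : Type*} {T : SimpleGraph ι}

open Classical in
/-- In a tree, a vertex has only one neighbour that is closer to the root. -/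
theorem IsTree.eq_of_dist_add_one (hT : T.IsTree) {r w a b : ι} (ha : T.Adj a w) (hb : T.Adj b w)
    (hda : T.dist r a + 1 = T.dist r w) (hdb : T.dist r b + 1 = T.dist r w) : a = b := by
  have key : ∀ c, T.Adj c w → T.dist r c + 1 = T.dist r w →
      ∃ p : T.Walk r w, p.IsPath ∧ p.penultimate = c := by
    intro c hc hd
    obtain ⟨p, hp, hpl⟩ := (hT.connected r c).exists_path_of_dist
    refine ⟨p.concat hc, ?_, by simp⟩
    refine hp.concat ?_ hc
    intro hw
    have h1 := SimpleGraph.dist_le (p.takeUntil w hw)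
    have h2 := p.length_takeUntil_le_length hw
    omega
  obtain ⟨p, hp, hpa⟩ := key a ha hda
  obtain ⟨q, hq, hqb⟩ := key b hb hdb
  have := (hT.existsUnique_path r w).unique hp hq
  rw [← hpa, ← hqb, this]

/-- In a tree with root `r`, each connected set of vertices that contains `i` and another vertex that
is not farther from the root contains the parent of `i`. -/
theorem IsTree.exists_parent (hT : T.IsTree) (r i : ι) : ∃ p, ∀ (s : Set ι) (j : ι),
    (T.induce s).Connected → i ∈ s → j ∈ s → j ≠ i → T.dist r j ≤ T.dist r i →
      T.dist r p < T.dist r i ∧ p ∈ s := by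
  by_cases hir : i = r
  -- The root has no parent, but no other vertex is at distance zero from it, so any witness does.
  · refine ⟨i, fun s j _ _ _ hne hle => absurd ?_ hne⟩
    subst hir
    rw [SimpleGraph.dist_self, Nat.le_zero] at hle
    exact ((hT.connected i j).dist_eq_zero_iff.1 hle).symm
  · obtain ⟨p, hpi, hpd⟩ : ∃ p, T.Adj p i ∧ T.dist r p + 1 = T.dist r i := by
      obtain ⟨q, hq⟩ := (hT.connected i r).exists_walk_length_eq_dist
      cases q with
      | nil => exact absurd rfl hir
      | @cons _ c _ hc q' =>
        refine ⟨c, hc.symm, ?_⟩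
        have h1 := SimpleGraph.dist_le q'
        have h2 := hT.connected.dist_triangle (u := i) (v := c) (w := r)
        rw [SimpleGraph.dist_eq_one_iff_adj.2 hc] at h2
        rw [SimpleGraph.Walk.length_cons] at hq
        rw [SimpleGraph.dist_comm (u := r) (v := c), SimpleGraph.dist_comm (u := r) (v := i)]
        omega
    refine ⟨p, fun s j hs hi hj hne hle => ⟨by omega, ?_⟩⟩
    by_contra hps
    -- A walk from `i` inside `s` that cannot use the parent `p` stays among the descendants of `i`,
    -- the vertices `x` whose distance from the root is the sum of the distances from `x` to `i` and
    -- from `i` to the root. So `j` would be farther from the root than `i`.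
    have hdesc : ∀ x y : s, (T.induce s).Walk x y →
        T.dist r x = T.dist x i + T.dist r i → T.dist r y = T.dist y i + T.dist r i := by
      intro x y q
      induction q with
      | nil => exact id
      | @cons u v _ huv _ ih =>
        intro hu
        refine ih ?_
        have huv' : T.Adj (u : ι) v := huv
        have hvi := hT.connected.dist_triangle (u := (v : ι)) (v := u) (w := i)
        have hrv := hT.connected.dist_triangle (u := r) (v := i) (w := (v : ι))
        rw [SimpleGraph.dist_eq_one_iff_adj.2 huv'.symm] at hvi
        rw [SimpleGraph.dist_comm (u := i)] at hrv
        -- Only a step towards the root is critical. From `i` it would lead to `p`, which is not in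
        -- `s`; from a proper descendant of `i` it leads to the unique nearer neighbour, which lies
        -- on the path to `i`.
        rcases hT.dist_eq_dist_add_one_of_adj r huv' with h1 | h1
        · by_cases hui : (u : ι) = i
          · exfalso
            rw [hui] at huv' h1
            have := hT.eq_of_dist_add_one huv'.symm hpi h1.symm hpd
            exact hps (this ▸ v.2)
          · obtain ⟨q, hq⟩ := (hT.connected (u : ι) i).exists_walk_length_eq_dist
            cases q with
            | nil => exact absurd rfl hui
            | @cons _ c _ hc q' =>
              have h2 := SimpleGraph.dist_le q'
              rw [SimpleGraph.Walk.length_cons] at hq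
              have h3 := hT.connected.dist_triangle (u := r) (v := i) (w := c)
              rw [SimpleGraph.dist_comm (u := i) (v := c)] at h3
              have h4 : T.dist r c + 1 = T.dist r u := by
                rcases hT.dist_eq_dist_add_one_of_adj r hc with h5 | h5 <;> omega
              have h5 := hT.eq_of_dist_add_one huv'.symm hc.symm h1.symm h4
              have h6 : T.dist (v : ι) i = T.dist c i := by rw [h5]
              omega
        · omega
    obtain ⟨q⟩ := hs.preconnected ⟨i, hi⟩ ⟨j, hj⟩
    have h1 := hdesc _ _ q (by simp)
    have h2 : T.dist j i = 0 := by simp only at h1; omega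
    exact hne ((hT.connected j i).dist_eq_zero_iff.1 h2)

end SimpleGraph

set_option linter.unusedSectionVars false

namespace Elim

/-- A tree decomposition with bags of size at most three, transported along an injective map. -/
theorem tw2_of_treeDecomposition {V W : Type*} {G : SimpleGraph W} (D : TreeDecomposition G)
    (hD : ∀ t, (D.bag t).card ≤ 3) (f : W → V) (hf : Function.Injective f) {S : Finset V}
    {F : V → V → Prop} (hF : ∀ u ∈ S, ∀ v ∈ S, u ≠ v → F u v →
      ∃ a b, f a = u ∧ f b = v ∧ G.Adj a b) : Tw2 S F := by
  classical
  obtain ⟨r⟩ := D.isTree.connected.nonempty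
  refine ⟨D.numNodes, fun i => (D.bag i).image f, fun i => D.tree.dist r i,
    fun i => Finset.card_image_le.trans (hD i), fun i => ?_, fun u hu v hv hne huv => ?_⟩
  · obtain ⟨p, hp⟩ := D.isTree.exists_parent r i
    refine ⟨p, fun j hji hj v hvi hvj => ?_⟩
    obtain ⟨a, ha, rfl⟩ := Finset.mem_image.1 hvi
    obtain ⟨b, hb, hab⟩ := Finset.mem_image.1 hvj
    obtain rfl := hf hab
    obtain ⟨h1, h2⟩ := hp {t | b ∈ D.bag t} j (D.connected b) ha hb hji hj
    exact ⟨h1, Finset.mem_image_of_mem f h2⟩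
  · obtain ⟨a, b, rfl, rfl, hab⟩ := hF u hu v hv hne huv
    obtain ⟨t, h1, h2⟩ := D.edge a b hab
    exact ⟨t, Finset.mem_image_of_mem f h1, Finset.mem_image_of_mem f h2⟩

/-- Each finite graph has a tree decomposition with one node. -/
theorem exists_treeDecomposition {W : Type*} [Fintype W] (G : SimpleGraph W) (h : treewidth G ≤ 2) :
    ∃ D : TreeDecomposition G, ∀ t, (D.bag t).card ≤ 3 := by
  -- The infimum in `treewidth` is attained only if some decomposition exists; the single bag of all
  -- vertices is one.
  have hne : {d | ∃ D : TreeDecomposition G, ∀ t, (D.bag t).card ≤ d + 1}.Nonempty := by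
    refine ⟨Fintype.card W, ⟨1, ⊥, .of_subsingleton, fun _ => Finset.univ, fun v => ?_,
      fun u v _ => ⟨0, by simp⟩⟩, fun t => by simp⟩
    have : Nonempty {t : Fin 1 | v ∈ (Finset.univ : Finset W)} := ⟨0, by simp⟩
    exact SimpleGraph.IsTree.of_subsingleton.connected
  obtain ⟨D, hD⟩ := Nat.sInf_mem hne
  refine ⟨D, fun t => (hD t).trans ?_⟩
  have : sInf {d | ∃ D : TreeDecomposition G, ∀ t, (D.bag t).card ≤ d + 1} ≤ 2 := h
  omega

/-! ## Elimination of vertices -/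

variable {V X R : Type*} [Fintype V] [LinearOrder V] [Fintype X] [CommRing R]

/-- The assignments of values to the vertices in `S`. The other vertices have the value `o`. -/
def asg (S : Finset V) (o : X) : Finset (V → X) :=
  Fintype.piFinset fun u => if u ∈ S then Finset.univ else {o}

theorem mem_asg {S : Finset V} {o : X} {φ : V → X} : φ ∈ asg S o ↔ ∀ u, u ∉ S → φ u = o := by
  simp only [asg, Fintype.mem_piFinset]
  refine forall_congr' fun u => ?_
  by_cases hu : u ∈ S <;> simp [hu]

/-- An assignment on `S` is an assignment on `S` without `x` together with a value for `x`. The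
fixed value `o` outside of `S` makes this a bijection between functions on all of `V`. -/
theorem sum_asg {S : Finset V} {o : X} {x : V} (hx : x ∈ S) (f : (V → X) → R) :
    ∑ φ ∈ asg S o, f φ = ∑ φ ∈ asg (S.erase x) o, ∑ z, f (Function.update φ x z) := by
  rw [Finset.sum_sigma']
  refine Finset.sum_bij' (fun φ _ => ⟨Function.update φ x o, φ x⟩)
    (fun p _ => Function.update p.1 x p.2) ?_ ?_ ?_ ?_ ?_
  · intro φ hφ
    rw [mem_asg] at hφ
    simp only [Finset.mem_sigma, mem_asg, Finset.mem_univ, and_true, Finset.mem_erase]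
    intro u hu
    by_cases hux : u = x
    · simp [hux]
    · simp [hux, hφ u (by tauto)]
  · rintro ⟨φ, z⟩ hp
    simp only [Finset.mem_sigma, mem_asg, Finset.mem_univ, and_true, Finset.mem_erase] at hp ⊢
    intro u hu
    have hux : u ≠ x := by rintro rfl; exact hu hx
    simp [hux, hp u (by tauto)]
  · intro φ _; simp
  · rintro ⟨φ, z⟩ hp
    simp only [Finset.mem_sigma, mem_asg, Finset.mem_univ, and_true, Finset.mem_erase] at hp
    have : φ x = o := hp x (by simp)
    simp [← this]
  · intro φ _; simp

/-- The factor of a pair of vertices. -/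
def pairW (M : V → V → X → X → R) (φ : V → X) (u v : V) : R :=
  if u < v then M u v (φ u) (φ v) else 1

/-- The sum over all assignments of values to the vertices in `S` of the products of the weights `M`
of the pairs of vertices in `S ∪ {q, p}`. -/
def Z (q p : V) (o : X) (S : Finset V) (M : V → V → X → X → R) : R :=
  ∑ φ ∈ asg S o, ∏ u ∈ insert q (insert p S), ∏ v ∈ insert q (insert p S), pairW M φ u v

theorem prod_prod_insert {U : Finset V} {x : V} (hx : x ∉ U) (g : V → V → R) :
    ∏ u ∈ insert x U, ∏ v ∈ insert x U, g u v =
      g x x * (∏ v ∈ U, g x v * g v x) * ∏ u ∈ U, ∏ v ∈ U, g u v := by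
  rw [Finset.prod_insert hx, Finset.prod_insert hx]
  simp_rw [Finset.prod_insert hx, Finset.prod_mul_distrib]
  ring

theorem prod_prod_ite {U : Finset V} {a b : V} (ha : a ∈ U) (hb : b ∈ U) (c : R) :
    ∏ u ∈ U, ∏ v ∈ U, (if u = a ∧ v = b then c else 1) = c := by
  rw [Finset.prod_eq_single_of_mem a ha, Finset.prod_eq_single_of_mem b hb]
  · simp
  · intro v _ hv; simp [hv]
  · intro u _ hu; simp [hu]

/-- The relation between the weights `M` and the edges `F` between the vertices in `S`: the weights
of nonadjacent vertices are one, `q` has only trivial weights, and the weights of a vertex and `p`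
are weights of the vertex. -/
structure Inv (q p : V) (S : Finset V) (F : V → V → Prop) (M : V → V → X → X → R) : Prop where
  lt_q : ∀ u ∈ S, u < q
  q_lt_p : q < p
  F_symm : ∀ u ∈ S, ∀ v ∈ S, F u v → F v u
  symm : ∀ u ∈ S, ∀ v ∈ S, ∀ i j, M u v i j = M v u j i
  none : ∀ u ∈ S, ∀ v ∈ S, u ≠ v → ¬F u v → ∀ i j, M u v i j = 1
  qL : ∀ u ∈ S, ∀ i j, M q u i j = 1
  qR : ∀ u ∈ S, ∀ i j, M u q i j = 1
  pR : ∀ u ∈ insert q S, ∀ i j j', M u p i j = M u p i j'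

/-- The vertex `x` has at most the neighbours `a` and `b`; the value `q` stands for no neighbour. -/
structure Pick (q : V) (S : Finset V) (F : V → V → Prop) (x a b : V) : Prop where
  mem : x ∈ S
  cases : (a = q ∧ b = q) ∨ (a ∈ S ∧ a ≠ x ∧ F x a ∧ b = q) ∨
    (a ∈ S ∧ b ∈ S ∧ a ≠ x ∧ b ≠ x ∧ a ≠ b ∧ F x a ∧ F x b)
  nb : ∀ y ∈ S, y ≠ x → F x y → y = a ∨ y = b

/-- The weight of the pair `(a, b)` that results from the elimination of `x`. -/
def newW (p : V) (M : V → V → X → X → R) (x a b : V) (i j : X) : R :=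
  ∑ z, M a x i z * (M x b z j * M x p z j)

/-- The weights after the elimination of `x`. -/
def elimM (p : V) (M : V → V → X → X → R) (x a b c : V) (u v : V) (i j : X) : R :=
  M u v i j * (if u = a ∧ v = c then newW p M x a b i j else 1) *
    (if u = c ∧ v = a then newW p M x b a i j else 1)

/-- The edges after the elimination of `x`. -/
def elimF (F : V → V → Prop) (x a c : V) (u v : V) : Prop :=
  (F u v ∧ u ≠ x ∧ v ≠ x) ∨ (u = a ∧ v = c) ∨ (u = c ∧ v = a)

section
variable {q p : V} {o : X} {S : Finset V} {F : V → V → Prop} {M : V → V → X → X → R} {x a b c : V}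

theorem Inv.q_notMem (h : Inv q p S F M) : q ∉ S := fun hq => (h.lt_q q hq).false

theorem Inv.p_notMem (h : Inv q p S F M) : p ∉ S := fun hp => (h.lt_q p hp).not_gt h.q_lt_p

/-- The unary weight of `x` is stored with the pair `(x, p)` and ignores its second index. In `newW`
it may therefore be evaluated at the value of the second neighbour, so that entrywise products of
matrices suffice, and exchanging `a` and `b` transposes the new weight. -/
theorem Inv.elim_newW_symm (h : Inv q p S F M) (hx : x ∈ S) (ha : a ∈ S) (hb : b ∈ S) (i j : X) :
    newW p M x a b i j = newW p M x b a j i := by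
  refine Finset.sum_congr rfl fun z _ => ?_
  rw [h.symm a ha x hx, h.symm x hx b hb, h.pR x (by simp [hx]) z j i]
  ring

/-- The new weight goes to the pair `(a, c)`, and transposed to `(c, a)`, to keep the weights
symmetric. With one neighbour, `c = p` and the new weight is a unary weight of `a`; without
neighbours, `a = q` and the factor is collected in the pair `(q, p)`. -/
theorem Inv.elim (h : Inv q p S F M) (hP : Pick q S F x a b) (hc : c = if b = q then p else b) :
    Inv q p (S.erase x) (elimF F x a c) (elimM p M x a b c) := by
  have hq := h.q_notMem
  have hp := h.p_notMem
  have hpq : p ≠ q := h.q_lt_p.ne'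
  have hsub : ∀ u, u ∈ S.erase x → u ∈ S := fun u hu => Finset.mem_of_mem_erase hu
  have hcq : c ≠ q := by rw [hc]; split_ifs with hb <;> assumption
  have hap : a ≠ p := by
    rcases hP.cases with h1 | h1 | h1
    · rw [h1.1]; exact hpq.symm
    · rintro rfl; exact hp h1.1
    · rintro rfl; exact hp h1.1
  have hcS : c ∈ S → a ∈ S ∧ b ∈ S ∧ c = b := by
    intro hcS
    rcases hP.cases with h1 | h1 | h1
    · rw [hc, if_pos h1.2] at hcS; exact absurd hcS hp
    · rw [hc, if_pos h1.2.2.2] at hcS; exact absurd hcS hp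
    · exact ⟨h1.1, h1.2.1, by rw [hc, if_neg]; rintro rfl; exact hq h1.2.1⟩
  refine ⟨fun u hu => h.lt_q u (hsub u hu), h.q_lt_p, ?_, ?_, ?_, ?_, ?_, ?_⟩
  · intro u hu v hv
    have := h.F_symm u (hsub u hu) v (hsub v hv)
    simp only [elimF]; tauto
  · intro u hu v hv i j
    simp only [elimM]
    rw [h.symm u (hsub u hu) v (hsub v hv)]
    have hn : c ∈ S → ∀ i j, newW p M x a b i j = newW p M x b a j i := fun h4 i j =>
      h.elim_newW_symm hP.mem (hcS h4).1 (hcS h4).2.1 i j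
    by_cases h1 : u = a ∧ v = c <;> by_cases h2 : u = c ∧ v = a
    · have hcS' : c ∈ S := h1.2 ▸ hsub v hv
      rw [if_pos h1, if_pos h2, if_pos ⟨h2.2, h2.1⟩, if_pos ⟨h1.2, h1.1⟩, hn hcS' i j, hn hcS' j i]
      ring
    · have hcS' : c ∈ S := h1.2 ▸ hsub v hv
      rw [if_pos h1, if_neg h2, if_neg (by tauto), if_pos ⟨h1.2, h1.1⟩, hn hcS' i j]
      ring
    · have hcS' : c ∈ S := h2.1 ▸ hsub u hu
      rw [if_neg h1, if_pos h2, if_pos ⟨h2.2, h2.1⟩, if_neg (by tauto), hn hcS' j i]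
      ring
    · rw [if_neg h1, if_neg h2, if_neg (by tauto), if_neg (by tauto)]
  · intro u hu v hv hne hF i j
    simp only [elimF, not_or] at hF
    have hu' := Finset.ne_of_mem_erase hu
    have hv' := Finset.ne_of_mem_erase hv
    simp only [elimM]
    rw [if_neg hF.2.1, if_neg hF.2.2, h.none u (hsub u hu) v (hsub v hv) hne (by tauto)]
    ring
  · intro u hu i j
    simp only [elimM]
    rw [if_neg, if_neg, h.qL u (hsub u hu)]
    · ring
    · exact fun h1 => hcq h1.1.symm
    · rintro ⟨h1, h2⟩
      have := (hcS (h2 ▸ hsub u hu)).1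
      rw [← h1] at this
      exact hq this
  · intro u hu i j
    simp only [elimM]
    rw [if_neg, if_neg, h.qR u (hsub u hu)]
    · ring
    · rintro ⟨h1, h2⟩
      have := (hcS (h1 ▸ hsub u hu)).1
      rw [← h2] at this
      exact hq this
    · exact fun h1 => hcq h1.2.symm
  · intro u hu i j j'
    have hu' : u ∈ insert q S := by
      rcases Finset.mem_insert.1 hu with rfl | h1
      · simp
      · exact Finset.mem_insert_of_mem (hsub u h1)
    simp only [elimM]
    rw [if_neg (c := u = c ∧ p = a) fun h1 => hap h1.2.symm,
      if_neg (c := u = c ∧ p = a) fun h1 => hap h1.2.symm, h.pR u hu' i j j']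
    -- A weight of a pair with `p` changes only if there is no second neighbour. Then `b = q` has
    -- trivial weights, and the new weight ignores its second index.
    by_cases h1 : u = a ∧ p = c
    · rw [if_pos h1, if_pos h1]
      have hbq : b = q := by
        by_contra hb
        rw [if_neg hb] at hc
        rcases hP.cases with h3 | h3 | h3
        · exact hb h3.2
        · exact hb h3.2.2.2
        · exact hp (h1.2.trans hc ▸ h3.2.1)
      have : newW p M x a b i j = newW p M x a b i j' := by
        refine Finset.sum_congr rfl fun z _ => ?_
        rw [hbq, h.qR x hP.mem, h.qR x hP.mem, h.pR x (by simp [hP.mem]) z j j']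
      rw [this]
    · rw [if_neg h1, if_neg h1]

/-- By distributivity the value of `x` is summed first. Among the weights of pairs with `x`, only
those with `a`, `b` and `p` can differ from one; the sum of their products is `newW`, and everything
else does not depend on the value of `x`. -/
theorem Inv.Z_elim (h : Inv q p S F M) (hP : Pick q S F x a b) (hc : c = if b = q then p else b) :
    Z q p o (S.erase x) (elimM p M x a b c) = Z q p o S M := by
  have hq := h.q_notMem
  have hp := h.p_notMem
  have hpq : p ≠ q := h.q_lt_p.ne'
  have hx := hP.mem
  have hxq : x < q := h.lt_q x hx
  have hxp : x < p := hxq.trans h.q_lt_p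
  rw [Z, Z, sum_asg hx]
  refine Finset.sum_congr rfl fun φ hφ => ?_
  set U := insert q (insert p (S.erase x)) with hU
  have hxU : x ∉ U := by simp [hU, hxq.ne, hxp.ne]
  have hUx : insert q (insert p S) = insert x U := by
    rw [hU, Finset.insert_comm x q, Finset.insert_comm x p, Finset.insert_erase hx]
  have haU : a ∈ U := by
    rcases hP.cases with h1 | h1 | h1
    · simp [hU, h1.1]
    · simp [hU, h1.1, h1.2.1]
    · simp [hU, h1.1, h1.2.2.1]
  have hcU : c ∈ U := by
    rw [hc]
    split_ifs with hb
    · simp [hU]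
    · rcases hP.cases with h1 | h1 | h1
      · exact absurd h1.2 hb
      · exact absurd h1.2.2.2 hb
      · simp [hU, h1.2.1, h1.2.2.2.1]
  have hside : ∀ z, ∏ v ∈ U, (pairW M (Function.update φ x z) x v *
      pairW M (Function.update φ x z) v x) = ∏ v ∈ U, M x v z (φ v) := by
    intro z
    refine Finset.prod_congr rfl fun v hv => ?_
    have hvx : v ≠ x := fun h1 => hxU (h1 ▸ hv)
    simp only [pairW, Function.update_self, Function.update_of_ne hvx]
    by_cases hvS : v ∈ S
    · rcases lt_or_gt_of_ne hvx with h1 | h1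
      · rw [if_neg h1.not_gt, if_pos h1, one_mul, h.symm v hvS x hx]
      · rw [if_pos h1, if_neg h1.not_gt, mul_one]
    · have hxv : x < v := by
        simp only [hU, Finset.mem_insert, Finset.mem_erase] at hv
        rcases hv with rfl | rfl | h1
        · exact hxq
        · exact hxp
        · exact absurd h1.2 hvS
      rw [if_pos hxv, if_neg hxv.not_gt, mul_one]
  have hrest : ∀ z, ∏ u ∈ U, ∏ v ∈ U, pairW M (Function.update φ x z) u v =
      ∏ u ∈ U, ∏ v ∈ U, pairW M φ u v := by
    intro z
    refine Finset.prod_congr rfl fun u hu => Finset.prod_congr rfl fun v hv => ?_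
    have hux : u ≠ x := fun h1 => hxU (h1 ▸ hu)
    have hvx : v ≠ x := fun h1 => hxU (h1 ▸ hv)
    simp only [pairW, Function.update_of_ne hux, Function.update_of_ne hvx]
  have hone : ∀ z, ∀ v ∈ U, v ≠ a → v ≠ b → v ≠ p → M x v z (φ v) = 1 := by
    intro z v hv h1 h2 h3
    simp only [hU, Finset.mem_insert, Finset.mem_erase] at hv
    rcases hv with rfl | rfl | hv
    · exact h.qR x hx _ _
    · exact absurd rfl h3
    · refine h.none x hx v hv.2 hv.1.symm (fun hF => ?_) _ _
      rcases hP.nb v hv.2 hv.1 hF with h4 | h4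
      · exact h1 h4
      · exact h2 h4
  -- The cases are: no neighbour, where only the weight with `p` remains; one neighbour, where `b =
  -- q` contributes one; two neighbours, where the unary weight is moved from the value of `p` to
  -- that of `b`.
  have hprod : ∑ z, ∏ v ∈ U, M x v z (φ v) = newW p M x a b (φ a) (φ c) := by
    refine Finset.sum_congr rfl fun z _ => ?_
    rcases hP.cases with ⟨rfl, rfl⟩ | ⟨haS, hax, -, rfl⟩ | ⟨haS, hbS, hax, hbx, hab, -⟩
    · rw [if_pos rfl] at hc
      subst hc
      rw [Finset.prod_eq_single_of_mem c (by simp [hU])]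
      · rw [h.qL x hx, h.qR x hx]; ring
      · intro v hv hne
        by_cases hva : v = b
        · subst hva; exact h.qR x hx _ _
        · exact hone z v hv hva hva hne
    · rw [if_pos rfl] at hc
      subst hc
      have hac : a ≠ c := fun h1 => hp (h1 ▸ haS)
      rw [← Finset.prod_subset (s₁ := {a, c}), Finset.prod_pair hac, h.qR x hx,
        h.symm a haS x hx]
      · ring
      · intro v hv
        simp only [Finset.mem_insert, Finset.mem_singleton] at hv
        rcases hv with rfl | rfl <;> assumption
      · intro v hv hne
        simp only [Finset.mem_insert, Finset.mem_singleton, not_or] at hne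
        by_cases hvb : v = b
        · subst hvb; exact h.qR x hx _ _
        · exact hone z v hv hne.1 hvb hne.2
    · have hbq : b ≠ q := fun h1 => hq (h1 ▸ hbS)
      rw [if_neg hbq] at hc
      subst hc
      have hap : a ≠ p := fun h1 => hp (h1 ▸ haS)
      have hbp : c ≠ p := fun h1 => hp (h1 ▸ hbS)
      rw [← Finset.prod_subset (s₁ := {a, c, p}), Finset.prod_insert (by simp [hab, hap]),
        Finset.prod_pair hbp, h.symm a haS x hx, h.pR x (by simp [hx]) z (φ p) (φ c)]
      · intro v hv
        simp only [Finset.mem_insert, Finset.mem_singleton] at hv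
        rcases hv with rfl | rfl | rfl
        · assumption
        · assumption
        · simp [hU]
      · intro v hv hne
        simp only [Finset.mem_insert, Finset.mem_singleton, not_or] at hne
        exact hone z v hv hne.1 hne.2.1 hne.2.2
  have hRHS : ∑ z, ∏ u ∈ insert q (insert p S), ∏ v ∈ insert q (insert p S),
      pairW M (Function.update φ x z) u v =
      newW p M x a b (φ a) (φ c) * ∏ u ∈ U, ∏ v ∈ U, pairW M φ u v := by
    rw [← hprod, Finset.sum_mul]
    refine Finset.sum_congr rfl fun z _ => ?_
    rw [hUx, prod_prod_insert hxU, hside, hrest]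
    simp [pairW]
  rw [hRHS]
  have hac : a ≠ c := by
    rw [hc]
    split_ifs with hb
    · rcases hP.cases with h1 | h1 | h1
      · rw [h1.1]; exact hpq.symm
      · rintro rfl; exact hp h1.1
      · rintro rfl; exact hp h1.1
    · rcases hP.cases with h1 | h1 | h1
      · exact absurd h1.2 hb
      · exact absurd h1.2.2.2 hb
      · exact h1.2.2.2.2.1
  -- `pairW` counts an unordered pair once, in increasing order. So exactly one of the two new
  -- factors of `elimM` takes part, the one at `(min a c, max a c)`.
  have hlast : ∏ u ∈ U, ∏ v ∈ U, pairW (elimM p M x a b c) φ u v =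
      (∏ u ∈ U, ∏ v ∈ U, pairW M φ u v) * ∏ u ∈ U, ∏ v ∈ U,
        (if u = min a c ∧ v = max a c then newW p M x a b (φ a) (φ c) else 1) := by
    simp_rw [← Finset.prod_mul_distrib]
    refine Finset.prod_congr rfl fun u hu => Finset.prod_congr rfl fun v hv => ?_
    simp only [pairW, elimM]
    rcases lt_or_gt_of_ne hac with h1 | h1
    · rw [min_eq_left h1.le, max_eq_right h1.le]
      by_cases huv : u < v
      · rw [if_pos huv, if_pos huv]
        by_cases h2 : u = a ∧ v = c
        · rw [if_pos h2, if_pos h2, if_neg (by rintro ⟨h3, -⟩; exact hac (h2.1.symm.trans h3)),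
            h2.1, h2.2, mul_one]
        · rw [if_neg h2, if_neg h2, if_neg (by rintro ⟨rfl, rfl⟩; exact huv.not_gt h1)]
          ring
      · rw [if_neg huv, if_neg huv, if_neg (by rintro ⟨rfl, rfl⟩; exact huv h1)]
        ring
    · rw [min_eq_right h1.le, max_eq_left h1.le]
      by_cases huv : u < v
      · rw [if_pos huv, if_pos huv]
        by_cases h2 : u = c ∧ v = a
        -- Since `p` is larger than `q` and all vertices in `S`, `c < a` is possible only for two
        -- proper neighbours. Then the symmetry of the new weight applies.
        · have hcS : c ∈ S ∧ c = b ∧ a ∈ S := by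
            rcases hP.cases with h3 | h3 | h3
            · rw [hc, if_pos h3.2, h3.1] at h1
              exact absurd h.q_lt_p h1.not_gt
            · rw [hc, if_pos h3.2.2.2] at h1
              exact absurd ((h.lt_q a h3.1).trans h.q_lt_p) h1.not_gt
            · have hbq : b ≠ q := fun h4 => hq (h4 ▸ h3.2.1)
              rw [if_neg hbq] at hc
              exact ⟨hc ▸ h3.2.1, hc, h3.1⟩
          rw [if_pos h2, if_pos h2, if_neg (by rintro ⟨h3, -⟩; exact hac (h3.symm.trans h2.1)),
            h2.1, h2.2, mul_one, h.elim_newW_symm hx hcS.2.2 (hcS.2.1 ▸ hcS.1)]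
        · rw [if_neg h2, if_neg h2, if_neg (by rintro ⟨rfl, rfl⟩; exact huv.not_gt h1)]
          ring
      · rw [if_neg huv, if_neg huv, if_neg (by rintro ⟨rfl, rfl⟩; exact huv h1)]
        ring
  rw [hlast, prod_prod_ite, mul_comm]
  · rcases min_choice a c with h1 | h1 <;> rw [h1] <;> assumption
  · rcases max_choice a c with h1 | h1 <;> rw [h1] <;> assumption

/-- Only the constant assignment and the pair `(q, p)` are left. -/
theorem Inv.Z_empty (h : Inv q p ∅ F M) : Z q p o ∅ M = M q p o o := by
  have h1 : asg (∅ : Finset V) o = {fun _ => o} := by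
    ext φ
    simp [mem_asg, funext_iff]
  have h2 : q ∉ insert p (∅ : Finset V) := by simp [h.q_lt_p.ne]
  rw [Z, h1, Finset.sum_singleton, prod_prod_insert h2]
  simp [pairW, h.q_lt_p, h.q_lt_p.not_gt]

/-- With two neighbours, joining `a` to `b` and removing `x` is the contraction of the edge between
`x` and `a`. With fewer neighbours the new edge involves `p`, and on `S` the vertex `x` is merely
deleted. -/
theorem Tw2.elim (hT : Tw2 S F) (h : Inv q p S F M) (hP : Pick q S F x a b)
    (hc : c = if b = q then p else b) : Tw2 (S.erase x) (elimF F x a c) := by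
  have hq := h.q_notMem
  have hp := h.p_notMem
  by_cases hb : b = q
  · rw [if_pos hb] at hc
    subst hc
    refine hT.mono (Finset.erase_subset _ _) fun u hu v hv huv => ?_
    rcases huv with h1 | h1 | h1
    · exact h1.1
    · exact absurd (Finset.mem_of_mem_erase (h1.2 ▸ hv)) hp
    · exact absurd (Finset.mem_of_mem_erase (h1.1 ▸ hu)) hp
  · rw [if_neg hb] at hc
    subst hc
    rcases hP.cases with h1 | h1 | ⟨h1, h2, h3, h4, h5, h6, h7⟩
    · exact absurd h1.2 hb
    · exact absurd h1.2.2.2 hb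
    · refine hT.contract hP.mem h1 h3.symm h6 fun u hu v hv hne huv => ?_
      rcases huv with h8 | ⟨rfl, rfl⟩ | ⟨rfl, rfl⟩
      · exact Or.inl h8.1
      · exact Or.inr (Or.inl ⟨rfl, h7⟩)
      · exact Or.inr (Or.inr ⟨rfl, h7⟩)

/-- The sum for the weights that are given by a graph counts homomorphisms. -/
theorem Z_init [DecidableRel F] (E : X → X → Prop) [DecidableRel E] (hlt : ∀ u ∈ S, u < q)
    (hqp : q < p) (hF : ∀ u ∈ S, ∀ v ∈ S, F u v → F v u) (hE : ∀ i j, E i j → E j i)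
    (hFi : ∀ u ∈ S, ¬F u u)
    (hM : ∀ u ∈ S, ∀ v ∈ S, ∀ i j, M u v i j = if F u v then (if E i j then 1 else 0) else 1)
    (hq : ∀ u, ∀ i j, M u q i j = 1) (hq' : ∀ u, ∀ i j, M q u i j = 1)
    (hp : ∀ u, ∀ i j, M u p i j = 1) :
    Inv q p S F M ∧ Z q p o S M =
      (((asg S o).filter fun φ => ∀ u ∈ S, ∀ v ∈ S, F u v → E (φ u) (φ v)).card : R) := by
  have hqS : q ∉ S := fun h => (hlt q h).false
  have hpS : p ∉ S := fun h => (hlt p h).not_gt hqp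
  refine ⟨⟨hlt, hqp, hF, fun u hu v hv i j => ?_, fun u hu v hv _ hn i j => ?_,
    fun u _ => hq' u, fun u _ => hq u, fun u _ i j j' => by rw [hp, hp]⟩, ?_⟩
  · rw [hM u hu v hv, hM v hv u hu]
    have h1 : F u v ↔ F v u := ⟨hF u hu v hv, hF v hv u hu⟩
    have h2 : E i j ↔ E j i := ⟨hE i j, hE j i⟩
    simp only [h1, h2]
  · rw [hM u hu v hv, if_neg hn]
  · rw [Z, Finset.card_filter, Nat.cast_sum]
    refine Finset.sum_congr rfl fun φ _ => ?_
    have hqU : q ∉ insert p S := by simp [hqS, hqp.ne]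
    rw [prod_prod_insert hqU, prod_prod_insert hpS]
    have e1 : ∀ v, pairW M φ q v * pairW M φ v q = 1 := by
      intro v; simp [pairW, hq, hq']
    have e2 : ∀ v ∈ S, pairW M φ p v * pairW M φ v p = 1 := by
      intro v hv
      have : v < p := (hlt v hv).trans hqp
      simp [pairW, hp, this.not_gt]
    rw [Finset.prod_congr rfl fun v _ => e1 v, Finset.prod_congr rfl e2]
    have e3 : ∀ u, pairW M φ u u = 1 := by intro u; simp [pairW]
    rw [e3, e3, Finset.prod_const_one, Finset.prod_const_one]
    simp only [one_mul]
    split_ifs with hall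
    · rw [Nat.cast_one]
      refine Finset.prod_eq_one fun u hu => Finset.prod_eq_one fun v hv => ?_
      rw [pairW]
      split_ifs with huv
      · rw [hM u hu v hv]
        split_ifs with h1 h2
        · rfl
        · exact absurd (hall u hu v hv h1) h2
        · rfl
      · rfl
    · push Not at hall
      obtain ⟨u, hu, v, hv, h1, h2⟩ := hall
      rw [Nat.cast_zero]
      have hne : u ≠ v := by rintro rfl; exact hFi u hu h1
      rcases lt_or_gt_of_ne hne with hlt' | hlt'
      · refine Finset.prod_eq_zero hu (Finset.prod_eq_zero hv ?_)
        rw [pairW, if_pos hlt', hM u hu v hv, if_pos h1, if_neg h2]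
      · refine Finset.prod_eq_zero hv (Finset.prod_eq_zero hu ?_)
        rw [pairW, if_pos hlt', hM v hv u hu, if_pos (hF u hu v hv h1),
          if_neg fun h3 => h2 (hE _ _ h3)]

end

end Elim

/-! ### The program for the new weights. -/

namespace WordRAM

theorem mm_inj {k u v u' v' : ℕ} (hv : v < k + 2) (hv' : v' < k + 2) :
    u * (k + 2) + v = u' * (k + 2) + v' ↔ u = u' ∧ v = v' := by
  refine ⟨fun h => ?_, fun h => by rw [h.1, h.2]⟩
  have key : ∀ a b, b < k + 2 → (a * (k + 2) + b) / (k + 2) = a := by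
    intro a b hb
    rw [add_comm, Nat.add_mul_div_right _ _ (by omega), Nat.div_eq_of_lt hb, zero_add]
  have h1 : u = u' := by rw [← key u v hv, h, key u' v' hv']
  subst h1
  exact ⟨rfl, by omega⟩

theorem Sz.mm_lt {k n w u v : ℕ} (h : Sz k n w) (hu : u < k + 2) (hv : v < k + 2) :
    u * (k + 2) < 2 ^ w ∧ u * (k + 2) + v < 2 ^ w := by
  have h1 : u * (k + 2) + v < (k + 2) * (k + 2) := mul_add_lt_mul hu hv
  have h2 : (k + 2) * (k + 2) ≤ (k + n + 2) ^ 2 := by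
    rw [sq]; gcongr <;> omega
  have := h.lt_of_le_pow h2
  omega

namespace Alg

theorem convTime_mono {k n B B' : ℕ} (h : B ≤ B') : convTime k n B ≤ convTime k n B' := by
  unfold convTime; gcongr

/-- The bound for the running time of the multiplication of matrices. -/
def mulTime (T : ℕ → ℕ) (k n : ℕ) : ℕ := convTime k n (n * n * 60 + T n + 60)

/-- The weights that result from the elimination of the vertex in register `10`, where `ra` and `rb`
are the registers of its neighbours, are multiplied into the matrix of the pair of vertices in the
registers `r` and `r'`. -/
def upd (P : Prog) (ra rb r r' : ℕ) : Prog :=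
  .set 20 (.v 7 * .v 5 + .v 7) ;; .set 21 (.v 10 * .v 5 + .v rb) ;;
  .set 22 (.v 10 * .v 5 + .v 7) ;; had ;;
  .set 21 (.v ra * .v 5 + .v 10) ;; .set 22 (.v 20) ;; mul P ;;
  .set 21 (.v r * .v 5 + .v r') ;; .set 20 (.v 21) ;; .set 22 (.v 7 * .v 5 + .v 7) ;; had

/-- The matrix of the pair `(p, p)` is never used as a weight and serves as scratch space. It
receives the entrywise product of the matrices `(x, b)` and `(x, p)`, is multiplied from the left by
the matrix `(a, x)`, and is finally multiplied entrywise into the matrix `(u, v)`. -/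
theorem upd_spec {k n w c : ℕ} {σ : HS} {P : Prog} {T : ℕ → ℕ} (hP : MatMul P c T)
    (hw : (n + 2) ^ c ≤ 2 ^ w) (hS : Sz k n w) (hC : Ctx k n σ) {ra rb r r' x a b u v : ℕ}
    (hr : ∀ y ∈ [ra, rb, r, r'], y < 20) (hx : σ.v 10 = x) (ha : σ.v ra = a) (hb : σ.v rb = b)
    (hu : σ.v r = u) (hv : σ.v r' = v) (hxk : x < k) (hak : a < k + 1) (hbk : b < k + 1)
    (huk : u < k + 2) (hvk : v < k + 2) (huv : ¬(u = k + 1 ∧ v = k + 1))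
    (hM : ∀ m < (k + 2) * (k + 2), MOK k n σ m) :
    Hwp w (upd P ra rb r r') (fun σ' t => t ≤ 3 * mulTime T k n + 100 ∧
      (∀ m < (k + 2) * (k + 2), MOK k n σ' m) ∧
      (∀ m < (k + 2) * (k + 2), m ≠ (k + 1) * (k + 2) + (k + 1) → m ≠ u * (k + 2) + v →
        ∀ e < n * n, mval k n σ' m e = mval k n σ m e) ∧
      ∀ i < n, ∀ j < n, mval k n σ' (u * (k + 2) + v) (i * n + j) =
        mval k n σ (u * (k + 2) + v) (i * n + j) * ∑ z ∈ Finset.range n,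
          mval k n σ (a * (k + 2) + x) (i * n + z) * (mval k n σ (x * (k + 2) + b) (z * n + j) *
            mval k n σ (x * (k + 2) + (k + 1)) (z * n + j))) σ := by
  have hn := hS.pos
  simp only [List.mem_cons, List.not_mem_nil, or_false, forall_eq_or_imp, forall_eq] at hr
  obtain ⟨hra, hrb, hr1, hr2⟩ := hr
  have hpp : (k + 1) * (k + 2) + (k + 1) < (k + 2) * (k + 2) :=
    mul_add_lt_mul (by omega) (by omega)
  have i0 := hS.mm_lt (u := k + 1) (v := k + 1) (by omega) (by omega)
  have i1 := hS.mm_lt (u := x) (v := b) (by omega) (by omega)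
  have i2 := hS.mm_lt (u := x) (v := k + 1) (by omega) (by omega)
  have i3 := hS.mm_lt (u := a) (v := x) (by omega) (by omega)
  have i4 := hS.mm_lt huk hvk
  have hT : convTime k n (n * n * 50 + 50) ≤ mulTime T k n := convTime_mono (by omega)
  refine Hwp.seq (Hwp.set (by norm_num) (by simp [hC.h7, hC.h5, i0]) ?_)
  refine Hwp.seq (Hwp.set (by norm_num) ?_ ?_)
  · simp [hC.h5, hx, hb, i1, show rb ≠ 20 by omega]; omega
  refine Hwp.seq (Hwp.set (by norm_num) (by simp [hC.h7, hC.h5, hx, i2]) ?_)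
  simp only [Ex.ev_add, Ex.ev_mul, Ex.ev_v, HS.setV_v, hC.h7, hC.h5, hx, hb,
    show rb ≠ 20 by omega, if_false,
    Nat.reduceEqDiff]
  set σ₁ := ((σ.setV 20 ((k + 1) * (k + 2) + (k + 1))).setV 21 (x * (k + 2) + b)).setV 22
    (x * (k + 2) + (k + 1)) with hσ1
  have hF1 : Fr [20, 21, 22] [] σ σ₁ :=
    (((Fr.refl _ _ _).setV (by decide)).setV (by decide)).setV (by decide)
  have hm1 : ∀ m e, mval k n σ₁ m e = mval k n σ m e := fun m e => rfl
  refine Hwp.seq (((had_spec hS (hC.of_fr hF1) (m := (k + 1) * (k + 2) + (k + 1))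
    (m1 := x * (k + 2) + b) (m2 := x * (k + 2) + (k + 1)) (by simp [hσ1]) (by simp [hσ1])
    (by simp [hσ1]) hpp
    (mul_add_lt_mul (by omega) (by omega)) (mul_add_lt_mul (by omega) (by omega))
    (hM _ (mul_add_lt_mul (by omega) (by omega)))
    (hM _ (mul_add_lt_mul (by omega) (by omega)))).frame [30, 31, 32, 35, 36]
    [3, 4, 8, 100, 101, 102] (conv_wr (by decide))).mono ?_)
  rintro σ₂ t₂ ⟨hF2, ht2, hm2⟩
  have hF12 : Fr [20, 21, 22, 30, 31, 32, 35, 36] [3, 4, 8, 100, 101, 102] σ σ₂ :=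
    (hF1.mono (by decide) (by decide)).trans (hF2.mono (by decide) (by decide))
  have hC2 := hC.of_fr hF12
  have hv2 : ∀ y < 20, σ₂.v y = σ.v y := fun y hy => hF12.v y (by omega) (by simp; omega)
  have h20 : σ₂.v 20 = (k + 1) * (k + 2) + (k + 1) := by
    rw [hF2.v 20 (by norm_num) (by decide)]; simp [hσ1]
  refine Hwp.seq (Hwp.set (by norm_num) ?_ ?_)
  · simp [hC2.h5, hv2 ra hra, hv2 10, hx, ha, i3]; omega
  refine Hwp.seq (Hwp.set (by norm_num) (by simp) ?_)
  simp only [Ex.ev_add, Ex.ev_mul, Ex.ev_v, HS.setV_v, hC2.h5, hv2 ra hra, hv2 10 (by norm_num),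
    hx, ha, h20, if_false, Nat.reduceEqDiff]
  set σ₃ := (σ₂.setV 21 (a * (k + 2) + x)).setV 22 ((k + 1) * (k + 2) + (k + 1)) with hσ3
  have hF3 : Fr [21, 22] [] σ₂ σ₃ := ((Fr.refl _ _ _).setV (by decide)).setV (by decide)
  have hM3 : ∀ m < (k + 2) * (k + 2), MOK k n σ₃ m := fun m hm => hm2.mok m (hM m hm)
  refine Hwp.seq (((mul_spec hP hw hS (hC2.of_fr hF3) (m := (k + 1) * (k + 2) + (k + 1))
    (m1 := a * (k + 2) + x) (m2 := (k + 1) * (k + 2) + (k + 1)) (by simp [hσ3, h20])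
    (by simp [hσ3]) (by simp [hσ3]) hpp (mul_add_lt_mul (by omega) (by omega)) hpp
    (hM3 _ (mul_add_lt_mul (by omega) (by omega))) (hM3 _ hpp)).frame [30, 31, 32, 35, 36]
    [3, 4, 8, 100, 101, 102] (mul_wr P)).mono ?_)
  rintro σ₄ t₄ ⟨hF4, ht4, hm4⟩
  have hF24 : Fr [20, 21, 22, 30, 31, 32, 35, 36] [3, 4, 8, 100, 101, 102] σ₂ σ₄ :=
    (hF3.mono (by decide) (by decide)).trans (hF4.mono (by decide) (by decide))
  have hC4 := hC2.of_fr hF24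
  have hv4 : ∀ y < 20, σ₄.v y = σ.v y := fun y hy =>
    (hF24.v y (by omega) (by simp; omega)).trans (hv2 y hy)
  refine Hwp.seq (Hwp.set (by norm_num) ?_ ?_)
  · simp [hC4.h5, hv4 r hr1, hv4 r' hr2, hu, hv, i4]; omega
  refine Hwp.seq (Hwp.set (by norm_num) (by simp) ?_)
  refine Hwp.seq (Hwp.set (by norm_num) (by simp [hC4.h7, hC4.h5, i0]) ?_)
  simp only [Ex.ev_add, Ex.ev_mul, Ex.ev_v, HS.setV_v, hC4.h5, hC4.h7, hv4 r hr1, hv4 r' hr2,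
    hu, hv, if_false, if_true, Nat.reduceEqDiff]
  set σ₅ := ((σ₄.setV 21 (u * (k + 2) + v)).setV 20 (u * (k + 2) + v)).setV 22
    ((k + 1) * (k + 2) + (k + 1)) with hσ5
  have hF5 : Fr [20, 21, 22] [] σ₄ σ₅ :=
    (((Fr.refl _ _ _).setV (by decide)).setV (by decide)).setV (by decide)
  have hM5 : ∀ m < (k + 2) * (k + 2), MOK k n σ₅ m := fun m hm => hm4.mok m (hM3 m hm)
  have huv' : u * (k + 2) + v < (k + 2) * (k + 2) := mul_add_lt_mul huk hvk
  refine ((had_spec hS (hC4.of_fr hF5) (m := u * (k + 2) + v)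
    (m1 := u * (k + 2) + v) (m2 := (k + 1) * (k + 2) + (k + 1)) (by simp [hσ5])
    (by simp [hσ5]) (by simp [hσ5]) huv' huv' hpp (hM5 _ huv') (hM5 _ hpp))).mono ?_
  rintro σ₆ t₆ ⟨ht6, hm6⟩
  have hne : u * (k + 2) + v ≠ (k + 1) * (k + 2) + (k + 1) := fun h =>
    huv ((mm_inj hvk (by omega)).1 h)
  have hax : a * (k + 2) + x ≠ (k + 1) * (k + 2) + (k + 1) := fun h => by
    have := (mm_inj (by omega) (by omega)).1 h; omega
  refine ⟨?_, fun m hm => hm6.mok m (hM5 m hm), fun m hm h1 h2 e he => ?_, fun i hi j hj => ?_⟩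
  · simp only [Ex.cost_add, Ex.cost_mul, Ex.cost_v]
    have : t₄ ≤ mulTime T k n := ht4
    omega
  · calc mval k n σ₆ m e = mval k n σ₄ m e := hm6.val_ne h2 he
      _ = mval k n σ₂ m e := hm4.val_ne h1 he
      _ = mval k n σ m e := hm2.val_ne h1 he
  · have hij : i * n + j < n * n := mul_add_lt_mul hi hj
    have hdiv : (i * n + j) / n = i := by
      rw [add_comm, Nat.add_mul_div_right _ _ hn, Nat.div_eq_of_lt hj, zero_add]
    have hmod : (i * n + j) % n = j := by
      rw [add_comm, Nat.add_mul_mod_self_right, Nat.mod_eq_of_lt hj]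
    have e4 := hm4.val _ hij
    simp only [hdiv, hmod] at e4
    calc mval k n σ₆ (u * (k + 2) + v) (i * n + j) = mval k n σ₄ (u * (k + 2) + v) (i * n + j) *
          mval k n σ₄ ((k + 1) * (k + 2) + (k + 1)) (i * n + j) := hm6.val _ hij
      _ = _ := by
        rw [e4, hm4.val_ne hne hij]
        congr 1
        · exact hm2.val_ne hne hij
        · refine Finset.sum_congr rfl fun z hz => ?_
          have hz := Finset.mem_range.1 hz
          congr 1
          · exact hm2.val_ne hax (mul_add_lt_mul hi hz)
          · exact hm2.val _ (mul_add_lt_mul hz hj)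

theorem upd_wr (P : Prog) : ∀ y ∈ [(11, 12, 11, 15), (12, 11, 15, 11)],
    (upd P y.1 y.2.1 y.2.2.1 y.2.2.2).wr [20, 21, 22, 30, 31, 32, 35, 36]
      [3, 4, 8, 100, 101, 102] = true := by
  have h := Prog.wr_mono (L' := [20, 21, 22, 30, 31, 32, 35, 36])
    (A' := [3, 4, 8, 100, 101, 102]) (by decide) (by decide) _ (mul_wr P)
  intro y hy
  simp only [List.mem_cons, List.not_mem_nil, or_false] at hy
  rcases hy with rfl | rfl
  all_goals
    refine Prog.wr_seq (by decide) (Prog.wr_seq (by decide) (Prog.wr_seq (by decide)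
      (Prog.wr_seq (by decide) (Prog.wr_seq (by decide) (Prog.wr_seq (by decide)
      (Prog.wr_seq h (by decide)))))))

/-! ## The search for a vertex of small degree -/

/-- The registers `11` and `12` get neighbours of the vertex in register `10`, and register `13` gets
the degree of this vertex. -/
def scan : Prog :=
  .set 11 (.v 0) ;; .set 12 (.v 0) ;; .set 13 (.c 0) ;;
  .for_ 14 (.v 0) (.cond (.ld 6 (.v 10 * .v 5 + .v 14))
    (.set 12 (.v 11) ;; .set 11 (.v 14) ;; .set 13 (.v 13 + .c 1)) .skip)

/-- The last neighbour found is in register `11`, the one before in register `12`. The default value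
`k` is the number of the auxiliary vertex `q`, as `Pick` demands for a missing neighbour. For more
than two neighbours only the degree matters. -/
theorem scan_spec {k n w : ℕ} {σ : HS} (hS : Sz k n w) (hC : Ctx k n σ) {x : ℕ}
    (hx : σ.v 10 = x) (hxk : x < k) :
    Hwp w scan (fun σ' t => t ≤ k * 40 + 20 ∧ ∃ N : Finset ℕ,
      N = (Finset.range k).filter (fun y => σ.m 6 (x * (k + 2) + y) ≠ 0) ∧ σ'.v 13 = N.card ∧
      (N.card = 0 → σ'.v 11 = k ∧ σ'.v 12 = k) ∧ (N.card = 1 → N = {σ'.v 11} ∧ σ'.v 12 = k) ∧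
      (N.card = 2 → N = {σ'.v 11, σ'.v 12})) σ := by
  have hk : k + 1 < 2 ^ w := hS.lt_of_le_pow (i := 1) (by simp; omega)
  set N : ℕ → Finset ℕ := fun j =>
    (Finset.range j).filter (fun y => σ.m 6 (x * (k + 2) + y) ≠ 0) with hN
  have hNc : ∀ j, (N j).card ≤ j := fun j =>
    (Finset.card_filter_le _ _).trans (by simp)
  have hNsucc : ∀ j, N (j + 1) = if σ.m 6 (x * (k + 2) + j) ≠ 0 then insert j (N j) else N j := by
    intro j
    simp only [hN, Finset.range_add_one, Finset.filter_insert]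
  have hjN : ∀ j, j ∉ N j := by intro j; simp [hN]
  refine Hwp.seq (Hwp.set (by norm_num) (by simp) ?_)
  refine Hwp.seq (Hwp.set (by norm_num) (by simp) ?_)
  refine Hwp.seq (Hwp.set (by norm_num) (by simp) ?_)
  simp only [Ex.ev_v, Ex.ev_c, HS.setV_v, hC.h0, if_false,
    Nat.reduceEqDiff]
  set σ₁ := ((σ.setV 11 k).setV 12 k).setV 13 0 with hσ1
  have hF1 : Fr [11, 12, 13] [] σ σ₁ :=
    (((Fr.refl _ _ _).setV (by decide)).setV (by decide)).setV (by decide)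
  refine Hwp.for_ [11, 12, 13] [] k 20 (fun j σ' => σ'.v 13 = (N j).card ∧
    ((N j).card = 0 → σ'.v 11 = k ∧ σ'.v 12 = k) ∧
    ((N j).card = 1 → N j = {σ'.v 11} ∧ σ'.v 12 = k) ∧
    ((N j).card = 2 → N j = {σ'.v 11, σ'.v 12})) hS.one_lt (by decide) (by norm_num) (by decide)
    ?_ ?_ ?_ ?_
  · intro σ' hF
    simp [((hC.of_fr hF1).of_fr hF).h0]
  · simp [hσ1, hN]
  · rintro j hj σ' hF hv ⟨h1, h2, h3, h4⟩
    have hC' := (hC.of_fr hF1).of_fr hF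
    have h10 : σ'.v 10 = x := ((hF.v 10 (by norm_num) (by decide)).trans
      (hF1.v 10 (by norm_num) (by decide))).trans hx
    have hm6 : σ'.m 6 = σ.m 6 := (hF.m 6 (by norm_num) (by decide)).trans
      (hF1.m 6 (by norm_num) (by decide))
    have i1 := hS.mm_lt (u := x) (v := j) (by omega) (by omega)
    have hev : (Ex.ld 6 (.v 10 * .v 5 + .v 14)).ev w σ' = σ.m 6 (x * (k + 2) + j) := by
      simp [h10, hv, hC'.h5, hm6]
    refine Hwp.cond (by simp [h10, hv, hC'.h5, i1]) (fun h0 => ?_) (fun h0 => ?_)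
    · rw [hev] at h0
      have hcj := hNc j
      refine Hwp.seq (Hwp.set (by norm_num) (by simp) ?_)
      refine Hwp.seq (Hwp.set (by norm_num) (by simp) ?_)
      refine Hwp.set (by norm_num) (by simp [h1, hS.w_ne]; omega) ?_
      rw [hNsucc j, if_pos h0, Finset.card_insert_of_notMem (hjN j)]
      simp only [Ex.ev_v, Ex.ev_c, Ex.ev_add, HS.setV_v, hv, h1, if_false,
        if_true, Nat.reduceEqDiff, Ex.cost_add, Ex.cost_ld, Ex.cost_mul, Ex.cost_v, Ex.cost_c]
      refine ⟨by norm_num, trivial, False.elim, fun h => ?_, fun h => ?_⟩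
      · rw [Finset.card_eq_zero.1 h]
        exact ⟨rfl, (h2 h).1⟩
      · rw [(h3 h).1]
    · rw [hev] at h0
      refine Hwp.skip ?_
      rw [hNsucc j, if_neg (by simpa using h0)]
      simp only [HS.setV_v, if_false, Nat.reduceEqDiff, Ex.cost_add,
        Ex.cost_ld, Ex.cost_mul, Ex.cost_v]
      exact ⟨by norm_num, h1, h2, h3, h4⟩
  · rintro σ' t hF ⟨h1, h2, h3, h4⟩ ht
    simp only [Ex.cost_v, Ex.cost_c] at ht ⊢
    exact ⟨by omega, N k, rfl, h1, h2, h3, h4⟩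

end Alg

end WordRAM

/-! ### The elimination of one vertex by the program. -/

namespace WordRAM

open Elim

namespace Alg

/-- The bookkeeping for the elimination of the vertex in register `10`. -/
def elimFlags : Prog :=
  .put 5 (.v 10) (.c 0) ;;
  .for_ 14 (.v 5) (.put 6 (.v 10 * .v 5 + .v 14) (.c 0)) ;;
  .for_ 14 (.v 5) (.put 6 (.v 14 * .v 5 + .v 10) (.c 0)) ;;
  .put 6 (.v 11 * .v 5 + .v 15) (.c 1) ;; .put 6 (.v 15 * .v 5 + .v 11) (.c 1)

/-- The elimination of the vertex in register `10` with the neighbours in the registers `11` and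
`12`. -/
def elim (P : Prog) : Prog :=
  .cond (.eq (.v 12) (.v 0)) (.set 15 (.v 7)) (.set 15 (.v 12)) ;;
  upd P 11 12 11 15 ;; upd P 12 11 15 11 ;; elimFlags

/-- The vertex in register `10` is eliminated if it is present and has degree at most two. -/
def step (P : Prog) : Prog :=
  .cond (.ld 5 (.v 10)) (scan ;; .cond (.lt (.v 13) (.c 3)) (elim P) .skip) .skip

theorem elimFlags_spec {k n w : ℕ} {σ : HS} (hS : Sz k n w) (hC : Ctx k n σ) {x a c : ℕ}
    (hx : σ.v 10 = x) (ha : σ.v 11 = a) (hc : σ.v 15 = c) (hxk : x < k) (hak : a < k + 2)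
    (hck : c < k + 2) :
    Hwp w elimFlags (fun σ' t => t ≤ (k + 2) * 50 + 100 ∧
      (∀ u, σ'.m 5 u = if u = x then 0 else σ.m 5 u) ∧
      ∀ u < k + 2, ∀ v < k + 2, (σ'.m 6 (u * (k + 2) + v) ≠ 0 ↔
        (σ.m 6 (u * (k + 2) + v) ≠ 0 ∧ u ≠ x ∧ v ≠ x) ∨ (u = a ∧ v = c) ∨ (u = c ∧ v = a))) σ := by
  refine Hwp.seq (Hwp.put (by norm_num) (by simp) (by simp) ?_)
  simp only [Ex.ev_v, Ex.ev_c, hx]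
  set σ₁ := σ.setM 5 x 0 with hσ1
  have hF1 : Fr [] [5] σ σ₁ := ⟨fun _ _ _ => rfl, fun y _ hy =>
    HS.setM_m_ne σ x 0 (by simpa using hy)⟩
  refine Hwp.seq (Hwp.fill (k + 2) (fun j => x * (k + 2) + j) (fun _ => 0) hS.one_lt (by norm_num)
    (by norm_num) (fun j' _ j hj => by omega) (fun σ' hF => ?_) (fun j hj σ' hF hv hm => ?_)
    fun σ₂ t₂ hF2 hw2 ho2 ht2 => ?_)
  · simp [((hC.of_fr hF1).of_fr hF).h5]
  · have i1 := hS.mm_lt (u := x) (by omega) hj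
    have h10 : σ'.v 10 = x := (hF.v 10 (by norm_num) (by decide)).trans hx
    simp [((hC.of_fr hF1).of_fr hF).h5, hv, h10, i1]
  have hF12 := (hF1.mono (L' := [14]) (A' := [5, 6]) (by decide) (by decide)).trans
    (hF2.mono (by decide) (by decide))
  refine Hwp.seq (Hwp.fill (k + 2) (fun j => j * (k + 2) + x) (fun _ => 0) hS.one_lt (by norm_num)
    (by norm_num) (fun j' _ j hj h => ?_) (fun σ' hF => ?_) (fun j hj σ' hF hv hm => ?_)
    fun σ₃ t₃ hF3 hw3 ho3 ht3 => ?_)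
  · exact hj.ne ((mm_inj (by omega) (by omega)).1 h).1
  · simp [((hC.of_fr hF12).of_fr hF).h5]
  · have i1 := hS.mm_lt (v := x) hj (by omega)
    have h10 : σ'.v 10 = x := (hF.v 10 (by norm_num) (by decide)).trans
      ((hF12.v 10 (by norm_num) (by decide)).trans hx)
    simp [((hC.of_fr hF12).of_fr hF).h5, hv, h10, i1]
  have hF13 := hF12.trans (hF3.mono (L' := [14]) (A' := [5, 6]) (by decide) (by decide))
  have hC3 := hC.of_fr hF13
  have h11 : σ₃.v 11 = a := (hF13.v 11 (by norm_num) (by decide)).trans ha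
  have h15 : σ₃.v 15 = c := (hF13.v 15 (by norm_num) (by decide)).trans hc
  have i1 := hS.mm_lt hak hck
  have i2 := hS.mm_lt hck hak
  -- If `a = q` or `c = p`, flags of auxiliary vertices are set. This is harmless: the search looks
  -- only at flags between vertices below `k`.
  refine Hwp.seq (Hwp.put (by norm_num) (by simp [hC3.h5, h11, h15, i1]) (by simp [hS.w_ne]) ?_)
  refine Hwp.put (by norm_num) (by simp [hC3.h5, h11, h15, i2]) (by simp [hS.w_ne]) ?_
  simp only [Ex.ev_v, Ex.ev_c, Ex.ev_add, Ex.ev_mul, HS.setM_v, hC3.h5, h11, h15, Ex.cost_add,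
    Ex.cost_mul, Ex.cost_v, Ex.cost_c]
  simp only [Ex.cost_add, Ex.cost_mul, Ex.cost_v, Ex.cost_c] at ht2 ht3
  refine ⟨by omega, fun u => ?_, fun u hu v hv => ?_⟩
  · rw [HS.setM_m_ne _ _ _ (by norm_num), HS.setM_m_ne _ _ _ (by norm_num),
      hF3.m 5 (by norm_num) (by decide), hF2.m 5 (by norm_num) (by decide), hσ1, HS.setM_m_self]
  · rw [HS.setM_m_self, HS.setM_m_self, if_congr (mm_inj hv hak) rfl rfl,
      if_congr (mm_inj hv hck) rfl rfl]
    have h3 : σ₃.m 6 (u * (k + 2) + v) = if u = x ∨ v = x then 0 else σ.m 6 (u * (k + 2) + v) := by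
      by_cases hvx : v = x
      · rw [if_pos (Or.inr hvx), hvx]; exact hw3 u hu
      · rw [ho3 _ fun j hj h => hvx ((mm_inj (by omega) hv).1 h).2.symm]
        by_cases hux : u = x
        · rw [if_pos (Or.inl hux), hux]; exact hw2 v hv
        · rw [if_neg (by tauto), ho2 _ fun j hj h => hux ((mm_inj hj hv).1 h).1.symm, hσ1,
            HS.setM_m_ne _ _ _ (by norm_num)]
    by_cases h1 : u = c ∧ v = a
    · rw [if_pos h1]; simp [h1]
    · rw [if_neg h1]
      by_cases h2 : u = a ∧ v = c
      · rw [if_pos h2]; simp [h2]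
      · rw [if_neg h2, h3]
        by_cases h4 : u = x ∨ v = x
        · rw [if_pos h4]
          constructor
          · intro h; exact absurd rfl h
          · rintro (h | h | h)
            · exact absurd h4 (by tauto)
            · exact absurd h h2
            · exact absurd h h1
        · rw [if_neg h4]; tauto

/-- The flags that represent the edges. -/
def flag {k : ℕ} (σ : HS) (u v : Fin (k + 2)) : Prop := σ.m 6 (u * (k + 2) + v) ≠ 0

/-- The first auxiliary vertex. -/
def qq (k : ℕ) : Fin (k + 2) := ⟨k, by omega⟩
/-- The second auxiliary vertex. -/
def pp (k : ℕ) : Fin (k + 2) := ⟨k + 1, by omega⟩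

/-- The invariant of the elimination: the vertices in `S` are left, and the value of the weighted
sum is `r`. -/
structure CoreInv (k n : ℕ) (hn : 0 < n) (σ : HS) (S : Finset (Fin (k + 2))) (r : Res k n)
    (M : Fin (k + 2) → Fin (k + 2) → Fin n → Fin n → Res k n) : Prop where
  alive : ∀ u : Fin (k + 2), (u : ℕ) < k → (σ.m 5 u ≠ 0 ↔ u ∈ S)
  mok : ∀ m < (k + 2) * (k + 2), MOK k n σ m
  val : ∀ u v : Fin (k + 2), ¬(u = pp k ∧ v = pp k) → ∀ i j : Fin n,
    mval k n σ (u * (k + 2) + v) (i * n + j) = M u v i j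
  inv : Inv (qq k) (pp k) S (flag σ) M
  edge : ∀ u v : Fin (k + 2), (u : ℕ) < k → (v : ℕ) < k → flag σ u v → u ∈ S ∧ v ∈ S ∧ u ≠ v
  tw : Tw2 S (flag σ)
  Z_eq : Z (qq k) (pp k) ⟨0, hn⟩ S M = r

theorem CoreInv.congr {k n : ℕ} {hn : 0 < n} {σ σ' : HS} {S : Finset (Fin (k + 2))} {r : Res k n}
    {M : Fin (k + 2) → Fin (k + 2) → Fin n → Fin n → Res k n} (h : CoreInv k n hn σ S r M)
    (h3 : σ'.m 3 = σ.m 3) (h5 : σ'.m 5 = σ.m 5) (h6 : σ'.m 6 = σ.m 6) :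
    CoreInv k n hn σ' S r M := by
  have hf : (flag σ' : Fin (k + 2) → Fin (k + 2) → Prop) = flag σ := by
    funext u v; simp [flag, h6]
  exact ⟨fun u hu => h5 ▸ h.alive u hu, fun m hm => (h.mok m hm).congr h3,
    fun u v huv i j => (mval_congr h3 _ _).trans (h.val u v huv i j), hf ▸ h.inv, hf ▸ h.edge,
    hf ▸ h.tw, h.Z_eq⟩

theorem CoreInv.pick {k n : ℕ} {hn : 0 < n} {σ : HS} {S : Finset (Fin (k + 2))} {r : Res k n}
    {M : Fin (k + 2) → Fin (k + 2) → Fin n → Fin n → Res k n} (h : CoreInv k n hn σ S r M)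
    {x : Fin (k + 2)} (hx : x ∈ S) {N : Finset ℕ} {a b : ℕ}
    (hN : N = (Finset.range k).filter (fun y => σ.m 6 (x * (k + 2) + y) ≠ 0)) (hcard : N.card < 3)
    (h0 : N.card = 0 → a = k ∧ b = k) (h1 : N.card = 1 → N = {a} ∧ b = k)
    (h2 : N.card = 2 → N = {a, b}) : ∃ (ha : a < k + 1) (hb : b < k + 1),
      Pick (qq k) S (flag σ) x ⟨a, by omega⟩ ⟨b, by omega⟩ := by
  have hxk : (x : ℕ) < k := h.inv.lt_q x hx
  have hmem : ∀ y, y ∈ N → ∃ hy : y < k, (⟨y, by omega⟩ : Fin (k + 2)) ∈ S ∧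
      (⟨y, by omega⟩ : Fin (k + 2)) ≠ x ∧ flag σ x ⟨y, by omega⟩ := by
    intro y hy
    rw [hN, Finset.mem_filter, Finset.mem_range] at hy
    obtain ⟨e1, e2, e3⟩ := h.edge x ⟨y, by omega⟩ hxk hy.1 hy.2
    exact ⟨hy.1, e2, e3.symm, hy.2⟩
  have hmem' : ∀ y : Fin (k + 2), y ∈ S → flag σ x y → (y : ℕ) ∈ N := by
    intro y hy hf
    rw [hN, Finset.mem_filter, Finset.mem_range]
    exact ⟨h.inv.lt_q y hy, hf⟩
  interval_cases hc : N.card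
  · obtain ⟨rfl, rfl⟩ := h0 rfl
    refine ⟨by omega, by omega, hx, Or.inl ⟨rfl, rfl⟩, fun y hy _ hf => ?_⟩
    have := hmem' y hy hf
    rw [Finset.card_eq_zero.1 hc] at this
    simp at this
  · obtain ⟨hNa, rfl⟩ := h1 rfl
    obtain ⟨e1, e2, e3, e4⟩ := hmem a (by simp [hNa])
    refine ⟨by omega, by omega, hx, Or.inr (Or.inl ⟨e2, e3, e4, rfl⟩), fun y hy _ hf => ?_⟩
    have := hmem' y hy hf
    rw [hNa, Finset.mem_singleton] at this
    exact Or.inl (Fin.ext this)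
  · have hNab := h2 rfl
    obtain ⟨e1, e2, e3, e4⟩ := hmem a (by simp [hNab])
    obtain ⟨f1, f2, f3, f4⟩ := hmem b (by simp [hNab])
    have hab : a ≠ b := by
      rintro rfl
      simp [hNab] at hc
    refine ⟨by omega, by omega, hx, Or.inr (Or.inr ⟨e2, f2, e3, f3, ?_, e4, f4⟩),
      fun y hy _ hf => ?_⟩
    · simpa [Fin.ext_iff] using hab
    · have := hmem' y hy hf
      rw [hNab, Finset.mem_insert, Finset.mem_singleton] at this
      exact this.imp Fin.ext Fin.ext

theorem elim_wr (P : Prog) :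
    (elim P).wr [14, 15, 20, 21, 22, 30, 31, 32, 35, 36] [3, 4, 5, 6, 8, 100, 101, 102] = true :=
  Prog.wr_seq (by decide) (Prog.wr_seq (Prog.wr_mono (by decide) (by decide) _
    (upd_wr P (11, 12, 11, 15) (by decide))) (Prog.wr_seq (Prog.wr_mono (by decide) (by decide) _
    (upd_wr P (12, 11, 15, 11) (by decide))) (by decide)))

theorem elim_spec {k n w c₀ : ℕ} {σ : HS} {P : Prog} {T : ℕ → ℕ} (hP : MatMul P c₀ T)
    (hw : (n + 2) ^ c₀ ≤ 2 ^ w) (hS : Sz k n w) (hC : Ctx k n σ) {S : Finset (Fin (k + 2))}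
    {r : Res k n} {M : Fin (k + 2) → Fin (k + 2) → Fin n → Fin n → Res k n}
    (h : CoreInv k n hS.pos σ S r M) {x a b : Fin (k + 2)} (hx : σ.v 10 = x) (ha : σ.v 11 = a)
    (hb : σ.v 12 = b) (hak : (a : ℕ) < k + 1) (hbk : (b : ℕ) < k + 1)
    (hpick : Pick (qq k) S (flag σ) x a b) :
    Hwp w (elim P) (fun σ' t => t ≤ 6 * mulTime T k n + (k + 2) * 50 + 400 ∧
      ∃ M', CoreInv k n hS.pos σ' (S.erase x) r M') σ := by
  have hxk : (x : ℕ) < k := h.inv.lt_q x hpick.mem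
  have hk : k + 1 < 2 ^ w := hS.lt_of_le_pow (i := 1) (by simp; omega)
  set c : Fin (k + 2) := if b = qq k then pp k else b with hc
  have hbq : b = qq k ↔ (b : ℕ) = k := by simp [Fin.ext_iff, qq]
  have hcx : (c : ℕ) ≠ x := by
    rw [hc]; split_ifs with h1
    · simp only [pp]; omega
    · rcases hpick.cases with h2 | h2 | h2
      · exact absurd h2.2 h1
      · exact absurd h2.2.2.2 h1
      · exact fun h3 => h2.2.2.2.1 (Fin.ext h3)
  have hax : (a : ℕ) ≠ x := by
    rcases hpick.cases with h2 | h2 | h2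
    · rw [h2.1]; simp only [qq]; omega
    · exact fun h3 => h2.2.1 (Fin.ext h3)
    · exact fun h3 => h2.2.2.1 (Fin.ext h3)
  have hac : (a : ℕ) ≠ c := by
    rw [hc]; split_ifs with h1
    · simp only [pp]; omega
    · rcases hpick.cases with h2 | h2 | h2
      · exact absurd h2.2 h1
      · exact absurd h2.2.2.2 h1
      · exact fun h3 => h2.2.2.2.2.1 (Fin.ext h3)
  have hck := c.2
  have hc15 : Hwp w (.cond (.eq (.v 12) (.v 0)) (.set 15 (.v 7)) (.set 15 (.v 12)))
      (fun σ' t => t ≤ 20 ∧ σ'.v 15 = c) σ := by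
    refine Hwp.cond (by simp [hS.w_ne]) (fun h1 => ?_) (fun h1 => ?_)
    · have h1' : (b : ℕ) = k := by
        by_contra h2
        simp [hb, hC.h0, h2] at h1
      refine Hwp.set (by norm_num) (by simp) ⟨by simp, ?_⟩
      simp [hc, hbq, h1', hC.h7, pp]
    · have h1' : (b : ℕ) ≠ k := by
        intro h2
        simp [hb, hC.h0, h2] at h1
      refine Hwp.set (by norm_num) (by simp) ⟨by simp, ?_⟩
      simp [hc, hbq, h1', hb]
  refine Hwp.seq ((hc15.frame [15] [] (by decide)).mono ?_)
  rintro σ₀ t₀ ⟨hF0, ht0, hv15⟩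
  have hC0 := hC.of_fr hF0
  have hv0 : ∀ y < 15, σ₀.v y = σ.v y := fun y hy => hF0.v y (by omega) (by simp; omega)
  have hm0 : ∀ y < 103, σ₀.m y = σ.m y := fun y hy => hF0.m y hy (by simp)
  have hmok0 : ∀ m < (k + 2) * (k + 2), MOK k n σ₀ m := fun m hm =>
    (h.mok m hm).congr (hm0 3 (by norm_num))
  have hval0 : ∀ m e, mval k n σ₀ m e = mval k n σ m e := fun m e =>
    mval_congr (hm0 3 (by norm_num)) m e
  refine Hwp.seq (((upd_spec hP hw hS hC0 (by decide) ((hv0 10 (by norm_num)).trans hx)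
    ((hv0 11 (by norm_num)).trans ha) ((hv0 12 (by norm_num)).trans hb)
    ((hv0 11 (by norm_num)).trans ha) hv15 hxk hak hbk (by omega) hck (by omega) hmok0).frame _ _
    (upd_wr P (11, 12, 11, 15) (by decide))).mono ?_)
  rintro σ₁ t₁ ⟨hF1, ht1, hmok1, hother1, hnew1⟩
  have hC1 := hC0.of_fr hF1
  have hv1 : ∀ y < 15, σ₁.v y = σ.v y := fun y hy =>
    (hF1.v y (by omega) (by simp; omega)).trans (hv0 y hy)
  have hv151 : σ₁.v 15 = c := (hF1.v 15 (by norm_num) (by decide)).trans hv15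
  -- The second update reads the matrices `(b, x)`, `(x, a)` and `(x, p)`. The first one has written
  -- only to `(a, c)` and to the scratch matrix, and `a` and `c` differ from `x`, so the old weights
  -- are still there.
  refine Hwp.seq (((upd_spec hP hw hS hC1 (by decide) ((hv1 10 (by norm_num)).trans hx)
    ((hv1 12 (by norm_num)).trans hb) ((hv1 11 (by norm_num)).trans ha) hv151
    ((hv1 11 (by norm_num)).trans ha) hxk hbk hak hck (by omega) (by omega) hmok1).frame _ _
    (upd_wr P (12, 11, 15, 11) (by decide))).mono ?_)
  rintro σ₂ t₂ ⟨hF2, ht2, hmok2, hother2, hnew2⟩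
  have hC2 := hC1.of_fr hF2
  have hv2 : ∀ y < 15, σ₂.v y = σ.v y := fun y hy =>
    (hF2.v y (by omega) (by simp; omega)).trans (hv1 y hy)
  have hv152 : σ₂.v 15 = c := (hF2.v 15 (by norm_num) (by decide)).trans hv151
  have h52 : σ₂.m 5 = σ.m 5 := (hF2.m 5 (by norm_num) (by decide)).trans
    ((hF1.m 5 (by norm_num) (by decide)).trans (hm0 5 (by norm_num)))
  have h62 : σ₂.m 6 = σ.m 6 := (hF2.m 6 (by norm_num) (by decide)).trans
    ((hF1.m 6 (by norm_num) (by decide)).trans (hm0 6 (by norm_num)))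
  refine ((elimFlags_spec hS hC2 ((hv2 10 (by norm_num)).trans hx)
    ((hv2 11 (by norm_num)).trans ha) hv152 hxk (by omega) hck).frame [14] [5, 6]
    (by decide)).mono ?_
  rintro σ₃ t₃ ⟨hF3, ht3, hal3, hfl3⟩
  have h33 : σ₃.m 3 = σ₂.m 3 := hF3.m 3 (by norm_num) (by decide)
  have hflag : (flag σ₃ : Fin (k + 2) → Fin (k + 2) → Prop) = elimF (flag σ) x a c := by
    funext u v
    have := hfl3 u u.2 v v.2
    rw [h62] at this
    simp only [flag, elimF, this, Fin.ext_iff, ne_eq]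
  have hvalσ : ∀ u v : ℕ, (hu : u < k + 2) → (hv : v < k + 2) → ¬(u = k + 1 ∧ v = k + 1) →
      ∀ i j : Fin n, mval k n σ (u * (k + 2) + v) (i * n + j) = M ⟨u, hu⟩ ⟨v, hv⟩ i j := by
    intro u v hu hv huv i j
    exact h.val ⟨u, hu⟩ ⟨v, hv⟩ (by simpa [Fin.ext_iff, pp] using huv) i j
  have hne : ∀ u v u' v' : ℕ, u < k + 2 → v < k + 2 → v' < k + 2 → ¬(u = u' ∧ v = v') →
      u * (k + 2) + v ≠ u' * (k + 2) + v' := fun u v u' v' _ hv hv' hn he =>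
    hn ((mm_inj hv hv').1 he)
  have hval1 : ∀ u v : ℕ, (hu : u < k + 2) → (hv : v < k + 2) → ¬(u = k + 1 ∧ v = k + 1) →
      ¬(u = a ∧ v = c) → ∀ i j : Fin n,
      mval k n σ₁ (u * (k + 2) + v) (i * n + j) = M ⟨u, hu⟩ ⟨v, hv⟩ i j := by
    intro u v hu hv huv huv' i j
    rw [hother1 _ (mul_add_lt_mul hu hv) (hne _ _ _ _ hu hv (by omega) huv)
      (hne _ _ _ _ hu hv hck huv') _ (mul_add_lt_mul i.2 j.2), hval0]
    exact hvalσ u v hu hv huv i j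
  refine ⟨by omega, elimM (pp k) M x a b c, fun u hu => ?_, fun m hm => (hmok2 m hm).congr h33,
    fun u v huv i j => ?_, hflag ▸ h.inv.elim hpick hc, fun u v hu hv hf => ?_,
    hflag ▸ h.tw.elim h.inv hpick hc, (h.inv.Z_elim hpick hc).trans h.Z_eq⟩
  · rw [hal3, h52, Finset.mem_erase, ← h.alive u hu]
    by_cases hux : (u : ℕ) = x
    · simp [Fin.ext hux]
    · rw [if_neg hux]
      have : u ≠ x := fun h1 => hux (by rw [h1])
      tauto
  · rw [mval_congr h33]
    have huv' : ¬((u : ℕ) = k + 1 ∧ (v : ℕ) = k + 1) := by simpa [Fin.ext_iff, pp] using huv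
    have hij : (i : ℕ) * n + j < n * n := mul_add_lt_mul i.2 j.2
    by_cases h1 : u = c ∧ v = a
    · obtain ⟨rfl, h1v⟩ := h1
      have h1v := h1v.symm
      subst h1v
      rw [hnew2 i i.2 j j.2, hval1 _ _ hck (by omega) huv' (by omega)]
      have e2 : elimM (pp k) M x a b c c a i j = M c a i j * 1 * newW (pp k) M x b a i j := by
        unfold elimM
        rw [if_neg (fun h2 => hac (congrArg Fin.val h2.1).symm), if_pos ⟨rfl, rfl⟩]
      rw [e2, mul_one, Finset.sum_range]
      congr 1
      refine Finset.sum_congr rfl fun z _ => ?_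
      rw [hval1 b x b.2 x.2 (by omega) (by omega), hval1 x _ x.2 _ (by omega) (by omega),
        hval1 x (k + 1) x.2 (by omega) (by omega) (by omega)]
      rfl
    · have h1' : ¬((u : ℕ) = c ∧ (v : ℕ) = a) := fun h2 => h1 ⟨Fin.ext h2.1, Fin.ext h2.2⟩
      rw [hother2 _ (mul_add_lt_mul u.2 v.2) (hne _ _ _ _ u.2 v.2 (by omega) huv')
        (hne _ _ _ _ u.2 v.2 (by omega) h1') _ hij]
      simp only [elimM]
      rw [if_neg h1, mul_one]
      by_cases h2 : u = a ∧ v = c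
      · obtain ⟨h2u, rfl⟩ := h2
        have h2u := h2u.symm
        subst h2u
        rw [hnew1 i i.2 j j.2, hval0, hvalσ a c a.2 hck huv', if_pos ⟨rfl, rfl⟩, Finset.sum_range]
        congr 1
        refine Finset.sum_congr rfl fun z _ => ?_
        rw [hval0, hval0, hval0, hvalσ _ x _ x.2 (by omega), hvalσ x b x.2 b.2 (by omega),
          hvalσ x (k + 1) x.2 (by omega) (by omega)]
        rfl
      · rw [if_neg h2, mul_one]
        exact hval1 u v u.2 v.2 huv' (fun h3 => h2 ⟨Fin.ext h3.1, Fin.ext h3.2⟩) i j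
  · rw [hflag] at hf
    have hq : (qq k : ℕ) = k := rfl
    have hp : (pp k : ℕ) = k + 1 := rfl
    have hac' : (a : ℕ) < k → (c : ℕ) < k → a ∈ S ∧ c ∈ S := by
      intro h1 h2
      rcases hpick.cases with h3 | h3 | h3
      · rw [h3.1] at h1; omega
      · rw [hc, if_pos h3.2.2.2] at h2; omega
      · refine ⟨h3.1, ?_⟩
        have : b ≠ qq k := by
          intro h4
          rw [hc, if_pos h4] at h2; omega
        rw [hc, if_neg this]
        exact h3.2.1
    have hax' : a ≠ x := fun h1 => hax (by rw [h1])
    have hcx' : c ≠ x := fun h1 => hcx (by rw [h1])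
    have hac2 : a ≠ c := fun h1 => hac (by rw [← h1])
    simp only [Finset.mem_erase]
    rcases hf with h1 | ⟨rfl, rfl⟩ | ⟨rfl, rfl⟩
    · have := h.edge u v hu hv h1.1
      tauto
    · have := hac' hu hv
      tauto
    · have := hac' hv hu
      exact ⟨⟨hcx', this.2⟩, ⟨hax', this.1⟩, hac2.symm⟩

/-- The bound for the running time of the treatment of one vertex. -/
def stepTime (T : ℕ → ℕ) (k n : ℕ) : ℕ := 6 * mulTime T k n + (k + 2) * 100 + 500

theorem step_wr (P : Prog) : (step P).wr [11, 12, 13, 14, 15, 20, 21, 22, 30, 31, 32, 35, 36]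
    [3, 4, 5, 6, 8, 100, 101, 102] = true :=
  Prog.wr_cond (by decide) (Prog.wr_seq (by decide) (Prog.wr_cond (by decide)
    (Prog.wr_mono (by decide) (by decide) _ (elim_wr P)) (by decide))) (by decide)

-- The alternative in the conclusion is what the analysis of a sweep needs: either a vertex
-- disappears, or the graph is unchanged and `x` was not eligible.
open Classical in
theorem step_spec {k n w c₀ : ℕ} {σ : HS} {P : Prog} {T : ℕ → ℕ} (hP : MatMul P c₀ T)
    (hw : (n + 2) ^ c₀ ≤ 2 ^ w) (hS : Sz k n w) (hC : Ctx k n σ) {S : Finset (Fin (k + 2))}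
    {r : Res k n} {M : Fin (k + 2) → Fin (k + 2) → Fin n → Fin n → Res k n}
    (h : CoreInv k n hS.pos σ S r M) {x : Fin (k + 2)} (hx : σ.v 10 = x) (hxk : (x : ℕ) < k) :
    Hwp w (step P) (fun σ' t => t ≤ stepTime T k n ∧
      ∃ S' M', CoreInv k n hS.pos σ' S' r M' ∧
        ((S' = S ∧ σ'.m 6 = σ.m 6 ∧ ¬(x ∈ S ∧ (S.filter fun y => y ≠ x ∧ flag σ x y).card ≤ 2)) ∨
          S'.card < S.card)) σ := by
  have hmul : 0 < mulTime T k n := by unfold mulTime convTime; omega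
  refine Hwp.cond (by simp) (fun h0 => ?_) (fun h0 => ?_)
  · have hxS : x ∈ S := (h.alive x hxk).1 (by simpa [hx] using h0)
    refine Hwp.seq (((scan_spec hS hC hx hxk).frame [11, 12, 13, 14] [] (by decide)).mono ?_)
    rintro σ₁ t₁ ⟨hF1, ht1, N, hN, h13, hN0, hN1, hN2⟩
    have h1 := h.congr (hF1.m 3 (by norm_num) (by decide)) (hF1.m 5 (by norm_num) (by decide))
      (hF1.m 6 (by norm_num) (by decide))
    have h6 : σ₁.m 6 = σ.m 6 := hF1.m 6 (by norm_num) (by decide)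
    have hNcard : N.card = (S.filter fun y => y ≠ x ∧ flag σ x y).card := by
      rw [← Finset.card_map Fin.valEmbedding]
      congr 1
      ext y
      simp only [hN, Finset.mem_filter, Finset.mem_range, Finset.mem_map, Fin.valEmbedding_apply]
      constructor
      · rintro ⟨hy, hf⟩
        have := h.edge x ⟨y, by omega⟩ hxk hy hf
        exact ⟨⟨y, by omega⟩, ⟨this.2.1, this.2.2.symm, hf⟩, rfl⟩
      · rintro ⟨z, ⟨hz, -, hf⟩, rfl⟩
        exact ⟨h.inv.lt_q z hz, hf⟩
    have hk3 : 3 < 2 ^ w := hS.lt_of_le_pow (i := 2) (by nlinarith [hS.pos])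
    refine Hwp.cond (by simp [hS.w_ne, hk3]) (fun h2 => ?_) (fun h2 => ?_)
    · have h2' : N.card < 3 := by
        by_contra h3
        simp [h13, h3] at h2
      obtain ⟨ha, hb, hpick⟩ := h1.pick hxS (hN.trans (by rw [h6])) h2' hN0 hN1 hN2
      refine (elim_spec hP hw hS (hC.of_fr hF1) h1 ((hF1.v 10 (by norm_num) (by decide)).trans hx)
        (a := ⟨σ₁.v 11, by omega⟩) (b := ⟨σ₁.v 12, by omega⟩) rfl rfl ha hb hpick).mono ?_
      rintro σ₂ t₂ ⟨ht2, M', hM'⟩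
      refine ⟨?_, _, M', hM', Or.inr (Finset.card_erase_lt_of_mem hxS)⟩
      simp only [Ex.cost_lt, Ex.cost_v, Ex.cost_c, Ex.cost_ld, stepTime]
      omega
    · have h2' : ¬N.card < 3 := by
        intro h3
        simp [h13, h3] at h2
      refine Hwp.skip ⟨?_, S, M, h1, Or.inl ⟨rfl, h6, fun h3 => h2' (by omega)⟩⟩
      simp only [Ex.cost_lt, Ex.cost_v, Ex.cost_c, Ex.cost_ld, stepTime]
      omega
  · refine Hwp.skip ⟨?_, S, M, h, Or.inl ⟨rfl, rfl, fun h1 => ?_⟩⟩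
    · simp only [Ex.cost_v, Ex.cost_ld, stepTime]
      omega
    · exact (h.alive x hxk).2 h1.1 (by simpa [hx] using h0)

end Alg

end WordRAM

/-! ### Initial weights and the elimination of all vertices. -/

namespace WordRAM

open Elim

namespace Alg

/-- The matrices for the flags of the edges. -/
def initMat : Prog :=
  .for_ 32 (.v 5 * .v 5 * (.v 4 * .v 3)) (.put 3 (.v 32) (.eq (.v 32 % .v 3) (.c 0) *
    (.c 1 + .ld 6 (.v 32 / (.v 4 * .v 3)) * .ld 1 (.v 32 % (.v 4 * .v 3) / .v 3) -
      .ld 6 (.v 32 / (.v 4 * .v 3)))))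

/-- The sum over the assignments of values to the present vertices. -/
def core (P : Prog) : Prog :=
  initMat ;; .for_ 16 (.v 0) (.for_ 10 (.v 0) (step P))

theorem dv_eq_of_digit_zero {k n : ℕ} (x : ℕ → ℕ) (h : ∀ g, g ≠ 0 → x g = 0) :
    dv k n x = (x 0 : Res k n) := by
  rw [dv, Finset.sum_eq_single_of_mem 0 (by simp)]
  · simp
  · intro g _ hg; simp [h g hg]

theorem initMat_spec {k n w : ℕ} {σ : HS} (hS : Sz k n w) (hC : Ctx k n σ)
    (hF : ∀ i < (k + 2) * (k + 2), σ.m 6 i ≤ 1) (hG : ∀ e < n * n, σ.m 1 e ≤ 1) :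
    Hwp w initMat (fun σ' t => t ≤ (k + 2) * (k + 2) * (n * n * (2 * (k + 1))) * 60 + 20 ∧
      ∀ m < (k + 2) * (k + 2), MOK k n σ' m ∧ ∀ e < n * n, mval k n σ' m e =
        if σ.m 6 m ≠ 0 then (if σ.m 1 e ≠ 0 then 1 else 0) else 1) σ := by
  have hn := hS.pos
  have hpos : 0 < n * n * (2 * (k + 1)) := by positivity
  have hpos' : 0 < n * n := by positivity
  have hlt : (k + 2) * (k + 2) * (n * n * (2 * (k + 1))) < 2 ^ w := by
    refine hS.lt_of_le_pow (i := 6) ?_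
    calc (k + 2) * (k + 2) * (n * n * (2 * (k + 1)))
      ≤ ((k + n + 2) * (k + n + 2)) * ((k + n + 2) * (k + n + 2) *
        ((k + n + 2) * (k + n + 2))) := by gcongr <;> omega
    _ = _ := by ring
  have h2 : (k + 2) * (k + 2) ≤ (k + 2) * (k + 2) * (n * n * (2 * (k + 1))) :=
    Nat.le_mul_of_pos_right _ hpos
  have h3 : n * n * (2 * (k + 1)) ≤ (k + 2) * (k + 2) * (n * n * (2 * (k + 1))) :=
    Nat.le_mul_of_pos_left _ (by positivity)
  -- For an edge flag `f` and an adjacency bit `g`, the number `1 + f * g - f` is `g` if `f = 1` and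
  -- `1` if `f = 0`. It is the digit number zero; the other digits vanish.
  refine Hwp.fill ((k + 2) * (k + 2) * (n * n * (2 * (k + 1)))) id
    (fun i => if i % (2 * (k + 1)) = 0 then 1 + σ.m 6 (i / (n * n * (2 * (k + 1)))) *
      σ.m 1 (i % (n * n * (2 * (k + 1))) / (2 * (k + 1))) - σ.m 6 (i / (n * n * (2 * (k + 1))))
      else 0) hS.one_lt (by norm_num) (by norm_num)
    (fun j' _ j hj => hj.ne) (fun σ' hF' => ?_) (fun j hj σ' hF' hv hm => ?_)
    fun σ' t hF' h1 _ ht => ?_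
  · have hC' := hC.of_fr hF'
    simp only [Ex.ok_mul, Ex.ok_v, Ex.ev_mul, Ex.ev_v, hC'.h5, hC'.h4, hC'.h3]
    simp [h2.trans_lt hlt, h3.trans_lt hlt, hlt]
  · have hC' := hC.of_fr hF'
    have h6 : σ'.m 6 = σ.m 6 := hF'.m 6 (by norm_num) (by decide)
    have h1 : σ'.m 1 = σ.m 1 := hF'.m 1 (by norm_num) (by decide)
    have ha := hF (j / (n * n * (2 * (k + 1)))) (Nat.div_lt_of_lt_mul (by rwa [mul_comm]))
    have hb := hG (j % (n * n * (2 * (k + 1))) / (2 * (k + 1)))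
      (Nat.div_lt_of_lt_mul (by rw [mul_comm (2 * (k + 1))]; exact Nat.mod_lt _ hpos))
    have h2w : 2 < 2 ^ w := hS.lt_of_le_pow (i := 1) (by rw [pow_one]; omega)
    simp only [Ex.ok_mul, Ex.ok_v, Ex.ev_mul, Ex.ev_v, hC'.h4, hC'.h3, Ex.ok_eq, Ex.ok_mod, Ex.ok_c,
      Ex.ok_sub, Ex.ok_add, Ex.ok_ld, Ex.ok_div, Ex.ev_eq, Ex.ev_mod, Ex.ev_sub, Ex.ev_add, Ex.ev_c,
      Ex.ev_ld, Ex.ev_div, hv, h6, h1, id]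
    interval_cases σ.m 6 (j / (n * n * (2 * (k + 1)))) <;>
      interval_cases σ.m 1 (j % (n * n * (2 * (k + 1))) / (2 * (k + 1))) <;>
        by_cases h0 : j % (2 * (k + 1)) = 0 <;> simp [h0, hS.w_ne, h3.trans_lt hlt, h2w]
  · simp only [Ex.cost_v, Ex.cost_c, Ex.cost_mul, Ex.cost_eq, Ex.cost_mod, Ex.cost_ld, Ex.cost_add,
      Ex.cost_sub, Ex.cost_div] at ht
    refine ⟨by omega, fun m hm => ?_⟩
    have key : ∀ e < n * n, ∀ g < 2 * (k + 1),
        σ'.m 3 (m * (n * n * (2 * (k + 1))) + (e * (2 * (k + 1)) + g)) =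
        if g = 0 then 1 + σ.m 6 m * σ.m 1 e - σ.m 6 m else 0 := by
      intro e he g hg
      have i1 := mul_add_lt_mul he hg
      have e0 := h1 _ (mul_add_lt_mul hm i1)
      simp only [id] at e0
      have e1 : (m * (n * n * (2 * (k + 1))) + (e * (2 * (k + 1)) + g)) /
          (n * n * (2 * (k + 1))) = m := by
        rw [add_comm, Nat.add_mul_div_right _ _ hpos, Nat.div_eq_of_lt i1, zero_add]
      have e2 : (m * (n * n * (2 * (k + 1))) + (e * (2 * (k + 1)) + g)) %
          (n * n * (2 * (k + 1))) = e * (2 * (k + 1)) + g := by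
        rw [add_comm, Nat.add_mul_mod_self_right, Nat.mod_eq_of_lt i1]
      have e3 : (e * (2 * (k + 1)) + g) / (2 * (k + 1)) = e := by
        rw [add_comm, Nat.add_mul_div_right _ _ (by omega), Nat.div_eq_of_lt hg, zero_add]
      have e4 : (m * (n * n * (2 * (k + 1))) + (e * (2 * (k + 1)) + g)) % (2 * (k + 1)) = g := by
        rw [show m * (n * n * (2 * (k + 1))) + (e * (2 * (k + 1)) + g) =
          g + (m * (n * n) + e) * (2 * (k + 1)) by ring, Nat.add_mul_mod_self_right,
          Nat.mod_eq_of_lt hg]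
      rw [e0, e1, e2, e3, e4]
    refine ⟨fun e he g hg => ?_, fun e he => ?_⟩
    · rw [key e he g hg]
      have ha := hF m hm
      have hb := hG e he
      interval_cases σ.m 6 m <;> interval_cases σ.m 1 e <;> split_ifs <;> omega
    · rw [mval, dv_congr (y := fun g => if g = 0 then 1 + σ.m 6 m * σ.m 1 e - σ.m 6 m else 0)
        (fun g hg => key e he g hg), dv_eq_of_digit_zero _ (fun g hg => if_neg hg)]
      have ha := hF m hm
      have hb := hG e he
      interval_cases σ.m 6 m <;> interval_cases σ.m 1 e <;> simp

/-- The bound for the running time of `core`. -/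
def coreTime (T : ℕ → ℕ) (k n : ℕ) : ℕ :=
  (k + 2) * (k + 2) * (n * n * (2 * (k + 1))) * 60 + 40 + k * (k * (stepTime T k n + 10) + 20)

theorem core_wr (P : Prog) : (core P).wr
    [10, 11, 12, 13, 14, 15, 16, 20, 21, 22, 30, 31, 32, 35, 36]
    [3, 4, 5, 6, 8, 100, 101, 102] = true :=
  Prog.wr_seq (by decide) (Prog.wr_for (by decide) (Prog.wr_for (by decide)
    (Prog.wr_mono (by decide) (by decide) _ (step_wr P))))

-- The program makes `k` sweeps over all vertices. As long as vertices are left, treewidth at most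
-- two provides one of degree at most two, so each sweep eliminates at least one vertex. The value
-- of the weighted sum never changes; at the end it is the entry zero of the matrix `(q, p)`.
open Classical in
theorem core_spec {k n w c₀ : ℕ} {σ : HS} {P : Prog} {T : ℕ → ℕ} (hP : MatMul P c₀ T)
    (hw : (n + 2) ^ c₀ ≤ 2 ^ w) (hS : Sz k n w) (hC : Ctx k n σ) {S : Finset (Fin (k + 2))}
    {G : SimpleGraph (Fin n)}
    (hG : ∀ i j : Fin n, σ.m 1 (i * n + j) = if G.Adj i j then 1 else 0)
    (hF : ∀ i < (k + 2) * (k + 2), σ.m 6 i ≤ 1)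
    (hal : ∀ u : Fin (k + 2), (u : ℕ) < k → (σ.m 5 u ≠ 0 ↔ u ∈ S)) (hSk : ∀ u ∈ S, (u : ℕ) < k)
    (hFS : ∀ u v : Fin (k + 2), flag σ u v → u ∈ S ∧ v ∈ S ∧ u ≠ v)
    (hFs : ∀ u v : Fin (k + 2), flag σ u v → flag σ v u) (htw : Tw2 S (flag σ)) :
    Hwp w (core P) (fun σ' t => t ≤ coreTime T k n ∧
      (∀ g < 2 * (k + 1), σ'.m 3 ((k * (k + 2) + (k + 1)) * (n * n * (2 * (k + 1))) + g) ≤ n) ∧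
      dv k n (fun g => σ'.m 3 ((k * (k + 2) + (k + 1)) * (n * n * (2 * (k + 1))) + g)) =
        (((asg S (⟨0, hS.pos⟩ : Fin n)).filter fun φ => ∀ u ∈ S, ∀ v ∈ S, flag σ u v →
          G.Adj (φ u) (φ v)).card : Res k n)) σ := by
  have hG1 : ∀ e < n * n, σ.m 1 e ≤ 1 := by
    intro e he
    have h1 : e / n < n := Nat.div_lt_of_lt_mul he
    have h2 : e % n < n := Nat.mod_lt _ hS.pos
    have := hG ⟨e / n, h1⟩ ⟨e % n, h2⟩
    rw [show (e / n) * n + e % n = e by rw [mul_comm]; exact Nat.div_add_mod e n] at this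
    rw [this]; split_ifs <;> omega
  refine Hwp.seq (((initMat_spec hS hC hF hG1).frame [32] [3] (by decide)).mono ?_)
  rintro σ₁ t₁ ⟨hF1, ht1, hM1⟩
  have hC1 := hC.of_fr hF1
  have h51 : σ₁.m 5 = σ.m 5 := hF1.m 5 (by norm_num) (by decide)
  have h61 : σ₁.m 6 = σ.m 6 := hF1.m 6 (by norm_num) (by decide)
  have hfl : (flag σ₁ : Fin (k + 2) → Fin (k + 2) → Prop) = flag σ := by
    funext u v; simp [flag, h61]
  set r : Res k n := (((asg S (⟨0, hS.pos⟩ : Fin n)).filter fun φ => ∀ u ∈ S, ∀ v ∈ S, flag σ u v →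
          G.Adj (φ u) (φ v)).card : Res k n)
  obtain ⟨hinv, hZ⟩ := Z_init (q := qq k) (p := pp k) (o := (⟨0, hS.pos⟩ : Fin n)) (S := S)
    (F := flag σ) (M := fun u v i j => mval k n σ₁ (u * (k + 2) + v) (i * n + j)) G.Adj
    (fun u hu => hSk u hu) (Nat.lt_succ_self k) (fun u _ v _ => hFs u v) (fun i j h => h.symm)
    (fun u _ h => (hFS u u h).2.2 rfl)
    (fun u _ v _ i j => by
      rw [(hM1 _ (mul_add_lt_mul u.2 v.2)).2 _ (mul_add_lt_mul i.2 j.2), hG]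
      refine if_congr Iff.rfl ?_ rfl
      by_cases h : G.Adj i j <;> simp [h])
    (fun u i j => by
      exact ((hM1 _ (mul_add_lt_mul u.2 (qq k).2)).2 _ (mul_add_lt_mul i.2 j.2)).trans
        (if_neg (show ¬flag σ u (qq k) from fun h => (hSk _ (hFS u (qq k) h).2.1).false)))
    (fun u i j => by
      exact ((hM1 _ (mul_add_lt_mul (qq k).2 u.2)).2 _ (mul_add_lt_mul i.2 j.2)).trans
        (if_neg (show ¬flag σ (qq k) u from fun h => (hSk _ (hFS (qq k) u h).1).false)))
    (fun u i j => by
      exact ((hM1 _ (mul_add_lt_mul u.2 (pp k).2)).2 _ (mul_add_lt_mul i.2 j.2)).trans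
        (if_neg (show ¬flag σ u (pp k) from
          fun h => (Nat.lt_succ_self k).not_gt (hSk _ (hFS u (pp k) h).2.1))))
  have hI1 : CoreInv k n hS.pos σ₁ S r _ := ⟨fun u hu => h51 ▸ hal u hu, fun m hm => (hM1 m hm).1,
    fun u v _ i j => rfl, hfl ▸ hinv, fun u v _ _ h => hFS u v (hfl ▸ h), hfl ▸ htw,
    hZ.trans (by congr!)⟩
  have hSc : S.card ≤ k := by
    rw [← Finset.card_map Fin.valEmbedding]
    refine le_of_le_of_eq ?_ (Finset.card_range k)
    refine Finset.card_le_card fun y hy => ?_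
    obtain ⟨z, hz, rfl⟩ := Finset.mem_map.1 hy
    exact Finset.mem_range.2 (hSk z hz)
  have hwrs := Prog.wr_mono (L' := [10, 11, 12, 13, 14, 15, 20, 21, 22, 30, 31, 32, 35, 36])
    (A' := [3, 4, 5, 6, 8, 100, 101, 102]) (by decide) (by decide) _ (step_wr P)
  -- After `j` sweeps at most `k - j` vertices are left.
  refine Hwp.for_ [10, 11, 12, 13, 14, 15, 20, 21, 22, 30, 31, 32, 35, 36]
    [3, 4, 5, 6, 8, 100, 101, 102] k (k * (stepTime T k n + 8) + 6)
    (fun j σ' => ∃ S' M', CoreInv k n hS.pos σ' S' r M' ∧ S'.card ≤ k - j) hS.one_lt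
    (Prog.wr_for (by decide) hwrs) (by norm_num) (by decide) (fun σ' hF' => ?_) ?_ ?_ ?_
  · simp [(hC1.of_fr hF').h0]
  · exact ⟨S, _, hI1.congr rfl rfl rfl, hSc⟩
  · rintro j hj σ₂ hF2 hv2 ⟨S', M', hI2, hc2⟩
    have hC2 := hC1.of_fr hF2
    refine Hwp.for_ [11, 12, 13, 14, 15, 20, 21, 22, 30, 31, 32, 35, 36]
      [3, 4, 5, 6, 8, 100, 101, 102] k (stepTime T k n)
      (fun x σ' => ∃ S'' M'', CoreInv k n hS.pos σ' S'' r M'' ∧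
        ((S'' = S' ∧ σ'.m 6 = σ₂.m 6 ∧ ∀ y : Fin (k + 2), (y : ℕ) < x →
          ¬(y ∈ S' ∧ (S'.filter fun z => z ≠ y ∧ flag σ₂ y z).card ≤ 2)) ∨ S''.card < S'.card))
      hS.one_lt (Prog.wr_mono (by decide) (by decide) _ (step_wr P)) (by norm_num) (by decide)
      (fun σ' hF' => ?_) ?_ ?_ ?_
    · simp [(hC2.of_fr hF').h0]
    · exact ⟨S', M', hI2.congr rfl rfl rfl, Or.inl ⟨rfl, rfl, fun y hy => by omega⟩⟩
    · rintro x hx σ₃ hF3 hv3 ⟨S'', M'', hI3, h3⟩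
      obtain ⟨x', hx'⟩ : ∃ x' : Fin (k + 2), (x' : ℕ) = x := ⟨⟨x, by omega⟩, rfl⟩
      subst hx'
      refine (step_spec hP hw hS (hC2.of_fr hF3) hI3 (x := x') hv3 hx).mono ?_
      rintro σ₄ t₄ ⟨ht4, S₄, M₄, hI4, h4⟩
      refine ⟨ht4, S₄, M₄, hI4.congr rfl rfl rfl, ?_⟩
      rcases h3 with ⟨rfl, h36, h3⟩ | h3
      · rcases h4 with ⟨rfl, h46, h4⟩ | h4
        · refine Or.inl ⟨rfl, h46.trans h36, fun y hy => ?_⟩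
          rcases Nat.lt_succ_iff_lt_or_eq.1 hy with h5 | h5
          · exact h3 y h5
          · obtain rfl : y = x' := Fin.ext h5
            have : (flag σ₃ : Fin (k + 2) → Fin (k + 2) → Prop) = flag σ₂ := by
              funext u v; simp [flag, h36]
            rwa [this] at h4
        · exact Or.inr h4
      · refine Or.inr ?_
        rcases h4 with ⟨rfl, -, -⟩ | h4
        · exact h3
        · exact h4.trans h3
    · rintro σ₃ t₃ hF3 ⟨S'', M'', hI3, h3⟩ ht3
      simp only [Ex.cost_v] at ht3
      refine ⟨ht3.trans (le_of_eq (by ring)), S'', M'', hI3.congr rfl rfl rfl, ?_⟩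
      rcases h3 with ⟨rfl, h36, h3⟩ | h3
      -- A sweep without elimination has found every vertex ineligible for one and the same graph.
      -- This contradicts the existence of a vertex of small degree, unless no vertex is left.
      · have h0 : S'' = ∅ := by
          by_contra hne
          have hfl' : (flag σ₃ : Fin (k + 2) → Fin (k + 2) → Prop) = flag σ₂ := by
            funext u v; simp [flag, h36]
          obtain ⟨y, hy, hd⟩ := hI3.tw.exists_degree_le_two (Finset.nonempty_iff_ne_empty.2 hne)
          rw [hfl'] at hd
          refine h3 y (hI3.inv.lt_q y hy) ⟨hy, ?_⟩
          convert hd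
        simp [h0]
      · omega
  · rintro σ₂ t₂ hF2 ⟨S', M', hI2, hc2⟩ ht2
    obtain rfl : S' = ∅ := Finset.card_eq_zero.1 (by omega)
    -- The value `0` was chosen as the default `o`, so the answer is in the entry `(0, 0)`.
    have e1 := hI2.inv.Z_empty (o := (⟨0, hS.pos⟩ : Fin n))
    rw [hI2.Z_eq, ← hI2.val (qq k) (pp k) (by simp [qq, pp])] at e1
    simp only [Ex.cost_v] at ht2
    have hm : k * (k + 2) + (k + 1) < (k + 2) * (k + 2) := mul_add_lt_mul (by omega) (by omega)
    have hn := hS.pos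
    refine ⟨?_, fun g hg => ?_, ?_⟩
    · simp only [coreTime]
      have : k * (k * (stepTime T k n + 8) + 6 + 1 + 7) ≤ k * (k * (stepTime T k n + 10) + 20) :=
        Nat.mul_le_mul_left _ (by
          have : k * (stepTime T k n + 8) ≤ k * (stepTime T k n + 10) :=
            Nat.mul_le_mul_left _ (by omega)
          linarith)
      linarith
    · simpa using hI2.mok _ hm 0 (by positivity) g hg
    · rw [e1, mval]
      refine dv_congr fun g hg => ?_
      simp [qq, pp]

end Alg

end WordRAM

namespace WordRAM

/-- Compiled expressions write only to scratch registers. This replaces `decide` for programs with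
register or array parameters or arbitrary expressions. -/
theorem Ex.comp_wr (L A : List ℕ) (e : Ex) : ∀ r, 50 ≤ r → (e.comp r).wr L A = true := by
  induction e with
  | v x => intro r hr; simp [Ex.comp, Prog.wr, hr]
  | c x => intro r hr; simp [Ex.comp, Prog.wr, hr]
  | o p e f h1 h2 => intro r hr; simp [Ex.comp, Prog.wr, hr, h1 r hr, h2 (r + 1) (by omega)]
  | wrap p e f h1 h2 => intro r hr; simp [Ex.comp, Prog.wr, hr, h1 r hr, h2 (r + 1) (by omega)]
  | ld x e h1 => intro r hr; simp [Ex.comp, Prog.wr, hr, h1 r hr]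

theorem Prog.wr_set {L A : List ℕ} {x : ℕ} (hx : x ∈ L) (e : Ex) :
    (Prog.set x e).wr L A = true := by
  simp [Prog.set, Prog.wr, e.comp_wr L A 50, hx]

theorem Prog.wr_put {L A : List ℕ} {a : ℕ} (ha : a ∈ A) (e f : Ex) :
    (Prog.put a e f).wr L A = true := by
  simp [Prog.put, Prog.wr, e.comp_wr L A 50, f.comp_wr L A 51, ha]

theorem Prog.wr_cond' {L A : List ℕ} {P Q : Prog} (e : Ex) (h1 : P.wr L A = true)
    (h2 : Q.wr L A = true) : (Prog.cond e P Q).wr L A = true := by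
  simp [Prog.cond, Prog.wr, e.comp_wr L A 50, h1, h2]

theorem Prog.wr_for' {L A : List ℕ} {P : Prog} {i : ℕ} (hi : i ∈ L) (e : Ex)
    (h1 : P.wr L A = true) : (Prog.for_ i e P).wr L A = true := by
  simp [Prog.for_, Prog.loop, Prog.wr, Prog.wr_set hi, Ex.comp_wr L A _ 50, h1]

theorem Prog.wr_loop' {L A : List ℕ} {P : Prog} (e : Ex)
    (h1 : P.wr L A = true) : (Prog.loop e P).wr L A = true := by
  simp [Prog.loop, Prog.wr, Ex.comp_wr L A _ 50, h1]

/-! ## Digit sequences -/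

/-- The number with the `N` digits `x 0, x 1, …` in base `b`. -/
def nv (b N : ℕ) (x : ℕ → ℕ) : ℕ := ∑ g ∈ Finset.range N, x g * b ^ g

theorem nv_succ (b N : ℕ) (x : ℕ → ℕ) : nv b (N + 1) x = nv b N x + x N * b ^ N :=
  Finset.sum_range_succ _ _

theorem nv_succ' (b N : ℕ) (x : ℕ → ℕ) : nv b (N + 1) x = b * nv b N (fun g => x (g + 1)) + x 0 := by
  rw [nv, Finset.sum_range_succ', nv, Finset.mul_sum, pow_zero, mul_one]
  congr 1
  exact Finset.sum_congr rfl fun g _ => by ring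

theorem nv_congr {b N : ℕ} {x y : ℕ → ℕ} (h : ∀ g < N, x g = y g) : nv b N x = nv b N y :=
  Finset.sum_congr rfl fun g hg => by rw [h g (Finset.mem_range.1 hg)]

theorem nv_lt {b N : ℕ} {x : ℕ → ℕ} (h : ∀ g < N, x g < b) : nv b N x < b ^ N := by
  induction N with
  | zero => simp [nv]
  | succ N ih =>
    rw [nv_succ, pow_succ, mul_comm (b ^ N)]
    have := ih fun g hg => h g (by omega)
    calc _ < b ^ N + x N * b ^ N := by omega
      _ = (x N + 1) * b ^ N := by ring
      _ ≤ b * b ^ N := Nat.mul_le_mul_right _ (h N (by omega))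

theorem nv_zero {b N : ℕ} {x : ℕ → ℕ} (h : ∀ g < N, x g = 0) : nv b N x = 0 :=
  Finset.sum_eq_zero fun g hg => by rw [h g (Finset.mem_range.1 hg), zero_mul]

theorem digit_of_nv {b N : ℕ} {x : ℕ → ℕ} (h : ∀ g < N, x g < b) {d : ℕ} (hd : d < N) :
    nv b N x / b ^ d % b = x d := by
  induction N generalizing x d with
  | zero => omega
  | succ N ih =>
    have hb : 0 < b := (Nat.zero_le _).trans_lt (h 0 (by omega))
    rw [nv_succ']
    cases d with
    | zero => rw [pow_zero, Nat.div_one, Nat.mul_add_mod, Nat.mod_eq_of_lt (h 0 (by omega))]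
    | succ d =>
      rw [pow_succ', ← Nat.div_div_eq_div_mul, Nat.mul_add_div hb,
        Nat.div_eq_of_lt (h 0 (by omega)), add_zero]
      exact ih (x := fun g => x (g + 1)) (fun g hg => h (g + 1) (by omega)) (by omega)

theorem dv_eq_nv (k n : ℕ) (x : ℕ → ℕ) :
    dv k n x = ((nv (n + 1) (2 * (k + 1)) x : ℕ) : Res k n) := dv_natCast k n x

namespace Alg

/-- Addition with carry: the value of `e` for each index (in register `32`) is reduced to a digit
for the base in register `rb`, and written to the array `a`. The carry is in register `17`. -/
def addc (a rb rl : ℕ) (e : Ex) : Prog :=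
  .for_ 32 (.v rl) (.set 18 (e + .v 17) ;; .put a (.v 32) (.v 18 % .v rb) ;;
    .set 17 (.v 18 / .v rb))

theorem addc_wr {L A : List ℕ} {a rb rl : ℕ} (e : Ex) (h17 : 17 ∈ L := by decide)
    (h18 : 18 ∈ L := by decide) (h32 : 32 ∈ L := by decide) (ha : a ∈ A := by decide) :
    (addc a rb rl e).wr L A = true :=
  Prog.wr_for' h32 _ (Prog.wr_seq (Prog.wr_set h18 _) (Prog.wr_seq (Prog.wr_put ha _ _)
    (Prog.wr_set h17 _)))

/-- With `x d ≤ 2 * b - 2` and a carry of at most one, each sum is below `2 * b`, so the carry stays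
at most one. The base is a parameter because the same loop is used in base `n + 1` for numbers and
in base `k` for the enumeration of functions; there `b = N = 0` is possible, whence the form of
`hb`. -/
theorem addc_spec {w : ℕ} {σ : HS} {a rb rl b N : ℕ} {e : Ex} (x : ℕ → ℕ) (hw : 1 < 2 ^ w)
    (hb : N ≠ 0 → 0 < b) (hbw : 2 * b ≤ 2 ^ w) (ha : a < 103) (hrb : rb < 50) (hrl : rl < 50)
    (hrb' : rb ∉ [17, 18, 32]) (hrl' : rl ∉ [17, 18, 32]) (hvb : σ.v rb = b) (hvl : σ.v rl = N)
    (hc : σ.v 17 ≤ 1) (hx : ∀ d < N, x d + 2 ≤ 2 * b)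
    (he : ∀ d < N, ∀ σ', Fr [17, 18, 32] [a] σ σ' → σ'.v 32 = d →
      (∀ i, d ≤ i → σ'.m a i = σ.m a i) → e.ok w σ' ∧ e.ev w σ' = x d) :
    Hwp w (addc a rb rl e) (fun σ' t => t ≤ N * (e.cost + 30) + 10 ∧ σ'.v 17 ≤ 1 ∧
      (∀ d < N, σ'.m a d < b) ∧ σ'.v 17 * b ^ N + nv b N (σ'.m a) = nv b N x + σ.v 17) σ := by
  have hsub : ∀ σ', Fr (32 :: [17, 18]) [a] σ σ' → Fr [17, 18, 32] [a] σ σ' := fun σ' h =>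
    h.mono (by simp) (by simp)
  refine Hwp.for_ [17, 18] [a] N (e.cost + 20) (fun j σ' => σ'.v 17 ≤ 1 ∧
    (∀ d < j, σ'.m a d < b) ∧ σ'.v 17 * b ^ j + nv b j (σ'.m a) = nv b j x + σ.v 17 ∧
    ∀ i, j ≤ i → σ'.m a i = σ.m a i) hw ?_ (by norm_num) (by decide) (fun σ' hF => ?_) ?_ ?_ ?_
  · exact Prog.wr_seq (Prog.wr_set (by decide) _) (Prog.wr_seq (Prog.wr_put (by simp) _ _)
      (Prog.wr_set (by decide) _))
  · exact ⟨hrl, ((hsub _ hF).v rl hrl hrl').trans hvl⟩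
  · simp [hc, nv]
  · rintro j hj σ' hF hv ⟨h1, h2, h3, h4⟩
    obtain ⟨e1, e2⟩ := he j hj σ' (hsub _ hF) hv h4
    have hxj := hx j hj
    have hvb' : σ'.v rb = b := ((hsub _ hF).v rb hrb hrb').trans hvb
    have hrb1 : rb ≠ 18 := by rintro rfl; simp at hrb'
    refine Hwp.seq (Hwp.set (by norm_num) ⟨e1, by simp, ?_⟩ ?_)
    · simp only [Ex.okOp, Ex.ev_v, e2]; omega
    refine Hwp.seq (Hwp.put ha (by simp) (by simp [hrb]) ?_)
    refine Hwp.set (by norm_num) (by simp [hrb]) ?_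
    simp only [Ex.ev_add, Ex.ev_v, e2, Ex.ev_mod, HS.setV_v, HS.setM_v, if_true, hv, hrb1, if_false,
      hvb', Ex.ev_div, Ex.cost_add, Ex.cost_v, Ex.cost_mod, Ex.cost_div, HS.setV_m,
      show (32 : ℕ) ≠ 18 by norm_num, show (17 : ℕ) ≠ 32 by norm_num]
    refine ⟨by omega, ?_, fun d hd => ?_, ?_, fun i hi => ?_⟩
    · exact Nat.lt_succ_iff.1 (Nat.div_lt_of_lt_mul (by omega))
    · rw [HS.setM_m_self]
      split_ifs with hdj
      · exact Nat.mod_lt _ (hb (by omega))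
      · exact h2 d (by omega)
    · have e3 : nv b j (((σ'.setV 18 (x j + σ'.v 17)).setM a j ((x j + σ'.v 17) % b)).m a) =
          nv b j (σ'.m a) := nv_congr fun g hg => by rw [HS.setM_m_self, if_neg hg.ne]; rfl
      rw [nv_succ, nv_succ, e3, HS.setM_m_self, if_pos rfl, pow_succ]
      have := Nat.div_add_mod (x j + σ'.v 17) b
      have e4 : (x j + σ'.v 17) / b * (b ^ j * b) + (nv b j (σ'.m a) +
          (x j + σ'.v 17) % b * b ^ j) =
          (b * ((x j + σ'.v 17) / b) + (x j + σ'.v 17) % b) * b ^ j + nv b j (σ'.m a) := by ring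
      rw [e4, this]
      linarith
    · rw [HS.setM_m_self, if_neg (by omega)]
      exact h4 i (by omega)
  · rintro σ' t hF ⟨h1, h2, h3, -⟩ ht
    simp only [Ex.cost_v] at ht
    refine ⟨?_, h1, h2, h3⟩
    have : N * (e.cost + 20 + 1 + 7) ≤ N * (e.cost + 30) := Nat.mul_le_mul_left _ (by omega)
    linarith

/-- The first digits of an array are set to zero. -/
def zero (a : ℕ) : Prog := .for_ 32 (.v 3) (.put a (.v 32) (.c 0))

theorem zero_spec {k n w : ℕ} {σ : HS} (hS : Sz k n w) (hC : Ctx k n σ) {a : ℕ} (ha : a < 103) :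
    Hwp w (zero a) (fun σ' t => t ≤ 2 * (k + 1) * 20 + 10 ∧
      ∀ d < 2 * (k + 1), σ'.m a d = 0) σ := by
  refine Hwp.fill (2 * (k + 1)) id (fun _ => 0) hS.one_lt (by norm_num) ha
    (fun j' _ j hj => hj.ne) (fun σ' hF => ?_) (fun j hj σ' hF hv hm => ?_)
    fun σ' t hF h1 h2 ht => ?_
  · simp [(hC.of_fr hF).h3]
  · simp [hv]
  · simp only [Ex.cost_v, Ex.cost_c] at ht
    exact ⟨by omega, h1⟩

/-- Register `r` becomes `1` if the value of `e` is nonzero for one of the values of register `9`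
below the value of `u`, and `0` otherwise. -/
def check (r : ℕ) (u e : Ex) : Prog :=
  .set r (.c 0) ;; .for_ 9 u (.cond e (.set r (.c 1)) .skip)

theorem check_wr {L A : List ℕ} {r : ℕ} (u e : Ex) (hr : r ∈ L := by decide)
    (h9 : 9 ∈ L := by decide) : (check r u e).wr L A = true :=
  Prog.wr_seq (Prog.wr_set hr _) (Prog.wr_for' h9 _ (Prog.wr_cond' _ (Prog.wr_set hr _)
    (by simp [Prog.skip, Prog.wr])))

theorem check_spec {w : ℕ} {σ : HS} {r N : ℕ} {u e : Ex} (x : ℕ → ℕ) (hw : 1 < 2 ^ w)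
    (hr : r < 50) (hr9 : r ≠ 9) (hu : ∀ σ', Fr [9, r] [] σ σ' → u.ok w σ' ∧ u.ev w σ' = N)
    (he : ∀ i < N, ∀ σ', Fr [9, r] [] σ σ' → σ'.v 9 = i → e.ok w σ' ∧ e.ev w σ' = x i) :
    Hwp w (check r u e) (fun σ' t => t ≤ N * (e.cost + u.cost + 12) + u.cost + 10 ∧
      (σ'.v r = 0 ↔ ∀ i < N, x i = 0)) σ := by
  have hF0 : Fr [9, r] [] σ (σ.setV r 0) := (Fr.refl _ _ _).setV (by simp)
  have hsub : ∀ σ', Fr (9 :: [r]) [] (σ.setV r 0) σ' → Fr [9, r] [] σ σ' := fun σ' h => hF0.trans h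
  refine Hwp.seq (Hwp.set hr (by simp) ?_)
  refine Hwp.for_ [r] [] N (e.cost + 4) (fun j σ' => σ'.v r = 0 ↔ ∀ i < j, x i = 0) hw
    (Prog.wr_cond' _ (Prog.wr_set (by simp) _) (by simp [Prog.skip, Prog.wr])) (by norm_num)
    (by simpa using hr9.symm) (fun σ' hF => hu σ' (hsub _ hF)) ?_ ?_ ?_
  · simp [hr9]
  · rintro j hj σ' hF hv hI
    obtain ⟨e1, e2⟩ := he j hj σ' (hsub _ hF) hv
    refine Hwp.cond e1 (fun h1 => ?_) (fun h1 => ?_)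
    · refine Hwp.set hr (by simpa using (by rintro rfl; simp at hw)) ⟨by simp, ?_⟩
      simp only [HS.setV_v, hr9, if_false, if_true, Ex.ev_c, one_ne_zero, false_iff]
      intro h
      exact h1 (e2.trans (h j (by omega)))
    · refine Hwp.skip ⟨by omega, ?_⟩
      simp only [HS.setV_v, hr9, if_false, hI]
      refine ⟨fun h i hi => ?_, fun h i hi => h i (by omega)⟩
      rcases Nat.lt_succ_iff_lt_or_eq.1 hi with h2 | rfl
      · exact h i h2
      · exact e2.symm.trans h1
  · rintro σ' t hF hI ht
    refine ⟨?_, hI⟩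
    simp only [Ex.cost_c]
    have : N * (e.cost + 4 + u.cost + 7) ≤ N * (e.cost + u.cost + 12) :=
      Nat.mul_le_mul_left _ (by omega)
    linarith

end Alg

end WordRAM

/-! ### Conversion from base `n + 1` to base `2 ^ w`. -/

namespace WordRAM

namespace Alg

/-- The digits in the array `a` are converted to the output format. -/
def toWords (a : ℕ) : Prog :=
  .for_ 32 (.v 3) (.put 2 (.v 32) (.c 0)) ;;
  .for_ 30 (.v 3) (.set 17 (.ld a (.v 3 - .v 30 - .c 1)) ;;
    .for_ 32 (.v 3) (.set 18 (.wrap .mul (.ld 2 (.v 32)) (.v 2)) ;;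
      .set 19 (.wrap .mulHigh (.ld 2 (.v 32)) (.v 2)) ;;
      .put 2 (.v 32) (.wrap .add (.v 18) (.v 17)) ;;
      .set 17 (.v 19 + .lt (.ld 2 (.v 32)) (.v 18)))) ;;
  .set 0 (.v 3)

/-- An addition of words overflows exactly if the result is smaller than a summand. -/
theorem add_carry {W lo c : ℕ} (hlo : lo < W) (hc : c < W) :
    (lo + c) % W + W * (if (lo + c) % W < lo then 1 else 0) = lo + c := by
  by_cases h : lo + c < W
  · rw [Nat.mod_eq_of_lt h, if_neg (by omega)]; omega
  · have : (lo + c) % W = lo + c - W := by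
      rw [Nat.mod_eq_sub_mod (by omega), Nat.mod_eq_of_lt (by omega)]
    rw [this, if_pos (by omega)]; omega

/-- Since `x * b + c ≤ (W - 1) * b + (b - 1) < W * b`, the high word together with the overflow bit
is again below `b` and can be carried to the next word. -/
theorem mul_add_carry {W x b c : ℕ} (hx : x < W) (hc : c < b) (hb : b < W) :
    W * (x * b / W + if (x * b % W + c) % W < x * b % W then 1 else 0) + (x * b % W + c) % W =
      x * b + c ∧ (x * b / W + if (x * b % W + c) % W < x * b % W then 1 else 0) < b := by
  have hac := add_carry (Nat.mod_lt (x * b) (show W > 0 by omega)) (show c < W by omega)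
  have hdm := Nat.div_add_mod (x * b) W
  have hxle : (x + 1) * b ≤ W * b := Nat.mul_le_mul_right _ hx
  generalize (if (x * b % W + c) % W < x * b % W then 1 else 0) = z at *
  generalize (x * b % W + c) % W = r at *
  have hkey : W * (x * b / W + z) + r = x * b + c := by rw [mul_add]; omega
  refine ⟨hkey, ?_⟩
  by_contra hcon
  have : W * b ≤ W * (x * b / W + z) := Nat.mul_le_mul_left _ (by omega)
  rw [add_mul, one_mul] at hxle
  omega

/-- Multiplication by the base and addition of a digit. -/
theorem mulWord_spec {k n w : ℕ} {σ : HS} (hS : Sz k n w) (hC : Ctx k n σ) (hc : σ.v 17 ≤ n) :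
    Hwp w (.for_ 32 (.v 3) (.set 18 (.wrap .mul (.ld 2 (.v 32)) (.v 2)) ;;
      .set 19 (.wrap .mulHigh (.ld 2 (.v 32)) (.v 2)) ;;
      .put 2 (.v 32) (.wrap .add (.v 18) (.v 17)) ;;
      .set 17 (.v 19 + .lt (.ld 2 (.v 32)) (.v 18))))
      (fun σ' t => t ≤ 2 * (k + 1) * 50 + 10 ∧ σ'.v 17 * (2 ^ w) ^ (2 * (k + 1)) +
        nv (2 ^ w) (2 * (k + 1)) (σ'.m 2) =
          (n + 1) * nv (2 ^ w) (2 * (k + 1)) (σ.m 2) + σ.v 17) σ := by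
  have hnw : n + 1 < 2 ^ w := hS.lt_of_le_pow (i := 1) (by rw [pow_one]; omega)
  refine Hwp.for_ [17, 18, 19] [2] (2 * (k + 1)) 30 (fun j σ' => σ'.v 17 ≤ n ∧
    σ'.v 17 * (2 ^ w) ^ j + nv (2 ^ w) j (σ'.m 2) = (n + 1) * nv (2 ^ w) j (σ.m 2) + σ.v 17 ∧
    ∀ i, j ≤ i → σ'.m 2 i = σ.m 2 i) hS.one_lt (by decide) (by norm_num) (by decide)
    (fun σ' hF => ?_) ?_ ?_ ?_
  · simp [(hC.of_fr hF).h3]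
  · simp [hc, nv]
  · rintro j hj σ' hF hv ⟨h1, h2, h3⟩
    refine Hwp.bd fun hbd => ?_
    have hC' := hC.of_fr hF
    have hx := hbd.2 2 (by norm_num) j
    set x := σ'.m 2 j with hxdef
    set c := σ'.v 17 with hcdef
    set W := 2 ^ w with hW
    obtain ⟨hkey, hcar⟩ := mul_add_carry hx (show c < n + 1 by omega) hnw
    have hhiW : x * (n + 1) / W % W = x * (n + 1) / W := Nat.mod_eq_of_lt (by omega)
    have hS1 := hS.one_lt
    refine Hwp.seq (Hwp.set (by norm_num) (by simp) ?_)
    refine Hwp.seq (Hwp.set (by norm_num) (by simp) ?_)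
    refine Hwp.seq (Hwp.put (by norm_num) (by simp) (by simp) ?_)
    refine Hwp.set (by norm_num) ?_ ?_
    · refine ⟨by simp, ⟨by simp, by simp, hS.one_lt⟩, ?_⟩
      simp only [Ex.okOp, Ex.ev_v, Ex.ev_lt, Ex.ev_ld, Ex.ev_wrap, Op.eval, HS.setM_v, HS.setV_v,
        HS.setM_m_self, HS.setV_m, hv, hC'.h2, if_true, ← hxdef, ← hcdef, reduceIte,
        show (32 : ℕ) ≠ 19 by norm_num, show (32 : ℕ) ≠ 18 by norm_num,
        show (18 : ℕ) ≠ 19 by norm_num, show (17 : ℕ) ≠ 19 by norm_num,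
        show (17 : ℕ) ≠ 18 by norm_num, show (2 : ℕ) ≠ 18 by norm_num,
        ← hW, hhiW]
      omega
    · simp only [Ex.ev_v, Ex.ev_lt, Ex.ev_add, Ex.ev_ld, Ex.ev_wrap, Op.eval, HS.setM_v, HS.setV_v,
        HS.setM_m_self, HS.setV_m, hv, hC'.h2, if_true, ← hxdef, ← hcdef, reduceIte,
        show (32 : ℕ) ≠ 19 by norm_num, show (32 : ℕ) ≠ 18 by norm_num,
        show (18 : ℕ) ≠ 19 by norm_num, show (17 : ℕ) ≠ 19 by norm_num, show (17 : ℕ) ≠ 32 by norm_num,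
        show (17 : ℕ) ≠ 18 by norm_num, show (2 : ℕ) ≠ 18 by norm_num,
        ← hW, hhiW]
      refine ⟨by simp, Nat.lt_succ_iff.1 hcar, ?_, fun i hi => ?_⟩
      · have e3 : ∀ y : ℕ → ℕ, (∀ g < j, y g = σ'.m 2 g) → nv W j y = nv W j (σ'.m 2) :=
          fun y hy => nv_congr hy
        rw [nv_succ, nv_succ, e3 _ fun g hg => ?_, HS.setM_m_self, if_pos rfl, ← h3 j le_rfl,
          ← hxdef, pow_succ]
        · clear_value W
          linear_combination W ^ j * hkey + h2
        · rw [HS.setM_m_self, if_neg hg.ne]; rfl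
      · rw [if_neg (by omega)]
        exact h3 i (by omega)
  · rintro σ' t hF ⟨-, h2, -⟩ ht
    simp only [Ex.cost_v] at ht
    exact ⟨by omega, h2⟩

/-- Horner's scheme, starting with the most significant digit. All intermediate values are below `(n
+ 1) ^ K ≤ (2 ^ w) ^ K`, so `K` words suffice and the carry out of the last word is always zero.
Leading zero words are permitted in the output. -/
theorem toWords_spec {k n w : ℕ} {σ : HS} (hS : Sz k n w) (hC : Ctx k n σ) {a : ℕ} (ha : a < 103)
    (ha2 : a ≠ 2) (hd : ∀ d < 2 * (k + 1), σ.m a d ≤ n) :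
    Hwp w (toWords a) (fun σ' t => t ≤ (k + 1) * (k + 1) * 600 + 50 ∧ σ'.v 0 = 2 * (k + 1) ∧
      nv (2 ^ w) (2 * (k + 1)) (σ'.m 2) = nv (n + 1) (2 * (k + 1)) (σ.m a)) σ := by
  have hnw : n + 1 < 2 ^ w := hS.lt_of_le_pow (i := 1) (by rw [pow_one]; omega)
  have hk3 : 2 * (k + 1) < 2 ^ w := hS.lt_of_le_pow (i := 2) (by nlinarith)
  refine Hwp.seq (Hwp.fill (2 * (k + 1)) id (fun _ => 0) hS.one_lt (by norm_num) (by norm_num)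
    (fun j' _ j hj => hj.ne) (fun σ' hF => by simp [(hC.of_fr hF).h3])
    (fun j hj σ' hF hv hm => by simp [hv]) fun σ₁ t₁ hF1 h1 _ ht1 => ?_)
  have hC1 := hC.of_fr hF1
  simp only [Ex.cost_v, Ex.cost_c] at ht1
  have ha1 : σ₁.m a = σ.m a := hF1.m a ha (by simpa using ha2)
  refine Hwp.seq (Hwp.for_ [17, 18, 19, 32] [2] (2 * (k + 1)) (2 * (k + 1) * 50 + 30)
    (fun j σ' => nv (2 ^ w) (2 * (k + 1)) (σ'.m 2) =
      nv (n + 1) j (fun g => σ.m a (2 * (k + 1) - j + g)))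
    hS.one_lt (Prog.wr_seq (Prog.wr_set (by decide) _) (Prog.wr_for' (by decide) _ (by decide))) (by norm_num) (by decide) (fun σ' hF => ?_) ?_ ?_ ?_)
  · simp [(hC1.of_fr hF).h3]
  · exact (nv_zero (fun g hg => h1 g hg)).trans (by simp [nv])
  · rintro j hj σ' hF hv hI
    have hC' := hC1.of_fr hF
    have ha' : σ'.m a = σ.m a := (hF.m a ha (by simpa using ha2)).trans ha1
    refine Hwp.seq (Hwp.set (by norm_num) ?_ ?_)
    · simp [ha, hv, hC'.h3, hS.w_ne]; omega
    set σ₂ := σ'.setV 17 ((Ex.ld a (.v 3 - .v 30 - .c 1)).ev w σ')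
    have hF2 : Fr [17] [] σ' σ₂ := (Fr.refl _ _ _).setV (by simp)
    have h17 : σ₂.v 17 = σ.m a (2 * (k + 1) - j - 1) := by
      simp [σ₂, hv, hC'.h3, ha']
    refine (mulWord_spec hS (hC'.of_fr hF2) (h17.trans_le (hd _ (by omega)))).mono ?_
    rintro σ₃ t₃ ⟨ht3, h3⟩
    refine ⟨by simp; omega, ?_⟩
    have e1 : (fun g => σ.m a (2 * (k + 1) - (j + 1) + (g + 1))) =
        fun g => σ.m a (2 * (k + 1) - j + g) := by
      funext g; congr 1; omega
    have e2 : (n + 1) * nv (2 ^ w) (2 * (k + 1)) (σ₂.m 2) + σ₂.v 17 =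
        nv (n + 1) (j + 1) (fun g => σ.m a (2 * (k + 1) - (j + 1) + g)) := by
      rw [nv_succ', e1, h17, ← hI, add_zero, Nat.sub_sub]
      rfl
    have e3 : nv (n + 1) (j + 1) (fun g => σ.m a (2 * (k + 1) - (j + 1) + g)) <
        (2 ^ w) ^ (2 * (k + 1)) := by
      refine (nv_lt fun g hg => Nat.lt_succ_iff.2 (hd _ (by omega))).trans_le ?_
      calc (n + 1) ^ (j + 1) ≤ (n + 1) ^ (2 * (k + 1)) := Nat.pow_le_pow_right (by omega) hj
        _ ≤ _ := Nat.pow_le_pow_left hnw.le _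
    rw [e2] at h3
    have h0 : σ₃.v 17 = 0 := by
      by_contra h0
      have := Nat.le_mul_of_pos_left ((2 ^ w) ^ (2 * (k + 1))) (Nat.pos_of_ne_zero h0)
      omega
    rw [h0, zero_mul, zero_add] at h3
    exact h3
  · rintro σ₂ t₂ hF2 hI ht2
    have hC2 := hC1.of_fr hF2
    refine Hwp.set (by norm_num) (by simp) ⟨?_, by simp [hC2.h3], ?_⟩
    · simp only [Ex.cost_v] at ht2 ⊢
      nlinarith
    · refine Eq.trans hI ?_
      simp

end Alg

end WordRAM

/-! ## Counting injective homomorphisms -/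

namespace Elim

section
variable {R : Type*} [CommRing R] {X : Type*}

open Classical in
/-- The factor of the vertex `v` and its representative `u` in the formula for the number of
injective functions. -/
noncomputable def step {k : ℕ} (ψ : Fin k → X) (v u : Fin k) : R :=
  if ψ u = ψ v then (if u < v then -1 else if u = v then 1 else 0) else 0

open Classical in
theorem sum_step {k : ℕ} (ψ : Fin k → X) (v : Fin k) :
    ∑ u, step ψ v u = 1 - (((Finset.univ.filter fun u => u < v ∧ ψ u = ψ v).card : ℕ) : R) := by
  have h1 : ∀ u, step (R := R) ψ v u =
      (if u = v then 1 else 0) - (if u < v ∧ ψ u = ψ v then 1 else 0) := by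
    intro u
    unfold step
    by_cases h2 : u = v
    · subst h2; simp
    · by_cases h3 : u < v <;> by_cases h4 : ψ u = ψ v <;> simp [h2, h3, h4]
  simp_rw [h1, Finset.sum_sub_distrib]
  simp

-- Expanding the product over `v` of the sums over `u` gives the factors `1 - #{u < v | ψ u = ψ v}`.
-- All are one if `ψ` is injective. Otherwise the least `v` that repeats an earlier value repeats it
-- from exactly one earlier vertex, and its factor is zero.
open Classical in
theorem sum_prod_step {k : ℕ} (ψ : Fin k → X) :
    ∑ f : Fin k → Fin k, ∏ v, step (R := R) ψ v (f v) =
      if Function.Injective ψ then 1 else 0 := by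
  rw [← Fintype.prod_sum, Finset.prod_congr rfl fun v _ => sum_step ψ v]
  split_ifs with h
  · refine Finset.prod_eq_one fun v _ => ?_
    rw [Finset.filter_false_of_mem, Finset.card_empty, Nat.cast_zero, sub_zero]
    rintro u - ⟨h1, h2⟩
    exact h1.ne (h h2)
  · have hex : ∃ m : ℕ, ∃ v u : Fin k, (v : ℕ) = m ∧ u < v ∧ ψ u = ψ v := by
      simp only [Function.Injective, not_forall] at h
      obtain ⟨a, b, hab, hne⟩ := h
      rcases lt_or_gt_of_ne hne with h1 | h1
      · exact ⟨b, b, a, rfl, h1, hab⟩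
      · exact ⟨a, a, b, rfl, h1, hab.symm⟩
    -- Two earlier vertices with the value of `v` would make the larger of them a smaller
    -- repetition.
    obtain ⟨v, u, hv, huv, he⟩ := Nat.find_spec hex
    refine Finset.prod_eq_zero (Finset.mem_univ v) ?_
    rw [show (Finset.univ.filter fun u => u < v ∧ ψ u = ψ v) = {u} from ?_]
    · simp
    · ext u'
      simp only [Finset.mem_filter, Finset.mem_univ, true_and, Finset.mem_singleton]
      refine ⟨fun ⟨h1, h2⟩ => ?_, fun h1 => h1 ▸ ⟨huv, he⟩⟩
      by_contra hne
      rcases lt_or_gt_of_ne hne with h3 | h3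
      · exact Nat.find_min hex (m := u) (hv ▸ huv) ⟨u, u', rfl, h3, h2.trans he.symm⟩
      · exact Nat.find_min hex (m := u') (hv ▸ h1) ⟨u', u, rfl, h3, he.trans h2.symm⟩

open Classical in
/-- The contribution of the function `f` to the number of injective homomorphisms. -/
noncomputable def term (R : Type*) [CommRing R] {k : ℕ} (T : Finset (Fin k → X))
    (f : Fin k → Fin k) : R :=
  if ∀ v, f v ≤ v then (-1) ^ (Finset.univ.filter fun v => f v < v).card *
    ((T.filter fun ψ => ∀ v, ψ (f v) = ψ v).card : R) else 0

-- For a fixed `f` the product of the factors is the sign of `f` if `f v ≤ v` for all `v` and `ψ ∘ f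
-- = ψ`, and zero otherwise. Exchanging the two sums reduces the claim to `sum_prod_step`.
open Classical in
theorem sum_term {k : ℕ} (T : Finset (Fin k → X)) :
    ∑ f, term R T f = ((T.filter Function.Injective).card : R) := by
  have h1 : ∀ f, term R T f = ∑ ψ ∈ T, ∏ v, step ψ v (f v) := by
    intro f
    unfold term
    split_ifs with h
    · rw [Finset.card_filter (fun ψ : Fin k → X => ∀ v, ψ (f v) = ψ v), Nat.cast_sum, Finset.mul_sum]
      refine Finset.sum_congr rfl fun ψ _ => ?_
      by_cases h2 : ∀ v, ψ (f v) = ψ v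
      · rw [if_pos h2, Nat.cast_one, mul_one, Finset.card_filter, ← Finset.prod_pow_eq_pow_sum]
        refine Finset.prod_congr rfl fun v _ => ?_
        rcases (h v).lt_or_eq with h3 | h3
        · simp [step, h2 v, h3]
        · simp [step, h3]
      · rw [if_neg h2]
        obtain ⟨v, hv⟩ := not_forall.1 h2
        rw [Finset.prod_eq_zero (Finset.mem_univ v) (by simp [step, hv])]
        simp
    · obtain ⟨v, hv⟩ := not_forall.1 h
      symm
      refine Finset.sum_eq_zero fun ψ _ => Finset.prod_eq_zero (Finset.mem_univ v) ?_
      have h2 : ¬f v < v := fun h3 => hv h3.le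
      have h3 : ¬f v = v := fun h3 => hv h3.le
      simp [step, h2, h3]
  simp_rw [h1]
  rw [Finset.sum_comm, Finset.sum_congr rfl fun ψ _ => sum_prod_step ψ, Finset.card_filter,
    Nat.cast_sum]
  exact Finset.sum_congr rfl fun ψ _ => by split_ifs <;> simp
end

open Classical in
/-- The homomorphisms from `H` to `G`. -/
noncomputable def homs {k n : ℕ} (H : SimpleGraph (Fin k)) (G : SimpleGraph (Fin n)) :
    Finset (Fin k → Fin n) :=
  Finset.univ.filter fun ψ => ∀ u v, H.Adj u v → G.Adj (ψ u) (ψ v)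

theorem homCount_eq {k n : ℕ} (H : SimpleGraph (Fin k)) (G : SimpleGraph (Fin n)) :
    homCount H G = (homs H G).card := by
  classical
  rw [homs, ← Fintype.card_subtype, ← Nat.card_eq_fintype_card, homCount]
  exact Nat.card_congr ⟨fun f => ⟨f, fun u v h => f.map_rel h⟩, fun f => ⟨f.1, fun {u v} h => f.2 u v h⟩,
    fun f => rfl, fun f => rfl⟩

open Classical in
theorem copies_eq {k n : ℕ} (H : SimpleGraph (Fin k)) (G : SimpleGraph (Fin n)) :
    Nat.card (SimpleGraph.Copy H G) = ((homs H G).filter Function.Injective).card := by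
  rw [homs, Finset.filter_filter, ← Fintype.card_subtype, ← Nat.card_eq_fintype_card]
  exact Nat.card_congr ⟨fun f => ⟨f, fun u v h => f.toHom.map_rel h, f.injective⟩,
    fun f => ⟨⟨f.1, fun {u v} h => f.2.1 u v h⟩, f.2.2⟩, fun f => rfl, fun f => rfl⟩

/-- The automorphisms of `H`. -/
def IsAut {k : ℕ} (H : SimpleGraph (Fin k)) (f : Fin k → Fin k) : Prop :=
  Function.Injective f ∧ ∀ u v, H.Adj u v ↔ H.Adj (f u) (f v)

open Classical in
theorem aut_eq {k : ℕ} (H : SimpleGraph (Fin k)) :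
    Nat.card (H ≃g H) = (Finset.univ.filter (IsAut H)).card := by
  rw [← Fintype.card_subtype, ← Nat.card_eq_fintype_card]
  exact Nat.card_congr ⟨fun f => ⟨f, f.injective, fun u v => f.map_rel_iff.symm⟩,
    fun f => ⟨Equiv.ofBijective f.1 (Finite.injective_iff_bijective.1 f.2.1),
      fun {u v} => (f.2.2 u v).symm⟩, fun f => by ext; rfl, fun f => rfl⟩

/-- A copy of `H` in `G` is its image, a subgraph, together with an isomorphism from `H` to this
subgraph. If such an isomorphism exists, there are as many as automorphisms of `H`. -/
theorem card_copy {V W : Type*} [Finite V] [Finite W] (H : SimpleGraph V) (G : SimpleGraph W) :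
    Nat.card (SimpleGraph.Copy H G) = subCount H G * Nat.card (H ≃g H) := by
  classical
  have hb : Function.Bijective (fun p : Σ S : G.Subgraph, (H ≃g S.coe) =>
      p.1.coeCopy.comp p.2.toCopy) := by
    constructor
    · rintro ⟨S, e⟩ ⟨S', e'⟩ h
      have key : ∀ (S : G.Subgraph) (e : H ≃g S.coe), (S.coeCopy.comp e.toCopy).toSubgraph = S := by
        intro S e
        change SimpleGraph.Subgraph.map (S.hom.comp e.toHom) ⊤ = S
        simp [SimpleGraph.Subgraph.map_comp]
      have hS : S = S' := by rw [← key S e, ← key S' e']; exact congrArg _ h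
      subst hS
      congr 1
      ext v
      exact congrArg (fun f : SimpleGraph.Copy H G => f v) h
    · intro f
      exact ⟨⟨f.toSubgraph, f.isoToSubgraph⟩, SimpleGraph.Copy.ext fun a => rfl⟩
  have : Finite G.Subgraph := by
    refine Finite.of_injective (fun S => (S.verts, S.Adj)) fun S S' h => ?_
    exact SimpleGraph.Subgraph.ext (congrArg Prod.fst h) (congrArg Prod.snd h)
  have := Fintype.ofFinite G.Subgraph
  have : ∀ S : G.Subgraph, Finite (H ≃g S.coe) := fun S =>
    Finite.of_injective (fun e => (e : V → S.verts)) DFunLike.coe_injective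
  have h1 : ∀ S : G.Subgraph, Nat.card (H ≃g S.coe) =
      if Nonempty (H ≃g S.coe) then Nat.card (H ≃g H) else 0 := by
    intro S
    split_ifs with h
    · obtain ⟨e⟩ := h
      exact Nat.card_congr ⟨fun f => f.trans e.symm, fun f => f.trans e, fun f => by ext; simp,
        fun f => by ext; simp⟩
    · have := not_nonempty_iff.1 h
      simp
  rw [← Nat.card_congr (Equiv.ofBijective _ hb), Nat.card_sigma, subCount,
    Finset.sum_congr rfl fun S _ => h1 S, ← Finset.sum_filter, Finset.sum_const, smul_eq_mul,
    ← Fintype.card_subtype, ← Nat.card_eq_fintype_card]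

/-! ## Quotients -/

/-- The vertices of `H` as vertices of the algorithm. -/
def emb {k : ℕ} (u : Fin k) : Fin (k + 2) := ⟨u, by omega⟩

theorem emb_injective {k : ℕ} : Function.Injective (emb : Fin k → Fin (k + 2)) := fun _ _ h =>
  Fin.ext (Fin.mk.inj h)

/-- The edges of the quotient of `H` for the representatives `ρ`. -/
def quotF {k : ℕ} (H : SimpleGraph (Fin k)) (ρ : Fin k → Fin k) (a b : Fin (k + 2)) : Prop :=
  ∃ u v, H.Adj u v ∧ emb (ρ u) = a ∧ emb (ρ v) = b

/-- The representatives. -/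
def quotS {k : ℕ} (ρ : Fin k → Fin k) : Finset (Fin (k + 2)) :=
  (Finset.univ.filter fun u => ρ u = u).image emb

theorem mem_quotS {k : ℕ} {ρ : Fin k → Fin k} {u : Fin k} : emb u ∈ quotS ρ ↔ ρ u = u := by
  simp [quotS, emb_injective.eq_iff]

-- A homomorphism that is constant on the classes is determined by its values on the
-- representatives; conversely, composition with `ρ` extends an assignment on the representatives.
open Classical in
theorem card_quot {k n : ℕ} (H : SimpleGraph (Fin k)) (G : SimpleGraph (Fin n)) (ρ : Fin k → Fin k)
    (hρ : ∀ u, ρ (ρ u) = ρ u) (o : Fin n) :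
    ((asg (quotS ρ) o).filter fun φ => ∀ a ∈ quotS ρ, ∀ b ∈ quotS ρ, quotF H ρ a b →
      G.Adj (φ a) (φ b)).card = ((homs H G).filter fun ψ => ∀ v, ψ (ρ v) = ψ v).card := by
  refine Finset.card_bij' (fun φ _ u => φ (emb (ρ u)))
    (fun ψ _ a => if h : (a : ℕ) < k then (if a ∈ quotS ρ then ψ ⟨a, h⟩ else o) else o) ?_ ?_ ?_ ?_
  · intro φ hφ
    simp only [Finset.mem_filter, mem_asg, homs, Finset.mem_univ, true_and] at hφ ⊢
    refine ⟨fun u v huv => ?_, fun v => by rw [hρ]⟩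
    exact hφ.2 _ (mem_quotS.2 (hρ u)) _ (mem_quotS.2 (hρ v)) ⟨u, v, huv, rfl, rfl⟩
  · intro ψ hψ
    simp only [Finset.mem_filter, mem_asg, homs, Finset.mem_univ, true_and] at hψ ⊢
    refine ⟨fun a ha => by simp [ha], ?_⟩
    rintro a ha b hb ⟨u, v, huv, rfl, rfl⟩
    rw [dif_pos (show ((emb (ρ u) : Fin (k + 2)) : ℕ) < k from (ρ u).2), if_pos ha,
      dif_pos (show ((emb (ρ v) : Fin (k + 2)) : ℕ) < k from (ρ v).2), if_pos hb]
    change G.Adj (ψ (ρ u)) (ψ (ρ v))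
    rw [hψ.2, hψ.2]
    exact hψ.1 u v huv
  · intro φ hφ
    simp only [Finset.mem_filter, mem_asg] at hφ
    funext a
    by_cases ha : a ∈ quotS ρ
    · obtain ⟨u, hu, rfl⟩ := Finset.mem_image.1 ha
      rw [dif_pos (show ((emb u : Fin (k + 2)) : ℕ) < k from u.2), if_pos ha]
      change φ (emb (ρ u)) = _
      rw [mem_quotS.1 ha]
    · simp [ha, hφ.1 a ha]
  · intro ψ hψ
    simp only [Finset.mem_filter, homs, Finset.mem_univ, true_and] at hψ
    funext u
    simp only
    rw [dif_pos (show ((emb (ρ u) : Fin (k + 2)) : ℕ) < k from (ρ u).2),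
      if_pos (mem_quotS.2 (hρ u))]
    exact hψ.2 u

/-- No edge is collapsed, so the quotient is a simple graph. The projection from `H` is surjective
on its vertices and edges, hence the quotient belongs to the spasm. -/
theorem tw2_quot {k : ℕ} (H : SimpleGraph (Fin k)) (ρ : Fin k → Fin k)
    (hρ : ∀ u, ρ (ρ u) = ρ u) (hH : ∀ u v, H.Adj u v → ρ u ≠ ρ v)
    (hsp : ∀ (m : ℕ) (F : SimpleGraph (Fin m)), InSpasm H F → treewidth F ≤ 2) :
    Tw2 (quotS ρ) (quotF H ρ) := by
  classical
  let e := Fintype.equivFin {u // ρ u = u}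
  let F : SimpleGraph (Fin (Fintype.card {u // ρ u = u})) :=
    { Adj := fun a b => ∃ u v, H.Adj u v ∧ ρ u = (e.symm a : Fin k) ∧ ρ v = (e.symm b : Fin k)
      symm := ⟨fun a b ⟨u, v, h1, h2, h3⟩ => ⟨v, u, h1.symm, h3, h2⟩⟩
      loopless := ⟨fun a ⟨u, v, h1, h2, h3⟩ => hH u v h1 (h2.trans h3.symm)⟩ }
  have hF : InSpasm H F := by
    refine ⟨⟨fun u => e ⟨ρ u, hρ u⟩, fun {u v} huv => ⟨u, v, huv, by simp, by simp⟩⟩, fun a => ?_,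
      ?_⟩
    · refine ⟨(e.symm a : Fin k), ?_⟩
      apply e.symm.injective
      ext
      simp [(e.symm a).2]
    · rintro a b ⟨u, v, h1, h2, h3⟩
      refine ⟨u, v, h1, ?_, ?_⟩ <;> apply e.symm.injective <;> ext <;> simp [h2, h3]
  obtain ⟨D, hD⟩ := exists_treeDecomposition F (hsp _ F hF)
  refine tw2_of_treeDecomposition D hD (fun a => emb (e.symm a : Fin k)) (fun a b h => ?_) ?_
  · exact e.symm.injective (Subtype.ext (emb_injective h))
  · rintro a - b - - ⟨u, v, h1, rfl, rfl⟩
    exact ⟨e ⟨ρ u, hρ u⟩, e ⟨ρ v, hρ v⟩, by simp, by simp, u, v, h1, by simp, by simp⟩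

theorem tw2_id {k : ℕ} (H : SimpleGraph (Fin k)) (h : treewidth H ≤ 2) :
    Tw2 (quotS (id : Fin k → Fin k)) (quotF H id) := by
  obtain ⟨D, hD⟩ := exists_treeDecomposition H h
  refine tw2_of_treeDecomposition D hD emb emb_injective ?_
  rintro a - b - - ⟨u, v, h1, rfl, rfl⟩
  exact ⟨u, v, rfl, rfl, h1⟩

/-- The functions `f` and `ρ` identify the same vertices. -/
theorem rep_iff {k : ℕ} {X : Type*} {f ρ : Fin k → Fin k} (hf : ∀ v, f v ≤ v)
    (hρ : ∀ v, ρ v = if f v = v then v else ρ (f v)) (ψ : Fin k → X) :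
    (∀ v, ψ (f v) = ψ v) ↔ ∀ v, ψ (ρ v) = ψ v := by
  constructor
  · intro h v
    induction v using WellFoundedLT.induction with
    | ind v ih =>
      rw [hρ]
      split_ifs with h1
      · rfl
      · rw [ih (f v) ((hf v).lt_of_ne h1), h]
  · intro h v
    by_cases h1 : f v = v
    · rw [h1]
    · rw [← h v, hρ v, if_neg h1, h]

/-- The chain `v, f v, f (f v), …` decreases until it reaches a fixed point of `f`, and `ρ v` is
this fixed point. -/
theorem rep_rep {k : ℕ} {f ρ : Fin k → Fin k} (hf : ∀ v, f v ≤ v)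
    (hρ : ∀ v, ρ v = if f v = v then v else ρ (f v)) (v : Fin k) : ρ (ρ v) = ρ v := by
  induction v using WellFoundedLT.induction with
  | ind v ih =>
    by_cases h1 : f v = v
    · have : ρ v = v := by rw [hρ, if_pos h1]
      rw [this, this]
    · rw [hρ v, if_neg h1]
      exact ih (f v) ((hf v).lt_of_ne h1)

end Elim

/-! ### Homomorphisms from quotients, computed by the program. -/

namespace WordRAM

open Elim

theorem exists_fin_mul_add {k j : ℕ} (hj : j < k * k) :
    ∃ u v : Fin k, j = u * k + v ∧ j / k = u ∧ j % k = v := by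
  have hk : 0 < k := by
    rcases Nat.eq_zero_or_pos k with rfl | h
    · simp at hj
    · exact h
  exact ⟨⟨j / k, Nat.div_lt_of_lt_mul hj⟩, ⟨j % k, Nat.mod_lt _ hk⟩,
    by rw [mul_comm]; exact (Nat.div_add_mod j k).symm, rfl, rfl⟩

theorem fin_mul_add_inj {k : ℕ} {u v u' v' : Fin k} (h : (u : ℕ) * k + v = u' * k + v') :
    u = u' ∧ v = v' := by
  have key : ∀ a b : Fin k, ((a : ℕ) * k + b) / k = a := fun a b => by
    rw [add_comm, Nat.add_mul_div_right _ _ a.pos, Nat.div_eq_of_lt b.2, zero_add]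
  have h1 : u = u' := Fin.ext (by rw [← key u v, h, key u' v'])
  subst h1
  exact ⟨rfl, Fin.ext (by omega)⟩

/-- The array `a` holds the adjacency matrix of `H`. -/
def Adj {k : ℕ} (σ : HS) (a : ℕ) (H : SimpleGraph (Fin k)) : Prop :=
  ∀ u v : Fin k, (σ.m a (u * k + v) ≠ 0 ↔ H.Adj u v) ∧ σ.m a (u * k + v) ≤ 1

theorem Adj.of_fr {k : ℕ} {L A : List ℕ} {σ σ' : HS} {a : ℕ} {H : SimpleGraph (Fin k)}
    (h : Adj σ a H) (hF : Fr L A σ σ') (ha : a < 103) (haA : a ∉ A := by decide) : Adj σ' a H := by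
  intro u v
  rw [hF.m a ha haA]
  exact h u v

theorem Sz.sq_lt {k n w : ℕ} (h : Sz k n w) : k * k < 2 ^ w ∧ k < 2 ^ w ∧ n < 2 ^ w ∧
    (k + 2) * (k + 2) < 2 ^ w := by
  refine ⟨h.lt_of_le_pow (i := 2) ?_, h.lt_of_le_pow (i := 1) ?_, h.lt_of_le_pow (i := 1) ?_,
    h.lt_of_le_pow (i := 2) ?_⟩
  · rw [sq]; gcongr <;> omega
  · rw [pow_one]; omega
  · rw [pow_one]; omega
  · rw [sq]; gcongr <;> omega

namespace Alg

/-- The present vertices and the edges for the representatives in the array `12`. -/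
def setup : Prog :=
  .for_ 9 (.v 0) (.put 5 (.v 9) (.eq (.ld 12 (.v 9)) (.v 9))) ;;
  .for_ 32 (.v 5 * .v 5) (.put 6 (.v 32) (.c 0)) ;;
  .for_ 9 (.v 0 * .v 0) (.cond (.ld 0 (.v 9))
    (.put 6 (.ld 12 (.v 9 / .v 0) * .v 5 + .ld 12 (.v 9 % .v 0)) (.c 1)) .skip)

theorem setup_spec {k n w : ℕ} {σ : HS} (hS : Sz k n w) (hC : Ctx k n σ) {H : SimpleGraph (Fin k)}
    {ρ : Fin k → Fin k} (hH : Adj σ 0 H) (hρ : ∀ u : Fin k, σ.m 12 u = ρ u) :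
    Hwp w setup (fun σ' t => t ≤ (k + 2) * (k + 2) * 100 + 50 ∧
      (∀ u : Fin (k + 2), (u : ℕ) < k → (σ'.m 5 u ≠ 0 ↔ u ∈ quotS ρ)) ∧
      (∀ i < (k + 2) * (k + 2), σ'.m 6 i ≤ 1) ∧
      ∀ a b : Fin (k + 2), flag σ' a b ↔ quotF H ρ a b) σ := by
  obtain ⟨hkk, hk, hn, hkk2⟩ := hS.sq_lt
  refine Hwp.seq (Hwp.fill k id (fun u => if σ.m 12 u = u then 1 else 0) hS.one_lt (by norm_num)
    (by norm_num) (fun j' _ j hj => hj.ne) (fun σ' hF => by simp [(hC.of_fr hF).h0])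
    (fun j hj σ' hF hv hm => ?_) fun σ₁ t₁ hF1 h1 _ ht1 => ?_)
  · have h12 : σ'.m 12 = σ.m 12 := hF.m 12 (by norm_num) (by decide)
    simp [hv, h12, hS.w_ne]
  have hC1 := hC.of_fr hF1
  refine Hwp.seq (Hwp.fill ((k + 2) * (k + 2)) id (fun _ => 0) hS.one_lt (by norm_num)
    (by norm_num) (fun j' _ j hj => hj.ne) (fun σ' hF => by simp [(hC1.of_fr hF).h5, hkk2])
    (fun j hj σ' hF hv hm => by simp [hv]) fun σ₂ t₂ hF2 h2 _ ht2 => ?_)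
  have hC2 := hC1.of_fr hF2
  have hF12 := (hF1.mono (L' := [9, 32]) (A' := [5, 6]) (by decide) (by decide)).trans
    (hF2.mono (by decide) (by decide))
  have hH2 := hH.of_fr hF12 (by norm_num)
  simp only [Ex.cost_v, Ex.cost_c, Ex.cost_eq, Ex.cost_ld, Ex.cost_mul] at ht1 ht2
  refine Hwp.for_ [] [6] (k * k) 20 (fun j σ' => (∀ i < (k + 2) * (k + 2), σ'.m 6 i ≤ 1) ∧
    ∀ a b : Fin (k + 2), flag σ' a b ↔ ∃ u v : Fin k, (u : ℕ) * k + v < j ∧ H.Adj u v ∧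
      emb (ρ u) = a ∧ emb (ρ v) = b) hS.one_lt (by decide) (by norm_num) (by decide)
    (fun σ' hF => by simp [(hC2.of_fr hF).h0, hkk]) ?_ ?_ ?_
  · refine ⟨fun i hi => ?_, fun a b => ?_⟩
    · have := h2 i hi
      simp only [id] at this
      simp [this]
    · have := h2 _ (mul_add_lt_mul a.2 b.2)
      simp only [id] at this
      simp [flag, this]
  · rintro j hj σ' hF hv ⟨i1, i2⟩
    have hC' := hC2.of_fr hF
    have hH' := hH2.of_fr hF (by norm_num)
    have h12 : ∀ u : Fin k, σ'.m 12 u = ρ u := fun u =>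
      (congrFun ((hF.m 12 (by norm_num) (by decide)).trans (hF12.m 12 (by norm_num) (by decide))) u)
        |>.trans (hρ u)
    obtain ⟨u, v, rfl, hu, hv'⟩ := exists_fin_mul_add hj
    have hstep : ∀ a b : Fin (k + 2), (∃ u' v' : Fin k, (u' : ℕ) * k + v' < u * k + v + 1 ∧
        H.Adj u' v' ∧ emb (ρ u') = a ∧ emb (ρ v') = b) ↔ (∃ u' v' : Fin k, (u' : ℕ) * k + v' <
        u * k + v ∧ H.Adj u' v' ∧ emb (ρ u') = a ∧ emb (ρ v') = b) ∨
        (H.Adj u v ∧ emb (ρ u) = a ∧ emb (ρ v) = b) := by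
      intro a b
      constructor
      · rintro ⟨u', v', h1, h2⟩
        rcases Nat.lt_succ_iff_lt_or_eq.1 h1 with h3 | h3
        · exact Or.inl ⟨u', v', h3, h2⟩
        · obtain ⟨rfl, rfl⟩ := fin_mul_add_inj h3
          exact Or.inr h2
      · rintro (⟨u', v', h1, h2⟩ | h2)
        · exact ⟨u', v', by omega, h2⟩
        · exact ⟨u, v, by omega, h2⟩
    have hadj := (hH' u v).1
    refine Hwp.cond (by simp) (fun h0 => ?_) (fun h0 => ?_)
    · have hA : H.Adj u v := hadj.1 (by simpa [hv] using h0)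
      have i3 := hS.mm_lt (u := ρ u) (v := ρ v) (by omega) (by omega)
      refine Hwp.put (by norm_num) ?_ (by simp [hS.w_ne]) ⟨by simp, fun i hi => ?_, fun a b => ?_⟩
      · simp [hC'.h0, hC'.h5, hv, hu, hv', h12, i3]
      · rw [HS.setV_m, HS.setM_m_self]
        split_ifs
        · simp
        · exact i1 i hi
      · rw [hstep, ← i2]
        simp only [flag, HS.setV_m, HS.setM_m_self, Ex.ev_add, Ex.ev_mul, Ex.ev_ld, Ex.ev_div,
          Ex.ev_v, Ex.ev_mod, Ex.ev_c, hC'.h0, hC'.h5, hv, hu, hv', h12, mm_inj b.2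
          (show (ρ v : ℕ) < k + 2 by omega)]
        have e1 : emb (ρ u) = a ∧ emb (ρ v) = b ↔ (a : ℕ) = ρ u ∧ (b : ℕ) = ρ v := by
          simp [Fin.ext_iff, emb, eq_comm]
        rw [e1]
        split_ifs with h3
        · simp [h3, hA]
        · simp [h3]
    · have hA : ¬H.Adj u v := fun h1 => hadj.2 h1 (by simpa [hv] using h0)
      refine Hwp.skip ⟨by simp, i1, fun a b => ?_⟩
      rw [hstep, ← i2]
      simp [hA, flag]
  · rintro σ₃ t₃ hF3 ⟨i1, i2⟩ ht3
    simp only [Ex.cost_v, Ex.cost_mul] at ht3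
    refine ⟨?_, fun u hu => ?_, i1, fun a b => (i2 a b).trans ?_⟩
    · have : k * k ≤ (k + 2) * (k + 2) := Nat.mul_le_mul (by omega) (by omega)
      have : k ≤ (k + 2) * (k + 2) := by nlinarith
      omega
    · have e1 := h1 u hu
      rw [hF3.m 5 (by norm_num) (by decide), hF2.m 5 (by norm_num) (by decide)]
      simp only [id] at e1
      rw [e1]
      have e2 := mem_quotS (ρ := ρ) (u := ⟨u, hu⟩)
      have e3 : emb (⟨u, hu⟩ : Fin k) = u := rfl
      have e4 := hρ ⟨u, hu⟩
      rw [e3, Fin.ext_iff, ← e4] at e2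
      rw [e2]
      simp
    · exact ⟨fun ⟨u, v, _, h⟩ => ⟨u, v, h⟩, fun ⟨u, v, h⟩ => ⟨u, v, mul_add_lt_mul u.2 v.2, h⟩⟩

/-- The number of homomorphisms from the quotient for the representatives in the array `12`. -/
def quotCore (P : Prog) : Prog := setup ;; core P

theorem quotCore_wr (P : Prog) : (quotCore P).wr
    [9, 10, 11, 12, 13, 14, 15, 16, 20, 21, 22, 30, 31, 32, 35, 36]
    [3, 4, 5, 6, 8, 100, 101, 102] = true :=
  Prog.wr_seq (by decide) (Prog.wr_mono (by decide) (by decide) _ (core_wr P))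

open Classical in
theorem quotCore_spec {k n w c₀ : ℕ} {σ : HS} {P : Prog} {T : ℕ → ℕ} (hP : MatMul P c₀ T)
    (hw : (n + 2) ^ c₀ ≤ 2 ^ w) (hS : Sz k n w) (hC : Ctx k n σ) {H : SimpleGraph (Fin k)}
    {G : SimpleGraph (Fin n)} {ρ : Fin k → Fin k} (hH : Adj σ 0 H) (hG : Adj σ 1 G)
    (hρ : ∀ u : Fin k, σ.m 12 u = ρ u) (hρρ : ∀ u, ρ (ρ u) = ρ u)
    (hne : ∀ u v, H.Adj u v → ρ u ≠ ρ v) (htw : Tw2 (quotS ρ) (quotF H ρ)) :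
    Hwp w (quotCore P) (fun σ' t => t ≤ coreTime T k n + (k + 2) * (k + 2) * 100 + 50 ∧
      (∀ g < 2 * (k + 1), σ'.m 3 ((k * (k + 2) + (k + 1)) * (n * n * (2 * (k + 1))) + g) ≤ n) ∧
      dv k n (fun g => σ'.m 3 ((k * (k + 2) + (k + 1)) * (n * n * (2 * (k + 1))) + g)) =
        (((homs H G).filter fun ψ => ∀ v, ψ (ρ v) = ψ v).card : Res k n)) σ := by
  refine Hwp.seq (((setup_spec hS hC hH hρ).frame [9, 32] [5, 6] (by decide)).mono ?_)
  rintro σ₁ t₁ ⟨hF1, ht1, h1, h2, h3⟩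
  have hfl : (flag σ₁ : Fin (k + 2) → Fin (k + 2) → Prop) = quotF H ρ := by
    funext a b; exact propext (h3 a b)
  have hmem : ∀ u : Fin k, emb (ρ u) ∈ quotS ρ := fun u => mem_quotS.2 (hρρ u)
  have hG1 := hG.of_fr hF1 (by norm_num)
  refine (core_spec hP hw hS (hC.of_fr hF1) (S := quotS ρ) (G := G) (fun i j => ?_) h2 h1
    (fun a ha => ?_) (fun a b hab => ?_) (fun a b hab => ?_) (hfl ▸ htw)).mono ?_
  · have := hG1 i j
    split_ifs with h4
    · have := this.1.2 h4; omega
    · by_contra h5; exact h4 (this.1.1 h5)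
  · obtain ⟨u, -, rfl⟩ := Finset.mem_image.1 ha
    exact u.2
  · obtain ⟨u, v, h4, rfl, rfl⟩ := (h3 a b).1 hab
    exact ⟨hmem u, hmem v, fun h5 => hne u v h4 (emb_injective h5)⟩
  · obtain ⟨u, v, h4, rfl, rfl⟩ := (h3 a b).1 hab
    exact (h3 _ _).2 ⟨v, u, h4.symm, rfl, rfl⟩
  · rintro σ₂ t₂ ⟨ht2, h4, h5⟩
    refine ⟨by omega, h4, h5.trans ?_⟩
    rw [← card_quot H G ρ hρρ ⟨0, hS.pos⟩]
    congr! 8 with φ a ha b hb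
    exact iff_of_eq (congrFun (congrFun hfl _) _)

/-- The last result is added to the number in the array `7`, or subtracted if the value of register
`23` is one. -/
def accum : Prog :=
  .set 17 (.v 23) ;; addc 7 2 3 (.ld 7 (.v 32) + (.v 23 * (.v 1 -
    .ld 3 ((.v 0 * .v 5 + .v 7) * (.v 4 * .v 3) + .v 32)) + (.c 1 - .v 23) *
    .ld 3 ((.v 0 * .v 5 + .v 7) * (.v 4 * .v 3) + .v 32)))

theorem dv_of_carry {k n c c' : ℕ} {x y : ℕ → ℕ} (h : c * (n + 1) ^ (2 * (k + 1)) +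
    nv (n + 1) (2 * (k + 1)) y = nv (n + 1) (2 * (k + 1)) x + c') : dv k n y = dv k n x + c' := by
  have h1 := congrArg (fun a : ℕ => (a : Res k n)) h
  simp only [Nat.cast_add, Nat.cast_mul, Nat.cast_pow, Nat.cast_one, base_pow_eq_zero,
    mul_zero, zero_add] at h1
  rw [dv_eq_nv, dv_eq_nv, h1]

theorem dv_add (k n : ℕ) (x y : ℕ → ℕ) : dv k n (fun g => x g + y g) = dv k n x + dv k n y := by
  simp [dv, add_mul, Finset.sum_add_distrib]

theorem nv_const (n N : ℕ) : nv (n + 1) N (fun _ => n) + 1 = (n + 1) ^ N := by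
  induction N with
  | zero => simp [nv]
  | succ N ih => rw [nv_succ, pow_succ]; linarith

/-- The digitwise complement of a number `x` is `-x - 1` modulo the power of the base. So `accum`
subtracts by adding the complement with an initial carry of one. -/
theorem dv_compl {k n : ℕ} {x : ℕ → ℕ} (h : ∀ g < 2 * (k + 1), x g ≤ n) :
    dv k n (fun g => n - x g) + 1 = - dv k n x := by
  have h1 : dv k n (fun g => n - x g) + dv k n x = dv k n fun _ => n := by
    rw [← dv_add]
    exact dv_congr fun g hg => Nat.sub_add_cancel (h g hg)
  have h2 : dv k n (fun _ => n) = -1 := by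
    have e2 := congrArg (fun a : ℕ => (a : Res k n)) (nv_const n (2 * (k + 1)))
    simp only [Nat.cast_add, Nat.cast_pow, Nat.cast_one, base_pow_eq_zero] at e2
    rw [dv_eq_nv]
    linear_combination e2
  linear_combination h1 + h2

theorem accum_spec {k n w : ℕ} {σ : HS} (hS : Sz k n w) (hC : Ctx k n σ) (h23 : σ.v 23 ≤ 1)
    (h7 : ∀ d < 2 * (k + 1), σ.m 7 d ≤ n)
    (h3 : ∀ g < 2 * (k + 1), σ.m 3 ((k * (k + 2) + (k + 1)) * (n * n * (2 * (k + 1))) + g) ≤ n) :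
    Hwp w accum (fun σ' t => t ≤ (k + 1) * 200 + 20 ∧ (∀ d < 2 * (k + 1), σ'.m 7 d ≤ n) ∧
      dv k n (σ'.m 7) = dv k n (σ.m 7) + (-1) ^ (σ.v 23) *
        dv k n fun g => σ.m 3 ((k * (k + 2) + (k + 1)) * (n * n * (2 * (k + 1))) + g)) σ := by
  refine Hwp.seq (Hwp.set (by norm_num) (by simp) ?_)
  set σ₁ := σ.setV 17 ((Ex.v 23).ev w σ)
  have hF1 : Fr [17] [] σ σ₁ := (Fr.refl _ _ _).setV (by simp)
  have hC1 := hC.of_fr hF1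
  have h231 : σ₁.v 23 = σ.v 23 := hF1.v 23 (by norm_num) (by decide)
  have h17 : σ₁.v 17 = σ.v 23 := by simp [σ₁]
  obtain ⟨hkk, hk, hn, hkk2⟩ := hS.sq_lt
  have hn2 : 2 * (n + 1) ≤ 2 ^ w := (hS.lt_of_le_pow (i := 2) (by nlinarith)).le
  set r : ℕ → ℕ := fun g => σ.m 3 ((k * (k + 2) + (k + 1)) * (n * n * (2 * (k + 1))) + g) with hr
  refine (addc_spec (b := n + 1) (N := 2 * (k + 1))
    (fun d => σ.m 7 d + (σ.v 23 * (n - r d) + (1 - σ.v 23) * r d)) hS.one_lt (by omega) hn2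
    (by norm_num) (by norm_num) (by norm_num) (by decide) (by decide) hC1.h2 hC1.h3
    (h17.trans_le h23) (fun d hd => ?_) (fun d hd σ' hF hv hm => ?_)).mono ?_
  · have := h7 d hd
    have := h3 d hd
    have h4 : r d ≤ n := this
    interval_cases σ.v 23 <;> simp <;> omega
  · have hC' := hC1.of_fr hF
    have h31 : σ'.m 3 = σ.m 3 := hF.m 3 (by norm_num) (by decide)
    have h71 : σ'.m 7 d = σ.m 7 d := hm d le_rfl
    have h23' : σ'.v 23 = σ.v 23 := (hF.v 23 (by norm_num) (by decide)).trans h231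
    have hm1 : k * (k + 2) + (k + 1) < (k + 2) * (k + 2) := mul_add_lt_mul (by omega) (by omega)
    have hn1 := hS.pos
    have i1 := hS.mat_lt hm1 (i := d) (lt_of_lt_of_le hd (Nat.le_mul_of_pos_left _ (by positivity)))
    have i2 := hS.mat_lt hm1 (i := 0) (by positivity)
    rw [add_zero] at i2
    have i3 : n * n * (2 * (k + 1)) < 2 ^ w :=
      (Nat.le_mul_of_pos_left _ (by omega)).trans_lt i2
    have i4 : k * (k + 2) < 2 ^ w := by omega
    have i5 : k * (k + 2) + (k + 1) < 2 ^ w := by omega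
    have h4 : r d ≤ n := h3 d hd
    have h5 := h7 d hd
    have i6 : r d < 2 ^ w := by omega
    have i7 : σ.m 7 d + (n - r d) < 2 ^ w := by omega
    have i8 : σ.m 7 d + r d < 2 ^ w := by omega
    have i9 : n - r d < 2 ^ w := by omega
    simp only [Ex.ok_mul, Ex.ok_v, Ex.ev_mul, Ex.ev_v, hC'.h0, hC'.h1, hC'.h7, hC'.h5, hC'.h4,
      hC'.h3, Ex.ok_c, Ex.ok_sub, Ex.ok_add, Ex.ok_ld, Ex.ev_sub, Ex.ev_add, Ex.ev_c,
      Ex.ev_ld, hv, h31, h71, h23']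
    have hr' : σ.m 3 ((k * (k + 2) + (k + 1)) * (n * n * (2 * (k + 1))) + d) = r d := rfl
    rw [hr']
    have hw1 := hS.one_lt
    interval_cases σ.v 23 <;> simp [i1, i2, i3, i4, i5, i6, i7, i8, i9, h4, hS.w_ne]
  · rintro σ₂ t₂ ⟨ht2, hc2, hd2, he2⟩
    simp only [Ex.cost_v, Ex.cost_c, Ex.cost_mul, Ex.cost_ld, Ex.cost_add, Ex.cost_sub] at ht2 ⊢
    refine ⟨by omega, fun d hd => Nat.lt_succ_iff.1 (hd2 d hd), ?_⟩
    rw [dv_of_carry he2, dv_add, h17]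
    have h4 : ∀ g < 2 * (k + 1), r g ≤ n := h3
    interval_cases σ.v 23
    · simp
    · have := dv_compl h4
      simp only [one_mul, Nat.sub_self, zero_mul, add_zero, Nat.cast_one, pow_one]
      linear_combination this

/-- The parameters. -/
def prelude : Prog :=
  .set 2 (.v 1 + .c 1) ;; .set 3 (.c 2 * (.v 0 + .c 1)) ;; .set 4 (.v 1 * .v 1) ;;
  .set 5 (.v 0 + .c 2) ;; .set 7 (.v 0 + .c 1)

theorem prelude_spec {k n w : ℕ} {σ : HS} (hS : Sz k n w) (h0 : σ.v 0 = k) (h1 : σ.v 1 = n) :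
    Hwp w prelude (fun σ' t => t ≤ 40 ∧ Ctx k n σ') σ := by
  have i1 : n + 1 < 2 ^ w := hS.lt_of_le_pow (i := 1) (by rw [pow_one]; omega)
  have i2 : k + 1 < 2 ^ w := hS.lt_of_le_pow (i := 1) (by rw [pow_one]; omega)
  have i3 : k + 2 < 2 ^ w := hS.lt_of_le_pow (i := 1) (by rw [pow_one]; omega)
  have i4 : 2 * (k + 1) < 2 ^ w := hS.lt_of_le_pow (i := 2) (by nlinarith)
  have i5 : n * n < 2 ^ w := hS.lt_of_le_pow (i := 2) (by nlinarith)
  have i6 : 2 < 2 ^ w := by omega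
  refine Hwp.seq (Hwp.set (by norm_num) (by simp [h1, i1, hS.w_ne]) ?_)
  refine Hwp.seq (Hwp.set (by norm_num) (by simp [h0, i2, i4, i6, hS.w_ne]) ?_)
  refine Hwp.seq (Hwp.set (by norm_num) (by simp [h1, i5]) ?_)
  refine Hwp.seq (Hwp.set (by norm_num) (by simp [h0, i3, i6]) ?_)
  refine Hwp.set (by norm_num) (by simp [h0, i2, hS.w_ne]) ⟨by simp, ?_, ?_, ?_, ?_, ?_, ?_, ?_⟩ <;>
    simp [h0, h1]

end Alg

end WordRAM

/-! ### The algorithm for homomorphisms. -/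

namespace WordRAM

open Elim

open Classical in
theorem CountsInTime.of_hwp {P : Prog} {promise : (k : ℕ) → SimpleGraph (Fin k) → Prop}
    {count : (k n : ℕ) → SimpleGraph (Fin k) → SimpleGraph (Fin n) → ℕ} {time : ℕ → ℕ → ℝ} (c : ℕ)
    (h : ∀ (k n w : ℕ) (H : SimpleGraph (Fin k)) (G : SimpleGraph (Fin n)), promise k H →
      (k + n + 2) ^ c ≤ 2 ^ w → ∀ σ : HS, σ.v 0 = k → σ.v 1 = n → Adj σ 0 H → Adj σ 1 G →
      Hwp w P (fun σ' t => (t : ℝ) ≤ time k n ∧ nv (2 ^ w) (σ'.v 0) (σ'.m 2) = count k n H G) σ) :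
    CountsInTime P promise count time := by
  refine ⟨c, fun k n w H G hp hw s hs h0 h1 hH hG => ?_⟩
  have hadj : ∀ {m : ℕ} (F : SimpleGraph (Fin m)) (a : ℕ), s.HoldsMatrix a (F.adjMatrix ℕ) →
      Adj ⟨s.reg, s.mem⟩ a F := by
    intro m F a hF u v
    have := hF u v
    rw [SimpleGraph.adjMatrix_apply] at this
    simp only [this]
    split_ifs with h2 <;> simp [h2]
  obtain ⟨s', σ', t, hr, hR, ht, hv⟩ := h k n w H G hp hw ⟨s.reg, s.mem⟩ h0 h1 (hadj H 0 hH)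
    (hadj G 1 hG) s ⟨hs, fun _ _ => rfl, fun _ _ => rfl⟩
  refine ⟨s', t, hr, ht, ?_⟩
  rw [← hv, State.output, hR.2.1 0 (by norm_num), hR.2.2 2 (by norm_num)]
  rfl

theorem nv_eq_of_dv {k n N : ℕ} {x : ℕ → ℕ} (hx : ∀ d < 2 * (k + 1), x d ≤ n)
    (h : dv k n x = (N : Res k n)) (hN : N < (n + 1) ^ (2 * (k + 1))) :
    nv (n + 1) (2 * (k + 1)) x = N := by
  rw [dv_eq_nv, ZMod.natCast_eq_natCast_iff'] at h
  rwa [Nat.mod_eq_of_lt hN, Nat.mod_eq_of_lt (nv_lt fun g hg => Nat.lt_succ_iff.2 (hx g hg))] at h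

theorem card_homs_le {k n : ℕ} (H : SimpleGraph (Fin k)) (G : SimpleGraph (Fin n)) :
    (homs H G).card ≤ n ^ k := by
  refine (Finset.card_le_univ _).trans (le_of_eq ?_)
  simp

namespace Alg

/-- The algorithm for homomorphisms. -/
def homProg (P : Prog) : Prog :=
  .cond (.v 1) (prelude ;; .for_ 9 (.v 0) (.put 12 (.v 9) (.v 9)) ;; quotCore P ;; zero 7 ;;
      .set 23 (.c 0) ;; accum ;; toWords 7)
    (.put 2 (.c 0) (.c 1) ;; .set 0 (.eq (.v 0) (.c 0)))

/-- The output for a graph `G` without vertices. -/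
theorem trivial_spec {k w : ℕ} {σ : HS} (hw : w ≠ 0) (h0 : σ.v 0 = k) :
    Hwp w (.put 2 (.c 0) (.c 1) ;; .set 0 (.eq (.v 0) (.c 0))) (fun σ' t => t ≤ 20 ∧
      nv (2 ^ w) (σ'.v 0) (σ'.m 2) = if k = 0 then 1 else 0) σ := by
  -- The first output word is always `1`; the answer is encoded in the number of output words, one
  -- for `k = 0` and none otherwise.
  refine Hwp.seq (Hwp.put (by norm_num) (by simp) (by simp [hw]) ?_)
  refine Hwp.set (by norm_num) (by simp [hw]) ⟨by simp, ?_⟩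
  by_cases hk : k = 0 <;> simp [h0, hk, nv, HS.setM_m_self]

theorem homProg_spec {k n w c₀ : ℕ} {σ : HS} {P : Prog} {T : ℕ → ℕ} (hP : MatMul P c₀ T)
    (hw : (n + 2) ^ c₀ ≤ 2 ^ w) (hw10 : (k + n + 2) ^ 10 ≤ 2 ^ w) {H : SimpleGraph (Fin k)}
    {G : SimpleGraph (Fin n)} (h0 : σ.v 0 = k) (h1 : σ.v 1 = n) (hH : Adj σ 0 H)
    (hG : Adj σ 1 G) (htw : treewidth H ≤ 2) :
    Hwp w (homProg P) (fun σ' t => t ≤ coreTime T k n + (k + 2) * (k + 2) * 2000 ∧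
      nv (2 ^ w) (σ'.v 0) (σ'.m 2) = homCount H G) σ := by
  have hkk : 4 ≤ (k + 2) * (k + 2) := by nlinarith
  refine Hwp.cond (by simp) (fun hn => ?_) (fun hn => ?_)
  · have hn1 : 1 ≤ n := by
      rw [Ex.ev_v, h1] at hn; omega
    have hS : Sz k n w := ⟨hn1, hw10⟩
    refine Hwp.seq (((prelude_spec hS h0 h1).frame [2, 3, 4, 5, 7] [] (by decide)).mono ?_)
    rintro σ₁ t₁ ⟨hF1, ht1, hC1⟩
    refine Hwp.seq (Hwp.fill k id id hS.one_lt (by norm_num)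
      (by norm_num) (fun j' _ j hj => hj.ne) (fun σ' hF => by simp [(hC1.of_fr hF).h0])
      (fun j hj σ' hF hv hm => by simp [hv]) fun σ₂ t₂ hF2 h12 _ ht2 => ?_)
    have hC2 := hC1.of_fr hF2
    have hH2 := (hH.of_fr hF1 (by norm_num)).of_fr hF2 (by norm_num)
    have hG2 := (hG.of_fr hF1 (by norm_num)).of_fr hF2 (by norm_num)
    refine Hwp.seq (((quotCore_spec hP hw hS hC2 hH2 hG2 (ρ := id) (fun u => h12 u u.2)
      (fun u => rfl) (fun u v h => h.ne) (tw2_id H htw)).frame _ _ (quotCore_wr P)).mono ?_)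
    rintro σ₃ t₃ ⟨hF3, ht3, hd3, hv3⟩
    have hC3 := hC2.of_fr hF3
    refine Hwp.seq (((zero_spec hS hC3 (a := 7) (by norm_num)).frame [32] [7] (by decide)).mono ?_)
    rintro σ₄ t₄ ⟨hF4, ht4, hz4⟩
    have hC4 := hC3.of_fr hF4
    have h34 : σ₄.m 3 = σ₃.m 3 := hF4.m 3 (by norm_num) (by decide)
    refine Hwp.seq (Hwp.set (by norm_num) (by simp) ?_)
    set σ₅ := σ₄.setV 23 ((Ex.c 0).ev w σ₄)
    have hF5 : Fr [23] [] σ₄ σ₅ := (Fr.refl _ _ _).setV (by simp)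
    have hC5 := hC4.of_fr hF5
    have h35 : σ₅.m 3 = σ₃.m 3 := h34
    have h235 : σ₅.v 23 = 0 := by simp [σ₅]
    have hz5 : ∀ d < 2 * (k + 1), σ₅.m 7 d = 0 := hz4
    refine Hwp.seq (((accum_spec hS hC5 (by omega) (fun d hd => by rw [hz5 d hd]; omega)
      (by rw [h35]; exact hd3)).frame [17, 18, 32] [7] (by decide)).mono ?_)
    rintro σ₆ t₆ ⟨hF6, ht6, hd6, hv6⟩
    refine (toWords_spec hS (hC5.of_fr hF6) (a := 7) (by norm_num) (by norm_num) hd6).mono ?_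
    rintro σ₇ t₇ ⟨ht7, h07, hv7⟩
    simp only [Ex.cost_v, Ex.cost_c] at ht2 ⊢
    refine ⟨by nlinarith, ?_⟩
    rw [h07, hv7, homCount_eq]
    -- The count is at most `n ^ k`, below the modulus, so the residue class determines it.
    have hlt : (homs H G).card < (n + 1) ^ (2 * (k + 1)) :=
      (card_homs_le H G).trans_lt ((Nat.pow_le_pow_left (Nat.le_succ n) k).trans_lt
        (Nat.pow_lt_pow_right (by omega) (by omega)))
    refine nv_eq_of_dv hd6 ?_ hlt
    rw [hv6, h235, h35, hv3, dv_eq_nv, nv_zero hz5]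
    simp
  · obtain rfl : n = 0 := by simpa [h1] using hn
    have hw0 : w ≠ 0 := by
      rintro rfl
      have : 1 < (k + 0 + 2) ^ 10 := Nat.one_lt_pow (by norm_num) (by omega)
      simp at hw10
    refine (trivial_spec hw0 h0).mono ?_
    rintro σ₁ t₁ ⟨ht1, hv1⟩
    refine ⟨by simp only [Ex.cost_v]; omega, ?_⟩
    rw [hv1, homCount_eq]
    split_ifs with hk
    · subst hk
      simp [homs]
    · have := card_homs_le H G
      rw [zero_pow hk] at this
      omega

end Alg

end WordRAM

/-! ### Long division. -/

namespace WordRAM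

/-- No digit is lost, because the `p` most significant digits of `y` are zero. -/
theorem nv_shift {b N p : ℕ} {y : ℕ → ℕ} (hp : p ≤ N) (hy : ∀ g, N - p ≤ g → g < N → y g = 0) :
    nv b N (fun d => if d < p then 0 else y (d - p)) = b ^ p * nv b N y := by
  obtain ⟨M, rfl⟩ := Nat.exists_eq_add_of_le hp
  have h1 : nv b (p + M) y = nv b M y := by
    rw [nv, add_comm, Finset.sum_range_add, Finset.sum_eq_zero (s := Finset.range p), add_zero]
    · rfl
    · intro g hg
      have := Finset.mem_range.1 hg
      rw [hy (M + g) (by omega) (by omega), zero_mul]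
  rw [h1, nv, Finset.sum_range_add, Finset.sum_eq_zero (s := Finset.range p), zero_add, nv,
    Finset.mul_sum]
  · refine Finset.sum_congr rfl fun g _ => ?_
    rw [if_neg (by omega), Nat.add_sub_cancel_left]
    ring
  · intro g hg
    rw [if_pos (Finset.mem_range.1 hg), zero_mul]

theorem digit_eq_zero {b N m : ℕ} {y : ℕ → ℕ} (hb : 0 < b) (h : nv b N y < b ^ m) {g : ℕ}
    (hm : m ≤ g) (hg : g < N) : y g = 0 := by
  by_contra h0
  have h1 : y g * b ^ g ≤ nv b N y :=
    Finset.single_le_sum (f := fun g => y g * b ^ g) (fun _ _ => Nat.zero_le _)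
      (Finset.mem_range.2 hg)
  have h2 : b ^ m ≤ b ^ g := Nat.pow_le_pow_right hb hm
  have h3 := Nat.le_mul_of_pos_left (b ^ g) (Nat.pos_of_ne_zero h0)
  omega

theorem nv_add (b N : ℕ) (x y : ℕ → ℕ) : nv b N (fun g => x g + y g) = nv b N x + nv b N y := by
  simp [nv, add_mul, Finset.sum_add_distrib]

theorem nv_update {b N p : ℕ} {x y : ℕ → ℕ} (hp : p < N) (h1 : x p = y p + 1)
    (h2 : ∀ g, g ≠ p → x g = y g) : nv b N x = nv b N y + b ^ p := by
  have h3 : ∀ g, x g = y g + if g = p then 1 else 0 := by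
    intro g
    split_ifs with h
    · rw [h, h1]
    · rw [h2 g h, add_zero]
  rw [nv_congr fun g _ => h3 g, nv_add]
  congr 1
  simp [nv, hp]

namespace Alg

/-- The difference of the numbers in the arrays `7` and `9`, where the latter is shifted by the value
of register `31`. -/
def subShift : Prog :=
  .set 17 (.c 1) ;;
  addc 13 2 3 (.ld 7 (.v 32) + (.v 1 - (.c 1 - .lt (.v 32) (.v 31)) *
    .ld 9 (.v 32 + .lt (.v 32) (.v 31) * .v 31 - .v 31)))

/-- A step of the division: if possible, the shifted divisor is subtracted. -/
def tryDigit : Prog :=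
  subShift ;;
  .cond (.v 17) (.for_ 32 (.v 3) (.put 7 (.v 32) (.ld 13 (.v 32))) ;;
    .put 10 (.v 31) (.ld 10 (.v 31) + .c 1)) .skip

/-- Division of the number in the array `7` by the number in the array `9`. The array `10` is for the
quotient. -/
def divide : Prog :=
  zero 10 ;; .for_ 30 (.v 7) (.set 31 (.v 0 - .v 30) ;; .for_ 28 (.v 1) tryDigit)

theorem subShift_wr : subShift.wr [17, 18, 32] [13] = true :=
  Prog.wr_seq (by decide) (addc_wr _)

theorem tryDigit_wr : tryDigit.wr [17, 18, 32] [7, 10, 13] = true :=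
  Prog.wr_seq (Prog.wr_mono (by decide) (by decide) _ subShift_wr) (by decide)

/-- The shifted divisor is subtracted by adding its complement and one; the final carry is one
exactly if the difference is not negative. The divisor has at most `k + 1` nonzero digits and is
shifted by at most `k`, so it fits into the `2 * (k + 1)` digits. -/
theorem subShift_spec {k n w p : ℕ} {σ : HS} (hS : Sz k n w) (hC : Ctx k n σ) (hp : p ≤ k)
    (h31 : σ.v 31 = p) (h7 : ∀ d < 2 * (k + 1), σ.m 7 d ≤ n) (h9 : ∀ d < 2 * (k + 1), σ.m 9 d ≤ n)
    (hA : nv (n + 1) (2 * (k + 1)) (σ.m 9) < (n + 1) ^ (k + 1)) :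
    Hwp w subShift (fun σ' t => t ≤ (k + 1) * 120 + 20 ∧ (∀ d < 2 * (k + 1), σ'.m 13 d ≤ n) ∧
      (σ'.v 17 ≠ 0 → nv (n + 1) (2 * (k + 1)) (σ.m 7) = nv (n + 1) (2 * (k + 1)) (σ'.m 13) +
        (n + 1) ^ p * nv (n + 1) (2 * (k + 1)) (σ.m 9)) ∧
      (σ'.v 17 = 0 → nv (n + 1) (2 * (k + 1)) (σ.m 7) <
        (n + 1) ^ p * nv (n + 1) (2 * (k + 1)) (σ.m 9))) σ := by
  refine Hwp.seq (Hwp.set (by norm_num) (by simp [hS.w_ne]) ?_)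
  set σ₁ := σ.setV 17 ((Ex.c 1).ev w σ)
  have hF1 : Fr [17] [] σ σ₁ := (Fr.refl _ _ _).setV (by simp)
  have hC1 := hC.of_fr hF1
  have h311 : σ₁.v 31 = p := by simpa [σ₁] using h31
  have h17 : σ₁.v 17 = 1 := by simp [σ₁]
  have hk3 : 2 * (k + 1) + k < 2 ^ w := hS.lt_of_le_pow (i := 2) (by
    have := Nat.mul_le_mul (show k + 2 ≤ k + n + 2 by omega)
      (show 3 ≤ k + n + 2 by have := hS.pos; omega)
    nlinarith)
  have hn2 : 2 * (n + 1) ≤ 2 ^ w := (hS.lt_of_le_pow (i := 2) (by nlinarith)).le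
  set s : ℕ → ℕ := fun d => if d < p then 0 else σ.m 9 (d - p) with hs
  have hsn : ∀ d < 2 * (k + 1), s d ≤ n := by
    intro d hd
    simp only [hs]
    split_ifs
    · omega
    · exact h9 _ (by omega)
  refine (addc_spec (b := n + 1) (N := 2 * (k + 1)) (fun d => σ.m 7 d + (n - s d)) hS.one_lt
    (by omega) hn2 (by norm_num) (by norm_num) (by norm_num) (by decide) (by decide) hC1.h2 hC1.h3
    h17.le (fun d hd => ?_) (fun d hd σ' hF hv hm => ?_)).mono ?_
  · have := h7 d hd
    omega
  · have hC' := hC1.of_fr hF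
    have h71 : σ'.m 7 = σ.m 7 := hF.m 7 (by norm_num) (by decide)
    have h91 : σ'.m 9 = σ.m 9 := hF.m 9 (by norm_num) (by decide)
    have h31' : σ'.v 31 = p := (hF.v 31 (by norm_num) (by decide)).trans h311
    have i1 := h7 d hd
    have i2 := hsn d hd
    have i3 : σ.m 7 d + (n - s d) < 2 ^ w := by omega
    have hw1 := hS.one_lt
    -- For `d < p` the index `d + p - p` avoids a negative difference; the digit read there is
    -- multiplied by zero.
    by_cases hdp : d < p
    · have e1 : s d = 0 := if_pos hdp
      rw [e1] at i3
      have i4 : d + p < 2 ^ w := by omega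
      have i5 : p < 2 ^ w := by omega
      have i6 : σ.m 7 d + n < 2 ^ w := by omega
      simp [hv, h71, h91, h31', hC'.h1, hdp, hS.w_ne, e1, i4, i5, i6]
    · have e1 : s d = σ.m 9 (d - p) := if_neg hdp
      rw [e1] at i3 i2
      have i4 : d < 2 ^ w := by omega
      have i5 : σ.m 9 (d - p) < 2 ^ w := by omega
      simp [hv, h71, h91, h31', hC'.h1, hdp, hS.w_ne, e1, i3, i4, i5, i2]
      omega
  · rintro σ₂ t₂ ⟨ht2, hc2, hd2, he2⟩
    simp only [Ex.cost_v, Ex.cost_c, Ex.cost_mul, Ex.cost_ld, Ex.cost_add, Ex.cost_sub,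
      Ex.cost_lt] at ht2 ⊢
    rw [h17] at he2
    have e1 : nv (n + 1) (2 * (k + 1)) s = (n + 1) ^ p * nv (n + 1) (2 * (k + 1)) (σ.m 9) :=
      nv_shift (by omega) fun g h1 h2 => digit_eq_zero (by omega) hA (by omega) h2
    have e2 : nv (n + 1) (2 * (k + 1)) (fun d => σ.m 7 d + (n - s d)) +
        nv (n + 1) (2 * (k + 1)) s + 1 =
        nv (n + 1) (2 * (k + 1)) (σ.m 7) + (n + 1) ^ (2 * (k + 1)) := by
      rw [← nv_const n, ← nv_add, ← add_assoc, ← nv_add]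
      congr 1
      exact nv_congr fun g hg => by have := hsn g hg; omega
    have e3 : nv (n + 1) (2 * (k + 1)) (σ₂.m 13) < (n + 1) ^ (2 * (k + 1)) := nv_lt hd2
    refine ⟨by omega, fun d hd => Nat.lt_succ_iff.1 (hd2 d hd), fun h0 => ?_, fun h0 => ?_⟩
    · have : σ₂.v 17 = 1 := by omega
      rw [this, one_mul] at he2
      omega
    · rw [h0, zero_mul] at he2
      omega

theorem divide_wr : divide.wr [17, 18, 28, 30, 31, 32] [7, 10, 13] = true :=
  Prog.wr_seq (by decide) (Prog.wr_for (by decide) (Prog.wr_seq (by decide)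
    (Prog.wr_for (by decide) (Prog.wr_mono (by decide) (by decide) _ tryDigit_wr))))

/-- With `i` trials done at position `p`, the remainder is below `A * (n + 1) ^ p * (n + 1 - i)`. A
successful trial lowers it by `A * (n + 1) ^ p`; a failed one shows that it is already below this
number. So `n` trials find the digit. -/
theorem tryDigit_spec {k n w p i A R : ℕ} {σ : HS} (hS : Sz k n w) (hC : Ctx k n σ) (hp : p ≤ k)
    (h31 : σ.v 31 = p) (h7 : ∀ d < 2 * (k + 1), σ.m 7 d ≤ n) (h9 : ∀ d < 2 * (k + 1), σ.m 9 d ≤ n)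
    (hA : nv (n + 1) (2 * (k + 1)) (σ.m 9) = A) (hAb : A < (n + 1) ^ (k + 1)) (hi : i < n)
    (h10 : σ.m 10 p ≤ i)
    (heq : nv (n + 1) (2 * (k + 1)) (σ.m 7) + A * nv (n + 1) (2 * (k + 1)) (σ.m 10) = R)
    (hlt : nv (n + 1) (2 * (k + 1)) (σ.m 7) < A * (n + 1) ^ p * (n + 1 - i)) :
    Hwp w tryDigit (fun σ' t => t ≤ (k + 1) * 200 + 60 ∧ (∀ d < 2 * (k + 1), σ'.m 7 d ≤ n) ∧
      (∀ g, g ≠ p → σ'.m 10 g = σ.m 10 g) ∧ σ'.m 10 p ≤ i + 1 ∧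
      nv (n + 1) (2 * (k + 1)) (σ'.m 7) + A * nv (n + 1) (2 * (k + 1)) (σ'.m 10) = R ∧
      nv (n + 1) (2 * (k + 1)) (σ'.m 7) < A * (n + 1) ^ p * (n + 1 - (i + 1))) σ := by
  refine Hwp.seq (((subShift_spec hS hC hp h31 h7 h9 (hA ▸ hAb)).frame _ _ subShift_wr).mono ?_)
  rintro σ₁ t₁ ⟨hF1, ht1, hd1, hy, hn⟩
  have hC1 := hC.of_fr hF1
  have h71 : σ₁.m 7 = σ.m 7 := hF1.m 7 (by norm_num) (by decide)
  have h101 : σ₁.m 10 = σ.m 10 := hF1.m 10 (by norm_num) (by decide)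
  have h311 : σ₁.v 31 = p := (hF1.v 31 (by norm_num) (by decide)).trans h31
  have hnw : n < 2 ^ w := hS.sq_lt.2.2.1
  have hstep : n + 1 - i = n + 1 - (i + 1) + 1 := by omega
  rw [hstep, Nat.mul_succ (A * (n + 1) ^ p)] at hlt
  rw [hA, mul_comm (_ ^ _)] at hy hn
  refine Hwp.cond (by simp) (fun h0 => ?_) (fun h0 => ?_)
  · have hy := hy (by simpa using h0)
    refine Hwp.seq (Hwp.fill (2 * (k + 1)) id (σ₁.m 13) hS.one_lt (by norm_num)
      (by norm_num) (fun j' _ j hj => hj.ne) (fun σ' hF => by simp [(hC1.of_fr hF).h3])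
      (fun j hj σ' hF hv hm => ?_) fun σ₂ t₂ hF2 h2 _ ht2 => ?_)
    · have : σ'.m 13 = σ₁.m 13 := hF.m 13 (by norm_num) (by decide)
      simp [hv, this]
    have h102 : σ₂.m 10 = σ.m 10 := (hF2.m 10 (by norm_num) (by decide)).trans h101
    have h312 : σ₂.v 31 = p := (hF2.v 31 (by norm_num) (by decide)).trans h311
    have e7 : nv (n + 1) (2 * (k + 1)) (σ₂.m 7) = nv (n + 1) (2 * (k + 1)) (σ₁.m 13) :=
      nv_congr h2
    simp only [Ex.cost_v, Ex.cost_ld] at ht2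
    have i1 : σ.m 10 p + 1 < 2 ^ w := by omega
    have i2 := hS.one_lt
    refine Hwp.put (by norm_num) (by simp) (by simp [h102, h312, i1, hS.w_ne]) ?_
    simp only [Ex.ev_v, h312, Ex.ev_add, Ex.ev_ld, h102, Ex.ev_c, Ex.cost_v, Ex.cost_ld,
      Ex.cost_add, Ex.cost_c]
    have e10 := nv_update (b := n + 1) (N := 2 * (k + 1)) (p := p) (y := σ.m 10)
      (x := (σ₂.setM 10 p (σ.m 10 p + 1)).m 10) (by omega) (by simp [HS.setM_m_self])
      (fun g hg => by rw [HS.setM_m_self, if_neg hg, h102])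
    refine ⟨by omega, fun d hd => ?_, fun g hg => ?_, ?_, ?_, ?_⟩
    · rw [HS.setM_m_ne _ _ _ (by norm_num)]
      exact (h2 d hd).trans_le (hd1 d hd)
    · rw [HS.setM_m_self, if_neg hg, h102]
    · rw [HS.setM_m_self, if_pos rfl]; omega
    · rw [e10, HS.setM_m_ne _ _ _ (by norm_num), e7, mul_add, ← heq, hy]
      ring_nf
    · rw [HS.setM_m_ne _ _ _ (by norm_num), e7]
      rw [hy] at hlt
      exact Nat.lt_of_add_lt_add_right hlt
  · have hn := hn (by simpa using h0)
    refine Hwp.skip ⟨by simp only [Ex.cost_v]; omega, fun d hd => by rw [h71]; exact h7 d hd,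
      fun g _ => by rw [h101], by rw [h101]; omega, by rw [h71, h101]; exact heq, ?_⟩
    rw [h71]
    exact hn.trans_le (Nat.le_mul_of_pos_right _ (by omega))

/-- The positions `k, …, 0` are treated in turn; after position `p` the remainder is below `A * (n +
1) ^ p`, at the end below `A`. The trial subtractions take time linear in `n` for fixed `k`, which
is within the allowance of `n ^ 2`. -/
theorem divide_spec {k n w A R : ℕ} {σ : HS} (hS : Sz k n w) (hC : Ctx k n σ)
    (h7 : ∀ d < 2 * (k + 1), σ.m 7 d ≤ n) (h9 : ∀ d < 2 * (k + 1), σ.m 9 d ≤ n)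
    (hA : nv (n + 1) (2 * (k + 1)) (σ.m 9) = A) (hA0 : 0 < A) (hAb : A < (n + 1) ^ (k + 1))
    (hR : nv (n + 1) (2 * (k + 1)) (σ.m 7) = R) (hRb : R < (n + 1) ^ (k + 1)) :
    Hwp w divide (fun σ' t => t ≤ (k + 1) * (n * ((k + 1) * 200 + 80) + 100) + 50 ∧
      (∀ d < 2 * (k + 1), σ'.m 10 d ≤ n) ∧ nv (n + 1) (2 * (k + 1)) (σ'.m 10) = R / A) σ := by
  refine Hwp.seq (((zero_spec hS hC (a := 10) (by norm_num)).frame [32] [10] (by decide)).mono ?_)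
  rintro σ₁ t₁ ⟨hF1, ht1, hz1⟩
  have hC1 := hC.of_fr hF1
  have h71 : σ₁.m 7 = σ.m 7 := hF1.m 7 (by norm_num) (by decide)
  have h91 : σ₁.m 9 = σ.m 9 := hF1.m 9 (by norm_num) (by decide)
  refine Hwp.for_ [17, 18, 28, 31, 32] [7, 10, 13] (k + 1) (n * ((k + 1) * 200 + 70) + 20)
    (fun j σ' => (∀ d < 2 * (k + 1), σ'.m 7 d ≤ n) ∧ (∀ d < 2 * (k + 1), σ'.m 10 d ≤ n) ∧
      (∀ d < k + 1 - j, σ'.m 10 d = 0) ∧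
      nv (n + 1) (2 * (k + 1)) (σ'.m 7) + A * nv (n + 1) (2 * (k + 1)) (σ'.m 10) = R ∧
      nv (n + 1) (2 * (k + 1)) (σ'.m 7) < A * (n + 1) ^ (k + 1 - j)) hS.one_lt
    (Prog.wr_seq (by decide) (Prog.wr_for (by decide)
      (Prog.wr_mono (by decide) (by decide) _ tryDigit_wr))) (by norm_num) (by decide)
    (fun σ' hF => by simp [(hC1.of_fr hF).h7]) ?_ ?_ ?_
  · refine ⟨fun d hd => ?_, fun d hd => ?_, fun d hd => hz1 d (by omega), ?_, ?_⟩
    · rw [HS.setV_m, h71]; exact h7 d hd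
    · rw [HS.setV_m, hz1 d hd]; omega
    · rw [HS.setV_m, h71, nv_zero hz1, hR]; omega
    · rw [HS.setV_m, h71, hR]
      exact hRb.trans_le (Nat.le_mul_of_pos_left _ hA0)
  · rintro j hj σ₂ hF2 hv2 ⟨i1, i2, i3, i4, i5⟩
    have hC2 := hC1.of_fr hF2
    refine Hwp.seq (Hwp.set (by norm_num) (by simp [hC2.h0, hv2]; omega) ?_)
    set σ₃ := σ₂.setV 31 ((Ex.v 0 - .v 30).ev w σ₂)
    have hF3 : Fr [31] [] σ₂ σ₃ := (Fr.refl _ _ _).setV (by simp)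
    have hC3 := hC2.of_fr hF3
    have h31 : σ₃.v 31 = k - j := by simp [σ₃, hC2.h0, hv2]
    refine Hwp.for_ [17, 18, 32] [7, 10, 13] n ((k + 1) * 200 + 60)
      (fun i σ' => (∀ d < 2 * (k + 1), σ'.m 7 d ≤ n) ∧
        (∀ g, g ≠ k - j → σ'.m 10 g = σ₂.m 10 g) ∧ σ'.m 10 (k - j) ≤ i ∧
        nv (n + 1) (2 * (k + 1)) (σ'.m 7) + A * nv (n + 1) (2 * (k + 1)) (σ'.m 10) = R ∧
        nv (n + 1) (2 * (k + 1)) (σ'.m 7) < A * (n + 1) ^ (k - j) * (n + 1 - i)) hS.one_lt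
      tryDigit_wr (by norm_num) (by decide) (fun σ' hF => by simp [(hC3.of_fr hF).h1]) ?_ ?_ ?_
    · refine ⟨i1, fun _ _ => rfl, (i3 _ (by omega)).le, i4, ?_⟩
      have e1 : k + 1 - j = k - j + 1 := by omega
      rw [e1, pow_succ, ← mul_assoc] at i5
      exact i5
    · rintro i hi σ₄ hF4 hv4 ⟨l1, l2, l3, l4, l5⟩
      have h94 : σ₄.m 9 = σ.m 9 := (hF4.m 9 (by norm_num) (by decide)).trans
        ((hF2.m 9 (by norm_num) (by decide)).trans h91)
      refine (tryDigit_spec hS (hC3.of_fr hF4) (p := k - j) (by omega)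
        ((hF4.v 31 (by norm_num) (by decide)).trans h31) l1 (by rw [h94]; exact h9)
        (by rw [h94]; exact hA) hAb hi l3 l4 l5).mono ?_
      rintro σ₅ t₅ ⟨ht5, m1, m2, m3, m4, m5⟩
      exact ⟨ht5, m1, fun g hg => (m2 g hg).trans (l2 g hg), m3, m4, m5⟩
    · rintro σ₄ t₄ hF4 ⟨l1, l2, l3, l4, l5⟩ ht4
      simp only [Ex.cost_v, Ex.cost_sub] at ht4 ⊢
      refine ⟨?_, l1, fun d hd => ?_, fun d hd => ?_, l4, ?_⟩
      · have : n * ((k + 1) * 200 + 60 + 1 + 7) ≤ n * ((k + 1) * 200 + 70) :=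
          Nat.mul_le_mul_left _ (by omega)
        omega
      · by_cases h0 : d = k - j
        · rw [h0]; exact l3
        · rw [HS.setV_m, l2 d h0]; exact i2 d hd
      · rw [HS.setV_m, l2 d (by omega)]
        exact i3 d (by omega)
      · rw [show k + 1 - (j + 1) = k - j by omega]
        rwa [show n + 1 - n = 1 by omega, mul_one] at l5
  · rintro σ₂ t₂ hF2 ⟨i1, i2, i3, i4, i5⟩ ht2
    simp only [Ex.cost_v] at ht2
    refine ⟨?_, i2, ?_⟩
    · have : (k + 1) * (n * ((k + 1) * 200 + 70) + 20 + 1 + 7) + 2 * (k + 1) * 20 ≤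
          (k + 1) * (n * ((k + 1) * 200 + 80) + 100) := by
        have : n * ((k + 1) * 200 + 70) ≤ n * ((k + 1) * 200 + 80) :=
          Nat.mul_le_mul_left _ (by omega)
        nlinarith
      omega
    · rw [Nat.sub_self, pow_zero, mul_one] at i5
      rw [← i4, Nat.add_mul_div_left _ _ hA0, Nat.div_eq_of_lt i5, zero_add]

end Alg

end WordRAM

/-! ### One term of the formula for injective homomorphisms. -/

namespace WordRAM

open Elim

namespace Alg

/-- The representatives for the function in the array `11`, and the sign of the function. -/
def repLoop : Prog :=
  .set 23 (.c 0) ;; .for_ 9 (.v 0) (.put 12 (.v 9) (.v 9) ;; .put 12 (.v 9) (.ld 12 (.ld 11 (.v 9))) ;;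
    .cond (.lt (.ld 11 (.v 9)) (.v 9)) (.set 23 (.c 1 - .v 23)) .skip)

theorem repLoop_wr : repLoop.wr [9, 23] [12] = true := by decide

-- The vertices are treated in increasing order. First `v` is made its own representative, and then
-- it gets the representative of `f v`. This gives `v` itself if `f v = v`, and otherwise a value
-- already computed, as `f v < v`. Register `23` holds the parity of the number of vertices that are
-- moved.
open Classical in
theorem repLoop_spec {k n w : ℕ} {σ : HS} (hS : Sz k n w) (hC : Ctx k n σ) {f : Fin k → Fin k}
    (hf : ∀ u : Fin k, σ.m 11 u = f u) (hle : ∀ v, f v ≤ v) :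
    Hwp w repLoop (fun σ' t => t ≤ k * 50 + 20 ∧ σ'.v 23 ≤ 1 ∧
      σ'.v 23 = (Finset.univ.filter fun v => f v < v).card % 2 ∧
      ∃ ρ : Fin k → Fin k, (∀ u : Fin k, σ'.m 12 u = ρ u) ∧
        ∀ v, ρ v = if f v = v then v else ρ (f v)) σ := by
  refine Hwp.seq (Hwp.set (by norm_num) (by simp) ?_)
  set σ₁ := σ.setV 23 ((Ex.c 0).ev w σ)
  have hF1 : Fr [23] [] σ σ₁ := (Fr.refl _ _ _).setV (by simp)
  have hC1 := hC.of_fr hF1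
  refine Hwp.for_ [23] [12] k 30 (fun j σ' =>
    σ'.v 23 = (∑ i ∈ Finset.range j, if σ.m 11 i < i then 1 else 0) % 2 ∧
    ∀ u : Fin k, (u : ℕ) < j → σ'.m 12 u < k ∧ σ'.m 12 u = if f u = u then (u : ℕ) else σ'.m 12 (f u))
    hS.one_lt (by decide) (by norm_num) (by decide) (fun σ' hF => by simp [(hC1.of_fr hF).h0])
    (by simp [σ₁]) ?_ ?_
  · rintro j hj σ' hF hv ⟨h23, h12⟩
    have h11 : σ'.m 11 = σ.m 11 := hF.m 11 (by norm_num) (by decide)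
    have hjf : σ.m 11 j = f ⟨j, hj⟩ := hf ⟨j, hj⟩
    have hfle : (f ⟨j, hj⟩ : ℕ) ≤ j := hle ⟨j, hj⟩
    have key : ∀ g, ((σ'.setM 12 j j).setM 12 j ((σ'.setM 12 j j).m 12 (f ⟨j, hj⟩))).m 12 g =
        if g = j then (if f ⟨j, hj⟩ = ⟨j, hj⟩ then j else σ'.m 12 (f ⟨j, hj⟩)) else σ'.m 12 g := by
      intro g
      simp only [HS.setM_m_self, Fin.ext_iff]
      split_ifs <;> rfl
    have h12' : ∀ u : Fin k, (u : ℕ) < j + 1 →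
        ((σ'.setM 12 j j).setM 12 j ((σ'.setM 12 j j).m 12 (f ⟨j, hj⟩))).m 12 u < k ∧
        ((σ'.setM 12 j j).setM 12 j ((σ'.setM 12 j j).m 12 (f ⟨j, hj⟩))).m 12 u =
        if f u = u then (u : ℕ) else
        ((σ'.setM 12 j j).setM 12 j ((σ'.setM 12 j j).m 12 (f ⟨j, hj⟩))).m 12 (f u) := by
      intro u hu
      simp only [key]
      by_cases hu' : (u : ℕ) = j
      · obtain rfl : u = ⟨j, hj⟩ := Fin.ext hu'
        simp only [if_true]
        by_cases h1 : f ⟨j, hj⟩ = ⟨j, hj⟩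
        · simp [h1, hj]
        · have h2 : (f ⟨j, hj⟩ : ℕ) ≠ j := fun h => h1 (Fin.ext h)
          simp only [h1, h2, if_false, and_true]
          exact (h12 _ (lt_of_le_of_ne hfle h2)).1
      · have h3 : (f u : ℕ) ≠ j := by
          have : (f u : ℕ) ≤ u := hle u
          omega
        rw [if_neg hu', if_neg h3]
        exact h12 u (by omega)
    refine Hwp.seq (Hwp.put (by norm_num) (by simp) (by simp) ?_)
    refine Hwp.seq (Hwp.put (by norm_num) (by simp) (by simp) ?_)
    have e11 : ((σ'.setM 12 j j).m 11) = σ.m 11 := by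
      rw [← h11]; funext g; rw [HS.setM_m_ne _ _ _ (by norm_num)]
    simp only [Ex.ev_v, HS.setM_v, hv, Ex.ev_ld, e11, hjf]
    have e11' : ∀ x, ((σ'.setM 12 j j).setM 12 j x).m 11 = σ.m 11 := by
      intro x; rw [← e11]; funext g; rw [HS.setM_m_ne _ _ _ (by norm_num)]
    refine Hwp.cond (by simp [hS.w_ne]) (fun h0 => ?_) (fun h0 => ?_)
    · have h1 : (f ⟨j, hj⟩ : ℕ) < j := by
        by_contra h; simp [e11', hjf, hv, h] at h0
      refine Hwp.set (by norm_num) (by simp [hS.w_ne, h23]; omega) ⟨by simp, ?_, fun u hu => ?_⟩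
      · rw [Finset.sum_range_succ, hjf, if_pos h1]
        simp [h23]; omega
      · simpa only [HS.setV_m] using h12' u hu
    · have h1 : ¬ (f ⟨j, hj⟩ : ℕ) < j := by
        intro h; simp [e11', hjf, hv, h] at h0
      refine Hwp.skip ⟨by simp, ?_, fun u hu => ?_⟩
      · rw [Finset.sum_range_succ, hjf, if_neg h1]
        simp [h23]
      · simpa only [HS.setV_m] using h12' u hu
  · rintro σ₂ t₂ hF2 ⟨h23, h12⟩ ht2
    simp only [Ex.cost_v, Ex.cost_c] at ht2 ⊢
    refine ⟨by omega, by omega, ?_, fun u => ⟨σ₂.m 12 u, (h12 u u.2).1⟩, fun u => rfl, fun v => ?_⟩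
    · rw [h23, Finset.sum_range, Finset.card_filter]
      simp only [hf, Fin.lt_def]
    · apply Fin.ext
      simp only
      rw [(h12 v v.2).2]
      split_ifs <;> rfl

/-- The term of the function in the array `11` in the formula for the number of injective
homomorphisms is added to the number in the array `7`. -/
def contrib (P : Prog) : Prog :=
  check 24 (.v 0) (.lt (.v 9) (.ld 11 (.v 9))) ;;
  .cond (.v 24) .skip (repLoop ;;
    check 24 (.v 0 * .v 0) (.ld 0 (.v 9) * .eq (.ld 12 (.v 9 / .v 0)) (.ld 12 (.v 9 % .v 0))) ;;
    .cond (.v 24) .skip (quotCore P ;; accum))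

theorem skip_wr (L A : List ℕ) : Prog.skip.wr L A = true := by
  simp [Prog.skip, Prog.wr]

theorem contrib_wr (P : Prog) : (contrib P).wr
    [9, 10, 11, 12, 13, 14, 15, 16, 17, 18, 20, 21, 22, 23, 24, 30, 31, 32, 35, 36]
    [3, 4, 5, 6, 7, 8, 12, 100, 101, 102] = true :=
  Prog.wr_seq (check_wr _ _) (Prog.wr_cond' _ (skip_wr _ _) (Prog.wr_seq (by decide)
    (Prog.wr_seq (check_wr _ _) (Prog.wr_cond' _ (skip_wr _ _) (Prog.wr_seq
      (Prog.wr_mono (by decide) (by decide) _ (quotCore_wr P))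
      (Prog.wr_seq (Prog.wr_set (by decide) _) (addc_wr _)))))))

/-- There are three cases. If `f v ≤ v` fails for some `v`, the term is zero by definition. If an
edge of `H` is collapsed, no homomorphism is constant on the classes, because `G` has no loops.
Otherwise the quotient is in the spasm, and its homomorphisms are counted by elimination. -/
theorem contrib_spec {k n w c₀ : ℕ} {σ : HS} {P : Prog} {T : ℕ → ℕ} (hP : MatMul P c₀ T)
    (hw : (n + 2) ^ c₀ ≤ 2 ^ w) (hS : Sz k n w) (hC : Ctx k n σ) {H : SimpleGraph (Fin k)}
    {G : SimpleGraph (Fin n)} (hH : Adj σ 0 H) (hG : Adj σ 1 G)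
    (hsp : ∀ (m : ℕ) (F : SimpleGraph (Fin m)), InSpasm H F → treewidth F ≤ 2)
    {f : Fin k → Fin k} (hf : ∀ u : Fin k, σ.m 11 u = f u) (h7 : ∀ d < 2 * (k + 1), σ.m 7 d ≤ n) :
    Hwp w (contrib P) (fun σ' t => t ≤ coreTime T k n + (k + 2) * (k + 2) * 1000 ∧
      (∀ d < 2 * (k + 1), σ'.m 7 d ≤ n) ∧
      dv k n (σ'.m 7) = dv k n (σ.m 7) + term (Res k n) (homs H G) f) σ := by
  have hkk : 4 ≤ (k + 2) * (k + 2) := by nlinarith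
  have hkk1 : k * k + 4 * k + 4 = (k + 2) * (k + 2) := by ring
  obtain ⟨hkw, hk, hn, hkk2⟩ := hS.sq_lt
  refine Hwp.seq (((check_spec (N := k) (fun i => if i < σ.m 11 i then 1 else 0) hS.one_lt
    (by norm_num) (by norm_num) (fun σ' hF => by simp [(hC.of_fr hF).h0])
    (fun i hi σ' hF hv => ?_)).frame [9, 24] [] (check_wr _ _)).mono ?_)
  · have h11 : σ'.m 11 = σ.m 11 := hF.m 11 (by norm_num) (by decide)
    simp [hv, h11, hS.w_ne]
  rintro σ₁ t₁ ⟨hF1, ht1, h241⟩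
  have hC1 := hC.of_fr hF1
  have h71 : σ₁.m 7 = σ.m 7 := hF1.m 7 (by norm_num) (by decide)
  have h111 : σ₁.m 11 = σ.m 11 := hF1.m 11 (by norm_num) (by decide)
  have hle : σ₁.v 24 = 0 ↔ ∀ v, f v ≤ v := by
    rw [h241]
    refine ⟨fun h v => ?_, fun h i hi => ?_⟩
    · have := h v v.2
      rw [hf] at this
      simpa using this
    · have h1 : (f ⟨i, hi⟩ : ℕ) ≤ i := h ⟨i, hi⟩
      have h2 : σ.m 11 i = f ⟨i, hi⟩ := hf ⟨i, hi⟩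
      rw [h2, if_neg (by omega)]
  simp only [Ex.cost_v, Ex.cost_lt, Ex.cost_ld] at ht1
  refine Hwp.cond (by simp) (fun h0 => ?_) (fun h0 => ?_)
  · rw [Ex.ev_v, Ne, hle] at h0
    refine Hwp.skip ⟨?_, by rw [h71]; exact h7, ?_⟩
    · simp only [Ex.cost_v]; nlinarith
    · rw [h71, term, if_neg h0, add_zero]
  rw [Ex.ev_v, hle] at h0
  refine Hwp.seq (((repLoop_spec hS hC1 (fun u => by rw [h111]; exact hf u) h0).frame _ _
    repLoop_wr).mono ?_)
  rintro σ₂ t₂ ⟨hF2, ht2, h23, h23', ρ, hρ, hρr⟩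
  have hC2 := hC1.of_fr hF2
  have hH2 := (hH.of_fr hF1 (by norm_num)).of_fr hF2 (by norm_num)
  have hG2 := (hG.of_fr hF1 (by norm_num)).of_fr hF2 (by norm_num)
  have h72 : σ₂.m 7 = σ.m 7 := (hF2.m 7 (by norm_num) (by decide)).trans h71
  have hterm : term (Res k n) (homs H G) f = (-1) ^ σ₂.v 23 *
      (((homs H G).filter fun ψ => ∀ v, ψ (ρ v) = ψ v).card : Res k n) := by
    rw [term, if_pos h0, h23', ← neg_one_pow_eq_pow_mod_two]
    simp only [rep_iff h0 hρr]
  refine Hwp.seq (((check_spec (N := k * k)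
    (fun i => σ₂.m 0 i * if σ₂.m 12 (i / k) = σ₂.m 12 (i % k) then 1 else 0) hS.one_lt
    (by norm_num) (by norm_num) (fun σ' hF => by simp [(hC2.of_fr hF).h0, hkw])
    (fun i hi σ' hF hv => ?_)).frame [9, 24] [] (check_wr _ _)).mono ?_)
  · have e0 : σ'.m 0 = σ₂.m 0 := hF.m 0 (by norm_num) (by decide)
    have e12 : σ'.m 12 = σ₂.m 12 := hF.m 12 (by norm_num) (by decide)
    have e1 : σ₂.m 0 i ≤ 1 := by
      obtain ⟨u, v, rfl, -, -⟩ := exists_fin_mul_add hi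
      exact (hH2 u v).2
    have e2 : σ₂.m 0 i < 2 ^ w := e1.trans_lt hS.one_lt
    have e3 : (if σ₂.m 12 (i / k) = σ₂.m 12 (i % k) then σ₂.m 0 i else 0) < 2 ^ w := by
      split_ifs <;> omega
    simp only [Ex.ok_mul, Ex.ok_ld, Ex.ok_v, Ex.ok_eq, Ex.ok_div, Ex.ok_mod, Ex.ev_mul, Ex.ev_ld,
      Ex.ev_v, Ex.ev_eq, Ex.ev_div, Ex.ev_mod, hv, e0, e12, (hC2.of_fr hF).h0]
    exact ⟨by simp [e3, hS.one_lt], trivial⟩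
  rintro σ₃ t₃ ⟨hF3, ht3, h243⟩
  have hC3 := hC2.of_fr hF3
  have h73 : σ₃.m 7 = σ.m 7 := (hF3.m 7 (by norm_num) (by decide)).trans h72
  have h123 : σ₃.m 12 = σ₂.m 12 := hF3.m 12 (by norm_num) (by decide)
  have h233 : σ₃.v 23 = σ₂.v 23 := hF3.v 23 (by norm_num) (by decide)
  have hne : σ₃.v 24 = 0 ↔ ∀ u v, H.Adj u v → ρ u ≠ ρ v := by
    have key : ∀ u v : Fin k, ((u : ℕ) * k + v) / k = u ∧ ((u : ℕ) * k + v) % k = v := by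
      intro u v
      obtain ⟨u', v', h1, h2, h3⟩ := exists_fin_mul_add (mul_add_lt_mul u.2 v.2)
      obtain ⟨rfl, rfl⟩ := fin_mul_add_inj h1
      exact ⟨h2, h3⟩
    rw [h243]
    refine ⟨fun h u v huv he => ?_, fun h i hi => ?_⟩
    · have h1 := h (u * k + v) (mul_add_lt_mul u.2 v.2)
      rw [(key u v).1, (key u v).2, hρ, hρ, he, if_pos rfl, mul_one] at h1
      exact ((hH2 u v).1.2 huv) h1
    · obtain ⟨u, v, rfl, e1, e2⟩ := exists_fin_mul_add hi
      rw [e1, e2, hρ, hρ]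
      by_cases huv : H.Adj u v
      · rw [if_neg fun h1 => h u v huv (Fin.ext h1), mul_zero]
      · rw [not_not.1 (mt (hH2 u v).1.1 huv), zero_mul]
  simp only [Ex.cost_v, Ex.cost_mul, Ex.cost_eq, Ex.cost_ld, Ex.cost_div, Ex.cost_mod] at ht3
  refine Hwp.cond (by simp) (fun h1 => ?_) (fun h1 => ?_)
  · rw [Ex.ev_v, Ne, hne] at h1
    refine Hwp.skip ⟨?_, by rw [h73]; exact h7, ?_⟩
    · simp only [Ex.cost_v]; nlinarith
    · rw [h73, hterm]
      push Not at h1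
      obtain ⟨u, v, huv, he⟩ := h1
      rw [Finset.filter_false_of_mem, Finset.card_empty, Nat.cast_zero, mul_zero, add_zero]
      intro ψ hψ h2
      simp only [homs, Finset.mem_filter, Finset.mem_univ, true_and] at hψ
      have h3 := hψ u v huv
      rw [← h2 u, ← h2 v, he] at h3
      exact G.loopless.irrefl _ h3
  rw [Ex.ev_v, hne] at h1
  refine Hwp.seq (((quotCore_spec hP hw hS hC3 (hH2.of_fr hF3 (by norm_num))
    (hG2.of_fr hF3 (by norm_num)) (fun u => by rw [h123]; exact hρ u) (rep_rep h0 hρr) h1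
    (tw2_quot H ρ (rep_rep h0 hρr) h1 hsp)).frame _ _ (quotCore_wr P)).mono ?_)
  rintro σ₄ t₄ ⟨hF4, ht4, hd4, hv4⟩
  have h74 : σ₄.m 7 = σ.m 7 := (hF4.m 7 (by norm_num) (by decide)).trans h73
  have h234 : σ₄.v 23 = σ₂.v 23 := (hF4.v 23 (by norm_num) (by decide)).trans h233
  refine (accum_spec hS (hC3.of_fr hF4) (by rw [h234]; exact h23) (by rw [h74]; exact h7)
    hd4).mono ?_
  rintro σ₅ t₅ ⟨ht5, hd5, hv5⟩
  refine ⟨?_, hd5, ?_⟩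
  · simp only [Ex.cost_v]; nlinarith
  · rw [hv5, hv4, h74, h234, hterm]

end Alg

end WordRAM

/-! ### Automorphisms and the enumeration of functions. -/

namespace WordRAM

open Elim

namespace Alg

/-- The number in the array `9` is increased if the function in the array `11` is an automorphism. -/
def autStep : Prog :=
  check 24 (.v 0 * .v 0) (.c 1 - .eq (.ld 0 (.v 9))
      (.ld 0 (.ld 11 (.v 9 / .v 0) * .v 0 + .ld 11 (.v 9 % .v 0))) +
    .eq (.ld 11 (.v 9 / .v 0)) (.ld 11 (.v 9 % .v 0)) *
      (.c 1 - .eq (.v 9 / .v 0) (.v 9 % .v 0))) ;;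
  .cond (.v 24) .skip (.set 17 (.c 1) ;; addc 9 2 3 (.ld 9 (.v 32)))

theorem autStep_wr : autStep.wr [9, 17, 18, 24, 32] [9] = true :=
  Prog.wr_seq (check_wr _ _) (Prog.wr_cond' _ (skip_wr _ _)
    (Prog.wr_seq (Prog.wr_set (by decide) _) (addc_wr _)))

open Classical in
theorem autStep_spec {k n w : ℕ} {σ : HS} (hS : Sz k n w) (hC : Ctx k n σ) {H : SimpleGraph (Fin k)}
    (hH : Adj σ 0 H) {f : Fin k → Fin k} (hf : ∀ u : Fin k, σ.m 11 u = f u)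
    (h9 : ∀ d < 2 * (k + 1), σ.m 9 d ≤ n)
    (hlt : nv (n + 1) (2 * (k + 1)) (σ.m 9) + 1 < (n + 1) ^ (2 * (k + 1))) :
    Hwp w autStep (fun σ' t => t ≤ (k + 2) * (k + 2) * 200 ∧ (∀ d < 2 * (k + 1), σ'.m 9 d ≤ n) ∧
      nv (n + 1) (2 * (k + 1)) (σ'.m 9) =
        nv (n + 1) (2 * (k + 1)) (σ.m 9) + if IsAut H f then 1 else 0) σ := by
  have hkk : 4 ≤ (k + 2) * (k + 2) := by nlinarith
  have hkk1 : k * k + 4 * k + 4 = (k + 2) * (k + 2) := by ring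
  obtain ⟨hkw, hk, hn, hkk2⟩ := hS.sq_lt
  have hw1 := hS.one_lt
  have hw2 : 2 < 2 ^ w := by omega
  refine Hwp.seq (((check_spec (N := k * k) (fun i =>
    (1 - if σ.m 0 i = σ.m 0 (σ.m 11 (i / k) * k + σ.m 11 (i % k)) then 1 else 0) +
    (if σ.m 11 (i / k) = σ.m 11 (i % k) then 1 else 0) * (1 - if i / k = i % k then 1 else 0)) hw1
    (by norm_num) (by norm_num) (fun σ' hF => by simp [(hC.of_fr hF).h0, hkw])
    (fun i hi σ' hF hv => ?_)).frame [9, 24] [] (check_wr _ _)).mono ?_)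
  · have e0 : σ'.m 0 = σ.m 0 := hF.m 0 (by norm_num) (by decide)
    have e11 : σ'.m 11 = σ.m 11 := hF.m 11 (by norm_num) (by decide)
    obtain ⟨u, v, -, e1, e2⟩ := exists_fin_mul_add hi
    have i1 : (f u : ℕ) * k + f v < 2 ^ w := (mul_add_lt_mul (f u).2 (f v).2).trans hkw
    have i2 : (f u : ℕ) * k < 2 ^ w := by omega
    simp only [Ex.ok_mul, Ex.ok_ld, Ex.ok_v, Ex.ok_eq, Ex.ok_div, Ex.ok_mod, Ex.ev_mul, Ex.ev_ld,
      Ex.ev_v, Ex.ev_eq, Ex.ev_div, Ex.ev_mod, Ex.ok_add, Ex.ok_sub, Ex.ok_c, Ex.ev_add, Ex.ev_sub,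
      Ex.ev_c, hv, e0, e11, (hC.of_fr hF).h0, e1, e2, hf]
    refine ⟨⟨⟨?_, ?_, ?_⟩, ⟨?_, ?_, ?_⟩, ?_⟩, trivial⟩ <;>
      (try split_ifs) <;> simp [i1, i2, hw2, hS.w_ne]
  rintro σ₁ t₁ ⟨hF1, ht1, h241⟩
  have hC1 := hC.of_fr hF1
  have h91 : σ₁.m 9 = σ.m 9 := hF1.m 9 (by norm_num) (by decide)
  have haut : σ₁.v 24 = 0 ↔ IsAut H f := by
    have key : ∀ u v : Fin k, ((u : ℕ) * k + v) / k = u ∧ ((u : ℕ) * k + v) % k = v := by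
      intro u v
      obtain ⟨u', v', h1, h2, h3⟩ := exists_fin_mul_add (mul_add_lt_mul u.2 v.2)
      obtain ⟨rfl, rfl⟩ := fin_mul_add_inj h1
      exact ⟨h2, h3⟩
    have hadj : ∀ u v u' v' : Fin k, σ.m 0 (u * k + v) = σ.m 0 (u' * k + v') ↔
        (H.Adj u v ↔ H.Adj u' v') := by
      intro u v u' v'
      obtain ⟨h1, h2⟩ := hH u v
      obtain ⟨h3, h4⟩ := hH u' v'
      rw [← h1, ← h3]
      omega
    -- The first summand detects a pair whose adjacency is not preserved, the second one a pair of
    -- different vertices with the same image. Both vanish for all pairs exactly for automorphisms.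
    have h1 : ∀ u v : Fin k, (1 - if σ.m 0 (u * k + v) = σ.m 0 (f u * k + f v) then 1 else 0) +
        (if (f u : ℕ) = f v then 1 else 0) * (1 - if (u : ℕ) = v then 1 else 0) = 0 ↔
        (H.Adj u v ↔ H.Adj (f u) (f v)) ∧ (f u = f v → u = v) := by
      intro u v
      rw [← hadj, Fin.ext_iff, Fin.ext_iff]
      split_ifs <;> simp_all
    rw [h241]
    constructor
    · intro h
      have h2 : ∀ u v : Fin k, (H.Adj u v ↔ H.Adj (f u) (f v)) ∧ (f u = f v → u = v) := by
        intro u v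
        have h3 := h (u * k + v) (mul_add_lt_mul u.2 v.2)
        rw [(key u v).1, (key u v).2, hf, hf] at h3
        exact (h1 u v).1 h3
      exact ⟨fun u v he => (h2 u v).2 he, fun u v => (h2 u v).1⟩
    · intro h i hi
      obtain ⟨u, v, rfl, e1, e2⟩ := exists_fin_mul_add hi
      rw [e1, e2, hf, hf]
      exact (h1 u v).2 ⟨h.2 u v, fun he => h.1 he⟩
  simp only [Ex.cost_v, Ex.cost_mul, Ex.cost_eq, Ex.cost_ld, Ex.cost_div, Ex.cost_mod, Ex.cost_add,
    Ex.cost_sub, Ex.cost_c] at ht1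
  refine Hwp.cond (by simp) (fun h0 => ?_) (fun h0 => ?_)
  · rw [Ex.ev_v, Ne, haut] at h0
    refine Hwp.skip ⟨?_, by rw [h91]; exact h9, ?_⟩
    · simp only [Ex.cost_v]; nlinarith
    · rw [h91, if_neg h0, add_zero]
  rw [Ex.ev_v, haut] at h0
  refine Hwp.seq (Hwp.set (by norm_num) (by simp [hS.w_ne]) ?_)
  set σ₂ := σ₁.setV 17 ((Ex.c 1).ev w σ₁)
  have hF2 : Fr [17] [] σ₁ σ₂ := (Fr.refl _ _ _).setV (by simp)
  have hC2 := hC1.of_fr hF2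
  have h17 : σ₂.v 17 = 1 := by simp [σ₂]
  have h92 : σ₂.m 9 = σ.m 9 := h91
  have hn2 : 2 * (n + 1) ≤ 2 ^ w := (hS.lt_of_le_pow (i := 2) (by nlinarith)).le
  refine (addc_spec (b := n + 1) (N := 2 * (k + 1)) (σ.m 9) hw1
    (by omega) hn2 (by norm_num) (by norm_num) (by norm_num) (by decide) (by decide) hC2.h2 hC2.h3
    h17.le (fun d hd => ?_) (fun d hd σ' hF hv hm => ?_)).mono ?_
  · have := h9 d hd
    have := hS.pos
    omega
  · simp [hv, hm d le_rfl, h92]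
  · rintro σ₃ t₃ ⟨ht3, hc3, hd3, he3⟩
    simp only [Ex.cost_v, Ex.cost_c, Ex.cost_ld] at ht3 ⊢
    refine ⟨by nlinarith, fun d hd => Nat.lt_succ_iff.1 (hd3 d hd), ?_⟩
    rw [h17] at he3
    rw [if_pos h0, ← he3]
    have h3 : σ₃.v 17 = 0 := by
      by_contra h4
      have : σ₃.v 17 = 1 := by omega
      rw [this] at he3
      omega
    rw [h3, zero_mul, zero_add]

/-- The function whose values are the digits of `i` in base `k`. -/
def dig (k i : ℕ) (d : Fin k) : Fin k := ⟨i / k ^ (d : ℕ) % k, Nat.mod_lt _ d.pos⟩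

theorem sum_dig {R : Type*} [AddCommMonoid R] (k : ℕ) (F : (Fin k → Fin k) → R) :
    ∑ i ∈ Finset.range (k ^ k), F (dig k i) = ∑ f, F f := by
  rw [Finset.sum_range, ← Equiv.sum_comp finFunctionFinEquiv.symm]
  refine Finset.sum_congr rfl fun i _ => congrArg F ?_
  funext d
  exact Fin.ext (by simp [dig, finFunctionFinEquiv])

/-- The treatment of the function in the array `11`, and the transition to the next function. -/
def iterate (P : Prog) : Prog :=
  contrib P ;; autStep ;; .set 17 (.c 1) ;; addc 11 0 0 (.ld 11 (.v 32)) ;; .set 26 (.v 17)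

theorem iterate_wr (P : Prog) : (iterate P).wr
    [9, 10, 11, 12, 13, 14, 15, 16, 17, 18, 20, 21, 22, 23, 24, 26, 30, 31, 32, 35, 36]
    [3, 4, 5, 6, 7, 8, 9, 11, 12, 100, 101, 102] = true :=
  Prog.wr_seq (Prog.wr_mono (by decide) (by decide) _ (contrib_wr P))
    (Prog.wr_seq (Prog.wr_mono (by decide) (by decide) _ autStep_wr)
      (Prog.wr_seq (Prog.wr_set (by decide) _) (Prog.wr_seq (addc_wr _)
        (Prog.wr_set (by decide) _))))

-- The array `11` is a counter with `k` digits in base `k`, whose digits are the values of the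
-- current function. The carry of its increment goes to register `26` and becomes one after the last
-- function.
open Classical in
theorem iterate_spec {k n w c₀ i : ℕ} {σ : HS} {P : Prog} {T : ℕ → ℕ} (hP : MatMul P c₀ T)
    (hw : (n + 2) ^ c₀ ≤ 2 ^ w) (hS : Sz k n w) (hC : Ctx k n σ) {H : SimpleGraph (Fin k)}
    {G : SimpleGraph (Fin n)} (hH : Adj σ 0 H) (hG : Adj σ 1 G)
    (hsp : ∀ (m : ℕ) (F : SimpleGraph (Fin m)), InSpasm H F → treewidth F ≤ 2)
    (h11 : ∀ d < k, σ.m 11 d < k) (hi : nv k k (σ.m 11) = i)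
    (h7 : ∀ d < 2 * (k + 1), σ.m 7 d ≤ n) (h9 : ∀ d < 2 * (k + 1), σ.m 9 d ≤ n)
    (hlt : nv (n + 1) (2 * (k + 1)) (σ.m 9) + 1 < (n + 1) ^ (2 * (k + 1))) :
    Hwp w (iterate P) (fun σ' t => t ≤ coreTime T k n + (k + 2) * (k + 2) * 1400 ∧
      (∀ d < k, σ'.m 11 d < k) ∧ σ'.v 26 * k ^ k + nv k k (σ'.m 11) = i + 1 ∧
      (∀ d < 2 * (k + 1), σ'.m 7 d ≤ n) ∧ (∀ d < 2 * (k + 1), σ'.m 9 d ≤ n) ∧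
      dv k n (σ'.m 7) = dv k n (σ.m 7) + term (Res k n) (homs H G) (dig k i) ∧
      nv (n + 1) (2 * (k + 1)) (σ'.m 9) =
        nv (n + 1) (2 * (k + 1)) (σ.m 9) + if IsAut H (dig k i) then 1 else 0) σ := by
  have hkk1 : k * k + 4 * k + 4 = (k + 2) * (k + 2) := by ring
  have hf : ∀ u : Fin k, σ.m 11 u = dig k i u := fun u => by
    rw [← hi]; exact (digit_of_nv h11 u.2).symm
  have hw1 := hS.one_lt
  refine Hwp.seq (((contrib_spec hP hw hS hC hH hG hsp hf h7).frame _ _ (contrib_wr P)).mono ?_)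
  rintro σ₁ t₁ ⟨hF1, ht1, hd1, hv1⟩
  have hC1 := hC.of_fr hF1
  have h91 : σ₁.m 9 = σ.m 9 := hF1.m 9 (by norm_num) (by decide)
  have h111 : σ₁.m 11 = σ.m 11 := hF1.m 11 (by norm_num) (by decide)
  refine Hwp.seq (((autStep_spec hS hC1 (hH.of_fr hF1 (by norm_num))
    (fun u => by rw [h111]; exact hf u) (by rw [h91]; exact h9)
    (by rw [h91]; exact hlt)).frame _ _ autStep_wr).mono ?_)
  rintro σ₂ t₂ ⟨hF2, ht2, hd2, hv2⟩
  have hC2 := hC1.of_fr hF2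
  have h72 : σ₂.m 7 = σ₁.m 7 := hF2.m 7 (by norm_num) (by decide)
  refine Hwp.seq (Hwp.set (by norm_num) (by simp [hS.w_ne]) ?_)
  set σ₃ := σ₂.setV 17 ((Ex.c 1).ev w σ₂)
  have hF3 : Fr [17] [] σ₂ σ₃ := (Fr.refl _ _ _).setV (by simp)
  have hC3 := hC2.of_fr hF3
  have h17 : σ₃.v 17 = 1 := by simp [σ₃]
  have h113 : σ₃.m 11 = σ.m 11 := (hF2.m 11 (by norm_num) (by decide)).trans h111
  have hk2 : 2 * k ≤ 2 ^ w := (hS.lt_of_le_pow (i := 2) (by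
    rw [sq]; exact Nat.mul_le_mul (by omega) (by omega))).le
  refine Hwp.seq (((addc_spec (b := k) (N := k) (σ.m 11) hw1
    (by omega) hk2 (by norm_num) (by norm_num) (by norm_num) (by decide) (by decide) hC3.h0 hC3.h0
    h17.le (fun d hd => ?_) (fun d hd σ' hF hv hm => ?_)).frame [17, 18, 32] [11]
    (addc_wr _)).mono ?_)
  · have := h11 d hd
    omega
  · simp [hv, hm d le_rfl, h113]
  · rintro σ₄ t₄ ⟨hF4, ht4, hc4, hd4, he4⟩
    have h74 : σ₄.m 7 = σ₁.m 7 := (hF4.m 7 (by norm_num) (by decide)).trans h72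
    have h94 : σ₄.m 9 = σ₂.m 9 := hF4.m 9 (by norm_num) (by decide)
    simp only [Ex.cost_v, Ex.cost_ld] at ht4
    refine Hwp.set (by norm_num) (by simp) ⟨?_, by simpa using hd4, ?_, ?_, ?_, ?_, ?_⟩
    · simp only [Ex.cost_v, Ex.cost_c]; nlinarith
    · simpa [hi, h17] using he4
    · simpa [h74] using hd1
    · simpa [h94] using hd2
    · simpa [h74] using hv1
    · simpa [h94, h91] using hv2

end Alg

end WordRAM

/-! ### The algorithm for subgraphs. -/

namespace WordRAM

open Elim

open Classical in
theorem subCount_mul {k n : ℕ} (H : SimpleGraph (Fin k)) (G : SimpleGraph (Fin n)) :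
    ((homs H G).filter Function.Injective).card =
      subCount H G * (Finset.univ.filter (IsAut H)).card := by
  rw [← copies_eq, ← aut_eq, card_copy]

open Classical in
theorem card_aut_pos {k : ℕ} (H : SimpleGraph (Fin k)) :
    0 < (Finset.univ.filter (IsAut H)).card :=
  Finset.card_pos.2 ⟨id, by simp [IsAut, Function.injective_id]⟩

theorem subCount_eq_zero {k n : ℕ} (H : SimpleGraph (Fin k)) (G : SimpleGraph (Fin n))
    (h : n < k) : subCount H G = 0 := by
  classical
  have h1 := subCount_mul H G
  rw [Finset.filter_false_of_mem, Finset.card_empty] at h1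
  · exact (Nat.mul_eq_zero.1 h1.symm).resolve_right (card_aut_pos H).ne'
  · intro ψ _ hψ
    have := Fintype.card_le_of_injective ψ hψ
    simp at this
    omega

theorem subCount_zero (H : SimpleGraph (Fin 0)) (G : SimpleGraph (Fin 0)) : subCount H G = 1 := by
  classical
  have h1 := subCount_mul H G
  have h2 : ((homs H G).filter Function.Injective).card = 1 := by
    rw [homs, Finset.filter_filter, Finset.filter_true_of_mem]
    · simp
    · exact fun ψ _ => ⟨fun u => u.elim0, fun u => u.elim0⟩
  rw [h2] at h1
  exact Nat.dvd_one.1 (Dvd.intro _ h1.symm)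

namespace Alg

/-- The numbers of injective homomorphisms and of automorphisms. -/
def subLoop (P : Prog) : Prog := .loop (.eq (.v 26) (.c 0)) (iterate P)

theorem subLoop_wr (P : Prog) : (subLoop P).wr
    [9, 10, 11, 12, 13, 14, 15, 16, 17, 18, 20, 21, 22, 23, 24, 26, 30, 31, 32, 35, 36]
    [3, 4, 5, 6, 7, 8, 9, 11, 12, 100, 101, 102] = true :=
  Prog.wr_loop' _ (iterate_wr P)

-- The loop runs through the `k ^ k` functions, once for `k = 0`. The number of automorphisms found
-- so far is at most the number of iterations, and `k ≤ n` keeps `k ^ k` below `(n + 1) ^ (k + 1)`,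
-- so its digits do not overflow. Negative partial sums of the signed formula are no problem,
-- because that sum is computed modulo the power of the base.
open Classical in
theorem subLoop_spec {k n w c₀ : ℕ} {σ : HS} {P : Prog} {T : ℕ → ℕ} (hP : MatMul P c₀ T)
    (hw : (n + 2) ^ c₀ ≤ 2 ^ w) (hS : Sz k n w) (hC : Ctx k n σ) {H : SimpleGraph (Fin k)}
    {G : SimpleGraph (Fin n)} (hH : Adj σ 0 H) (hG : Adj σ 1 G)
    (hsp : ∀ (m : ℕ) (F : SimpleGraph (Fin m)), InSpasm H F → treewidth F ≤ 2) (hkn : k ≤ n)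
    (h26 : σ.v 26 = 0) (h11 : ∀ d < k, σ.m 11 d = 0) (hz7 : ∀ d < 2 * (k + 1), σ.m 7 d = 0)
    (hz9 : ∀ d < 2 * (k + 1), σ.m 9 d = 0) :
    Hwp w (subLoop P) (fun σ' t =>
      t ≤ k ^ k * (coreTime T k n + (k + 2) * (k + 2) * 1400 + 10) + 10 ∧
      (∀ d < 2 * (k + 1), σ'.m 7 d ≤ n) ∧ (∀ d < 2 * (k + 1), σ'.m 9 d ≤ n) ∧
      dv k n (σ'.m 7) = (((homs H G).filter Function.Injective).card : Res k n) ∧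
      nv (n + 1) (2 * (k + 1)) (σ'.m 9) = (Finset.univ.filter (IsAut H)).card) σ := by
  have hn1 := hS.pos
  have hpow : k ^ k < (n + 1) ^ (k + 1) := (Nat.pow_le_pow_left (show k ≤ n + 1 by omega) k).trans_lt
    (Nat.pow_lt_pow_right (by omega) (by omega))
  have hpow2 : (n + 1) ^ (k + 1) < (n + 1) ^ (2 * (k + 1)) :=
    Nat.pow_lt_pow_right (by omega) (by omega)
  refine Hwp.loop_frame _ _ (iterate_wr P) (k ^ k)
    (coreTime T k n + (k + 2) * (k + 2) * 1400) (fun j σ' => (∀ d < k, σ'.m 11 d < k) ∧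
      σ'.v 26 * k ^ k + nv k k (σ'.m 11) = j ∧
      (∀ d < 2 * (k + 1), σ'.m 7 d ≤ n) ∧ (∀ d < 2 * (k + 1), σ'.m 9 d ≤ n) ∧
      dv k n (σ'.m 7) = ∑ i ∈ Finset.range j, term (Res k n) (homs H G) (dig k i) ∧
      nv (n + 1) (2 * (k + 1)) (σ'.m 9) =
        ∑ i ∈ Finset.range j, if IsAut H (dig k i) then 1 else 0) ?_ ?_ ?_ ?_
  · refine ⟨fun d hd => ?_, ?_, fun d hd => ?_, fun d hd => ?_, ?_, ?_⟩
    · have : σ.m 11 d = 0 := h11 d hd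
      omega
    · have : nv k k (σ.m 11) = 0 := nv_zero h11
      rw [this]
      simp [h26]
    · rw [hz7 d hd]; omega
    · rw [hz9 d hd]; omega
    · rw [dv_eq_nv, nv_zero hz7]; simp
    · rw [nv_zero hz9]; simp
  · rintro j hj σ' hF ⟨i1, i2, i3, i4, i5, i6⟩
    have hv26 : σ'.v 26 = 0 := by
      by_contra h
      have := Nat.le_mul_of_pos_left (k ^ k) (Nat.pos_of_ne_zero h)
      omega
    rw [hv26, zero_mul, zero_add] at i2
    have hle : (∑ i ∈ Finset.range j, if IsAut H (dig k i) then 1 else 0) ≤ j :=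
      (Finset.sum_le_card_nsmul _ _ 1 fun i _ => by split_ifs <;> omega).trans (by simp)
    refine ⟨by simp [hS.w_ne], by simp [hv26], (iterate_spec hP hw hS (hC.of_fr hF)
      (hH.of_fr hF (by norm_num)) (hG.of_fr hF (by norm_num)) hsp
      i1 i2 i3 i4 (by rw [i6]; omega)).mono ?_⟩
    rintro σ₆ t₆ ⟨ht6, l1, l2, l3, l4, l5, l6⟩
    refine ⟨ht6, l1, l2, l3, l4, ?_, ?_⟩
    · rw [l5, i5, Finset.sum_range_succ]
    · rw [l6, i6, Finset.sum_range_succ]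
  · rintro σ' hF ⟨i1, i2, -⟩
    have h26 : σ'.v 26 ≠ 0 := by
      intro h
      have := nv_lt i1
      rw [h, zero_mul, zero_add] at i2
      omega
    exact ⟨by simp [hS.w_ne], by simp [h26]⟩
  rintro σ₆ t₆ hF6 ⟨-, -, i3, i4, i5, i6⟩ ht6
  rw [sum_dig, sum_term] at i5
  rw [sum_dig k fun f => if IsAut H f then 1 else 0, ← Finset.card_filter] at i6
  simp only [Ex.cost_v, Ex.cost_c, Ex.cost_eq] at ht6
  refine ⟨?_, i3, i4, by convert i5, i6⟩
  have e1 : k ^ k * (coreTime T k n + (k + 2) * (k + 2) * 1400 + (1 + 1 + 1) + 1) ≤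
      k ^ k * (coreTime T k n + (k + 2) * (k + 2) * 1400 + 10) :=
    Nat.mul_le_mul_left _ (by omega)
  omega

/-- The algorithm for subgraphs. -/
def subProg (P : Prog) : Prog :=
  .cond (.v 1) (.cond (.lt (.v 1) (.v 0)) (.set 0 (.c 0))
      (prelude ;; zero 7 ;; zero 9 ;; .for_ 32 (.v 0) (.put 11 (.v 32) (.c 0)) ;; .set 26 (.c 0) ;;
        subLoop P ;; divide ;; toWords 10))
    (.put 2 (.c 0) (.c 1) ;; .set 0 (.eq (.v 0) (.c 0)))

def subTime (T : ℕ → ℕ) (k n : ℕ) : ℕ :=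
  k ^ k * (coreTime T k n + (k + 2) * (k + 2) * 1400 + 10) +
    (k + 1) * (n * ((k + 1) * 200 + 80) + 100) + (k + 2) * (k + 2) * 1000

theorem subProg_spec {k n w c₀ : ℕ} {σ : HS} {P : Prog} {T : ℕ → ℕ} (hP : MatMul P c₀ T)
    (hw : (n + 2) ^ c₀ ≤ 2 ^ w) (hw10 : (k + n + 2) ^ 10 ≤ 2 ^ w) {H : SimpleGraph (Fin k)}
    {G : SimpleGraph (Fin n)} (h0 : σ.v 0 = k) (h1 : σ.v 1 = n) (hH : Adj σ 0 H)
    (hG : Adj σ 1 G)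
    (hsp : ∀ (m : ℕ) (F : SimpleGraph (Fin m)), InSpasm H F → treewidth F ≤ 2) :
    Hwp w (subProg P) (fun σ' t => t ≤ subTime T k n ∧
      nv (2 ^ w) (σ'.v 0) (σ'.m 2) = subCount H G) σ := by
  classical
  have hkk : 4 ≤ (k + 2) * (k + 2) := by nlinarith
  have hkk1 : k * k + 4 * k + 4 = (k + 2) * (k + 2) := by ring
  have hw0 : w ≠ 0 := by
    rintro rfl
    have : 1 < (k + n + 2) ^ 10 := Nat.one_lt_pow (by norm_num) (by omega)
    simp at hw10
  refine Hwp.cond (by simp) (fun hn => ?_) (fun hn => ?_)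
  · have hn1 : 1 ≤ n := by
      rw [Ex.ev_v, h1] at hn; omega
    have hS : Sz k n w := ⟨hn1, hw10⟩
    -- For `n < k` there is no injective function, and the output is the empty sequence of words.
    -- The remaining case `k ≤ n` bounds the number of automorphisms, which the division needs.
    refine Hwp.cond (by simp [hw0]) (fun hkn => ?_) (fun hkn => ?_)
    · have hkn : n < k := by
        by_contra h; simp [h0, h1, h] at hkn
      refine Hwp.set (by norm_num) (by simp) ⟨?_, ?_⟩
      · simp only [Ex.cost_v, Ex.cost_lt, Ex.cost_c, subTime]; omega
      · simp [nv, subCount_eq_zero H G hkn]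
    have hkn : k ≤ n := by
      by_contra h; simp [h0, h1, not_le.1 h] at hkn
    have hpow : k ^ k < (n + 1) ^ (k + 1) := (Nat.pow_le_pow_left (show k ≤ n + 1 by omega) k).trans_lt
      (Nat.pow_lt_pow_right (by omega) (by omega))
    have hpow2 : (n + 1) ^ (k + 1) < (n + 1) ^ (2 * (k + 1)) :=
      Nat.pow_lt_pow_right (by omega) (by omega)
    refine Hwp.seq (((prelude_spec hS h0 h1).frame [2, 3, 4, 5, 7] [] (by decide)).mono ?_)
    rintro σ₁ t₁ ⟨hF1, ht1, hC1⟩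
    refine Hwp.seq (((zero_spec hS hC1 (a := 7) (by norm_num)).frame [32] [7] (by decide)).mono ?_)
    rintro σ₂ t₂ ⟨hF2, ht2, hz2⟩
    have hC2 := hC1.of_fr hF2
    refine Hwp.seq (((zero_spec hS hC2 (a := 9) (by norm_num)).frame [32] [9] (by decide)).mono ?_)
    rintro σ₃ t₃ ⟨hF3, ht3, hz3⟩
    have hC3 := hC2.of_fr hF3
    refine Hwp.seq (Hwp.fill k id (fun _ => 0) hS.one_lt (by norm_num)
      (by norm_num) (fun j' _ j hj => hj.ne) (fun σ' hF => by simp [(hC3.of_fr hF).h0])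
      (fun j hj σ' hF hv hm => by simp [hv]) fun σ₄ t₄ hF4 h114 _ ht4 => ?_)
    have hC4 := hC3.of_fr hF4
    refine Hwp.seq (Hwp.set (by norm_num) (by simp) ?_)
    set σ₅ := σ₄.setV 26 ((Ex.c 0).ev w σ₄)
    have hF5 : Fr [26] [] σ₄ σ₅ := (Fr.refl _ _ _).setV (by simp)
    have hC5 := hC4.of_fr hF5
    have hH5 := (((hH.of_fr hF1 (by norm_num)).of_fr hF2 (by norm_num)).of_fr hF3
      (by norm_num)).of_fr hF4 (by norm_num)
    have hG5 := (((hG.of_fr hF1 (by norm_num)).of_fr hF2 (by norm_num)).of_fr hF3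
      (by norm_num)).of_fr hF4 (by norm_num)
    have hz7 : ∀ d < 2 * (k + 1), σ₅.m 7 d = 0 := by
      have h74 : σ₄.m 7 = σ₂.m 7 := (hF4.m 7 (by norm_num) (by decide)).trans
        (hF3.m 7 (by norm_num) (by decide))
      intro d hd
      rw [← hz2 d hd, ← h74]
      rfl
    have hz9 : ∀ d < 2 * (k + 1), σ₅.m 9 d = 0 := by
      have h94 : σ₄.m 9 = σ₃.m 9 := hF4.m 9 (by norm_num) (by decide)
      intro d hd
      rw [← hz3 d hd, ← h94]
      rfl
    refine Hwp.seq (((subLoop_spec hP hw hS hC5 (Adj.of_fr (σ := σ₄) hH5 hF5 (by norm_num))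
      (Adj.of_fr (σ := σ₄) hG5 hF5 (by norm_num)) hsp hkn (by simp [σ₅]) h114 hz7 hz9).frame _ _
      (subLoop_wr P)).mono ?_)
    rintro σ₆ t₆ ⟨hF6, ht6, i3, i4, i5, i6⟩
    have hC6 := hC5.of_fr hF6
    have hinj : ((homs H G).filter Function.Injective).card < (n + 1) ^ (k + 1) :=
      ((Finset.card_filter_le _ _).trans (card_homs_le H G)).trans_lt
        ((Nat.pow_le_pow_left (Nat.le_succ n) k).trans_lt
          (Nat.pow_lt_pow_right (by omega) (by omega)))
    have haut : (Finset.univ.filter (IsAut H)).card < (n + 1) ^ (k + 1) := by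
      refine (Finset.card_le_univ _).trans_lt ?_
      simpa using hpow
    refine Hwp.seq (((divide_spec hS hC6 i3 i4 i6 (card_aut_pos H) haut
      (nv_eq_of_dv i3 i5 (hinj.trans hpow2)) hinj).frame _ _ divide_wr).mono ?_)
    rintro σ₇ t₇ ⟨hF7, ht7, hd7, hv7⟩
    refine (toWords_spec hS (hC6.of_fr hF7) (a := 10) (by norm_num) (by norm_num) hd7).mono ?_
    rintro σ₈ t₈ ⟨ht8, h08, hv8⟩
    refine ⟨?_, ?_⟩
    · simp only [Ex.cost_v, Ex.cost_c, Ex.cost_lt, subTime] at ht4 ⊢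
      nlinarith
    · rw [h08, hv8, hv7, subCount_mul, Nat.mul_div_cancel _ (card_aut_pos H)]
  · obtain rfl : n = 0 := by simpa [h1] using hn
    refine (trivial_spec hw0 h0).mono ?_
    rintro σ₁ t₁ ⟨ht1, hv1⟩
    refine ⟨by simp only [Ex.cost_v, subTime]; omega, ?_⟩
    rw [hv1]
    split_ifs with hk
    · subst hk
      exact (subCount_zero H G).symm
    · exact (subCount_eq_zero H G (Nat.pos_of_ne_zero hk)).symm

end Alg

end WordRAM

/-! ### Running times and the lower bound for matrix multiplication. -/

namespace WordRAM

open Alg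

theorem coreTime_le (T : ℕ → ℕ) (k n : ℕ) :
    coreTime T k n + (k + 2) * (k + 2) * 2000 ≤
      20000 * (k + 2) ^ 4 * (T n + n * n + 1) := by
  unfold coreTime stepTime mulTime convTime
  zify
  -- As a polynomial in `k`, `n` and `T n`, the difference has only nonnegative coefficients.
  rw [← sub_nonneg]
  ring_nf
  positivity

theorem subTime_le (T : ℕ → ℕ) (k n : ℕ) :
    subTime T k n ≤ 20000 * (k ^ k + 1) * (k + 2) ^ 4 * (T n + n * n + 1) := by
  have h1 := coreTime_le T k n
  have h2 : coreTime T k n + (k + 2) * (k + 2) * 1400 + 10 ≤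
      20000 * (k + 2) ^ 4 * (T n + n * n + 1) := by nlinarith
  have h3 : (k + 1) * (n * ((k + 1) * 200 + 80) + 100) + (k + 2) * (k + 2) * 1000 ≤
      20000 * (k + 2) ^ 4 * (T n + n * n + 1) := by
    -- The division is linear in `n`; replacing `n` by `n * n` makes the coefficientwise comparison
    -- possible.
    have h4 : (k + 1) * (n * ((k + 1) * 200 + 80) + 100) ≤
        (k + 1) * (n * n * ((k + 1) * 200 + 80) + 100) := by
      gcongr
      exact Nat.le_mul_self n
    refine (Nat.add_le_add_right h4 _).trans ?_
    zify
    rw [← sub_nonneg]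
    ring_nf
    positivity
  calc subTime T k n ≤ k ^ k * (20000 * (k + 2) ^ 4 * (T n + n * n + 1)) +
        20000 * (k + 2) ^ 4 * (T n + n * n + 1) := by
        unfold subTime
        rw [add_assoc]
        exact Nat.add_le_add (Nat.mul_le_mul_left _ h2) h3
    _ = _ := by ring

/-- The product of two matrices cannot be written faster than entry by entry. -/
theorem sq_le_of_mul {P : Prog} {c : ℕ} {ω C : ℝ}
    (h : ∀ (n w : ℕ) (A B : Matrix (Fin n) (Fin n) ℕ),
      (∀ i j, A i j ≤ n) → (∀ i j, B i j ≤ n) → (n + 2) ^ c ≤ 2 ^ w →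
      ∀ s : State, s.Bounded w → s.reg 0 = n → s.HoldsMatrix 0 A → s.HoldsMatrix 1 B →
        ∃ (s' : State) (t : ℕ), Run w P s s' t ∧ (t : ℝ) ≤ C * ((max n 1 : ℕ) : ℝ) ^ ω ∧
          s'.HoldsMatrix 2 (A * B)) {n : ℕ} (hn : 1 ≤ n) :
    ((n * n : ℕ) : ℝ) ≤ C * ((max n 1 : ℕ) : ℝ) ^ ω := by
  -- Any sufficiently large word length serves; this one exceeds the requirement of the program and
  -- makes `n` fit into a word.
  have hw : (n + 2) ^ (c + 1) < 2 ^ (n + 2) ^ (c + 1) := Nat.lt_two_pow_self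
  have h2 : (n + 2) ^ c ≤ (n + 2) ^ (c + 1) := Nat.pow_le_pow_right (by omega) (by omega)
  have h3 : n + 2 ≤ (n + 2) ^ (c + 1) := Nat.le_self_pow (by omega) _
  -- The factors are all-ones matrices and the output array starts with zeros. All entries of the
  -- product are `n ≥ 1`, so each of the `n * n` cells has to be changed.
  obtain ⟨s', t, hr, ht, hm⟩ := h n ((n + 2) ^ (c + 1)) (Matrix.of fun _ _ => 1) (Matrix.of fun _ _ => 1)
    (fun _ _ => hn) (fun _ _ => hn) (h2.trans hw.le)
    ⟨fun _ => n, fun a _ => if a = 2 then 0 else 1⟩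
    ⟨fun _ => by simp only; omega, fun a _ => by simp only; split_ifs <;> omega⟩ rfl
    (fun _ _ => rfl) (fun _ _ => rfl)
  obtain ⟨I, hI, hch⟩ := hr.exists_finset_changed 2
  have hsub : Finset.range (n * n) ⊆ I := by
    intro i hi
    by_contra hiI
    obtain ⟨u, v, rfl, -, -⟩ := exists_fin_mul_add (Finset.mem_range.1 hi)
    have h4 := hm u v
    rw [hch _ hiI] at h4
    rw [Matrix.mul_apply] at h4
    simp at h4
    omega
  have h5 := (Finset.card_le_card hsub).trans hI
  rw [Finset.card_range] at h5
  exact (Nat.cast_le.2 h5).trans ht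

/-- The real time bound is rounded down to a natural number, and the overhead `n * n + 1` of the
algorithms is absorbed into `O(n ^ ω)`. -/
theorem exists_matMul {ω : ℝ} (hω : IsMatMulExponent ω) :
    ∃ (P : Prog) (c : ℕ) (T : ℕ → ℕ) (D : ℕ), MatMul P c T ∧
      ∀ n, ((T n + n * n + 1 : ℕ) : ℝ) ≤ D * ((max n 1 : ℕ) : ℝ) ^ ω := by
  obtain ⟨P, c, C, h⟩ := hω
  -- For `n ≥ 1` each of the summands `T n`, `n * n` and `1 ≤ n * n` is at most `⌈|C|⌉₊` times the
  -- power, which explains the factor three. The additional one covers `n = 0`.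
  refine ⟨P, c, fun n => ⌊C * ((max n 1 : ℕ) : ℝ) ^ ω⌋₊, 3 * ⌈|C|⌉₊ + 1,
    fun n w A B hA hB hw s hs h0 h1 h2 => ?_, fun n => ?_⟩
  · obtain ⟨s', t, hr, ht, hm⟩ := h n w A B hA hB hw s hs h0 h1 h2
    exact ⟨s', t, hr, Nat.le_floor ht, hm⟩
  · have hE : (0 : ℝ) ≤ ((max n 1 : ℕ) : ℝ) ^ ω := by positivity
    have hC : C * ((max n 1 : ℕ) : ℝ) ^ ω ≤ ⌈|C|⌉₊ * ((max n 1 : ℕ) : ℝ) ^ ω :=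
      mul_le_mul_of_nonneg_right ((le_abs_self C).trans (Nat.le_ceil _)) hE
    have hC0 : (0 : ℝ) ≤ ⌈|C|⌉₊ * ((max n 1 : ℕ) : ℝ) ^ ω := by positivity
    have hT : ((⌊C * ((max n 1 : ℕ) : ℝ) ^ ω⌋₊ : ℕ) : ℝ) ≤ ⌈|C|⌉₊ * ((max n 1 : ℕ) : ℝ) ^ ω :=
      (Nat.floor_le_floor hC |> Nat.cast_le.2).trans (Nat.floor_le hC0)
    push_cast at hT ⊢
    rcases Nat.eq_zero_or_pos n with rfl | hn
    · have hE1 : max (0 : ℝ) 1 ^ ω = 1 := by simp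
      simp only [Nat.cast_zero, hE1, mul_one] at hT ⊢
      linarith [Nat.cast_nonneg (α := ℝ) ⌈|C|⌉₊]
    · have h1 := sq_le_of_mul h hn
      have h2 : (1 : ℝ) ≤ n * n := by
        have : (1 : ℝ) ≤ n := by exact_mod_cast hn
        nlinarith
      push_cast at h1 hC hE
      linarith

theorem computable_bound (A : ℕ) : Computable fun k : ℕ => A * ((k ^ k + 1) * (k + 2) ^ 4) := by
  have hpow : Primrec₂ fun a b : ℕ => a ^ b := by
    have : Primrec fun p : ℕ × ℕ => Nat.rec (motive := fun _ => ℕ) 1 (fun _ r => r * p.1) p.2 :=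
      Primrec.nat_rec' Primrec.snd (Primrec.const 1)
        (Primrec.nat_mul.comp (Primrec.snd.comp Primrec.snd) (Primrec.fst.comp Primrec.fst)).to₂
    refine this.of_eq ?_
    rintro ⟨a, b⟩
    induction b with
    | zero => simp
    | succ b ih => exact (congrArg (· * a) ih).trans (pow_succ a b).symm
  refine Primrec.to_comp ?_
  exact Primrec.nat_mul.comp (Primrec.const A) (Primrec.nat_mul.comp
    (Primrec.nat_add.comp (hpow.comp Primrec.id Primrec.id) (Primrec.const 1))
    (hpow.comp (Primrec.nat_add.comp Primrec.id (Primrec.const 2)) (Primrec.const 4)))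

end WordRAM

theorem mainTheorem9 (ω : ℝ) (hω : WordRAM.IsMatMulExponent ω) :
    (∃ (P : WordRAM.Prog) (p : Polynomial ℕ),
      WordRAM.CountsInTime P
        (fun _ H => treewidth H ≤ 2)
        (fun _ _ H G => homCount H G)
        (fun k n => ((p.eval k : ℕ) : ℝ) * ((max n 1 : ℕ) : ℝ) ^ ω)) ∧
    (∃ (P : WordRAM.Prog) (f : ℕ → ℕ), Computable f ∧
      WordRAM.CountsInTime P
        (fun _ H => ∀ (m : ℕ) (F : SimpleGraph (Fin m)), InSpasm H F → treewidth F ≤ 2)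
        (fun _ _ H G => subCount H G)
        (fun k n => (f k : ℝ) * ((max n 1 : ℕ) : ℝ) ^ ω)) := by
  obtain ⟨P, c, T, D, hP, hT⟩ := WordRAM.exists_matMul hω
  -- The exponent `c` is required by the given multiplication program, the exponent `10` by the
  -- address computations in `Sz`.
  have hword : ∀ {k n w : ℕ}, (k + n + 2) ^ (c + 10) ≤ 2 ^ w →
      (n + 2) ^ c ≤ 2 ^ w ∧ (k + n + 2) ^ 10 ≤ 2 ^ w := fun {k n w} h =>
    ⟨((Nat.pow_le_pow_left (by omega) c).trans (Nat.pow_le_pow_right (by omega) (by omega))).trans h,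
      (Nat.pow_le_pow_right (by omega) (by omega)).trans h⟩
  have htime : ∀ {t a n : ℕ}, t ≤ a * (T n + n * n + 1) →
      (t : ℝ) ≤ ((D * a : ℕ) : ℝ) * ((max n 1 : ℕ) : ℝ) ^ ω := by
    intro t a n h
    calc (t : ℝ) ≤ ((a * (T n + n * n + 1) : ℕ) : ℝ) := Nat.cast_le.2 h
      _ = a * ((T n + n * n + 1 : ℕ) : ℝ) := Nat.cast_mul _ _
      _ ≤ a * (D * ((max n 1 : ℕ) : ℝ) ^ ω) := mul_le_mul_of_nonneg_left (hT n) (Nat.cast_nonneg _)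
      _ = _ := by rw [Nat.cast_mul]; ring
  refine ⟨⟨WordRAM.Alg.homProg P,
    Polynomial.C (D * 20000) * (Polynomial.X + Polynomial.C 2) ^ 4,
    WordRAM.CountsInTime.of_hwp (c + 10) fun k n w H G hH hw σ h0 h1 hA0 hA1 => ?_⟩,
    ⟨WordRAM.Alg.subProg P, fun k => D * 20000 * ((k ^ k + 1) * (k + 2) ^ 4),
      WordRAM.computable_bound _,
      WordRAM.CountsInTime.of_hwp (c + 10) fun k n w H G hH hw σ h0 h1 hA0 hA1 => ?_⟩⟩
  · obtain ⟨hw1, hw2⟩ := hword hw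
    refine (WordRAM.Alg.homProg_spec hP hw1 hw2 h0 h1 hA0 hA1 hH).mono ?_
    rintro σ' t ⟨ht, hv⟩
    refine ⟨?_, hv⟩
    simp only [Polynomial.eval_mul, Polynomial.eval_pow, Polynomial.eval_add, Polynomial.eval_C,
      Polynomial.eval_X, mul_assoc D]
    exact htime (ht.trans (WordRAM.coreTime_le T k n))
  · obtain ⟨hw1, hw2⟩ := hword hw
    refine (WordRAM.Alg.subProg_spec hP hw1 hw2 h0 h1 hA0 hA1 hH).mono ?_
    rintro σ' t ⟨ht, hv⟩
    refine ⟨?_, hv⟩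
    have h2 := htime (ht.trans (WordRAM.subTime_le T k n))
    rwa [mul_assoc 20000, ← mul_assoc D] at h2
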